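/- **Setting.** Let $\kappa=(\kappa_1,\kappa_2)$ with $\kappa_1,\kappa_2>0$ and $\kappa\neq(1,1)$, and put $\delta_r(x)=(r^{\kappa_1}x_1,r^{\kappa_2}x_2)$ for $r>0$. A function $g$ on $\mathbb{R}^2\setminus\{0\}$ is $\kappa$-homogeneous of degree $d$ if $g(\delta_r x)=r^d g(x)$ for all $x\ne0$, $r>0$. Let $f\in C^\infty(\mathbb{R}^2\setminus\{0\})$ be real-valued and $\kappa$-homogeneous of degree one. For a smooth function $g$ on $\mathbb{R}^2\setminus\{0\}$ let $\mathrm{ord}\,g(x)\in\{0,1,\dots,\infty\}$ be the least $j$ with $D^jg(x)\neq0$, and $\mathrm{ord}\,g=\sup_{x\neq0}\mathrm{ord}\,g(x)$. Let $\mathrm{Hess} f=\det D^2f$ and $h=\max\{\frac1{\kappa_1+\kappa_2},\mathrm{ord} f\}$. Assume $$h\ge2,\qquad \mathrm{ord}(\mathrm{Hess} f)<\infty,\qquad \alpha>\tfrac12-\tfrac1h .$$ Call $x\neq0$ *degenerate* if $\partial_jf(x)=0$ for every $j\in\{1,2\}$ with $\kappa_j\neq1$ (if $\kappa_1\ne1\ne\kappa_2$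 this means $\nabla f(x)=0$). For a function $G\ge0$ on $\mathbb{R}^2\setminus\{0\}$ and $a\in C_0^\infty(\mathbb{R}^2)$ (complex-valued) put $$J_G(t,s)=\int_{\mathbb{R}^2}a(x)\,G(x)^\alpha e^{it(f(x)+x\cdot s)}\,dx,\qquad \|a\|_{L^1_3}=\sum_{j=0}^{3}\int_{\mathbb{R}^2}\|D^ja(x)\|\,dx .$$ **Theorem.** Let $V\subset\mathbb{R}^2$ be a bounded neighbourhood of the origin and let $\Gamma\subset\mathbb{R}^2$ be a closed set that is invariant under all $\delta_r$, $r>0$. 1. Let $x^0\in S^1$ with $\nabla f(x^0)=0$, let $n=\mathrm{ord} f(x^0)$, and let $G_f$ be the $\kappa$-homogeneous function of degree one with $G_f=|\nabla f|^{n/(n-1)}$ on $S^1$. Assume that $\nabla f(x)=0$ at every degenerate $x\in\Gamma\setminus\{0\}$ (for $\kappa_1\neq1\neq\kappa_2$ this holds automatically, and one may take $\Gamma=\mathbb{R}^2$). Then there are $C,\varepsilon>0$ such that $$|J_{G_f}(t,s)|\le C\|a\|_{L^1_3}(1+|t|)^{-(\frac12+\varepsilon)}\qquad\text{for all }t\in\mathbb{R},\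 s\in\mathbb{R}^2,$$ for every $a\in C_0^\infty(\mathbb{R}^2)$ with $\mathrm{supp}\,a\subset V\cap\Gamma$ such that every $x\in\mathrm{supp}\,a\setminus\{0\}$ with $\nabla f(x)=0$ is of the form $\delta_r(x^0)$, $r>0$. 2. Assume that $\Gamma\setminus\{0\}$ contains no degenerate point, and let $G$ be the $\kappa$-homogeneous function of degree one with $G\equiv1$ on $S^1$. Then there are $C,\varepsilon>0$ such that $|J_G(t,s)|\le C\|a\|_{L^1_3}(1+|t|)^{-(\frac12+\varepsilon)}$ for all $t\in\mathbb{R}$, $s\in\mathbb{R}^2$ and all $a\in C_0^\infty(\mathbb{R}^2)$ with $\mathrm{supp}\,a\subset V\cap\Gamma$. 3. Assume that $\Gamma\setminus\{0\}$ contains no degenerate point, and let $\rho\in\mathbb{R}$, where $\rho>0$ or $\kappa_1+\kappa_2>\frac12$. Then there are $C,\varepsilon>0$ such that the undamped integral ($G\equiv1$) satisfies $|J_1(t,s)|\le C\|a\|_{L^1_3}(1+|t|)^{-(\frac12+\varepsilon)}$ for all $t\in\mathbb{R}$, $s\in\mathbb{R}^2$ and all $a\in C_0^\infty(\mathbb{R}^2)$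 with $\mathrm{supp}\,a\subset V\cap\Gamma\cap\{|x|\ge\rho\}$. -/

import Mathlib

open MeasureTheory Filter Topology
open scoped ENNReal ContDiff

noncomputable section

namespace DampedOsc

/-- The Euclidean plane. -/
abbrev Plane : Type := EuclideanSpace ℝ (Fin 2)

/-- The dilation `δ_r (x₁, x₂) = (r ^ κ₁ * x₁, r ^ κ₂ * x₂)`. -/
def dil (κ : Fin 2 → ℝ) (r : ℝ) (x : Plane) : Plane :=
  WithLp.toLp 2 (fun j => r ^ κ j * x j)

/-- `g` is `κ`-homogeneous of degree `d` on the punctured plane. -/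
def IsHomog (κ : Fin 2 → ℝ) (d : ℝ) (g : Plane → ℝ) : Prop :=
  ∀ x : Plane, x ≠ 0 → ∀ r : ℝ, 0 < r → g (dil κ r x) = r ^ d * g x

/-- The order of `g` at `x`: the least `j` with `D^j g (x) ≠ 0` (`⊤` if there is none). -/
def ordAt (g : Plane → ℝ) (x : Plane) : ℕ∞ :=
  ⨅ (j : ℕ) (_ : iteratedFDeriv ℝ j g x ≠ 0), (j : ℕ∞)

/-- The supremum of the orders of `g` at all points of the punctured plane. -/
def ord (g : Plane → ℝ) : ℕ∞ :=
  ⨆ (x : Plane) (_ : x ≠ 0), ordAt g x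

/-- The determinant of the Hessian matrix of `f`. -/
def hess (f : Plane → ℝ) (x : Plane) : ℝ :=
  Matrix.det (Matrix.of fun i j : Fin 2 =>
    iteratedFDeriv ℝ 2 f x ![EuclideanSpace.single i 1, EuclideanSpace.single j 1])

/-- The height `max {1 / (κ₁ + κ₂), ord f}`. -/
def height (κ : Fin 2 → ℝ) (f : Plane → ℝ) : ℝ≥0∞ :=
  max (ENNReal.ofReal (1 / (κ 0 + κ 1))) (ord f : ℝ≥0∞)

/-- For `x ≠ 0`, the number `r > 0` such that `δ_{1/r} x` lies on the unit circle. -/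
def homRadius (κ : Fin 2 → ℝ) (x : Plane) : ℝ :=
  sInf {r : ℝ | 0 < r ∧ ‖dil κ r⁻¹ x‖ ≤ 1}

/-- The function that is `κ`-homogeneous of degree one on the punctured plane and agrees with
`g` on the unit circle. -/
def homExtend (κ : Fin 2 → ℝ) (g : Plane → ℝ) (x : Plane) : ℝ :=
  homRadius κ x * g (dil κ (homRadius κ x)⁻¹ x)

theorem dil_dil (κ : Fin 2 → ℝ) {r s : ℝ} (hr : 0 ≤ r) (hs : 0 ≤ s) (x : Plane) :
    dil κ r (dil κ s x) = dil κ (r * s) x := by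
  ext j
  simp only [dil]
  rw [Real.mul_rpow hr hs, mul_assoc]

theorem homRadius_nonneg (κ : Fin 2 → ℝ) (x : Plane) : 0 ≤ homRadius κ x :=
  Real.sInf_nonneg fun _ h => h.1.le

theorem homRadius_dil (κ : Fin 2 → ℝ) {r : ℝ} (hr : 0 < r) (x : Plane) :
    homRadius κ (dil κ r x) = r * homRadius κ x := by
  unfold homRadius
  rw [← smul_eq_mul, ← Real.sInf_smul_of_nonneg hr.le]
  congr 1
  ext t
  rw [Set.mem_smul_set_iff_inv_smul_mem₀ hr.ne']
  simp only [Set.mem_ofPred_eq, smul_eq_mul, mul_inv, inv_inv]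
  constructor
  · rintro ⟨h1, h2⟩
    rw [dil_dil κ (inv_nonneg.2 h1.le) hr.le, mul_comm] at h2
    exact ⟨by positivity, h2⟩
  · rintro ⟨h1, h2⟩
    have ht : 0 < t := (mul_pos_iff_of_pos_left (inv_pos.2 hr)).1 h1
    refine ⟨ht, ?_⟩
    rw [dil_dil κ (inv_nonneg.2 ht.le) hr.le, mul_comm]
    exact h2

theorem homRadius_of_norm_eq_one (κ : Fin 2 → ℝ) (hκ : ∀ j, 0 < κ j) (x : Plane)
    (hx : ‖x‖ = 1) : homRadius κ x = 1 := by
  have hx2 : x 0 ^ 2 + x 1 ^ 2 = 1 := by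
    have := EuclideanSpace.norm_sq_eq x
    rw [hx, Fin.sum_univ_two] at this
    simpa using this.symm
  have key : {r : ℝ | 0 < r ∧ ‖dil κ r⁻¹ x‖ ≤ 1} = Set.Ici 1 := by
    ext r
    simp only [Set.mem_ofPred_eq, Set.mem_Ici]
    have hn : ‖dil κ r⁻¹ x‖ ^ 2 =
        (r⁻¹ ^ κ 0) ^ 2 * x 0 ^ 2 + (r⁻¹ ^ κ 1) ^ 2 * x 1 ^ 2 := by
      rw [EuclideanSpace.norm_sq_eq, Fin.sum_univ_two]
      simp [dil, mul_pow]
    constructor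
    · rintro ⟨h0, h1⟩
      by_contra hlt
      push Not at hlt
      have hinv : 1 < r⁻¹ := (one_lt_inv₀ h0).2 hlt
      have h3 : ∀ j, 1 < (r⁻¹ ^ κ j) ^ 2 := fun j =>
        one_lt_pow₀ (Real.one_lt_rpow hinv (hκ j)) two_ne_zero
      have h4 : ‖dil κ r⁻¹ x‖ ^ 2 ≤ 1 := pow_le_one₀ (norm_nonneg _) h1
      rw [hn] at h4
      rcases (sq_nonneg (x 0)).eq_or_lt with h5 | h5
      · have : x 1 ^ 2 = 1 := by linarith
        nlinarith [h3 1]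
      · nlinarith [h3 0, h3 1, sq_nonneg (x 1), mul_pos (sub_pos.2 (h3 0)) h5,
          mul_nonneg (sub_pos.2 (h3 1)).le (sq_nonneg (x 1))]
    · intro h
      have h0 : 0 < r := by linarith
      refine ⟨h0, ?_⟩
      have h3 : ∀ j, (r⁻¹ ^ κ j) ^ 2 ≤ 1 := fun j =>
        pow_le_one₀ (by positivity)
          (Real.rpow_le_one (by positivity) (inv_le_one_of_one_le₀ h) (hκ j).le)
      have h4 : ‖dil κ r⁻¹ x‖ ^ 2 ≤ 1 := by
        rw [hn]
        nlinarith [h3 0, h3 1, mul_nonneg (sub_nonneg.2 (h3 0)) (sq_nonneg (x 0)),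
          mul_nonneg (sub_nonneg.2 (h3 1)) (sq_nonneg (x 1))]
      nlinarith [norm_nonneg (dil κ r⁻¹ x)]
  rw [homRadius, key, csInf_Ici]

theorem homExtend_isHomog (κ : Fin 2 → ℝ) (g : Plane → ℝ) : IsHomog κ 1 (homExtend κ g) := by
  intro x _ r hr
  have h : dil κ (r * homRadius κ x)⁻¹ (dil κ r x) = dil κ (homRadius κ x)⁻¹ x := by
    rw [dil_dil κ (inv_nonneg.2 (mul_nonneg hr.le (homRadius_nonneg κ x))) hr.le]
    congr 1
    field_simp
  rw [homExtend, homRadius_dil κ hr, h, homExtend, Real.rpow_one, mul_assoc]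

theorem homExtend_of_norm_eq_one (κ : Fin 2 → ℝ) (hκ : ∀ j, 0 < κ j) (g : Plane → ℝ)
    (x : Plane) (hx : ‖x‖ = 1) : homExtend κ g x = g x := by
  rw [homExtend, homRadius_of_norm_eq_one κ hκ x hx]
  simp [dil]

/-- The homogenized gradient power `G_f` attached to a critical point `x0` of order `n`: the
`κ`-homogeneous function of degree one that equals `|∇f| ^ (n / (n - 1))` on the unit circle. -/
def gradDamping (κ : Fin 2 → ℝ) (f : Plane → ℝ) (x0 : Plane) : Plane → ℝ :=
  homExtend κ fun x =>
    ‖gradient f x‖ ^ (((ordAt f x0).toNat : ℝ) / (((ordAt f x0).toNat : ℝ) - 1))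

/-- The points at which every partial derivative `∂_j f` with `κ_j ≠ 1` vanishes. If
`κ₁ ≠ 1 ≠ κ₂` these are the zeros of `∇f`; if `κ₁ = 1 ≠ κ₂` these are the zeros of `∂₂f`. -/
def IsDegenerate (κ : Fin 2 → ℝ) (f : Plane → ℝ) (x : Plane) : Prop :=
  ∀ j, κ j ≠ 1 → gradient f x j = 0

/-- Closed sets that are invariant under all dilations `δ_r`. -/
def IsClosedCone (κ : Fin 2 → ℝ) (Γ : Set Plane) : Prop :=
  IsClosed Γ ∧ ∀ x ∈ Γ, ∀ r : ℝ, 0 < r → dil κ r x ∈ Γ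

/-- The oscillatory integral with phase `f (x) + x · s`, amplitude `a` and damping `G ^ α`. -/
def oscInt (f G : Plane → ℝ) (α : ℝ) (a : Plane → ℂ) (t : ℝ) (s : Plane) : ℂ :=
  ∫ x : Plane, a x * ((G x ^ α : ℝ) : ℂ) *
    Complex.exp (Complex.I * ((t * (f x + inner ℝ x s) : ℝ) : ℂ))

/-- The norm of the Sobolev space `L¹₃` on smooth compactly supported functions. -/
def sobolevNorm (a : Plane → ℂ) : ℝ :=
  ∑ j ∈ Finset.range 4, ∫ x : Plane, ‖iteratedFDeriv ℝ j a x‖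

/-- Smooth functions with compact support contained in `A`. -/
def IsTest (A : Set Plane) (a : Plane → ℂ) : Prop :=
  ContDiff ℝ ∞ a ∧ HasCompactSupport a ∧ tsupport a ⊆ A

end DampedOsc

end

open MeasureTheory Filter Topology
open scoped ENNReal ContDiff

noncomputable section

namespace DampedOsc

/-! Scaling reduces the theorem to amplitudes supported near a single point of the punctured plane.
A dyadic partition adapted to the dilations moves the shell of size `r = 2⁻ᵏ` to a fixed shell,
replaces `t` by `t r`, and produces the factor `r ^ (κ 0 + κ 1 + d)` for a weight of degree `d`. The
shells can be summed with a decay exponent slightly above 1/2 as soon as `κ 0 + κ 1 + d > 1/2`. For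
`d = α` this follows from `α > 1/2 - 1/h` and `1/h ≤ κ 0 + κ 1` (`exponent_bounds`,
`exists_global_bound`). The amplitude enters only through the suprema of `a` and `Da`, which the
`L¹₃` norm bounds in the plane.

Near a point, homogeneous coordinates `x > 0`, `u = y x ^ (-θ)` turn the phase into `x ^ p g(u) + σ₁
x + σ₂ x ^ θ u`, where `g` is the profile of `f`. The Hessian determinant becomes a power of `x`
times a function `H(u)` (`hessFactor`) that vanishes to finite order. Where `|H| ≥ μ`, the gradient
map has a quantitatively invertible derivative, and integration by parts along a regularized
gradient field gives `|t| ^ (-3/4) μ ^ (-4)`, uniformly in the linear term (`exists_far_bound`).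
Only the strip `|u - u₀| ≤ 2l` around a zero of `H` remains. If it contributes `O(l ^ γ |t| ^
(-1/2))` with some `γ > 0`, then taking for `l` a small negative power of `|t|` gives more than 1/2
(`exists_bound_of_near`).

Two mechanisms handle the strip. Write `H = g'' N - (p - θ)² g'²` with `N` = `hessCoeff`. At a point
that is not degenerate, `H` and `N` cannot both vanish (`hessFactor_or_hessCoeff_ne_zero`). If `N ≠
0`, either the phase has no stationary point in `u`, or its second derivative in `x` stays away from
zero and van der Corput in `x` gives `γ = 1` (`exists_bound_nondegenerate`). At a zero of the
gradient both `H` and `N` vanish. There `g` has some order `n + 2 ≥ 2`, so `|g''|` is comparable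
with `|u - u₀| ^ n`, while the damping is `O(|u - u₀| ^ β)` with `β = (n + 1) α n₀ / (n₀ - 1)`, `n₀`
being the order of `f` at `x0`. Van der Corput in `u` then gives `γ = β - n/2`
(`exists_bound_critical`), which is positive because of the hypothesis on `α` (`exponent_pos`). -/

/-! ### One-dimensional oscillatory integrals -/

/-- The oscillating factor `e ^ (i y)`. -/
abbrev cis (y : ℝ) : ℂ := Complex.exp (Complex.I * (y : ℂ))

theorem norm_cis (y : ℝ) : ‖cis y‖ = 1 := by
  rw [cis, mul_comm]
  exact Complex.norm_exp_ofReal_mul_I y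

theorem hasDerivAt_cis {ψ : ℝ → ℝ} {ψ' x : ℝ} (h : HasDerivAt ψ ψ' x) :
    HasDerivAt (fun y => cis (ψ y)) (Complex.I * ψ' * cis (ψ x)) x := by
  have h1 : HasDerivAt (fun y => Complex.I * (ψ y : ℂ)) (Complex.I * ψ') x :=
    (h.ofReal_comp).const_mul _
  simpa [cis, mul_comm] using h1.cexp

theorem continuous_cis : Continuous cis := by
  unfold cis
  fun_prop

theorem conj_cis (y : ℝ) : (starRingEnd ℂ) (cis y) = cis (-y) := by
  simp [cis, ← Complex.exp_conj]

/-- Van der Corput's lemma for a phase with second derivative bounded from below. -/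
theorem norm_integral_cis_le_of_le_deriv2 {a b : ℝ} (hab : a ≤ b) {ψ ψ' ψ'' : ℝ → ℝ}
    (h1 : ∀ x ∈ Set.Icc a b, HasDerivAt ψ (ψ' x) x)
    (h2 : ∀ x ∈ Set.Icc a b, HasDerivAt ψ' (ψ'' x) x)
    (h2c : ContinuousOn ψ'' (Set.Icc a b)) {Λ : ℝ} (hΛ : 0 < Λ)
    (hψ : ∀ x ∈ Set.Icc a b, Λ ≤ ψ'' x) {A A' : ℝ → ℂ}
    (hA : ∀ x ∈ Set.Icc a b, HasDerivAt A (A' x) x) (hAc : ContinuousOn A' (Set.Icc a b))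
    {M₀ M₁ : ℝ} (hM₀ : ∀ x ∈ Set.Icc a b, ‖A x‖ ≤ M₀) (hM₁ : ∀ x ∈ Set.Icc a b, ‖A' x‖ ≤ M₁) :
    ‖∫ x in a..b, A x * cis (ψ x)‖ ≤ 9 * (M₀ + M₁ * (b - a)) / √Λ := by
  have hM₀0 : 0 ≤ M₀ := (norm_nonneg _).trans (hM₀ a ⟨le_rfl, hab⟩)
  have hM₁0 : 0 ≤ M₁ := (norm_nonneg _).trans (hM₁ a ⟨le_rfl, hab⟩)
  set ν := √Λ with hν
  have hν0 : 0 < ν := Real.sqrt_pos.2 hΛ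
  have hνΛ : ν ^ 2 = Λ := Real.sq_sqrt hΛ.le
  have hI : Set.uIcc a b = Set.Icc a b := Set.uIcc_of_le hab
  -- The splitting `1 = Λ / D + ψ'² / D` makes it unnecessary to locate the zero of `ψ'`. The first
  -- part is dominated by `ψ'' / D`, the derivative of an arctangent, whose integral is `O(1/ν)`
  -- whatever the length of the interval. The second part contains the factor `ψ'` that one
  -- integration by parts needs.
  let D : ℝ → ℝ := fun x => ψ' x ^ 2 + Λ
  have hD : ∀ x, 0 < D x := fun x => by positivity
  have cψ : ContinuousOn ψ (Set.Icc a b) := fun x hx => (h1 x hx).continuousAt.continuousWithinAt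
  have cψ' : ContinuousOn ψ' (Set.Icc a b) := fun x hx => (h2 x hx).continuousAt.continuousWithinAt
  have cA : ContinuousOn A (Set.Icc a b) := fun x hx => (hA x hx).continuousAt.continuousWithinAt
  have cD : ContinuousOn D (Set.Icc a b) := (cψ'.pow 2).add continuousOn_const
  have ce : ContinuousOn (fun x => cis (ψ x)) (Set.Icc a b) :=
    continuous_cis.comp_continuousOn cψ
  -- the integral of `ψ'' / D`
  have hT : ∀ x ∈ Set.Icc a b,
      HasDerivAt (fun x => ν⁻¹ * Real.arctan (ψ' x / ν)) (ψ'' x / D x) x := by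
    intro x hx
    refine ((((h2 x hx).div_const ν).arctan).const_mul ν⁻¹).congr_deriv ?_
    have : D x ≠ 0 := (hD x).ne'
    have h3 : 1 + (ψ' x / ν) ^ 2 = D x / ν ^ 2 := by
      simp only [D, ← hνΛ]; field_simp; ring
    rw [h3]; field_simp
  have cQ : ContinuousOn (fun x => ψ'' x / D x) (Set.Icc a b) := h2c.div cD fun x _ => (hD x).ne'
  have hQ : ∫ x in a..b, ψ'' x / D x ≤ 4 / ν := by
    rw [intervalIntegral.integral_eq_sub_of_hasDerivAt (by rwa [hI])
      (by rw [← hI] at cQ; exact cQ.intervalIntegrable)]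
    have e1 := Real.arctan_lt_pi_div_two (ψ' b / ν)
    have e2 := Real.neg_pi_div_two_lt_arctan (ψ' a / ν)
    have := Real.pi_lt_four
    rw [← mul_sub, inv_mul_eq_div]
    gcongr
    linarith
  have iQ : IntervalIntegrable (fun x => ψ'' x / D x) volume a b := by
    rw [← hI] at cQ; exact cQ.intervalIntegrable
  -- the boundary term
  let h : ℝ → ℂ := fun x => A x * ((ψ' x / D x : ℝ) : ℂ) * cis (ψ x)
  let R : ℝ → ℂ := fun x => (A' x * ((ψ' x / D x : ℝ) : ℂ) +
    A x * ((ψ'' x / D x * (1 - 2 * ψ' x ^ 2 / D x) : ℝ) : ℂ)) * cis (ψ x)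
  let S : ℝ → ℂ := fun x => A x * ((ψ' x ^ 2 / D x : ℝ) : ℂ) * cis (ψ x)
  have hh : ∀ x ∈ Set.Icc a b, HasDerivAt h (R x + Complex.I * S x) x := by
    intro x hx
    have d1 : HasDerivAt D (2 * ψ' x * ψ'' x) x := by
      simpa [D, mul_comm, mul_assoc] using ((h2 x hx).pow 2).add_const Λ
    have d2 : HasDerivAt (fun y => ((ψ' y / D y : ℝ) : ℂ)) _ x :=
      ((h2 x hx).div d1 (hD x).ne').ofReal_comp
    refine (((hA x hx).mul d2).mul (hasDerivAt_cis (h1 x hx))).congr_deriv ?_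
    have : (D x : ℂ) ≠ 0 := by exact_mod_cast (hD x).ne'
    simp only [R, S, Pi.mul_apply]
    push_cast
    field_simp
  have cq : ContinuousOn (fun x => ((ψ' x / D x : ℝ) : ℂ)) (Set.Icc a b) :=
    Complex.continuous_ofReal.comp_continuousOn (cψ'.div cD fun x _ => (hD x).ne')
  have cR : ContinuousOn R (Set.Icc a b) := by
    refine ContinuousOn.mul (ContinuousOn.add (hAc.mul cq) (cA.mul ?_)) ce
    refine Complex.continuous_ofReal.comp_continuousOn (cQ.mul (continuousOn_const.sub ?_))
    exact (continuousOn_const.mul (cψ'.pow 2)).div cD fun x _ => (hD x).ne'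
  have cS : ContinuousOn S (Set.Icc a b) := by
    refine (cA.mul ?_).mul ce
    exact Complex.continuous_ofReal.comp_continuousOn ((cψ'.pow 2).div cD fun x _ => (hD x).ne')
  have iR : IntervalIntegrable R volume a b := by rw [← hI] at cR; exact cR.intervalIntegrable
  have iS : IntervalIntegrable S volume a b := by rw [← hI] at cS; exact cS.intervalIntegrable
  have key : Complex.I * ∫ x in a..b, S x = h b - h a - ∫ x in a..b, R x := by
    have := intervalIntegral.integral_eq_sub_of_hasDerivAt (f := h) (by rwa [hI])
      (iR.add (iS.const_mul Complex.I))
    rw [intervalIntegral.integral_add iR (iS.const_mul _),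
      intervalIntegral.integral_const_mul] at this
    rw [← this]; ring
  have hquot : ∀ x, |ψ' x / D x| ≤ 1 / (2 * ν) := by
    intro x
    rw [abs_div, abs_of_pos (hD x), div_le_div_iff₀ (hD x) (by positivity)]
    simp only [D, ← hνΛ]
    nlinarith [sq_nonneg (|ψ' x| - ν), sq_abs (ψ' x)]
  have hhb : ∀ x ∈ Set.Icc a b, ‖h x‖ ≤ M₀ * (1 / (2 * ν)) := by
    intro x hx
    simp only [h, norm_mul, norm_cis, mul_one, Complex.norm_real, Real.norm_eq_abs]
    exact mul_le_mul (hM₀ x hx) (hquot x) (abs_nonneg _) hM₀0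
  have hRb : ‖∫ x in a..b, R x‖ ≤ M₁ * (1 / (2 * ν)) * (b - a) + M₀ * (4 / ν) := by
    calc ‖∫ x in a..b, R x‖ ≤ ∫ x in a..b, (M₁ * (1 / (2 * ν)) + M₀ * (ψ'' x / D x)) := by
          refine intervalIntegral.norm_integral_le_of_norm_le hab ?_
            (intervalIntegrable_const.add (iQ.const_mul _))
          refine Eventually.of_forall fun x hx => ?_
          have hx' : x ∈ Set.Icc a b := Set.Ioc_subset_Icc_self hx
          simp only [R, norm_mul, norm_cis, mul_one]
          refine (norm_add_le _ _).trans ?_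
          simp only [norm_mul, Complex.norm_real, Real.norm_eq_abs]
          have h0 : 0 ≤ ψ'' x / D x := div_nonneg (hΛ.le.trans (hψ x hx')) (hD x).le
          have h3 : |1 - 2 * ψ' x ^ 2 / D x| ≤ 1 := by
            have e1 : ψ' x ^ 2 / D x ≤ 1 := by
              rw [div_le_one (hD x)]; simp only [D]; linarith
            have e2 : 0 ≤ ψ' x ^ 2 / D x := div_nonneg (sq_nonneg _) (hD x).le
            rw [mul_div_assoc, abs_le]; constructor <;> linarith
          rw [abs_of_nonneg h0]
          refine add_le_add (mul_le_mul (hM₁ x hx') (hquot x) (abs_nonneg _) hM₁0)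
            (mul_le_mul (hM₀ x hx') ?_ (by positivity) hM₀0)
          exact mul_le_of_le_one_right h0 h3
      _ = M₁ * (1 / (2 * ν)) * (b - a) + M₀ * ∫ x in a..b, ψ'' x / D x := by
          rw [intervalIntegral.integral_add intervalIntegrable_const (iQ.const_mul _),
            intervalIntegral.integral_const, smul_eq_mul,
            mul_comm (b - a), intervalIntegral.integral_const_mul]
      _ ≤ _ := by gcongr
  have hfirst : ‖∫ x in a..b, A x * ((Λ / D x : ℝ) : ℂ) * cis (ψ x)‖ ≤ M₀ * (4 / ν) := by
    calc _ ≤ ∫ x in a..b, M₀ * (ψ'' x / D x) := by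
          refine intervalIntegral.norm_integral_le_of_norm_le hab ?_ (iQ.const_mul _)
          refine Eventually.of_forall fun x hx => ?_
          have hx' : x ∈ Set.Icc a b := Set.Ioc_subset_Icc_self hx
          simp only [norm_mul, norm_cis, mul_one, Complex.norm_real, Real.norm_eq_abs]
          rw [abs_of_nonneg (div_nonneg hΛ.le (hD x).le)]
          exact mul_le_mul (hM₀ x hx') (div_le_div_of_nonneg_right (hψ x hx') (hD x).le)
            (div_nonneg hΛ.le (hD x).le) hM₀0
      _ ≤ _ := by
          rw [intervalIntegral.integral_const_mul]
          gcongr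
  have hsecond : ‖∫ x in a..b, S x‖ ≤
      M₀ * (1 / (2 * ν)) + M₀ * (1 / (2 * ν)) +
        (M₁ * (1 / (2 * ν)) * (b - a) + M₀ * (4 / ν)) := by
    have : ‖∫ x in a..b, S x‖ = ‖h b - h a - ∫ x in a..b, R x‖ := by
      rw [← key, norm_mul, Complex.norm_I, one_mul]
    rw [this]
    exact (norm_sub_le _ _).trans (add_le_add ((norm_sub_le _ _).trans
      (add_le_add (hhb b ⟨hab, le_rfl⟩) (hhb a ⟨le_rfl, hab⟩))) hRb)
  have hsplit : ∫ x in a..b, A x * cis (ψ x) =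
      (∫ x in a..b, A x * ((Λ / D x : ℝ) : ℂ) * cis (ψ x)) + ∫ x in a..b, S x := by
    rw [← intervalIntegral.integral_add _ iS]
    · refine intervalIntegral.integral_congr fun x _ => ?_
      have : (D x : ℂ) ≠ 0 := by exact_mod_cast (hD x).ne'
      simp only [S]
      push_cast
      rw [← add_mul, ← mul_add, ← add_div]
      have h4 : (Λ : ℂ) + (ψ' x : ℂ) ^ 2 = D x := by simp only [D]; push_cast; ring
      rw [h4, div_self this, mul_one]
    · have : ContinuousOn (fun x => A x * ((Λ / D x : ℝ) : ℂ) * cis (ψ x)) (Set.uIcc a b) := by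
        rw [hI]
        refine (cA.mul ?_).mul ce
        exact Complex.continuous_ofReal.comp_continuousOn
          (continuousOn_const.div cD fun x _ => (hD x).ne')
      exact this.intervalIntegrable
  rw [hsplit]
  refine (norm_add_le _ _).trans ((add_le_add hfirst hsecond).trans ?_)
  rw [le_div_iff₀ hν0]
  have hba : 0 ≤ b - a := sub_nonneg.2 hab
  have : (M₀ * (4 / ν) + (M₀ * (1 / (2 * ν)) + M₀ * (1 / (2 * ν)) +
      (M₁ * (1 / (2 * ν)) * (b - a) + M₀ * (4 / ν)))) * ν = 9 * M₀ + M₁ * (b - a) / 2 := by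
    field_simp; ring
  rw [this]
  nlinarith [mul_nonneg hM₁0 hba]

/-- Van der Corput's lemma for a phase whose second derivative is bounded away from zero. -/
theorem norm_integral_cis_le_of_deriv2 {a b : ℝ} (hab : a ≤ b) {ψ ψ' ψ'' : ℝ → ℝ}
    (h1 : ∀ x ∈ Set.Icc a b, HasDerivAt ψ (ψ' x) x)
    (h2 : ∀ x ∈ Set.Icc a b, HasDerivAt ψ' (ψ'' x) x)
    (h2c : ContinuousOn ψ'' (Set.Icc a b)) {Λ : ℝ} (hΛ : 0 < Λ)
    (hψ : ∀ x ∈ Set.Icc a b, Λ ≤ |ψ'' x|) {A A' : ℝ → ℂ}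
    (hA : ∀ x ∈ Set.Icc a b, HasDerivAt A (A' x) x) (hAc : ContinuousOn A' (Set.Icc a b))
    {M₀ M₁ : ℝ} (hM₀ : ∀ x ∈ Set.Icc a b, ‖A x‖ ≤ M₀) (hM₁ : ∀ x ∈ Set.Icc a b, ‖A' x‖ ≤ M₁) :
    ‖∫ x in a..b, A x * cis (ψ x)‖ ≤ 9 * (M₀ + M₁ * (b - a)) / √Λ := by
  -- A continuous function without zeros has constant sign on an interval. The negative case follows
  -- from the positive one by complex conjugation.
  have hsign : (∀ x ∈ Set.Icc a b, 0 < ψ'' x) ∨ ∀ x ∈ Set.Icc a b, ψ'' x < 0 := by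
    by_contra! hcon
    obtain ⟨⟨x, hx, hx0⟩, y, hy, hy0⟩ := hcon
    obtain ⟨z, hz, hz0⟩ := isPreconnected_Icc.intermediate_value hx hy h2c ⟨hx0, hy0⟩
    have := hψ z hz
    rw [hz0, abs_zero] at this
    linarith
  rcases hsign with hs | hs
  · exact norm_integral_cis_le_of_le_deriv2 hab h1 h2 h2c hΛ
      (fun x hx => (hψ x hx).trans_eq (abs_of_pos (hs x hx))) hA hAc hM₀ hM₁
  · have := norm_integral_cis_le_of_le_deriv2 hab (fun x hx => (h1 x hx).neg)
      (fun x hx => (h2 x hx).neg) h2c.neg hΛ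
      (fun x hx => (hψ x hx).trans_eq (abs_of_neg (hs x hx)))
      (A := fun x => (starRingEnd ℂ) (A x)) (A' := fun x => (starRingEnd ℂ) (A' x))
      (fun x hx => (hA x hx).star)
      (Complex.continuous_conj.comp_continuousOn hAc)
      (fun x hx => by simpa using hM₀ x hx) (fun x hx => by simpa using hM₁ x hx)
    rw [← Complex.norm_conj, ← intervalIntegral.intervalIntegral_conj]
    simpa [conj_cis] using this

/-- Integration by parts against a phase without stationary points. -/
theorem norm_integral_cis_le_of_deriv1 {a b : ℝ} (hab : a ≤ b) {ψ ψ' ψ'' : ℝ → ℝ}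
    (h1 : ∀ x ∈ Set.Icc a b, HasDerivAt ψ (ψ' x) x)
    (h2 : ∀ x ∈ Set.Icc a b, HasDerivAt ψ' (ψ'' x) x)
    (h2c : ContinuousOn ψ'' (Set.Icc a b)) {ν L : ℝ} (hν : 0 < ν)
    (hψ : ∀ x ∈ Set.Icc a b, ν ≤ |ψ' x|) (hL : ∀ x ∈ Set.Icc a b, |ψ'' x| ≤ L * ν) {A A' : ℝ → ℂ}
    (hA : ∀ x ∈ Set.Icc a b, HasDerivAt A (A' x) x) (hAc : ContinuousOn A' (Set.Icc a b))
    (hAa : A a = 0) (hAb : A b = 0)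
    {M : ℝ} (hM₀ : ∀ x ∈ Set.Icc a b, ‖A x‖ ≤ M) (hM₁ : ∀ x ∈ Set.Icc a b, ‖A' x‖ ≤ M) :
    ‖∫ x in a..b, A x * cis (ψ x)‖ ≤ M * (1 + L) * (b - a) / ν := by
  have hM0 : 0 ≤ M := (norm_nonneg _).trans (hM₀ a ⟨le_rfl, hab⟩)
  have hI : Set.uIcc a b = Set.Icc a b := Set.uIcc_of_le hab
  have hn : ∀ x ∈ Set.Icc a b, ψ' x ≠ 0 := fun x hx h0 => by
    have := hψ x hx
    rw [h0, abs_zero] at this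
    linarith
  have cψ : ContinuousOn ψ (Set.Icc a b) := fun x hx => (h1 x hx).continuousAt.continuousWithinAt
  have cψ' : ContinuousOn ψ' (Set.Icc a b) := fun x hx => (h2 x hx).continuousAt.continuousWithinAt
  have cA : ContinuousOn A (Set.Icc a b) := fun x hx => (hA x hx).continuousAt.continuousWithinAt
  have ce : ContinuousOn (fun x => cis (ψ x)) (Set.Icc a b) :=
    continuous_cis.comp_continuousOn cψ
  let R : ℝ → ℂ := fun x => (A' x * (((ψ' x)⁻¹ : ℝ) : ℂ) -
    A x * ((ψ'' x / ψ' x ^ 2 : ℝ) : ℂ)) * cis (ψ x)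
  have hh : ∀ x ∈ Set.Icc a b, HasDerivAt (fun x => A x * (((ψ' x)⁻¹ : ℝ) : ℂ) * cis (ψ x))
      (R x + Complex.I * (A x * cis (ψ x))) x := by
    intro x hx
    have d2 : HasDerivAt (fun y => (((ψ' y)⁻¹ : ℝ) : ℂ)) _ x :=
      ((h2 x hx).inv (hn x hx)).ofReal_comp
    refine (((hA x hx).mul d2).mul
      (hasDerivAt_cis (h1 x hx))).congr_deriv ?_
    have : (ψ' x : ℂ) ≠ 0 := by exact_mod_cast hn x hx
    simp only [R, Pi.mul_apply]
    push_cast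
    field_simp
    ring
  have cR : ContinuousOn R (Set.Icc a b) := by
    refine ContinuousOn.mul (ContinuousOn.sub (hAc.mul ?_) (cA.mul ?_)) ce
    · exact Complex.continuous_ofReal.comp_continuousOn (cψ'.inv₀ hn)
    · exact Complex.continuous_ofReal.comp_continuousOn
        (h2c.div (cψ'.pow 2) fun x hx => pow_ne_zero 2 (hn x hx))
  have iR : IntervalIntegrable R volume a b := by rw [← hI] at cR; exact cR.intervalIntegrable
  have iS : IntervalIntegrable (fun x => A x * cis (ψ x)) volume a b := by
    have := cA.mul ce
    rw [← hI] at this; exact this.intervalIntegrable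
  have key : Complex.I * ∫ x in a..b, A x * cis (ψ x) = - ∫ x in a..b, R x := by
    have := intervalIntegral.integral_eq_sub_of_hasDerivAt (by rwa [hI])
      (iR.add (iS.const_mul Complex.I))
    rw [intervalIntegral.integral_add iR (iS.const_mul _),
      intervalIntegral.integral_const_mul, hAa, hAb] at this
    rw [eq_neg_iff_add_eq_zero, add_comm, this]; simp
  have : ‖∫ x in a..b, A x * cis (ψ x)‖ = ‖∫ x in a..b, R x‖ := by
    rw [← norm_neg (∫ x in a..b, R x), ← key, norm_mul, Complex.norm_I, one_mul]
  rw [this]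
  calc ‖∫ x in a..b, R x‖ ≤ M * (1 + L) / ν * |b - a| := by
        refine intervalIntegral.norm_integral_le_of_norm_le_const fun x hx => ?_
        rw [Set.uIoc_of_le hab] at hx
        have hx' : x ∈ Set.Icc a b := Set.Ioc_subset_Icc_self hx
        have e1 : |(ψ' x)⁻¹| ≤ ν⁻¹ := by
          rw [abs_inv]; exact inv_anti₀ hν (hψ x hx')
        have e2 : |ψ'' x / ψ' x ^ 2| ≤ L * ν⁻¹ := by
          have hL0 : 0 ≤ L * ν := (abs_nonneg _).trans (hL x hx')
          rw [abs_div, abs_pow, div_le_iff₀ (pow_pos (hν.trans_le (hψ x hx')) 2)]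
          calc |ψ'' x| ≤ L * ν := hL x hx'
            _ = (L * ν) * ν⁻¹ ^ 2 * ν ^ 2 := by field_simp
            _ ≤ (L * ν) * ν⁻¹ ^ 2 * |ψ' x| ^ 2 := by gcongr; exact hψ x hx'
            _ = _ := by field_simp
        simp only [R, norm_mul, norm_cis, mul_one]
        refine (norm_sub_le _ _).trans ?_
        simp only [norm_mul, Complex.norm_real, Real.norm_eq_abs]
        calc _ ≤ M * ν⁻¹ + M * (L * ν⁻¹) :=
              add_le_add (mul_le_mul (hM₁ x hx') e1 (abs_nonneg _) hM0)
                (mul_le_mul (hM₀ x hx') e2 (abs_nonneg _) hM0)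
          _ = _ := by field_simp
    _ = _ := by rw [abs_of_nonneg (sub_nonneg.2 hab)]; ring

/-- Van der Corput's lemma for an amplitude that vanishes at the point where the second derivative
of the phase degenerates. -/
theorem norm_integral_weight_cis_le {l : ℝ} (hl : 0 < l) {ψ ψ' ψ'' : ℝ → ℝ} {A A' : ℝ → ℂ}
    (hψc : Continuous ψ)
    (h1 : ∀ x ∈ Set.Ioc 0 l, HasDerivAt ψ (ψ' x : ℝ) x)
    (h2 : ∀ x ∈ Set.Ioc 0 l, HasDerivAt ψ' (ψ'' x : ℝ) x)
    (h2c : ContinuousOn ψ'' (Set.Ioc 0 l)) {Λ β : ℝ} {m : ℕ} (hΛ : 0 < Λ)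
    (hψ : ∀ x ∈ Set.Ioc 0 l, Λ * x ^ m ≤ |ψ'' x|)
    (hA : ∀ x ∈ Set.Ioc 0 l, HasDerivAt A (A' x : ℂ) x) (hAc : ContinuousOn A' (Set.Ioc 0 l))
    (hAc0 : ContinuousOn A (Set.Icc 0 l))
    {M : ℝ} (hM₀ : ∀ x ∈ Set.Ioc 0 l, ‖A x‖ ≤ M * x ^ β)
    (hM₁ : ∀ x ∈ Set.Ioc 0 l, ‖A' x‖ ≤ M * x ^ (β - 1)) (hβ : 0 < β - m / 2) :
    ‖∫ x in (0 : ℝ)..l, A x * cis (ψ x)‖ ≤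
      9 * M / √Λ * (1 + 1 / (β - m / 2)) * l ^ (β - m / 2) := by
  set γ := β - m / 2 with hγ
  have hM : 0 ≤ M := by
    have := (norm_nonneg _).trans (hM₀ l ⟨hl, le_rfl⟩)
    exact nonneg_of_mul_nonneg_left this (Real.rpow_pos_of_pos hl _)
  have hsΛ : 0 < √Λ := Real.sqrt_pos.2 hΛ
  have ce : Continuous fun x => cis (ψ x) := continuous_cis.comp hψc
  -- On `[v, l]` the second derivative is at least `Λ v ^ m`, so `F v` is `O(Λ ^ (-1/2) v ^
  -- (-m/2))`. Integrating by parts against this primitive lets the vanishing of `A` at the origin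
  -- absorb the singularity.
  let F : ℝ → ℂ := fun v => ∫ x in v..l, cis (ψ x)
  have hF : ∀ v, HasDerivAt F (-cis (ψ v)) v := fun v =>
    intervalIntegral.integral_hasDerivAt_left (ce.intervalIntegrable _ _)
      (ce.stronglyMeasurableAtFilter _ _) ce.continuousAt
  have cF : Continuous F := continuous_iff_continuousAt.2 fun v => (hF v).continuousAt
  have hFb : ∀ v ∈ Set.Ioc 0 l, ‖F v‖ ≤ 9 / √Λ * v ^ (-(m / 2 : ℝ)) := by
    intro v hv
    have hsub : Set.Icc v l ⊆ Set.Ioc 0 l := fun x hx => ⟨hv.1.trans_le hx.1, hx.2⟩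
    have := norm_integral_cis_le_of_deriv2 hv.2 (fun x hx => h1 x (hsub hx))
      (fun x hx => h2 x (hsub hx)) (h2c.mono hsub) (Λ := Λ * v ^ m)
      (mul_pos hΛ (pow_pos hv.1 m))
      (fun x hx => le_trans (by gcongr; exacts [hv.1.le, hx.1]) (hψ x (hsub hx)))
      (A := fun _ => 1) (A' := fun _ => 0) (fun x _ => hasDerivAt_const x _) continuousOn_const
      (M₀ := 1) (M₁ := 0) (by simp) (by simp)
    simp only [one_mul, zero_mul, add_zero, mul_one] at this
    refine this.trans_eq ?_
    rw [Real.sqrt_mul hΛ.le, Real.rpow_neg hv.1.le]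
    have : √(v ^ m) = v ^ (m / 2 : ℝ) := by
      rw [Real.sqrt_eq_rpow, ← Real.rpow_natCast v m, ← Real.rpow_mul hv.1.le]
      congr 1; ring
    rw [this]; field_simp
  -- The derivative of `A` is only controlled away from the origin, hence the truncation. The bound
  -- is independent of `ε` because `x ^ (γ - 1)` is integrable at the origin.
  have hε : ∀ ε ∈ Set.Ioo 0 l, ‖∫ x in ε..l, A x * cis (ψ x)‖ ≤
      9 * M / √Λ * (1 + 1 / γ) * l ^ γ := by
    intro ε hε
    have hsub : Set.Icc ε l ⊆ Set.Ioc 0 l := fun x hx => ⟨hε.1.trans_le hx.1, hx.2⟩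
    have hI : Set.uIcc ε l = Set.Icc ε l := Set.uIcc_of_le hε.2.le
    have ibp := intervalIntegral.integral_mul_deriv_eq_deriv_mul (a := ε) (b := l)
      (u := A) (u' := A') (v := F) (v' := fun v => -cis (ψ v))
      (fun x hx => hA x (hsub (hI ▸ hx))) (fun x _ => hF x)
      (by rw [← hI] at hsub; exact (hAc.mono hsub).intervalIntegrable)
      (ce.neg.intervalIntegrable _ _)
    have hFl : F l = 0 := intervalIntegral.integral_same
    have e : ∫ x in ε..l, A x * cis (ψ x) = A ε * F ε + ∫ x in ε..l, A' x * F x := by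
      simp only [mul_neg, intervalIntegral.integral_neg, hFl, mul_zero, zero_sub] at ibp
      linear_combination -ibp
    rw [e]
    have hεm : ε ∈ Set.Ioc 0 l := ⟨hε.1, hε.2.le⟩
    have p1 : ‖A ε * F ε‖ ≤ 9 * M / √Λ * ε ^ γ := by
      rw [norm_mul]
      calc _ ≤ (M * ε ^ β) * (9 / √Λ * ε ^ (-(m / 2 : ℝ))) :=
            mul_le_mul (hM₀ ε hεm) (hFb ε hεm) (norm_nonneg _)
              (mul_nonneg hM (Real.rpow_nonneg hε.1.le _))
        _ = 9 * M / √Λ * (ε ^ β * ε ^ (-(m / 2 : ℝ))) := by ring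
        _ = _ := by rw [← Real.rpow_add hε.1, hγ, sub_eq_add_neg]
    have p2 : ‖∫ x in ε..l, A' x * F x‖ ≤ 9 * M / √Λ * ((l ^ γ - ε ^ γ) / γ) := by
      calc _ ≤ ∫ x in ε..l, 9 * M / √Λ * x ^ (γ - 1) := by
            refine intervalIntegral.norm_integral_le_of_norm_le hε.2.le ?_ ?_
            · refine Eventually.of_forall fun x hx => ?_
              have hx0 : 0 < x := hε.1.trans hx.1
              have hxm : x ∈ Set.Ioc 0 l := ⟨hx0, hx.2⟩
              rw [norm_mul]
              calc _ ≤ (M * x ^ (β - 1)) * (9 / √Λ * x ^ (-(m / 2 : ℝ))) :=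
                    mul_le_mul (hM₁ x hxm) (hFb x hxm) (norm_nonneg _)
                      (mul_nonneg hM (Real.rpow_nonneg hx0.le _))
                _ = 9 * M / √Λ * (x ^ (β - 1) * x ^ (-(m / 2 : ℝ))) := by ring
                _ = _ := by
                  rw [← Real.rpow_add hx0, hγ]; congr 2; ring
            · refine (intervalIntegral.intervalIntegrable_rpow' ?_).const_mul _
              linarith
        _ = _ := by
            rw [intervalIntegral.integral_const_mul, integral_rpow (Or.inl (by linarith))]
            simp
    refine (norm_add_le _ _).trans ((add_le_add p1 p2).trans ?_)
    have q1 : ε ^ γ ≤ l ^ γ := Real.rpow_le_rpow hε.1.le hε.2.le hβ.le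
    have q2 : 0 ≤ ε ^ γ := Real.rpow_nonneg hε.1.le _
    rw [← mul_add, mul_assoc (9 * M / √Λ)]
    refine mul_le_mul_of_nonneg_left ?_ (by positivity)
    rw [add_mul, one_mul, div_mul_eq_mul_div, one_mul]
    gcongr
    linarith
  have h_int : IntegrableOn (fun x => A x * cis (ψ x)) (Set.uIcc 0 l) := by
    rw [Set.uIcc_of_le hl.le]
    exact (hAc0.mul ce.continuousOn).integrableOn_Icc
  have hlim : Tendsto (fun ε => ∫ x in ε..l, A x * cis (ψ x)) (𝓝[Set.Ioo 0 l] 0)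
      (𝓝 (∫ x in (0 : ℝ)..l, A x * cis (ψ x))) := by
    have := intervalIntegral.continuousOn_primitive_interval_left (b := l) h_int 0 (by simp)
    refine this.tendsto.mono_left (nhdsWithin_mono _ ?_)
    rw [Set.uIcc_of_le hl.le]
    exact Set.Ioo_subset_Icc_self
  have : (𝓝[Set.Ioo 0 l] (0 : ℝ)).NeBot := by
    rw [nhdsWithin_Ioo_eq_nhdsGT hl]; infer_instance
  exact le_of_tendsto hlim.norm (eventually_nhdsWithin_of_forall hε)

/-! ### Integrals of inverse powers of a map with nondegenerate derivative -/

/-- The true size is logarithmic in `δ`. The cruder power comes from `|z|² + δ² ≥ |z| ^ (3/2) δ ^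
(1/2)` and the local integrability of `|z| ^ (-3/2)` in dimension two. It suffices because `δ = |t|
^ (-1/2)` is used next to a factor `|t|⁻¹`, so any exponent above `-1` would do. -/
theorem exists_lintegral_inv_sq_le : ∃ C : ℝ, 0 < C ∧ ∀ (z₀ : ℝ × ℝ) (δ : ℝ), 0 < δ →
    ∫⁻ z in Metric.ball z₀ 1, ENNReal.ofReal (1 / (‖z - z₀‖ ^ 2 + δ ^ 2)) ≤
      ENNReal.ofReal (C * δ ^ (-(1 / 2) : ℝ)) := by
  have h_int : IntegrableOn (fun z : ℝ × ℝ => ‖z‖ ^ (-(3 / 2) : ℝ)) (Metric.ball 0 1) := by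
    rw [integrableOn_fun_norm_addHaar volume (f := fun y => y ^ (-(3 / 2) : ℝ))]
    have h1 : IntegrableOn (fun y : ℝ => y ^ (-(1 / 2) : ℝ)) (Set.Ioo 0 1) :=
      (intervalIntegral.integrableOn_Ioo_rpow_iff one_pos).2 (by norm_num)
    refine h1.congr_fun (fun y hy => ?_) measurableSet_Ioo
    simp only [Module.finrank_prod, Module.finrank_self, smul_eq_mul]
    rw [← Real.rpow_natCast, ← Real.rpow_add hy.1]
    norm_num
  set I := ∫⁻ z in Metric.ball (0 : ℝ × ℝ) 1, ENNReal.ofReal (‖z‖ ^ (-(3 / 2) : ℝ)) with hI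
  have hIfin : I ≠ ⊤ := h_int.lintegral_lt_top.ne
  refine ⟨I.toReal + 1, by positivity, fun z₀ δ hδ => ?_⟩
  have htrans : ∫⁻ z in Metric.ball z₀ 1, ENNReal.ofReal (1 / (‖z - z₀‖ ^ 2 + δ ^ 2)) =
      ∫⁻ z in Metric.ball (0 : ℝ × ℝ) 1, ENNReal.ofReal (1 / (‖z‖ ^ 2 + δ ^ 2)) := by
    rw [← lintegral_indicator measurableSet_ball, ← lintegral_indicator measurableSet_ball,
      ← lintegral_sub_right_eq_self
        ((Metric.ball (0 : ℝ × ℝ) 1).indicator fun z => ENNReal.ofReal (1 / (‖z‖ ^ 2 + δ ^ 2))) z₀]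
    congr 1; ext z
    simp [Set.indicator, dist_eq_norm]
  rw [htrans]
  calc _ ≤ ∫⁻ z in Metric.ball (0 : ℝ × ℝ) 1,
        ENNReal.ofReal (δ ^ (-(1 / 2) : ℝ)) * ENNReal.ofReal (‖z‖ ^ (-(3 / 2) : ℝ)) := by
        refine lintegral_mono_ae ?_
        have : ∀ᵐ z : ℝ × ℝ ∂volume.restrict (Metric.ball 0 1), z ≠ 0 :=
          ae_restrict_of_ae (Measure.ae_ne volume 0)
        filter_upwards [this] with z hz
        have hz0 : 0 < ‖z‖ := norm_pos_iff.2 hz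
        rw [← ENNReal.ofReal_mul (by positivity)]
        refine ENNReal.ofReal_le_ofReal ?_
        rw [Real.rpow_neg hδ.le, Real.rpow_neg hz0.le, ← mul_inv, one_div]
        refine inv_anti₀ (by positivity) ?_
        have e1 : δ ^ (1 / 2 : ℝ) ≤ (‖z‖ ^ 2 + δ ^ 2) ^ (1 / 4 : ℝ) := by
          have : δ ^ (1 / 2 : ℝ) = (δ ^ 2) ^ (1 / 4 : ℝ) := by
            rw [← Real.rpow_natCast, ← Real.rpow_mul hδ.le]; norm_num
          rw [this]; gcongr; nlinarith
        have e2 : ‖z‖ ^ (3 / 2 : ℝ) ≤ (‖z‖ ^ 2 + δ ^ 2) ^ (3 / 4 : ℝ) := by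
          have : ‖z‖ ^ (3 / 2 : ℝ) = (‖z‖ ^ 2) ^ (3 / 4 : ℝ) := by
            rw [← Real.rpow_natCast, ← Real.rpow_mul hz0.le]; norm_num
          rw [this]; gcongr; nlinarith
        calc _ ≤ (‖z‖ ^ 2 + δ ^ 2) ^ (1 / 4 : ℝ) * (‖z‖ ^ 2 + δ ^ 2) ^ (3 / 4 : ℝ) := by gcongr
          _ = _ := by rw [← Real.rpow_add (by positivity)]; norm_num
    _ = ENNReal.ofReal (δ ^ (-(1 / 2) : ℝ)) * I := by
        rw [lintegral_const_mul' _ _ ENNReal.ofReal_ne_top]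
    _ ≤ _ := by
        rw [← ENNReal.ofReal_toReal hIfin, ← ENNReal.ofReal_mul (by positivity), mul_comm]
        refine ENNReal.ofReal_le_ofReal ?_
        rw [ENNReal.toReal_ofReal ENNReal.toReal_nonneg]
        gcongr
        linarith

/-- Local form on a ball whose radius is small compared with the nondegeneracy of the
derivative. -/
theorem lintegral_inv_sq_ball_le {Z : ℝ × ℝ → ℝ × ℝ} {Z' : ℝ × ℝ → ℝ × ℝ →L[ℝ] ℝ × ℝ}
    {Q : Set (ℝ × ℝ)} (hQ : IsCompact Q) (hQc : Convex ℝ Q)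
    (hZ : ∀ z ∈ Q, HasFDerivAt Z (Z' z) z) {L : ℝ} (hL : 1 ≤ L)
    (hlip : ∀ z ∈ Q, ∀ w ∈ Q, ‖Z' z - Z' w‖ ≤ L * ‖z - w‖)
    {C : ℝ} (hC : ∀ (z₀ : ℝ × ℝ) (δ : ℝ), 0 < δ →
      ∫⁻ z in Metric.ball z₀ 1, ENNReal.ofReal (1 / (‖z - z₀‖ ^ 2 + δ ^ 2)) ≤
        ENNReal.ofReal (C * δ ^ (-(1 / 2) : ℝ)))
    {S : Set (ℝ × ℝ)} (hS : S ⊆ Q) {μ : ℝ} (hμ : 0 < μ) (hμ1 : μ ≤ 1)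
    (hlow : ∀ z ∈ S, ∀ v, μ * ‖v‖ ≤ ‖Z' z v‖) (σ c : ℝ × ℝ) {δ : ℝ} (hδ : 0 < δ) :
    ∫⁻ z in S ∩ Metric.ball c (μ / (8 * L)), ENNReal.ofReal (1 / (‖Z z + σ‖ ^ 2 + δ ^ 2)) ≤
      ENNReal.ofReal (16 / μ ^ 2 * (C * δ ^ (-(1 / 2) : ℝ))) := by
  set R := μ / (8 * L) with hR
  have hR0 : 0 < R := by positivity
  have hLR : L * (2 * R) = μ / 4 := by rw [hR]; field_simp; norm_num
  have hR1 : R ≤ 1 / 8 := by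
    rw [hR, div_le_div_iff₀ (by positivity) (by norm_num)]; nlinarith
  rcases (S ∩ Metric.ball c R).eq_empty_or_nonempty with he | ⟨q, hqS, hqB⟩
  · simp [he]
  set T := Q ∩ Metric.closedBall c R with hT
  have hTc : Convex ℝ T := hQc.inter (convex_closedBall c R)
  have hqT : q ∈ T := ⟨hS hqS, Metric.ball_subset_closedBall hqB⟩
  have hdiam : ∀ z ∈ T, ∀ w ∈ T, ‖z - w‖ ≤ 2 * R := fun z hz w hw => by
    rw [← dist_eq_norm]
    have h1 := Metric.mem_closedBall.1 hz.2
    have h2 := Metric.mem_closedBall.1 hw.2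
    linarith [dist_triangle_right z w c]
  -- The radius `μ / (8 L)` is chosen so that the derivative of `Z` varies by at most `μ / 4` on
  -- `T`. One point `q` at which it expands by `μ` then makes `Z` itself expanding on all of `T`.
  have hexp : ∀ z ∈ T, ∀ w ∈ T, μ / 2 * ‖z - w‖ ≤ ‖Z z - Z w‖ := by
    intro z hz w hw
    have h1 : ‖Z z - Z w - Z' q (z - w)‖ ≤ μ / 4 * ‖z - w‖ := by
      refine hTc.norm_image_sub_le_of_norm_hasFDerivWithin_le'
        (fun y hy => (hZ y hy.1).hasFDerivWithinAt) (fun y hy => ?_) hw hz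
      refine (hlip y hy.1 q hqT.1).trans ?_
      rw [← hLR]
      exact mul_le_mul_of_nonneg_left (hdiam y hy q hqT) (by linarith)
    have h2 := hlow q hqS (z - w)
    have h3 : ‖Z' q (z - w)‖ ≤ ‖Z z - Z w‖ + ‖Z z - Z w - Z' q (z - w)‖ := by
      have := norm_sub_le (Z z - Z w) (Z z - Z w - Z' q (z - w))
      simpa using this
    nlinarith [norm_nonneg (z - w)]
  have cZ : ContinuousOn (fun z => ‖Z z + σ‖) T := fun z hz =>
    ((hZ z hz.1).continuousAt.add continuousAt_const).norm.continuousWithinAt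
  -- A minimizer replaces a zero of `Z + σ`, which need not exist in `T`. Minimality gives `|Z z - Z
  -- z₀| ≤ 2 |Z z + σ|`, so `|Z z + σ|` still dominates a multiple of `|z - z₀|`.
  obtain ⟨z₀, hz₀, hmin⟩ := (hQ.inter_right Metric.isClosed_closedBall).exists_isMinOn
    ⟨q, hqT⟩ cZ
  have hbd : ∀ z ∈ T, μ / 4 * ‖z - z₀‖ ≤ ‖Z z + σ‖ := by
    intro z hz
    have h1 := hexp z hz z₀ hz₀
    have h2 : ‖Z z₀ + σ‖ ≤ ‖Z z + σ‖ := hmin hz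
    have h3 : ‖Z z - Z z₀‖ ≤ ‖Z z + σ‖ + ‖Z z₀ + σ‖ := by
      have := norm_sub_le (Z z + σ) (Z z₀ + σ)
      simpa using this
    linarith
  have hsub : S ∩ Metric.ball c R ⊆ Metric.ball z₀ 1 ∩ T := fun z hz => by
    have hzT : z ∈ T := ⟨hS hz.1, Metric.ball_subset_closedBall hz.2⟩
    refine ⟨?_, hzT⟩
    rw [Metric.mem_ball, dist_eq_norm]
    linarith [hdiam z hzT z₀ hz₀]
  calc _ ≤ ∫⁻ z in Metric.ball z₀ 1 ∩ T, ENNReal.ofReal (1 / (‖Z z + σ‖ ^ 2 + δ ^ 2)) :=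
        lintegral_mono_set hsub
    _ ≤ ∫⁻ z in Metric.ball z₀ 1 ∩ T, ENNReal.ofReal (16 / μ ^ 2) *
          ENNReal.ofReal (1 / (‖z - z₀‖ ^ 2 + δ ^ 2)) := by
        have hTm : MeasurableSet T := (hQ.inter_right Metric.isClosed_closedBall).measurableSet
        refine setLIntegral_mono' (measurableSet_ball.inter hTm) fun z hz => ?_
        rw [← ENNReal.ofReal_mul (by positivity)]
        refine ENNReal.ofReal_le_ofReal ?_
        rw [div_mul_div_comm, mul_one, div_le_div_iff₀ (by positivity) (by positivity)]
        have h1 := hbd z hz.2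
        have h2 : (μ / 4 * ‖z - z₀‖) ^ 2 ≤ ‖Z z + σ‖ ^ 2 := by gcongr
        have h3 : μ ^ 2 * δ ^ 2 ≤ δ ^ 2 := mul_le_of_le_one_left (by positivity) (by nlinarith)
        nlinarith [sq_nonneg δ]
    _ ≤ ∫⁻ z in Metric.ball z₀ 1, ENNReal.ofReal (16 / μ ^ 2) *
          ENNReal.ofReal (1 / (‖z - z₀‖ ^ 2 + δ ^ 2)) := lintegral_mono_set Set.inter_subset_left
    _ ≤ _ := by
        rw [lintegral_const_mul' _ _ ENNReal.ofReal_ne_top, ENNReal.ofReal_mul (by positivity)]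
        gcongr
        exact hC z₀ δ hδ

/-- The integral of `1 / (|Z + σ| ^ 2 + δ ^ 2)` over the points where the derivative of `Z`
expands by at least `μ`. -/
theorem exists_lintegral_inv_sq_map_le {Z : ℝ × ℝ → ℝ × ℝ} {Z' : ℝ × ℝ → ℝ × ℝ →L[ℝ] ℝ × ℝ}
    (hZm : Measurable Z) {Q : Set (ℝ × ℝ)} (hQ : IsCompact Q) (hQc : Convex ℝ Q)
    (hZ : ∀ z ∈ Q, HasFDerivAt Z (Z' z) z) {L : ℝ}
    (hlip : ∀ z ∈ Q, ∀ w ∈ Q, ‖Z' z - Z' w‖ ≤ L * ‖z - w‖) :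
    ∃ C : ℝ, 0 < C ∧ ∀ (S : Set (ℝ × ℝ)), MeasurableSet S → S ⊆ Q → ∀ μ : ℝ, 0 < μ → μ ≤ 1 →
      (∀ z ∈ S, ∀ v, μ * ‖v‖ ≤ ‖Z' z v‖) → ∀ (σ : ℝ × ℝ) (δ : ℝ), 0 < δ →
      ∫⁻ z in S, ENNReal.ofReal (1 / (‖Z z + σ‖ ^ 2 + δ ^ 2)) ≤
        ENNReal.ofReal (C / μ ^ 4 * δ ^ (-(1 / 2) : ℝ)) := by
  obtain ⟨C, hC0, hC⟩ := exists_lintegral_inv_sq_le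
  wlog hL : 1 ≤ L generalizing L
  · exact this (L := 1) (fun z hz w hw => (hlip z hz w hw).trans
      (mul_le_mul_of_nonneg_right (le_of_not_ge hL) (norm_nonneg _))) le_rfl
  obtain ⟨ρ, hρ0, hρ⟩ := hQ.isBounded.exists_pos_norm_le
  set V := (volume (Metric.ball (0 : ℝ × ℝ) (ρ + 1))).toReal with hV
  set v := (volume (Metric.ball (0 : ℝ × ℝ) 1)).toReal with hv
  have hVf : volume (Metric.ball (0 : ℝ × ℝ) (ρ + 1)) ≠ ⊤ := measure_ball_lt_top.ne
  have hvf : volume (Metric.ball (0 : ℝ × ℝ) 1) ≠ ⊤ := measure_ball_lt_top.ne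
  have hv0 : 0 < v := ENNReal.toReal_pos (Metric.measure_ball_pos volume _ one_pos).ne' hvf
  have hV0 : 0 < V :=
    ENNReal.toReal_pos (Metric.measure_ball_pos volume _ (by positivity)).ne' hVf
  refine ⟨V / v * (8 * L) ^ 2 * 16 * C, by positivity,
    fun S hSm hS μ hμ hμ1 hlow σ δ hδ => ?_⟩
  set R := μ / (8 * L) with hR
  have hR0 : 0 < R := by positivity
  have hR1 : R ≤ 1 := by
    rw [hR, div_le_one (by positivity)]; nlinarith
  let F : ℝ × ℝ → ℝ≥0∞ := fun z => ENNReal.ofReal (1 / (‖Z z + σ‖ ^ 2 + δ ^ 2))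
  have hF : Measurable F := by
    refine ENNReal.measurable_ofReal.comp (measurable_const.div ?_)
    exact ((hZm.add_const σ).norm.pow_const 2).add_const _
  have hball : ∀ z : ℝ × ℝ, volume (Metric.ball z R) = ENNReal.ofReal (R ^ 2 * v) := by
    intro z
    rw [Measure.addHaar_ball _ _ hR0.le, ENNReal.ofReal_mul (by positivity),
      ENNReal.ofReal_toReal hvf]
    simp
  -- Instead of covering `S` by balls, the local bound is averaged over all centres `c`. By Fubini
  -- every `z` is counted with the area `R² v` of a ball. Dividing by this area costs a second
  -- factor `μ ^ (-2)`, whence `μ ^ (-4)`.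
  let G : ℝ × ℝ → ℝ × ℝ → ℝ≥0∞ := fun z c => F z * (Metric.ball z R).indicator 1 c
  have hG : Measurable (Function.uncurry G) := by
    refine (hF.comp measurable_fst).mul ?_
    have : (fun y : (ℝ × ℝ) × (ℝ × ℝ) => (Metric.ball y.1 R).indicator (1 : ℝ × ℝ → ℝ≥0∞) y.2) =
        ({y : (ℝ × ℝ) × (ℝ × ℝ) | dist y.2 y.1 < R}).indicator 1 := by
      ext y; simp [Set.indicator, Metric.mem_ball]
    rw [this]
    exact measurable_one.indicator
      (measurableSet_lt (measurable_snd.dist measurable_fst) measurable_const)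
  have e1 : (∫⁻ z in S, F z) * ENNReal.ofReal (R ^ 2 * v) = ∫⁻ c, ∫⁻ z in S, G z c := by
    rw [← lintegral_mul_const _ hF, lintegral_lintegral_swap]
    · refine lintegral_congr fun z => ?_
      rw [lintegral_const_mul _ (measurable_one.indicator measurableSet_ball),
        lintegral_indicator_one measurableSet_ball, hball]
    · exact (hG.comp measurable_swap).aemeasurable
  have e2 : ∀ c, ∫⁻ z in S, G z c ≤ (Metric.ball (0 : ℝ × ℝ) (ρ + 1)).indicator
      (fun _ => ENNReal.ofReal (16 / μ ^ 2 * (C * δ ^ (-(1 / 2) : ℝ)))) c := by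
    intro c
    have e3 : ∫⁻ z in S, G z c = ∫⁻ z in S ∩ Metric.ball c R, F z := by
      rw [Set.inter_comm, ← Measure.restrict_restrict measurableSet_ball,
        ← lintegral_indicator measurableSet_ball]
      refine lintegral_congr fun z => ?_
      simp [G, Set.indicator, dist_comm]
    rw [e3]
    by_cases hc : c ∈ Metric.ball (0 : ℝ × ℝ) (ρ + 1)
    · rw [Set.indicator_of_mem hc]
      exact lintegral_inv_sq_ball_le hQ hQc hZ hL hlip hC hS hμ hμ1 hlow σ c hδ
    · have : S ∩ Metric.ball c R = ∅ := by
        refine Set.eq_empty_of_forall_notMem fun z hz => hc ?_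
        have h1 := hρ z (hS hz.1)
        have h2 := Metric.mem_ball'.1 hz.2
        rw [Metric.mem_ball, dist_zero_right]
        have := norm_sub_norm_le c z
        rw [dist_eq_norm] at h2
        linarith
      simp [this]
  have e4 : (∫⁻ z in S, F z) * ENNReal.ofReal (R ^ 2 * v) ≤
      ENNReal.ofReal (16 / μ ^ 2 * (C * δ ^ (-(1 / 2) : ℝ)) * V) := by
    rw [e1]
    refine (lintegral_mono e2).trans ?_
    rw [lintegral_indicator measurableSet_ball, setLIntegral_const,
      ENNReal.ofReal_mul (q := V) (by positivity), hV, ENNReal.ofReal_toReal hVf]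
  have hpos : 0 < R ^ 2 * v := by positivity
  rw [← ENNReal.le_div_iff_mul_le (by simp [hpos]) (by simp),
    ← ENNReal.ofReal_div_of_pos hpos] at e4
  refine e4.trans_eq (congrArg _ ?_)
  rw [hR]
  field_simp

/-! ### Integration by parts on a rectangle -/

theorem setIntegral_deriv_fst_eq_zero {x₁ x₂ u₁ u₂ : ℝ} (hx : x₁ ≤ x₂) {h h' : ℝ × ℝ → ℂ}
    (hd : ∀ x ∈ Set.Icc x₁ x₂, ∀ u ∈ Set.Icc u₁ u₂,
      HasDerivAt (fun x => h (x, u)) (h' (x, u)) x)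
    (hc : ContinuousOn h' (Set.Icc x₁ x₂ ×ˢ Set.Icc u₁ u₂))
    (h1 : ∀ u ∈ Set.Icc u₁ u₂, h (x₁, u) = 0) (h2 : ∀ u ∈ Set.Icc u₁ u₂, h (x₂, u) = 0) :
    ∫ z in Set.Icc x₁ x₂ ×ˢ Set.Icc u₁ u₂, h' z = 0 := by
  have h_int : IntegrableOn h' (Set.Icc x₁ x₂ ×ˢ Set.Icc u₁ u₂) (volume.prod volume) :=
    hc.integrableOn_compact (isCompact_Icc.prod isCompact_Icc)
  rw [Measure.volume_eq_prod, ← setIntegral_prod_swap, setIntegral_prod]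
  · refine setIntegral_eq_zero_of_forall_eq_zero fun u hu => ?_
    simp only [Prod.swap_prod_mk]
    rw [integral_Icc_eq_integral_Ioc, ← intervalIntegral.integral_of_le hx,
      intervalIntegral.integral_eq_sub_of_hasDerivAt (f := fun x => h (x, u)), h1 u hu, h2 u hu,
      sub_zero]
    · rw [Set.uIcc_of_le hx]
      exact fun x hx => hd x hx u hu
    · refine ContinuousOn.intervalIntegrable ?_
      rw [Set.uIcc_of_le hx]
      exact hc.comp (by fun_prop) fun x hx => ⟨hx, hu⟩
  · exact h_int.swap

theorem setIntegral_deriv_snd_eq_zero {x₁ x₂ u₁ u₂ : ℝ} (hu : u₁ ≤ u₂) {h h' : ℝ × ℝ → ℂ}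
    (hd : ∀ x ∈ Set.Icc x₁ x₂, ∀ u ∈ Set.Icc u₁ u₂,
      HasDerivAt (fun u => h (x, u)) (h' (x, u)) u)
    (hc : ContinuousOn h' (Set.Icc x₁ x₂ ×ˢ Set.Icc u₁ u₂))
    (h1 : ∀ x ∈ Set.Icc x₁ x₂, h (x, u₁) = 0) (h2 : ∀ x ∈ Set.Icc x₁ x₂, h (x, u₂) = 0) :
    ∫ z in Set.Icc x₁ x₂ ×ˢ Set.Icc u₁ u₂, h' z = 0 := by
  have h_int : IntegrableOn h' (Set.Icc x₁ x₂ ×ˢ Set.Icc u₁ u₂) (volume.prod volume) :=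
    hc.integrableOn_compact (isCompact_Icc.prod isCompact_Icc)
  rw [Measure.volume_eq_prod, setIntegral_prod _ h_int]
  refine setIntegral_eq_zero_of_forall_eq_zero fun x hx => ?_
  rw [integral_Icc_eq_integral_Ioc, ← intervalIntegral.integral_of_le hu,
    intervalIntegral.integral_eq_sub_of_hasDerivAt (f := fun u => h (x, u)), h1 x hx, h2 x hx,
    sub_zero]
  · rw [Set.uIcc_of_le hu]
    exact fun u hu => hd x hx u hu
  · refine ContinuousOn.intervalIntegrable ?_
    rw [Set.uIcc_of_le hu]
    exact hc.comp (by fun_prop) fun u hu => ⟨hx, hu⟩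

/-- The derivative of the regularized field `A P / (P ^ 2 + Q ^ 2 + δ)` times the oscillating
factor. -/
theorem hasDerivAt_regularized {A : ℝ → ℂ} {Ψ P Q : ℝ → ℝ} {A' : ℂ} {P' Q' t δ x : ℝ}
    (hA : HasDerivAt A A' x) (hΨ : HasDerivAt Ψ (P x) x) (hP : HasDerivAt P P' x)
    (hQ : HasDerivAt Q Q' x) (hδ : 0 < δ) :
    HasDerivAt (fun x => A x * ((P x / (P x ^ 2 + Q x ^ 2 + δ) : ℝ) : ℂ) * cis (t * Ψ x))
      ((A' * ((P x / (P x ^ 2 + Q x ^ 2 + δ) : ℝ) : ℂ) +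
        A x * ((P' / (P x ^ 2 + Q x ^ 2 + δ) -
          2 * P x * (P x * P' + Q x * Q') / (P x ^ 2 + Q x ^ 2 + δ) ^ 2 : ℝ) : ℂ)) * cis (t * Ψ x) +
        Complex.I * t * (A x * ((P x ^ 2 / (P x ^ 2 + Q x ^ 2 + δ) : ℝ) : ℂ) * cis (t * Ψ x))) x := by
  have hD : P x ^ 2 + Q x ^ 2 + δ ≠ 0 := by positivity
  have d1 : HasDerivAt (fun x => P x ^ 2 + Q x ^ 2 + δ) (2 * P x * P' + 2 * Q x * Q') x := by
    simpa [mul_comm, mul_assoc] using ((hP.pow 2).add (hQ.pow 2)).add_const δ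
  have d2 : HasDerivAt (fun y => ((P y / (P y ^ 2 + Q y ^ 2 + δ) : ℝ) : ℂ)) _ x :=
    (hP.div d1 hD).ofReal_comp
  refine ((hA.mul d2).mul (hasDerivAt_cis (hΨ.const_mul t))).congr_deriv ?_
  have : ((P x : ℂ) ^ 2 + (Q x : ℂ) ^ 2 + δ) ≠ 0 := by exact_mod_cast hD
  simp only [Pi.mul_apply]
  push_cast
  field_simp

/-- Here `P, Q` play the role of the first derivatives of the phase and `P', Q'` of second ones. The
second derivatives may grow as fast as the first ones, since `1 + |P| + |Q| ≤ 2 (D + 1)`. This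
tolerance is what makes the integration by parts uniform in the linear part of the phase. -/
theorem abs_regularized_deriv_le {P Q P' Q' δ L : ℝ} (hδ : 0 < δ)
    (hP' : |P'| ≤ L * (1 + |P| + |Q|)) (hQ' : |Q'| ≤ L * (1 + |P| + |Q|)) :
    |P' / (P ^ 2 + Q ^ 2 + δ) - 2 * P * (P * P' + Q * Q') / (P ^ 2 + Q ^ 2 + δ) ^ 2| ≤
      10 * L * (1 + 1 / (P ^ 2 + Q ^ 2 + δ)) := by
  set D := P ^ 2 + Q ^ 2 + δ with hD
  have hD0 : 0 < D := by positivity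
  set K := L * (1 + |P| + |Q|) with hK
  have hK0 : 0 ≤ K := (abs_nonneg _).trans hP'
  have hL : 0 ≤ L := nonneg_of_mul_nonneg_left hK0 (by positivity)
  have e1 : |2 * P * (P * P' + Q * Q')| ≤ 4 * K * D := by
    have h1 : |P * P' + Q * Q'| ≤ (|P| + |Q|) * K := by
      calc _ ≤ |P| * |P'| + |Q| * |Q'| := by
            rw [← abs_mul, ← abs_mul]; exact abs_add_le _ _
        _ ≤ |P| * K + |Q| * K := by gcongr
        _ = _ := by ring
    rw [abs_mul, abs_mul, abs_two]
    calc 2 * |P| * |P * P' + Q * Q'| ≤ 2 * |P| * ((|P| + |Q|) * K) := by gcongr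
      _ = (2 * |P| * (|P| + |Q|)) * K := by ring
      _ ≤ (4 * D) * K := by
          refine mul_le_mul_of_nonneg_right ?_ hK0
          nlinarith [sq_nonneg (|P| - |Q|), sq_abs P, sq_abs Q]
      _ = _ := by ring
  have e2 : |2 * P * (P * P' + Q * Q') / D ^ 2| ≤ 4 * K / D := by
    rw [abs_div, abs_of_pos (pow_pos hD0 2), div_le_div_iff₀ (by positivity) hD0]
    nlinarith
  have e3 : |P' / D| ≤ K / D := by
    rw [abs_div, abs_of_pos hD0]; gcongr
  have e4 : 5 * K / D ≤ 10 * L * (1 + 1 / D) := by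
    rw [div_le_iff₀ hD0]
    have : 10 * L * (1 + 1 / D) * D = 10 * L * (D + 1) := by field_simp
    rw [this, hK]
    have : 1 + |P| + |Q| ≤ 2 * (D + 1) := by
      nlinarith [sq_nonneg (|P| - 1), sq_nonneg (|Q| - 1), sq_abs P, sq_abs Q]
    nlinarith
  calc _ ≤ |P' / D| + |2 * P * (P * P' + Q * Q') / D ^ 2| := abs_sub _ _
    _ ≤ K / D + 4 * K / D := add_le_add e3 e2
    _ = 5 * K / D := by ring
    _ ≤ _ := e4

theorem abs_regularized_le {P Q δ : ℝ} (hδ : 0 < δ) :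
    |P / (P ^ 2 + Q ^ 2 + δ)| ≤ 1 + 1 / (P ^ 2 + Q ^ 2 + δ) := by
  have hD0 : 0 < P ^ 2 + Q ^ 2 + δ := by positivity
  rw [abs_div, abs_of_pos hD0, div_le_iff₀ hD0, add_mul, one_mul, one_div_mul_cancel hD0.ne']
  nlinarith [sq_nonneg (|P| - 1), sq_abs P, sq_nonneg Q]

/-- A phase on a rectangle together with its first and second partial derivatives, the second ones
being controlled by the first ones. -/
structure PhaseOn (x₁ x₂ u₁ u₂ L : ℝ) (Ψ Ψx Ψu Ψxx Ψxu Ψuu : ℝ × ℝ → ℝ) : Prop where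
  dx : ∀ x ∈ Set.Icc x₁ x₂, ∀ u ∈ Set.Icc u₁ u₂, HasDerivAt (fun x => Ψ (x, u)) (Ψx (x, u)) x
  du : ∀ x ∈ Set.Icc x₁ x₂, ∀ u ∈ Set.Icc u₁ u₂, HasDerivAt (fun u => Ψ (x, u)) (Ψu (x, u)) u
  dxx : ∀ x ∈ Set.Icc x₁ x₂, ∀ u ∈ Set.Icc u₁ u₂, HasDerivAt (fun x => Ψx (x, u)) (Ψxx (x, u)) x
  dux : ∀ x ∈ Set.Icc x₁ x₂, ∀ u ∈ Set.Icc u₁ u₂, HasDerivAt (fun x => Ψu (x, u)) (Ψxu (x, u)) x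
  dxu : ∀ x ∈ Set.Icc x₁ x₂, ∀ u ∈ Set.Icc u₁ u₂, HasDerivAt (fun u => Ψx (x, u)) (Ψxu (x, u)) u
  duu : ∀ x ∈ Set.Icc x₁ x₂, ∀ u ∈ Set.Icc u₁ u₂, HasDerivAt (fun u => Ψu (x, u)) (Ψuu (x, u)) u
  c : ContinuousOn Ψ (Set.Icc x₁ x₂ ×ˢ Set.Icc u₁ u₂)
  cx : ContinuousOn Ψx (Set.Icc x₁ x₂ ×ˢ Set.Icc u₁ u₂)
  cu : ContinuousOn Ψu (Set.Icc x₁ x₂ ×ˢ Set.Icc u₁ u₂)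
  cxx : ContinuousOn Ψxx (Set.Icc x₁ x₂ ×ˢ Set.Icc u₁ u₂)
  cxu : ContinuousOn Ψxu (Set.Icc x₁ x₂ ×ˢ Set.Icc u₁ u₂)
  cuu : ContinuousOn Ψuu (Set.Icc x₁ x₂ ×ˢ Set.Icc u₁ u₂)
  bxx : ∀ z ∈ Set.Icc x₁ x₂ ×ˢ Set.Icc u₁ u₂, |Ψxx z| ≤ L * (1 + |Ψx z| + |Ψu z|)
  bxu : ∀ z ∈ Set.Icc x₁ x₂ ×ˢ Set.Icc u₁ u₂, |Ψxu z| ≤ L * (1 + |Ψx z| + |Ψu z|)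
  buu : ∀ z ∈ Set.Icc x₁ x₂ ×ˢ Set.Icc u₁ u₂, |Ψuu z| ≤ L * (1 + |Ψx z| + |Ψu z|)

/-- A `C¹` amplitude on a rectangle that vanishes on the boundary. -/
structure AmplitudeOn (x₁ x₂ u₁ u₂ M : ℝ) (B Bx Bu : ℝ × ℝ → ℂ) : Prop where
  dx : ∀ x ∈ Set.Icc x₁ x₂, ∀ u ∈ Set.Icc u₁ u₂, HasDerivAt (fun x => B (x, u)) (Bx (x, u)) x
  du : ∀ x ∈ Set.Icc x₁ x₂, ∀ u ∈ Set.Icc u₁ u₂, HasDerivAt (fun u => B (x, u)) (Bu (x, u)) u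
  c : ContinuousOn B (Set.Icc x₁ x₂ ×ˢ Set.Icc u₁ u₂)
  cx : ContinuousOn Bx (Set.Icc x₁ x₂ ×ˢ Set.Icc u₁ u₂)
  cu : ContinuousOn Bu (Set.Icc x₁ x₂ ×ˢ Set.Icc u₁ u₂)
  b : ∀ z ∈ Set.Icc x₁ x₂ ×ˢ Set.Icc u₁ u₂, ‖B z‖ ≤ M
  bx : ∀ z ∈ Set.Icc x₁ x₂ ×ˢ Set.Icc u₁ u₂, ‖Bx z‖ ≤ M
  bu : ∀ z ∈ Set.Icc x₁ x₂ ×ˢ Set.Icc u₁ u₂, ‖Bu z‖ ≤ M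
  zx₁ : ∀ u ∈ Set.Icc u₁ u₂, B (x₁, u) = 0
  zx₂ : ∀ u ∈ Set.Icc u₁ u₂, B (x₂, u) = 0
  zu₁ : ∀ x ∈ Set.Icc x₁ x₂, B (x, u₁) = 0
  zu₂ : ∀ x ∈ Set.Icc x₁ x₂, B (x, u₂) = 0

/-- Integration by parts along the regularized gradient of the phase. -/
theorem norm_setIntegral_cis_le {x₁ x₂ u₁ u₂ L M : ℝ} (hx : x₁ ≤ x₂) (hu : u₁ ≤ u₂)
    {Ψ Ψx Ψu Ψxx Ψxu Ψuu : ℝ × ℝ → ℝ} (hΨ : PhaseOn x₁ x₂ u₁ u₂ L Ψ Ψx Ψu Ψxx Ψxu Ψuu)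
    {B Bx Bu : ℝ × ℝ → ℂ} (hB : AmplitudeOn x₁ x₂ u₁ u₂ M B Bx Bu)
    {S : Set (ℝ × ℝ)} (hS : MeasurableSet S)
    (hBS : ∀ z ∈ Set.Icc x₁ x₂ ×ˢ Set.Icc u₁ u₂, z ∉ S → B z = 0 ∧ Bx z = 0 ∧ Bu z = 0)
    {t : ℝ} (ht : t ≠ 0) :
    ‖∫ z in Set.Icc x₁ x₂ ×ˢ Set.Icc u₁ u₂, B z * cis (t * Ψ z)‖ ≤
      M * (3 + 20 * L) / |t| * ∫ z in S ∩ Set.Icc x₁ x₂ ×ˢ Set.Icc u₁ u₂,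
        (1 + 1 / (Ψx z ^ 2 + Ψu z ^ 2 + 1 / |t|)) := by
  set Q := Set.Icc x₁ x₂ ×ˢ Set.Icc u₁ u₂ with hQ
  have hQc : IsCompact Q := isCompact_Icc.prod isCompact_Icc
  set δ := 1 / |t| with hδ
  have hδ0 : 0 < δ := by positivity
  -- Two-dimensional form of the splitting used for van der Corput's lemma: `1 = δ / D + Ψx² / D +
  -- Ψu² / D`. Each of the last two terms is integrated by parts in its own variable and gains `1 /
  -- |t|`. The choice `δ = 1 / |t|` gives the first term the same size without any integration by
  -- parts.
  let D : ℝ × ℝ → ℝ := fun z => Ψx z ^ 2 + Ψu z ^ 2 + δ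
  have hD : ∀ z, 0 < D z := fun z => by positivity
  have cD : ContinuousOn D Q := ((hΨ.cx.pow 2).add (hΨ.cu.pow 2)).add continuousOn_const
  have ce : ContinuousOn (fun z => cis (t * Ψ z)) Q :=
    continuous_cis.comp_continuousOn (continuousOn_const.mul hΨ.c)
  have cdiv : ∀ {g : ℝ × ℝ → ℝ}, ContinuousOn g Q →
      ContinuousOn (fun z => ((g z / D z : ℝ) : ℂ)) Q := fun hg =>
    Complex.continuous_ofReal.comp_continuousOn (hg.div cD fun z _ => (hD z).ne')
  let Rx : ℝ × ℝ → ℂ := fun z => (Bx z * ((Ψx z / D z : ℝ) : ℂ) + B z * ((Ψxx z / D z -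
    2 * Ψx z * (Ψx z * Ψxx z + Ψu z * Ψxu z) / D z ^ 2 : ℝ) : ℂ)) * cis (t * Ψ z)
  let Ru : ℝ × ℝ → ℂ := fun z => (Bu z * ((Ψu z / D z : ℝ) : ℂ) + B z * ((Ψuu z / D z -
    2 * Ψu z * (Ψu z * Ψuu z + Ψx z * Ψxu z) / D z ^ 2 : ℝ) : ℂ)) * cis (t * Ψ z)
  let Sx : ℝ × ℝ → ℂ := fun z => B z * ((Ψx z ^ 2 / D z : ℝ) : ℂ) * cis (t * Ψ z)
  let Su : ℝ × ℝ → ℂ := fun z => B z * ((Ψu z ^ 2 / D z : ℝ) : ℂ) * cis (t * Ψ z)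
  let S0 : ℝ × ℝ → ℂ := fun z => B z * ((δ / D z : ℝ) : ℂ) * cis (t * Ψ z)
  have cRx : ContinuousOn Rx Q := by
    refine ((hB.cx.mul (cdiv hΨ.cx)).add (hB.c.mul ?_)).mul ce
    refine Complex.continuous_ofReal.comp_continuousOn ?_
    exact (hΨ.cxx.div cD fun z _ => (hD z).ne').sub (((continuousOn_const.mul hΨ.cx).mul
      ((hΨ.cx.mul hΨ.cxx).add (hΨ.cu.mul hΨ.cxu))).div (cD.pow 2)
        fun z _ => pow_ne_zero 2 (hD z).ne')
  have cRu : ContinuousOn Ru Q := by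
    refine ((hB.cu.mul (cdiv hΨ.cu)).add (hB.c.mul ?_)).mul ce
    refine Complex.continuous_ofReal.comp_continuousOn ?_
    exact (hΨ.cuu.div cD fun z _ => (hD z).ne').sub (((continuousOn_const.mul hΨ.cu).mul
      ((hΨ.cu.mul hΨ.cuu).add (hΨ.cx.mul hΨ.cxu))).div (cD.pow 2)
        fun z _ => pow_ne_zero 2 (hD z).ne')
  have cSx : ContinuousOn Sx Q := (hB.c.mul (cdiv (hΨ.cx.pow 2))).mul ce
  have cSu : ContinuousOn Su Q := (hB.c.mul (cdiv (hΨ.cu.pow 2))).mul ce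
  have cS0 : ContinuousOn S0 Q := (hB.c.mul (cdiv continuousOn_const)).mul ce
  have iRx := cRx.integrableOn_compact (μ := volume) hQc
  have iRu := cRu.integrableOn_compact (μ := volume) hQc
  have iSx := cSx.integrableOn_compact (μ := volume) hQc
  have iSu := cSu.integrableOn_compact (μ := volume) hQc
  have iS0 := cS0.integrableOn_compact (μ := volume) hQc
  have zx : ∫ z in Q, (Rx z + Complex.I * t * Sx z) = 0 := by
    refine setIntegral_deriv_fst_eq_zero hx
      (h := fun z => B z * ((Ψx z / D z : ℝ) : ℂ) * cis (t * Ψ z)) (fun x hx u hu => ?_)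
      (cRx.add (continuousOn_const.mul cSx)) (fun u hu => by simp [hB.zx₁ u hu])
      (fun u hu => by simp [hB.zx₂ u hu])
    exact hasDerivAt_regularized (hB.dx x hx u hu) (hΨ.dx x hx u hu) (hΨ.dxx x hx u hu)
      (hΨ.dux x hx u hu) hδ0
  have zu : ∫ z in Q, (Ru z + Complex.I * t * Su z) = 0 := by
    refine setIntegral_deriv_snd_eq_zero hu
      (h := fun z => B z * ((Ψu z / D z : ℝ) : ℂ) * cis (t * Ψ z)) (fun x hx u hu => ?_)
      (cRu.add (continuousOn_const.mul cSu)) (fun u hu => by simp [hB.zu₁ u hu])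
      (fun u hu => by simp [hB.zu₂ u hu])
    have := hasDerivAt_regularized (t := t) (hB.du x hx u hu) (hΨ.du x hx u hu) (hΨ.duu x hx u hu)
      (hΨ.dxu x hx u hu) hδ0
    simpa only [D, Ru, Su, add_comm (Ψu _ ^ 2) (Ψx _ ^ 2)] using this
  rw [integral_add iRx (iSx.const_mul _), integral_const_mul] at zx
  rw [integral_add iRu (iSu.const_mul _), integral_const_mul] at zu
  have hsplit : ∫ z in Q, B z * cis (t * Ψ z) =
      (∫ z in Q, S0 z) + ((∫ z in Q, Sx z) + ∫ z in Q, Su z) := by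
    have i2 : IntegrableOn (fun z => Sx z + Su z) Q := iSx.add iSu
    rw [← integral_add iSx iSu, ← integral_add iS0 i2]
    refine integral_congr_ae (Eventually.of_forall fun z => ?_)
    have h0 : (D z : ℂ) ≠ 0 := by exact_mod_cast (hD z).ne'
    simp only [S0, Sx, Su]
    rw [← add_mul, ← add_mul, ← mul_add, ← mul_add, ← Complex.ofReal_add, ← Complex.ofReal_add]
    have : δ / D z + (Ψx z ^ 2 / D z + Ψu z ^ 2 / D z) = 1 := by
      have := (hD z).ne'
      field_simp
      simp only [D]; ring
    rw [this]; simp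
  have htC : (t : ℂ) ≠ 0 := by exact_mod_cast ht
  have hsum : (∫ z in Q, Sx z) + (∫ z in Q, Su z) =
      Complex.I / t * ((∫ z in Q, Rx z) + ∫ z in Q, Ru z) := by
    have : Complex.I * t * ((∫ z in Q, Sx z) + ∫ z in Q, Su z) =
        -((∫ z in Q, Rx z) + ∫ z in Q, Ru z) := by linear_combination zx + zu
    have h2 : (∫ z in Q, Rx z) + (∫ z in Q, Ru z) =
        -(Complex.I * t * ((∫ z in Q, Sx z) + ∫ z in Q, Su z)) := by rw [this, neg_neg]
    rw [h2]
    field_simp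
    rw [Complex.I_sq]; ring
  set g : ℝ × ℝ → ℝ := fun z => 1 + 1 / D z with hg
  have cg : ContinuousOn g Q :=
    continuousOn_const.add (continuousOn_const.div cD fun z _ => (hD z).ne')
  have ig := cg.integrableOn_compact (μ := volume) hQc
  have hg0 : ∀ z, 0 ≤ g z := fun z => by
    have := hD z
    positivity
  have hpt : ∀ z ∈ Q, ‖S0 z‖ + 1 / |t| * (‖Rx z‖ + ‖Ru z‖) ≤
      S.indicator (fun z => M * (3 + 20 * L) / |t| * g z) z := by
    intro z hz
    by_cases hzS : z ∈ S
    · rw [Set.indicator_of_mem hzS]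
      have hM0 : 0 ≤ M := (norm_nonneg _).trans (hB.b z hz)
      have b0 : ‖S0 z‖ ≤ M * (1 / |t| * g z) := by
        simp only [S0, norm_mul, norm_cis, mul_one, Complex.norm_real, Real.norm_eq_abs]
        refine mul_le_mul (hB.b z hz) ?_ (abs_nonneg _) hM0
        rw [abs_of_nonneg (div_nonneg hδ0.le (hD z).le), div_eq_mul_one_div]
        refine mul_le_mul_of_nonneg_left ?_ hδ0.le
        simp only [hg]; linarith
      have bb : ∀ {A' : ℂ} {a b : ℝ}, ‖A'‖ ≤ M → |a| ≤ g z → |b| ≤ 10 * L * g z →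
          ‖(A' * (a : ℂ) + B z * (b : ℂ)) * cis (t * Ψ z)‖ ≤ M * (1 + 10 * L) * g z := by
        intro A' a b h1 h2 h3
        rw [norm_mul, norm_cis, mul_one]
        refine (norm_add_le _ _).trans ?_
        simp only [norm_mul, Complex.norm_real, Real.norm_eq_abs]
        calc _ ≤ M * g z + M * (10 * L * g z) :=
              add_le_add (mul_le_mul h1 h2 (abs_nonneg _) hM0)
                (mul_le_mul (hB.b z hz) h3 (abs_nonneg _) hM0)
          _ = _ := by ring
      have b1 : ‖Rx z‖ ≤ M * (1 + 10 * L) * g z :=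
        bb (hB.bx z hz) (abs_regularized_le hδ0)
          (abs_regularized_deriv_le hδ0 (hΨ.bxx z hz) (hΨ.bxu z hz))
      have b2 : ‖Ru z‖ ≤ M * (1 + 10 * L) * g z := by
        refine bb (hB.bu z hz) ?_ ?_
        · simp only [g, D, add_comm (Ψx z ^ 2)]
          exact abs_regularized_le hδ0
        · simp only [g, D, add_comm (Ψx z ^ 2)]
          refine abs_regularized_deriv_le hδ0 ((hΨ.buu z hz).trans_eq ?_)
            ((hΨ.bxu z hz).trans_eq ?_) <;> ring
      calc _ ≤ M * (1 / |t| * g z) +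
            1 / |t| * (M * (1 + 10 * L) * g z + M * (1 + 10 * L) * g z) := by gcongr
        _ = _ := by ring
    · rw [Set.indicator_of_notMem hzS]
      obtain ⟨h1, h2, h3⟩ := hBS z hz hzS
      simp [S0, Rx, Ru, h1, h2, h3]
  have hQm : MeasurableSet Q := hQc.measurableSet
  calc ‖∫ z in Q, B z * cis (t * Ψ z)‖
      ≤ ‖∫ z in Q, S0 z‖ + 1 / |t| * (‖∫ z in Q, Rx z‖ + ‖∫ z in Q, Ru z‖) := by
        rw [hsplit, hsum]
        refine (norm_add_le _ _).trans ?_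
        rw [norm_mul, norm_div, Complex.norm_I, Complex.norm_real, Real.norm_eq_abs]
        gcongr
        exact norm_add_le _ _
    _ ≤ (∫ z in Q, ‖S0 z‖) + 1 / |t| * ((∫ z in Q, ‖Rx z‖) + ∫ z in Q, ‖Ru z‖) := by
        gcongr <;> exact norm_integral_le_integral_norm _
    _ = ∫ z in Q, (‖S0 z‖ + 1 / |t| * (‖Rx z‖ + ‖Ru z‖)) := by
        have i2 : IntegrableOn (fun z => 1 / |t| * (‖Rx z‖ + ‖Ru z‖)) Q :=
          (iRx.norm.add iRu.norm).const_mul _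
        rw [← integral_add iRx.norm iRu.norm, ← integral_const_mul, ← integral_add iS0.norm i2]
    _ ≤ ∫ z in Q, S.indicator (fun z => M * (3 + 20 * L) / |t| * g z) z := by
        refine setIntegral_mono_on (iS0.norm.add ((iRx.norm.add iRu.norm).const_mul _))
          ((ig.const_mul _).indicator hS) hQm hpt
    _ = _ := by
        rw [integral_indicator hS, Measure.restrict_restrict hS, integral_const_mul]

/-! ### Phases in homogeneous coordinates -/

/-- The phase `x ^ p g(u) + σ₁ x + σ₂ x ^ θ u`. -/
def homPhase (p θ : ℝ) (g : ℝ → ℝ) (σ : ℝ × ℝ) (z : ℝ × ℝ) : ℝ :=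
  z.1 ^ p * g z.2 + σ.1 * z.1 + σ.2 * z.1 ^ θ * z.2

/-- The factor of the Hessian determinant of `x ^ p g (y / x ^ θ)` that depends on `y / x ^ θ`. -/
def hessFactor (p θ : ℝ) (g : ℝ → ℝ) (u : ℝ) : ℝ :=
  deriv (deriv g) u * (p * (p - 1) * g u + θ * (1 - θ) * u * deriv g u) -
    (p - θ) ^ 2 * deriv g u ^ 2

/-- The gradient of `x ^ p g (y / x ^ θ)` in the coordinates `x` and `u = y / x ^ θ`. -/
def homGrad (p θ : ℝ) (g : ℝ → ℝ) (z : ℝ × ℝ) : ℝ × ℝ :=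
  (z.1 ^ (p - 1) * (p * g z.2 - θ * z.2 * deriv g z.2), z.1 ^ (p - θ) * deriv g z.2)

theorem hasDerivAt_rpow {x : ℝ} (hx : 0 < x) (p : ℝ) :
    HasDerivAt (fun x : ℝ => x ^ p) (p * x ^ (p - 1)) x :=
  Real.hasDerivAt_rpow_const (Or.inl hx.ne')

theorem continuousOn_rpow_fst {Q : Set (ℝ × ℝ)} (hQ : ∀ z ∈ Q, 0 < z.1) (p : ℝ) :
    ContinuousOn (fun z : ℝ × ℝ => z.1 ^ p) Q :=
  continuous_fst.continuousOn.rpow_const fun z hz => Or.inl (hQ z hz).ne'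

section Smooth

variable {g : ℝ → ℝ}

theorem contDiff_deriv_infty (hg : ContDiff ℝ ∞ g) : ContDiff ℝ ∞ (deriv g) :=
  (contDiff_infty_iff_deriv.1 hg).2

theorem hasDerivAt_of_infty (hg : ContDiff ℝ ∞ g) (u : ℝ) : HasDerivAt g (deriv g u) u :=
  ((contDiff_infty_iff_deriv.1 hg).1 u).hasDerivAt

/-- Since `σ` is arbitrary, the second derivatives of the phase are not bounded uniformly. They
contain `σ` only through `σ₂`, however, and `σ₂ = x ^ (-θ) Ψ_u - x ^ (p - θ) g'(u)` is controlled by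
the first derivative in `u`. Hence `L` can be chosen before `σ`. -/
theorem exists_phaseOn (hg : ContDiff ℝ ∞ g) (p θ : ℝ) {x₁ x₂ u₁ u₂ : ℝ} (hx₁ : 0 < x₁) :
    ∃ L : ℝ, 0 ≤ L ∧ ∀ σ : ℝ × ℝ, PhaseOn x₁ x₂ u₁ u₂ L (homPhase p θ g σ)
      (fun z => p * z.1 ^ (p - 1) * g z.2 + σ.1 + θ * σ.2 * z.1 ^ (θ - 1) * z.2)
      (fun z => z.1 ^ p * deriv g z.2 + σ.2 * z.1 ^ θ)
      (fun z => p * (p - 1) * z.1 ^ (p - 2) * g z.2 + θ * (θ - 1) * σ.2 * z.1 ^ (θ - 2) * z.2)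
      (fun z => p * z.1 ^ (p - 1) * deriv g z.2 + θ * σ.2 * z.1 ^ (θ - 1))
      (fun z => z.1 ^ p * deriv (deriv g) z.2) := by
  set Q := Set.Icc x₁ x₂ ×ˢ Set.Icc u₁ u₂ with hQdef
  have hQ : IsCompact Q := isCompact_Icc.prod isCompact_Icc
  have hpos : ∀ z ∈ Q, 0 < z.1 := fun z hz => hx₁.trans_le hz.1.1
  have cr := continuousOn_rpow_fst hpos
  have cg : ContinuousOn (fun z : ℝ × ℝ => g z.2) Q :=
    (hg.continuous.comp continuous_snd).continuousOn
  have cg1 : ContinuousOn (fun z : ℝ × ℝ => deriv g z.2) Q :=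
    ((contDiff_deriv_infty hg).continuous.comp continuous_snd).continuousOn
  have cg2 : ContinuousOn (fun z : ℝ × ℝ => deriv (deriv g) z.2) Q :=
    ((contDiff_deriv_infty (contDiff_deriv_infty hg)).continuous.comp continuous_snd).continuousOn
  have c2 : ContinuousOn (fun z : ℝ × ℝ => z.2) Q := continuous_snd.continuousOn
  -- a common bound for all coefficients
  have hbd : ∀ {h : ℝ × ℝ → ℝ}, ContinuousOn h Q → ∃ K : ℝ, 0 ≤ K ∧ ∀ z ∈ Q, |h z| ≤ K :=
    fun hh => by
      obtain ⟨K, hK⟩ := hQ.exists_bound_of_continuousOn hh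
      exact ⟨|K|, abs_nonneg _, fun z hz => (hK z hz).trans (le_abs_self K)⟩
  obtain ⟨K1, hK1, k1⟩ := hbd ((continuousOn_const (c := p * (p - 1))).mul ((cr (p - 2)).mul cg))
  obtain ⟨K2, hK2, k2⟩ :=
    hbd ((continuousOn_const (c := θ * (θ - 1))).mul ((cr (θ - 2)).mul c2))
  obtain ⟨K3, hK3, k3⟩ := hbd ((continuousOn_const (c := p)).mul ((cr (p - 1)).mul cg1))
  obtain ⟨K4, hK4, k4⟩ := hbd ((continuousOn_const (c := θ)).mul (cr (θ - 1)))
  obtain ⟨K5, hK5, k5⟩ := hbd ((cr p).mul cg2)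
  obtain ⟨K6, hK6, k6⟩ := hbd (cr (-θ))
  obtain ⟨K7, hK7, k7⟩ := hbd ((cr (p - θ)).mul cg1)
  have hσ : ∀ σ : ℝ × ℝ, ∀ z ∈ Q,
      |σ.2| ≤ (K6 + K7) * (1 + |z.1 ^ p * deriv g z.2 + σ.2 * z.1 ^ θ|) := by
    intro σ z hz
    have hz1 := hpos z hz
    have e : σ.2 = z.1 ^ (-θ) * (z.1 ^ p * deriv g z.2 + σ.2 * z.1 ^ θ) -
        z.1 ^ (p - θ) * deriv g z.2 := by
      have h1 : z.1 ^ (-θ) * z.1 ^ θ = 1 := by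
        rw [← Real.rpow_add hz1]; simp
      have h2 : z.1 ^ (-θ) * z.1 ^ p = z.1 ^ (p - θ) := by
        rw [← Real.rpow_add hz1]; congr 1; ring
      linear_combination (-σ.2) * h1 - deriv g z.2 * h2
    set w := z.1 ^ p * deriv g z.2 + σ.2 * z.1 ^ θ
    rw [e]
    calc _ ≤ |z.1 ^ (-θ) * w| + |z.1 ^ (p - θ) * deriv g z.2| := abs_sub _ _
      _ ≤ K6 * |w| + K7 := by
          rw [abs_mul]
          exact add_le_add (mul_le_mul_of_nonneg_right (k6 z hz) (abs_nonneg _)) (k7 z hz)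
      _ ≤ _ := by nlinarith [abs_nonneg w]
  refine ⟨K1 + K3 + K5 + (K2 + K4) * (K6 + K7), by positivity, fun σ => ?_⟩
  have habs : ∀ a b : ℝ, (1 : ℝ) ≤ 1 + |a| + |b| := fun a b => by
    linarith [abs_nonneg a, abs_nonneg b]
  refine
    { dx := fun x hx u hu => ?_, du := fun x hx u hu => ?_, dxx := fun x hx u hu => ?_,
      dux := fun x hx u hu => ?_, dxu := fun x hx u hu => ?_, duu := fun x hx u hu => ?_,
      c := ?_, cx := ?_, cu := ?_, cxx := ?_, cxu := ?_, cuu := (cr p).mul cg2,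
      bxx := fun z hz => ?_, bxu := fun z hz => ?_, buu := fun z hz => ?_ }
  · have h0 : 0 < x := hx₁.trans_le hx.1
    refine ((((hasDerivAt_rpow h0 p).mul_const (g u)).add ((hasDerivAt_id x).const_mul σ.1)).add
      (((hasDerivAt_rpow h0 θ).const_mul σ.2).mul_const u)).congr_deriv ?_
    simp only; ring
  · refine ((((hasDerivAt_of_infty hg u).const_mul (x ^ p)).add
      (hasDerivAt_const u (σ.1 * x))).add
      ((hasDerivAt_id u).const_mul (σ.2 * x ^ θ))).congr_deriv ?_
    simp
  · have h0 : 0 < x := hx₁.trans_le hx.1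
    refine (((((hasDerivAt_rpow h0 (p - 1)).const_mul p).mul_const (g u)).add_const σ.1).add
      (((hasDerivAt_rpow h0 (θ - 1)).const_mul (θ * σ.2)).mul_const u)).congr_deriv ?_
    simp only [sub_sub]; norm_num; ring
  · have h0 : 0 < x := hx₁.trans_le hx.1
    refine (((hasDerivAt_rpow h0 p).mul_const (deriv g u)).add
      ((hasDerivAt_rpow h0 θ).const_mul σ.2)).congr_deriv ?_
    simp only; ring
  · refine (((((hasDerivAt_of_infty hg u).const_mul (p * x ^ (p - 1))).add_const σ.1)).add
      ((hasDerivAt_id u).const_mul (θ * σ.2 * x ^ (θ - 1)))).congr_deriv ?_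
    simp
  · refine (((hasDerivAt_of_infty (contDiff_deriv_infty hg) u).const_mul (x ^ p)).add_const
      (σ.2 * x ^ θ)).congr_deriv ?_
    simp
  · exact (((cr p).mul cg).add (continuousOn_const.mul continuous_fst.continuousOn)).add
      ((continuousOn_const.mul (cr θ)).mul c2)
  · exact (((continuousOn_const.mul (cr (p - 1))).mul cg).add continuousOn_const).add
      ((continuousOn_const.mul (cr (θ - 1))).mul c2)
  · exact ((cr p).mul cg1).add (continuousOn_const.mul (cr θ))
  · exact ((continuousOn_const.mul (cr (p - 2))).mul cg).add
      ((continuousOn_const.mul (cr (θ - 2))).mul c2)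
  · exact ((continuousOn_const.mul (cr (p - 1))).mul cg1).add (continuousOn_const.mul (cr (θ - 1)))
  · have h1 := k1 z hz
    have h2 := k2 z hz
    have h3 := hσ σ z hz
    set a := p * z.1 ^ (p - 1) * g z.2 + σ.1 + θ * σ.2 * z.1 ^ (θ - 1) * z.2
    set b := z.1 ^ p * deriv g z.2 + σ.2 * z.1 ^ θ
    have e : p * (p - 1) * z.1 ^ (p - 2) * g z.2 + θ * (θ - 1) * σ.2 * z.1 ^ (θ - 2) * z.2 =
      p * (p - 1) * (z.1 ^ (p - 2) * g z.2) + θ * (θ - 1) * (z.1 ^ (θ - 2) * z.2) * σ.2 := by ring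
    rw [e]
    calc _ ≤ _ := abs_add_le _ _
      _ ≤ K1 * (1 + |a| + |b|) + K2 * ((K6 + K7) * (1 + |a| + |b|)) := by
          rw [abs_mul _ σ.2]
          refine add_le_add (h1.trans (le_mul_of_one_le_right hK1 (habs a b)))
            (mul_le_mul h2 (h3.trans ?_) (abs_nonneg _) hK2)
          have := abs_nonneg a
          gcongr; linarith
      _ ≤ _ := by
          rw [← mul_assoc, ← add_mul]
          refine mul_le_mul_of_nonneg_right ?_ (by positivity)
          nlinarith [mul_nonneg hK4 (add_nonneg hK6 hK7)]
  · have h1 := k3 z hz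
    have h2 := k4 z hz
    have h3 := hσ σ z hz
    set a := p * z.1 ^ (p - 1) * g z.2 + σ.1 + θ * σ.2 * z.1 ^ (θ - 1) * z.2
    set b := z.1 ^ p * deriv g z.2 + σ.2 * z.1 ^ θ
    have e : p * z.1 ^ (p - 1) * deriv g z.2 + θ * σ.2 * z.1 ^ (θ - 1) =
      p * (z.1 ^ (p - 1) * deriv g z.2) + θ * z.1 ^ (θ - 1) * σ.2 := by ring
    rw [e]
    calc _ ≤ _ := abs_add_le _ _
      _ ≤ K3 * (1 + |a| + |b|) + K4 * ((K6 + K7) * (1 + |a| + |b|)) := by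
          rw [abs_mul _ σ.2]
          refine add_le_add (h1.trans (le_mul_of_one_le_right hK3 (habs a b)))
            (mul_le_mul h2 (h3.trans ?_) (abs_nonneg _) hK4)
          have := abs_nonneg a
          gcongr; linarith
      _ ≤ _ := by
          rw [← mul_assoc, ← add_mul]
          refine mul_le_mul_of_nonneg_right ?_ (by positivity)
          nlinarith [mul_nonneg hK2 (add_nonneg hK6 hK7)]
  · have h1 := k5 z hz
    refine h1.trans ?_
    have h2 : K5 ≤ K1 + K3 + K5 + (K2 + K4) * (K6 + K7) := by
      nlinarith [mul_nonneg (add_nonneg hK2 hK4) (add_nonneg hK6 hK7)]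
    exact h2.trans (le_mul_of_one_le_right (by positivity) (habs _ _))

theorem contDiffAt_homGrad (hg : ContDiff ℝ ∞ g) (p θ : ℝ) {z : ℝ × ℝ} (hz : 0 < z.1) :
    ContDiffAt ℝ ∞ (homGrad p θ g) z := by
  have h1 : ∀ q : ℝ, ContDiffAt ℝ ∞ (fun z : ℝ × ℝ => z.1 ^ q) z := fun q =>
    contDiffAt_fst.rpow_const_of_ne hz.ne'
  have h2 : ContDiffAt ℝ ∞ (fun z : ℝ × ℝ => g z.2) z := (hg.comp contDiff_snd).contDiffAt
  have h3 : ContDiffAt ℝ ∞ (fun z : ℝ × ℝ => deriv g z.2) z :=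
    ((contDiff_deriv_infty hg).comp contDiff_snd).contDiffAt
  exact ((h1 _).mul ((contDiffAt_const.mul h2).sub
    ((contDiffAt_const.mul contDiffAt_snd).mul h3))).prodMk ((h1 _).mul h3)

theorem homGrad_fderiv (hg : ContDiff ℝ ∞ g) (p θ : ℝ) {z : ℝ × ℝ} (hz : 0 < z.1) (v : ℝ × ℝ) :
    fderiv ℝ (homGrad p θ g) z v =
      ((p - 1) * z.1 ^ (p - 2) * (p * g z.2 - θ * z.2 * deriv g z.2) * v.1 +
        z.1 ^ (p - 1) * ((p - θ) * deriv g z.2 - θ * z.2 * deriv (deriv g) z.2) * v.2,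
       (p - θ) * z.1 ^ (p - θ - 1) * deriv g z.2 * v.1 +
        z.1 ^ (p - θ) * deriv (deriv g) z.2 * v.2) := by
  obtain ⟨x, u⟩ := z
  have hd : HasFDerivAt (homGrad p θ g) (fderiv ℝ (homGrad p θ g) (x, u)) (x, u) :=
    ((contDiffAt_homGrad hg p θ hz).differentiableAt (by simp)).hasFDerivAt
  have e1 : fderiv ℝ (homGrad p θ g) (x, u) (1, 0) =
      ((p - 1) * x ^ (p - 2) * (p * g u - θ * u * deriv g u),
        (p - θ) * x ^ (p - θ - 1) * deriv g u) := by
    have h1 := hd.comp_hasDerivAt x ((hasDerivAt_id x).prodMk (hasDerivAt_const x u))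
    have h2 : HasDerivAt (fun x => homGrad p θ g (x, u)) _ x :=
      ((hasDerivAt_rpow hz (p - 1)).mul_const (p * g u - θ * u * deriv g u)).prodMk
      ((hasDerivAt_rpow hz (p - θ)).mul_const (deriv g u))
    have h3 := h1.unique h2
    rw [h3]; congr 3; ring_nf
  have e2 : fderiv ℝ (homGrad p θ g) (x, u) (0, 1) =
      (x ^ (p - 1) * ((p - θ) * deriv g u - θ * u * deriv (deriv g) u),
        x ^ (p - θ) * deriv (deriv g) u) := by
    have h1 := hd.comp_hasDerivAt u ((hasDerivAt_const u x).prodMk (hasDerivAt_id u))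
    have d1 := hasDerivAt_of_infty hg u
    have d2 := hasDerivAt_of_infty (contDiff_deriv_infty hg) u
    have h2 : HasDerivAt (fun u => homGrad p θ g (x, u)) _ u :=
      (((d1.const_mul p).sub (((hasDerivAt_id u).const_mul θ).mul d2)).const_mul
        (x ^ (p - 1))).prodMk (d2.const_mul (x ^ (p - θ)))
    have h3 := h1.unique h2
    rw [h3]; congr 2; simp; ring
  have hv : v = v.1 • ((1, 0) : ℝ × ℝ) + v.2 • ((0, 1) : ℝ × ℝ) := by ext <;> simp
  conv_lhs => rw [hv, map_add, map_smul, map_smul, e1, e2]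
  ext <;> simp <;> ring

theorem measurable_homGrad (hg : ContDiff ℝ ∞ g) (p θ : ℝ) : Measurable (homGrad p θ g) := by
  have h1 := hg.continuous.measurable
  have h2 := (contDiff_deriv_infty hg).continuous.measurable
  unfold homGrad
  fun_prop

theorem continuous_hessFactor (hg : ContDiff ℝ ∞ g) (p θ : ℝ) : Continuous (hessFactor p θ g) := by
  have h1 := hg.continuous
  have h2 := (contDiff_deriv_infty hg).continuous
  have h3 := (contDiff_deriv_infty (contDiff_deriv_infty hg)).continuous
  unfold hessFactor
  fun_prop

/-- The Jacobian determinant of `homGrad` is `x ^ (2 p - θ - 2)` times `hessFactor`. By Cramer's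
rule a 2×2 matrix with bounded entries expands every vector by at least a multiple of its
determinant. -/
theorem exists_homGrad_fderiv_lower (hg : ContDiff ℝ ∞ g) (p θ : ℝ) {x₁ x₂ u₁ u₂ : ℝ}
    (hx₁ : 0 < x₁) : ∃ c : ℝ, 0 < c ∧ c ≤ 1 ∧ ∀ z ∈ Set.Icc x₁ x₂ ×ˢ Set.Icc u₁ u₂, ∀ v,
      c * |hessFactor p θ g z.2| * ‖v‖ ≤ ‖fderiv ℝ (homGrad p θ g) z v‖ := by
  set Q := Set.Icc x₁ x₂ ×ˢ Set.Icc u₁ u₂ with hQdef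
  have hQ : IsCompact Q := isCompact_Icc.prod isCompact_Icc
  have hpos : ∀ z ∈ Q, 0 < z.1 := fun z hz => hx₁.trans_le hz.1.1
  have cf : ContinuousOn (fderiv ℝ (homGrad p θ g)) Q := fun z hz =>
    (((contDiffAt_homGrad hg p θ (hpos z hz)).fderiv_right (m := 0)
      (by simp)).continuousAt).continuousWithinAt
  obtain ⟨K, hK⟩ := hQ.exists_bound_of_continuousOn cf
  obtain ⟨K', hK'⟩ := hQ.exists_bound_of_continuousOn
    (continuousOn_rpow_fst hpos (-(2 * p - θ - 2)))
  refine ⟨1 / (2 * (|K| + 1) * (|K'| + 1)), by positivity, ?_, fun z hz v => ?_⟩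
  · rw [div_le_one (by positivity)]
    nlinarith [abs_nonneg K, abs_nonneg K', mul_nonneg (abs_nonneg K) (abs_nonneg K')]
  have h0 := hpos z hz
  set w := fderiv ℝ (homGrad p θ g) z v with hw
  have hwv := homGrad_fderiv hg p θ h0 v
  rw [← hw] at hwv
  set a := (p - 1) * z.1 ^ (p - 2) * (p * g z.2 - θ * z.2 * deriv g z.2) with ha
  set b := z.1 ^ (p - 1) * ((p - θ) * deriv g z.2 - θ * z.2 * deriv (deriv g) z.2) with hb
  set c := (p - θ) * z.1 ^ (p - θ - 1) * deriv g z.2 with hc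
  set d := z.1 ^ (p - θ) * deriv (deriv g) z.2 with hd
  have hn1 : ‖fderiv ℝ (homGrad p θ g) z (1, 0)‖ ≤ |K| + 1 := by
    refine (ContinuousLinearMap.le_opNorm _ _).trans ?_
    have := hK z hz
    have h1 : ‖((1 : ℝ), (0 : ℝ))‖ = 1 := by simp [Prod.norm_def]
    rw [h1, mul_one]
    linarith [le_abs_self K]
  have hn2 : ‖fderiv ℝ (homGrad p θ g) z (0, 1)‖ ≤ |K| + 1 := by
    refine (ContinuousLinearMap.le_opNorm _ _).trans ?_
    have := hK z hz
    have h1 : ‖((0 : ℝ), (1 : ℝ))‖ = 1 := by simp [Prod.norm_def]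
    rw [h1, mul_one]
    linarith [le_abs_self K]
  rw [homGrad_fderiv hg p θ h0] at hn1 hn2
  simp only [mul_one, mul_zero, add_zero, zero_add, Prod.norm_def, Real.norm_eq_abs,
    sup_le_iff] at hn1 hn2
  obtain ⟨na, nc⟩ := hn1
  obtain ⟨nb, nd⟩ := hn2
  have hw1 : |a * v.1 + b * v.2| ≤ ‖w‖ := by
    rw [hwv, ← Real.norm_eq_abs]
    exact norm_fst_le (a * v.1 + b * v.2, c * v.1 + d * v.2)
  have hw2 : |c * v.1 + d * v.2| ≤ ‖w‖ := by
    rw [hwv, ← Real.norm_eq_abs]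
    exact norm_snd_le (a * v.1 + b * v.2, c * v.1 + d * v.2)
  have hdet : z.1 ^ (-(2 * p - θ - 2)) * (a * d - b * c) = hessFactor p θ g z.2 := by
    have r1 : z.1 ^ (-(2 * p - θ - 2)) * (z.1 ^ (p - 2) * z.1 ^ (p - θ)) = 1 := by
      rw [← Real.rpow_add h0, ← Real.rpow_add h0,
        show -(2 * p - θ - 2) + (p - 2 + (p - θ)) = 0 by ring, Real.rpow_zero]
    have r2 : z.1 ^ (-(2 * p - θ - 2)) * (z.1 ^ (p - 1) * z.1 ^ (p - θ - 1)) = 1 := by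
      rw [← Real.rpow_add h0, ← Real.rpow_add h0,
        show -(2 * p - θ - 2) + (p - 1 + (p - θ - 1)) = 0 by ring, Real.rpow_zero]
    simp only [ha, hb, hc, hd, hessFactor]
    linear_combination ((p - 1) * (p * g z.2 - θ * z.2 * deriv g z.2) * deriv (deriv g) z.2) * r1 -
      (((p - θ) * deriv g z.2 - θ * z.2 * deriv (deriv g) z.2) * ((p - θ) * deriv g z.2)) * r2
  have hdetb : |hessFactor p θ g z.2| ≤ (|K'| + 1) * |a * d - b * c| := by
    rw [← hdet, abs_mul]
    refine mul_le_mul_of_nonneg_right ?_ (abs_nonneg _)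
    have := hK' z hz
    rw [Real.norm_eq_abs] at this
    linarith [le_abs_self K']
  have hv : |a * d - b * c| * ‖v‖ ≤ 2 * (|K| + 1) * ‖w‖ := by
    rw [Prod.norm_def, mul_max_of_nonneg _ _ (abs_nonneg _), Real.norm_eq_abs, Real.norm_eq_abs,
      ← abs_mul, ← abs_mul]
    refine max_le ?_ ?_
    · have : (a * d - b * c) * v.1 = d * (a * v.1 + b * v.2) - b * (c * v.1 + d * v.2) := by ring
      rw [this]
      calc _ ≤ _ := abs_sub _ _
        _ ≤ (|K| + 1) * ‖w‖ + (|K| + 1) * ‖w‖ := by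
            rw [abs_mul d, abs_mul b]; gcongr
        _ = _ := by ring
    · have : (a * d - b * c) * v.2 = a * (c * v.1 + d * v.2) - c * (a * v.1 + b * v.2) := by ring
      rw [this]
      calc _ ≤ _ := abs_sub _ _
        _ ≤ (|K| + 1) * ‖w‖ + (|K| + 1) * ‖w‖ := by
            rw [abs_mul a, abs_mul c]; gcongr
        _ = _ := by ring
  rw [mul_assoc, div_mul_eq_mul_div, one_mul, div_le_iff₀ (by positivity)]
  calc _ ≤ (|K'| + 1) * |a * d - b * c| * ‖v‖ := by gcongr
    _ = (|K'| + 1) * (|a * d - b * c| * ‖v‖) := by ring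
    _ ≤ (|K'| + 1) * (2 * (|K| + 1) * ‖w‖) := by gcongr
    _ = _ := by ring

/-- This fixes the scale, proportional to the lower bound of the derivative, on which the gradient
map is close to affine. -/
theorem exists_homGrad_fderiv_lipschitz (hg : ContDiff ℝ ∞ g) (p θ : ℝ) {x₁ x₂ u₁ u₂ : ℝ}
    (hx₁ : 0 < x₁) : ∃ L : ℝ, ∀ z ∈ Set.Icc x₁ x₂ ×ˢ Set.Icc u₁ u₂,
      ∀ w ∈ Set.Icc x₁ x₂ ×ˢ Set.Icc u₁ u₂,
      ‖fderiv ℝ (homGrad p θ g) z - fderiv ℝ (homGrad p θ g) w‖ ≤ L * ‖z - w‖ := by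
  set Q := Set.Icc x₁ x₂ ×ˢ Set.Icc u₁ u₂ with hQdef
  have hQ : IsCompact Q := isCompact_Icc.prod isCompact_Icc
  have hQc : Convex ℝ Q := (convex_Icc _ _).prod (convex_Icc _ _)
  have hpos : ∀ z ∈ Q, 0 < z.1 := fun z hz => hx₁.trans_le hz.1.1
  have hs : ∀ z ∈ Q, ContDiffAt ℝ 1 (fderiv ℝ (homGrad p θ g)) z := fun z hz =>
    (contDiffAt_homGrad hg p θ (hpos z hz)).fderiv_right (by norm_cast)
  have cf : ContinuousOn (fderiv ℝ (fderiv ℝ (homGrad p θ g))) Q := fun z hz =>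
    (((hs z hz).fderiv_right (m := 0) (by simp)).continuousAt).continuousWithinAt
  obtain ⟨K, hK⟩ := hQ.exists_bound_of_continuousOn
    (E := ℝ × ℝ →L[ℝ] ℝ × ℝ →L[ℝ] ℝ × ℝ) cf
  refine ⟨K, fun z hz w hw => ?_⟩
  exact hQc.norm_image_sub_le_of_norm_fderiv_le
    (fun y hy => (hs y hy).differentiableAt (by simp)) hK hw hz

/-- The gradient of the full phase in plane coordinates is `homGrad + σ`. It arises from `(Ψ_x,
Ψ_u)` by a triangular matrix that is bounded for `x` in a compact subset of `(0, ∞)`. This replaces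
the denominator from the integration by parts by `|Z + σ|²` with a map `Z` independent of `σ`. -/
theorem exists_homGrad_norm_le (p θ : ℝ) {x₁ x₂ u₁ u₂ : ℝ} (hx₁ : 0 < x₁) :
    ∃ N : ℝ, 1 ≤ N ∧ ∀ σ : ℝ × ℝ, ∀ z ∈ Set.Icc x₁ x₂ ×ˢ Set.Icc u₁ u₂,
      ‖homGrad p θ g z + σ‖ ^ 2 ≤
        N * ((p * z.1 ^ (p - 1) * g z.2 + σ.1 + θ * σ.2 * z.1 ^ (θ - 1) * z.2) ^ 2 +
          (z.1 ^ p * deriv g z.2 + σ.2 * z.1 ^ θ) ^ 2) := by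
  set Q := Set.Icc x₁ x₂ ×ˢ Set.Icc u₁ u₂ with hQdef
  have hQ : IsCompact Q := isCompact_Icc.prod isCompact_Icc
  have hpos : ∀ z ∈ Q, 0 < z.1 := fun z hz => hx₁.trans_le hz.1.1
  obtain ⟨K, hK⟩ := hQ.exists_bound_of_continuousOn (continuousOn_rpow_fst hpos (-θ))
  obtain ⟨K', hK'⟩ := hQ.exists_bound_of_continuousOn
    ((continuousOn_const (c := θ)).mul
      ((continuousOn_rpow_fst hpos (-1)).mul continuous_snd.continuousOn))
  set N := 2 * (1 + |K| + |K'|) ^ 2 with hN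
  have hN1 : 1 ≤ N := by
    rw [hN]; nlinarith [abs_nonneg K, abs_nonneg K']
  refine ⟨N, hN1, fun σ => ?_⟩
  set a : ℝ × ℝ → ℝ := fun z => p * z.1 ^ (p - 1) * g z.2 + σ.1 + θ * σ.2 * z.1 ^ (θ - 1) * z.2
    with ha
  set b : ℝ × ℝ → ℝ := fun z => z.1 ^ p * deriv g z.2 + σ.2 * z.1 ^ θ with hb
  change ∀ z ∈ Q, ‖homGrad p θ g z + σ‖ ^ 2 ≤ N * (a z ^ 2 + b z ^ 2)
  intro z hz
  have h0 := hpos z hz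
  have e1 : z.1 ^ (p - 1) * (p * g z.2 - θ * z.2 * deriv g z.2) + σ.1 =
      a z - θ * (z.1 ^ (-1 : ℝ) * z.2) * b z := by
    have r1 : z.1 ^ (-1 : ℝ) * z.1 ^ p = z.1 ^ (p - 1) := by
      rw [← Real.rpow_add h0]; congr 1; ring
    have r2 : z.1 ^ (-1 : ℝ) * z.1 ^ θ = z.1 ^ (θ - 1) := by
      rw [← Real.rpow_add h0]; congr 1; ring
    simp only [ha, hb]
    linear_combination (θ * z.2 * deriv g z.2) * r1 + (θ * z.2 * σ.2) * r2
  have e2 : z.1 ^ (p - θ) * deriv g z.2 + σ.2 = z.1 ^ (-θ) * b z := by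
    have r1 : z.1 ^ (-θ) * z.1 ^ p = z.1 ^ (p - θ) := by
      rw [← Real.rpow_add h0]; congr 1; ring
    have r2 : z.1 ^ (-θ) * z.1 ^ θ = 1 := by
      rw [← Real.rpow_add h0]; simp
    simp only [hb]
    linear_combination (-deriv g z.2) * r1 - σ.2 * r2
  have k1 : |z.1 ^ (-θ)| ≤ |K| := (hK z hz).trans (le_abs_self K)
  have k2 : |θ * (z.1 ^ (-1 : ℝ) * z.2)| ≤ |K'| := (hK' z hz).trans (le_abs_self K')
  have f1 : ‖homGrad p θ g z + σ‖ ≤ (1 + |K| + |K'|) * (|a z| + |b z|) := by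
    rw [Prod.norm_def]
    refine max_le ?_ ?_
    · change |z.1 ^ (p - 1) * (p * g z.2 - θ * z.2 * deriv g z.2) + σ.1| ≤ _
      rw [e1]
      calc _ ≤ _ := abs_sub _ _
        _ ≤ |a z| + |K'| * |b z| := by rw [abs_mul _ (b z)]; gcongr
        _ ≤ _ := by nlinarith [abs_nonneg K, abs_nonneg K', abs_nonneg (a z), abs_nonneg (b z),
          mul_nonneg (abs_nonneg K) (abs_nonneg (a z)),
          mul_nonneg (abs_nonneg K) (abs_nonneg (b z)),
          mul_nonneg (abs_nonneg K') (abs_nonneg (a z))]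
    · change |z.1 ^ (p - θ) * deriv g z.2 + σ.2| ≤ _
      rw [e2]
      calc _ ≤ |K| * |b z| := by rw [abs_mul _ (b z)]; gcongr
        _ ≤ _ := by nlinarith [abs_nonneg K, abs_nonneg K', abs_nonneg (a z), abs_nonneg (b z),
          mul_nonneg (abs_nonneg K) (abs_nonneg (a z)),
          mul_nonneg (abs_nonneg K') (abs_nonneg (b z)),
          mul_nonneg (abs_nonneg K') (abs_nonneg (a z))]
  calc _ ≤ ((1 + |K| + |K'|) * (|a z| + |b z|)) ^ 2 := by gcongr
    _ = (1 + |K| + |K'|) ^ 2 * (|a z| + |b z|) ^ 2 := by ring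
    _ ≤ (1 + |K| + |K'|) ^ 2 * (2 * (a z ^ 2 + b z ^ 2)) := by
        gcongr
        nlinarith [sq_nonneg (|a z| - |b z|), sq_abs (a z), sq_abs (b z)]
    _ = _ := by rw [hN]; ring

/-- Decay away from the zeros of the Hessian. -/
theorem exists_far_bound (hg : ContDiff ℝ ∞ g) (p θ : ℝ) {x₁ x₂ u₁ u₂ : ℝ}
    (hx₁ : 0 < x₁) (hx : x₁ ≤ x₂) (hu : u₁ ≤ u₂) : ∃ C : ℝ, 0 < C ∧ ∀ (μ : ℝ), 0 < μ → μ ≤ 1 →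
      ∀ T : Set ℝ, MeasurableSet T → (∀ u ∈ T, u ∈ Set.Icc u₁ u₂ → μ ≤ |hessFactor p θ g u|) →
      ∀ (M : ℝ) (B Bx Bu : ℝ × ℝ → ℂ), AmplitudeOn x₁ x₂ u₁ u₂ M B Bx Bu →
      (∀ z ∈ Set.Icc x₁ x₂ ×ˢ Set.Icc u₁ u₂, z.2 ∉ T → B z = 0 ∧ Bx z = 0 ∧ Bu z = 0) →
      ∀ (t : ℝ), 1 ≤ |t| → ∀ σ : ℝ × ℝ,
      ‖∫ z in Set.Icc x₁ x₂ ×ˢ Set.Icc u₁ u₂, B z * cis (t * homPhase p θ g σ z)‖ ≤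
        C * M / μ ^ 4 * |t| ^ (-(3 / 4) : ℝ) := by
  set Q := Set.Icc x₁ x₂ ×ˢ Set.Icc u₁ u₂ with hQdef
  have hQ : IsCompact Q := isCompact_Icc.prod isCompact_Icc
  have hQc : Convex ℝ Q := (convex_Icc _ _).prod (convex_Icc _ _)
  have hpos : ∀ z ∈ Q, 0 < z.1 := fun z hz => hx₁.trans_le hz.1.1
  obtain ⟨L, hL, hph⟩ := exists_phaseOn (x₂ := x₂) (u₁ := u₁) (u₂ := u₂) hg p θ hx₁
  obtain ⟨c, hc0, hc1, hlow⟩ :=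
    exists_homGrad_fderiv_lower (x₂ := x₂) (u₁ := u₁) (u₂ := u₂) hg p θ hx₁
  obtain ⟨L', hlip⟩ :=
    exists_homGrad_fderiv_lipschitz (x₂ := x₂) (u₁ := u₁) (u₂ := u₂) hg p θ hx₁
  obtain ⟨C, hC0, hC⟩ := exists_lintegral_inv_sq_map_le (measurable_homGrad hg p θ) hQ hQc
    (fun z hz => ((contDiffAt_homGrad hg p θ (hpos z hz)).differentiableAt (by simp)).hasFDerivAt)
    hlip
  obtain ⟨N, hN1, hcomp'⟩ := exists_homGrad_norm_le (x₂ := x₂) (u₁ := u₁) (u₂ := u₂) (g := g) p θ hx₁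
  set v := volume.real Q with hv
  refine ⟨(3 + 20 * L) * (v + N * (C / c ^ 4)), by positivity, ?_⟩
  intro μ hμ hμ1 T hT hTH M B Bx Bu hB hBT t ht σ
  have ht0 : t ≠ 0 := by
    rintro rfl; norm_num at ht
  have hM : 0 ≤ M := (norm_nonneg _).trans (hB.b (x₁, u₁) ⟨⟨le_rfl, hx⟩, ⟨le_rfl, hu⟩⟩)
  set S : Set (ℝ × ℝ) := Prod.snd ⁻¹' T with hSdef
  have hS : MeasurableSet S := measurable_snd hT
  have main := norm_setIntegral_cis_le hx hu (hph σ) hB hS hBT ht0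
  set a : ℝ × ℝ → ℝ := fun z => p * z.1 ^ (p - 1) * g z.2 + σ.1 + θ * σ.2 * z.1 ^ (θ - 1) * z.2
    with ha
  set b : ℝ × ℝ → ℝ := fun z => z.1 ^ p * deriv g z.2 + σ.2 * z.1 ^ θ with hb
  -- With `δ² = 1 / |t|` the loss `δ ^ (-1/2)` equals `|t| ^ (1/4)`. Against the factor `1 / |t|` of
  -- the integration by parts this leaves `|t| ^ (-3/4)`.
  set δ := |t| ^ (-(1 / 2) : ℝ) with hδ
  have hδ0 : 0 < δ := by positivity
  have hδ2 : δ ^ 2 = 1 / |t| := by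
    rw [hδ, ← Real.rpow_natCast, ← Real.rpow_mul (abs_nonneg t)]
    norm_num [Real.rpow_neg_one]
  have hcomp := fun z hz => hcomp' σ z hz
  have hSQ : MeasurableSet (S ∩ Q) := hS.inter hQ.measurableSet
  have hlint : ∫⁻ z in S ∩ Q, ENNReal.ofReal (1 / (‖homGrad p θ g z + σ‖ ^ 2 + δ ^ 2)) ≤
      ENNReal.ofReal (C / (c * μ) ^ 4 * δ ^ (-(1 / 2) : ℝ)) := by
    refine hC (S ∩ Q) hSQ Set.inter_subset_right (c * μ) (by positivity)
      (mul_le_one₀ hc1 hμ.le hμ1)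
      (fun z hz w => ?_) σ δ hδ0
    refine le_trans ?_ (hlow z hz.2 w)
    have := hTH z.2 hz.1 hz.2.2
    gcongr
  have hmeas : Measurable fun z => 1 / (‖homGrad p θ g z + σ‖ ^ 2 + δ ^ 2) :=
    measurable_const.div ((((measurable_homGrad hg p θ).add_const σ).norm.pow_const 2).add_const _)
  have h_int : IntegrableOn (fun z => 1 / (‖homGrad p θ g z + σ‖ ^ 2 + δ ^ 2)) (S ∩ Q) := by
    refine ⟨hmeas.aestronglyMeasurable, ?_⟩
    rw [hasFiniteIntegral_iff_ofReal (Eventually.of_forall fun z => by positivity)]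
    exact hlint.trans_lt ENNReal.ofReal_lt_top
  have hreal : ∫ z in S ∩ Q, 1 / (‖homGrad p θ g z + σ‖ ^ 2 + δ ^ 2) ≤
      C / (c * μ) ^ 4 * δ ^ (-(1 / 2) : ℝ) := by
    rw [integral_eq_lintegral_of_nonneg_ae (Eventually.of_forall fun z => by positivity)
      hmeas.aestronglyMeasurable]
    exact ENNReal.toReal_le_of_le_ofReal (by positivity) hlint
  have hfin : volume (S ∩ Q) ≠ ⊤ :=
    ((measure_mono Set.inter_subset_right).trans_lt hQ.measure_lt_top).ne
  have hvol : volume.real (S ∩ Q) ≤ v :=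
    measureReal_mono Set.inter_subset_right hQ.measure_lt_top.ne
  have hδt : δ ^ (-(1 / 2) : ℝ) = |t| ^ (1 / 4 : ℝ) := by
    rw [hδ, ← Real.rpow_mul (abs_nonneg t)]; norm_num
  have ht1 : 1 ≤ |t| ^ (1 / 4 : ℝ) := Real.one_le_rpow ht (by norm_num)
  have hone : IntegrableOn (fun _ : ℝ × ℝ => (1 : ℝ)) (S ∩ Q) := integrableOn_const hfin
  have hI : ∫ z in S ∩ Q, (1 + 1 / (a z ^ 2 + b z ^ 2 + 1 / |t|)) ≤
      (v + N * (C / c ^ 4)) / μ ^ 4 * |t| ^ (1 / 4 : ℝ) := by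
    calc _ ≤ ∫ z in S ∩ Q, (1 + N * (1 / (‖homGrad p θ g z + σ‖ ^ 2 + δ ^ 2))) := by
          refine integral_mono_of_nonneg (Eventually.of_forall fun z => by positivity)
            (hone.add (h_int.const_mul N)) ?_
          refine (ae_restrict_iff' hSQ).2 (Eventually.of_forall fun z hz => ?_)
          have h1 := hcomp z hz.2
          beta_reduce
          gcongr
          rw [mul_one_div, div_le_div_iff₀ (by positivity) (by positivity), hδ2]
          have : 1 / |t| ≤ N * (1 / |t|) := le_mul_of_one_le_left (by positivity) hN1
          linarith
      _ = volume.real (S ∩ Q) + N * ∫ z in S ∩ Q, 1 / (‖homGrad p θ g z + σ‖ ^ 2 + δ ^ 2) := by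
          rw [integral_add hone (h_int.const_mul N), integral_const_mul]
          simp
      _ ≤ v + N * (C / (c * μ) ^ 4 * δ ^ (-(1 / 2) : ℝ)) := by gcongr
      _ ≤ v / μ ^ 4 * |t| ^ (1 / 4 : ℝ) + N * (C / (c * μ) ^ 4 * |t| ^ (1 / 4 : ℝ)) := by
          rw [hδt]
          gcongr
          have h4 : v ≤ v / μ ^ 4 := by
            rw [le_div_iff₀ (by positivity)]
            exact mul_le_of_le_one_right (by positivity) (pow_le_one₀ hμ.le hμ1)
          exact h4.trans (le_mul_of_one_le_right (by positivity) ht1)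
      _ = _ := by field_simp
  refine main.trans ?_
  calc _ ≤ M * (3 + 20 * L) / |t| * ((v + N * (C / c ^ 4)) / μ ^ 4 * |t| ^ (1 / 4 : ℝ)) := by
        gcongr
    _ = (3 + 20 * L) * (v + N * (C / c ^ 4)) * M / μ ^ 4 * (|t| ^ (1 / 4 : ℝ) * |t|⁻¹) := by
        field_simp
    _ = _ := by
        rw [← Real.rpow_neg_one |t|, ← Real.rpow_add (by positivity)]; norm_num

end Smooth

/-! ### Decomposition into a neighbourhood of a zero of the Hessian and its complement -/

/-- The vanishing of `η'` for `|s| < 1` lets `1 - η` remove a whole neighbourhood of `u₀`, where the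
weights need not be differentiable. -/
theorem exists_cutoff : ∃ (η η' : ℝ → ℝ) (K : ℝ), (∀ s, HasDerivAt η (η' s) s) ∧ Continuous η' ∧
    (∀ s, |s| ≤ 1 → η s = 1) ∧ (∀ s, 2 ≤ |s| → η s = 0) ∧ (∀ s, |η s| ≤ 1) ∧ 1 ≤ K ∧
    (∀ s, |η' s| ≤ K) ∧ (∀ s, |s| < 1 → η' s = 0) ∧ (∀ s, 2 < |s| → η' s = 0) := by
  let b : ContDiffBump (0 : ℝ) := ⟨1, 2, one_pos, one_lt_two⟩
  have hb : ContDiff ℝ 1 b := b.contDiff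
  have hd : Continuous (deriv b) := hb.continuous_deriv le_rfl
  have hz : ∀ s : ℝ, 2 ≤ |s| → b s = 0 := fun s hs =>
    b.zero_of_le_dist (by rwa [dist_zero_right])
  have h1 : ∀ s : ℝ, |s| ≤ 1 → b s = 1 := fun s hs =>
    b.one_of_mem_closedBall (by rwa [mem_closedBall_zero_iff])
  have hcs : HasCompactSupport (deriv b) := b.hasCompactSupport.deriv
  obtain ⟨K, hK⟩ := hd.bounded_above_of_compact_support hcs
  refine ⟨b, deriv b, |K| + 1, fun s => (hb.differentiable one_ne_zero s).hasDerivAt, hd, h1, hz,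
    fun s => ?_, by linarith [abs_nonneg K], fun s => ?_, fun s hs => ?_, fun s hs => ?_⟩
  · rw [abs_of_nonneg b.nonneg]
    exact b.le_one
  · have := hK s
    rw [Real.norm_eq_abs] at this
    linarith [le_abs_self K]
  · have : b =ᶠ[𝓝 s] fun _ => 1 := by
      filter_upwards [(isOpen_lt continuous_abs continuous_const).mem_nhds hs] with y hy
      exact h1 y (le_of_lt hy)
    rw [this.deriv_eq, deriv_const]
  · have : b =ᶠ[𝓝 s] fun _ => 0 := by
      filter_upwards [(isOpen_lt continuous_const continuous_abs).mem_nhds hs] with y hy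
      exact hz y (le_of_lt hy)
    rw [this.deriv_eq, deriv_const]

theorem AmplitudeOn.mul_snd {x₁ x₂ u₁ u₂ M K : ℝ} {A Ax Au : ℝ × ℝ → ℂ}
    (hA : AmplitudeOn x₁ x₂ u₁ u₂ M A Ax Au) {k k' : ℝ → ℝ}
    (hk : ∀ u ∈ Set.Icc u₁ u₂, HasDerivAt k (k' u) u) (hk' : ContinuousOn k' (Set.Icc u₁ u₂))
    (hkb : ∀ u ∈ Set.Icc u₁ u₂, |k u| ≤ K) (hkb' : ∀ u ∈ Set.Icc u₁ u₂, |k' u| ≤ K) :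
    AmplitudeOn x₁ x₂ u₁ u₂ (2 * M * K) (fun z => A z * (k z.2 : ℂ)) (fun z => Ax z * (k z.2 : ℂ))
      (fun z => Au z * (k z.2 : ℂ) + A z * (k' z.2 : ℂ)) := by
  have ck : ContinuousOn (fun z : ℝ × ℝ => (k z.2 : ℂ)) (Set.Icc x₁ x₂ ×ˢ Set.Icc u₁ u₂) := by
    have : ContinuousOn k (Set.Icc u₁ u₂) := fun u hu => (hk u hu).continuousAt.continuousWithinAt
    exact Complex.continuous_ofReal.comp_continuousOn
      (this.comp continuousOn_snd fun z hz => hz.2)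
  have ck' : ContinuousOn (fun z : ℝ × ℝ => (k' z.2 : ℂ)) (Set.Icc x₁ x₂ ×ˢ Set.Icc u₁ u₂) :=
    Complex.continuous_ofReal.comp_continuousOn (hk'.comp continuousOn_snd fun z hz => hz.2)
  have hb : ∀ {a b : ℂ} {r : ℝ}, ‖a‖ ≤ M → |r| ≤ K → ‖a * (r : ℂ)‖ ≤ M * K := by
    intro a b r ha hr
    rw [norm_mul, Complex.norm_real, Real.norm_eq_abs]
    exact mul_le_mul ha hr (abs_nonneg _) ((norm_nonneg _).trans ha)
  have hMK : ∀ z ∈ Set.Icc x₁ x₂ ×ˢ Set.Icc u₁ u₂, M * K ≤ 2 * M * K := fun z hz => by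
    have h1 : 0 ≤ M := (norm_nonneg _).trans (hA.b z hz)
    have h2 : 0 ≤ K := (abs_nonneg _).trans (hkb z.2 hz.2)
    nlinarith [mul_nonneg h1 h2]
  refine
    { dx := fun x hx u hu => (hA.dx x hx u hu).mul_const (k u : ℂ)
      du := fun x hx u hu => (hA.du x hx u hu).mul (hk u hu).ofReal_comp
      c := hA.c.mul ck
      cx := hA.cx.mul ck
      cu := (hA.cu.mul ck).add (hA.c.mul ck')
      b := fun z hz => (hb (b := 0) (hA.b z hz) (hkb z.2 hz.2)).trans (hMK z hz)
      bx := fun z hz => (hb (b := 0) (hA.bx z hz) (hkb z.2 hz.2)).trans (hMK z hz)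
      bu := fun z hz => ?_
      zx₁ := fun u hu => by simp [hA.zx₁ u hu]
      zx₂ := fun u hu => by simp [hA.zx₂ u hu]
      zu₁ := fun x hx => by simp [hA.zu₁ x hx]
      zu₂ := fun x hx => by simp [hA.zu₂ x hx] }
  refine (norm_add_le _ _).trans ((add_le_add (hb (b := 0) (hA.bu z hz) (hkb z.2 hz.2))
    (hb (b := 0) (hA.b z hz) (hkb' z.2 hz.2))).trans_eq ?_)
  ring

theorem AmplitudeOn.integrableOn {x₁ x₂ u₁ u₂ M : ℝ} {A Ax Au : ℝ × ℝ → ℂ}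
    (hA : AmplitudeOn x₁ x₂ u₁ u₂ M A Ax Au) {w : ℝ → ℝ} (hw : ContinuousOn w (Set.Icc u₁ u₂))
    {φ : ℝ × ℝ → ℝ} (hφ : ContinuousOn φ (Set.Icc x₁ x₂ ×ˢ Set.Icc u₁ u₂)) :
    IntegrableOn (fun z => A z * (w z.2 : ℂ) * cis (φ z)) (Set.Icc x₁ x₂ ×ˢ Set.Icc u₁ u₂) := by
  refine ContinuousOn.integrableOn_compact (isCompact_Icc.prod isCompact_Icc) ?_
  exact (hA.c.mul (Complex.continuous_ofReal.comp_continuousOn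
    (hw.comp continuousOn_snd fun z hz => hz.2))).mul (continuous_cis.comp_continuousOn hφ)

/-- If the part of the integral near `u₀` is small, then so is the whole integral. -/
theorem exists_bound_of_near {g : ℝ → ℝ} (hg : ContDiff ℝ ∞ g) (p θ : ℝ) {x₁ x₂ u₁ u₂ u₀ : ℝ}
    (hx₁ : 0 < x₁) (hx : x₁ ≤ x₂) (hu : u₁ ≤ u₂) {c : ℝ} {m : ℕ} (hc : 0 < c)
    (hH : ∀ u ∈ Set.Icc u₁ u₂, c * |u - u₀| ^ m ≤ |hessFactor p θ g u|)
    {η η' : ℝ → ℝ} {Kη : ℝ} (hη : ∀ s, HasDerivAt η (η' s) s) (hη' : Continuous η')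
    (hη1 : ∀ s, |s| ≤ 1 → η s = 1) (hηb : ∀ s, |η s| ≤ 1) (hKη : 1 ≤ Kη)
    (hηb' : ∀ s, |η' s| ≤ Kη) (hη'0 : ∀ s, |s| < 1 → η' s = 0)
    {w w' : ℝ → ℝ} {K : ℝ} (hw : ContinuousOn w (Set.Icc u₁ u₂))
    (hw' : ∀ u ∈ Set.Icc u₁ u₂, u ≠ u₀ → HasDerivAt w (w' u) u)
    (hwc : ContinuousOn w' (Set.Icc u₁ u₂ \ {u₀})) (hwb : ∀ u ∈ Set.Icc u₁ u₂, |w u| ≤ K)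
    (hwb' : ∀ u ∈ Set.Icc u₁ u₂, u ≠ u₀ → |w' u| ≤ K / |u - u₀|)
    {P : ℝ × ℝ → Prop} {C₁ γ : ℝ} (hC₁ : 0 < C₁) (hγ : 0 < γ)
    (near : ∀ l : ℝ, 0 < l → l ≤ 1 → ∀ (M : ℝ) (A Ax Au : ℝ × ℝ → ℂ),
      AmplitudeOn x₁ x₂ u₁ u₂ M A Ax Au → ∀ t : ℝ, 1 ≤ |t| → ∀ σ, P σ →
      ‖∫ z in Set.Icc x₁ x₂ ×ˢ Set.Icc u₁ u₂, A z * ((w z.2 * η ((z.2 - u₀) / l) : ℝ) : ℂ) *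
        cis (t * homPhase p θ g σ z)‖ ≤ C₁ * M * l ^ γ * |t| ^ (-(1 / 2) : ℝ)) :
    ∃ C : ℝ, 0 < C ∧ ∃ ε : ℝ, 0 < ε ∧ ∀ (M : ℝ) (A Ax Au : ℝ × ℝ → ℂ),
      AmplitudeOn x₁ x₂ u₁ u₂ M A Ax Au → ∀ t : ℝ, 1 ≤ |t| → ∀ σ, P σ →
      ‖∫ z in Set.Icc x₁ x₂ ×ˢ Set.Icc u₁ u₂, A z * (w z.2 : ℂ) *
        cis (t * homPhase p θ g σ z)‖ ≤ C * M * |t| ^ (-(1 / 2 + ε)) := by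
  set Q := Set.Icc x₁ x₂ ×ˢ Set.Icc u₁ u₂ with hQdef
  obtain ⟨C, hC0, hfar⟩ := exists_far_bound hg p θ hx₁ hx hu
  obtain ⟨L, hL, hph⟩ := exists_phaseOn (x₂ := x₂) (u₁ := u₁) (u₂ := u₂) hg p θ hx₁
  have hK : 0 ≤ K := (abs_nonneg _).trans (hwb u₁ ⟨le_rfl, hu⟩)
  set c' := min c 1 with hc'
  have hc'0 : 0 < c' := lt_min hc one_pos
  -- The far part loses `μ ^ (-4)` with `μ` proportional to `l ^ m`, and `1 / l` for the derivative
  -- of the cutoff. For `l = |t| ^ (-ϖ)` this is `l ^ (-(4 m + 1)) = |t| ^ (1/8)`, so `|t| ^ (-3/4)`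
  -- becomes `|t| ^ (-(1/2 + 1/8))`. The near part gains `l ^ γ = |t| ^ (-ϖ γ)`.
  set ϖ : ℝ := 1 / (8 * (4 * m + 1)) with hϖ
  have hϖ0 : 0 < ϖ := by positivity
  have hη_cont : Continuous η := continuous_iff_continuousAt.2 fun s => (hη s).continuousAt
  refine ⟨C₁ + C * (2 * (2 * (K + 1) * Kη)) / c' ^ 4 * 2, by positivity, min (ϖ * γ) (1 / 8),
    by positivity, ?_⟩
  intro M A Ax Au hA t ht σ hσ
  have hM : 0 ≤ M := (norm_nonneg _).trans (hA.b (x₁, u₁) ⟨⟨le_rfl, hx⟩, ⟨le_rfl, hu⟩⟩)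
  have ht0 : 0 < |t| := by linarith
  set l := |t| ^ (-ϖ) with hl
  have hl0 : 0 < l := by positivity
  have hl1 : l ≤ 1 := Real.rpow_le_one_of_one_le_of_nonpos ht (by linarith)
  have hN := near l hl0 hl1 M A Ax Au hA t ht σ hσ
  -- the far part
  let k : ℝ → ℝ := fun u => w u * (1 - η ((u - u₀) / l))
  -- The weight `w` may fail to be differentiable at `u₀`. As `k` vanishes identically for `|u - u₀|
  -- < l`, its derivative is set to zero there.
  let k' : ℝ → ℝ := fun u =>
    if |u - u₀| < l then 0 else w' u * (1 - η ((u - u₀) / l)) - w u * (η' ((u - u₀) / l) / l)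
  have habs : ∀ u, |(u - u₀) / l| = |u - u₀| / l := fun u => by rw [abs_div, abs_of_pos hl0]
  have hk0 : ∀ u, |u - u₀| < l → k u = 0 := fun u hu => by
    simp only [k]
    rw [hη1 _ (by rw [habs]; exact ((div_lt_one hl0).2 hu).le)]; simp
  have hdη : ∀ u, HasDerivAt (fun u => 1 - η ((u - u₀) / l)) (-(η' ((u - u₀) / l) / l)) u := by
    intro u
    have h1 : HasDerivAt (fun u => (u - u₀) / l) (1 / l) u :=
      ((hasDerivAt_id u).sub_const u₀).div_const l
    refine (((hη _).comp u h1).const_sub 1).congr_deriv ?_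
    ring
  have hkd : ∀ u ∈ Set.Icc u₁ u₂, HasDerivAt k (k' u) u := by
    intro u hu
    by_cases h : |u - u₀| < l
    · simp only [k', if_pos h]
      have : k =ᶠ[𝓝 u] fun _ => 0 := by
        filter_upwards [(isOpen_lt (f := fun y => |y - u₀|) (g := fun _ => l) (by fun_prop)
          continuous_const).mem_nhds h] with y hy
        exact hk0 y hy
      exact (hasDerivAt_const u (0 : ℝ)).congr_of_eventuallyEq this
    · simp only [k', if_neg h]
      have hne : u ≠ u₀ := by
        rintro rfl; simp [hl0] at h
      refine ((hw' u hu hne).mul (hdη u)).congr_deriv ?_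
      ring
  have hkc : ContinuousOn k' (Set.Icc u₁ u₂) := by
    have e : ∀ u, u ≠ u₀ → k' u =
        w' u * (1 - η ((u - u₀) / l)) - w u * (η' ((u - u₀) / l) / l) := by
      intro u hne
      by_cases h : |u - u₀| < l
      · have h1 : |(u - u₀) / l| < 1 := by rw [habs]; exact (div_lt_one hl0).2 h
        simp [k', h, hη1 _ h1.le, hη'0 _ h1]
      · simp [k', h]
    intro u hu
    by_cases hne : u = u₀
    · have : k' =ᶠ[𝓝 u] fun _ => 0 := by
        have h : |u - u₀| < l := by simp [hne, hl0]
        filter_upwards [(isOpen_lt (f := fun y => |y - u₀|) (g := fun _ => l) (by fun_prop)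
          continuous_const).mem_nhds h] with y hy
        simp only [k']; exact if_pos hy
      exact (continuousAt_const.congr this.symm).continuousWithinAt
    · have h1 : ContinuousWithinAt w' (Set.Icc u₁ u₂) u := by
        have := hwc u ⟨hu, hne⟩
        rwa [Set.sdiff_eq, continuousWithinAt_inter (isOpen_compl_singleton.mem_nhds hne)] at this
      have h2 : ContinuousWithinAt (fun u => w' u * (1 - η ((u - u₀) / l)) -
          w u * (η' ((u - u₀) / l) / l)) (Set.Icc u₁ u₂) u := by
        refine (h1.mul ?_).sub ((hw u hu).mul ?_)
        · exact (by fun_prop : Continuous fun u => 1 - η ((u - u₀) / l)).continuousWithinAt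
        · exact (by fun_prop : Continuous fun u => η' ((u - u₀) / l) / l).continuousWithinAt
      refine h2.congr_of_eventuallyEq ?_ (e u hne)
      filter_upwards [mem_nhdsWithin_of_mem_nhds (isOpen_compl_singleton.mem_nhds hne)] with y hy
      exact e y hy
  have hη2 : ∀ s, |1 - η s| ≤ 2 := fun s => by
    have := abs_le.1 (hηb s)
    rw [abs_le]; constructor <;> linarith
  have hone : 1 ≤ 1 / l := by rw [le_div_iff₀ hl0]; linarith
  have hkb : ∀ u ∈ Set.Icc u₁ u₂, |k u| ≤ 2 * (2 * (K + 1) * Kη) / l / 2 := by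
    intro u hu
    simp only [k, abs_mul]
    calc _ ≤ K * 2 := mul_le_mul (hwb u hu) (hη2 _) (abs_nonneg _) hK
      _ ≤ (2 * (K + 1) * Kη) * (1 / l) := by
          have : K * 2 ≤ 2 * (K + 1) * Kη := by nlinarith
          exact this.trans (le_mul_of_one_le_right (by positivity) hone)
      _ = _ := by ring
  have hkb' : ∀ u ∈ Set.Icc u₁ u₂, |k' u| ≤ 2 * (2 * (K + 1) * Kη) / l / 2 * 2 := by
    intro u hu
    by_cases h : |u - u₀| < l
    · simp only [k', if_pos h, abs_zero]; positivity
    · simp only [k', if_neg h]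
      have hne : u ≠ u₀ := by
        rintro rfl; simp [hl0] at h
      push Not at h
      have e1 : |w' u| ≤ K / l := (hwb' u hu hne).trans (by gcongr)
      have e2 : |η' ((u - u₀) / l) / l| ≤ Kη / l := by
        rw [abs_div, abs_of_pos hl0]; gcongr; exact hηb' _
      calc _ ≤ |w' u * (1 - η ((u - u₀) / l))| + |w u * (η' ((u - u₀) / l) / l)| := abs_sub _ _
        _ ≤ K / l * 2 + K * (Kη / l) := by
            rw [abs_mul, abs_mul]
            exact add_le_add (mul_le_mul e1 (hη2 _) (abs_nonneg _) (by positivity))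
              (mul_le_mul (hwb u hu) e2 (abs_nonneg _) hK)
        _ = (K * 2 + K * Kη) / l := by ring
        _ ≤ (2 * (2 * (K + 1) * Kη)) / l := by
            gcongr
            nlinarith [mul_nonneg hK (sub_nonneg.2 hKη)]
        _ = _ := by ring
  have hB := hA.mul_snd (K := 2 * (2 * (K + 1) * Kη) / l) hkd hkc
    (fun u hu => (hkb u hu).trans (half_le_self (by positivity)))
    (fun u hu => (hkb' u hu).trans_eq (by ring))
  have hμ0 : 0 < c' * l ^ m := by positivity
  have hF := hfar (c' * l ^ m) hμ0 (mul_le_one₀ (min_le_right _ _) (by positivity)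
      (pow_le_one₀ hl0.le hl1)) {u | l ≤ |u - u₀|}
      (isClosed_le continuous_const (by fun_prop)).measurableSet
      (fun u (hu : l ≤ |u - u₀|) hu' => by
        refine le_trans ?_ (hH u hu')
        have : c' ≤ c := min_le_left _ _
        gcongr) _ _ _ _ hB
      (fun z hz hzT => by
        have h : |z.2 - u₀| < l := not_le.1 hzT
        have h1 := hk0 _ h
        have h2 : k' z.2 = 0 := by simp only [k', if_pos h]
        simp [h1, h2]) t ht σ
  have cφ : ContinuousOn (fun z => t * homPhase p θ g σ z) Q := continuousOn_const.mul (hph σ).c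
  have cη : ContinuousOn (fun u => η ((u - u₀) / l)) (Set.Icc u₁ u₂) :=
    (by fun_prop : Continuous fun u => η ((u - u₀) / l)).continuousOn
  have hsplit : ∫ z in Q, A z * (w z.2 : ℂ) * cis (t * homPhase p θ g σ z) =
      (∫ z in Q, A z * ((w z.2 * η ((z.2 - u₀) / l) : ℝ) : ℂ) * cis (t * homPhase p θ g σ z)) +
      ∫ z in Q, A z * (k z.2 : ℂ) * cis (t * homPhase p θ g σ z) := by
    rw [← integral_add (hA.integrableOn (w := fun u => w u * η ((u - u₀) / l)) (hw.mul cη) cφ)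
      (hA.integrableOn (w := k) (hw.mul (continuousOn_const.sub cη)) cφ)]
    refine integral_congr_ae (Eventually.of_forall fun z => ?_)
    simp only [k]; push_cast; ring
  rw [hsplit]
  refine (norm_add_le _ _).trans ((add_le_add hN hF).trans ?_)
  have hlγ : l ^ γ * |t| ^ (-(1 / 2) : ℝ) ≤ |t| ^ (-(1 / 2 + min (ϖ * γ) (1 / 8))) := by
    rw [hl, ← Real.rpow_mul ht0.le, ← Real.rpow_add ht0]
    refine Real.rpow_le_rpow_of_exponent_le ht ?_
    have := min_le_left (ϖ * γ) (1 / 8)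
    linarith
  have hlm : 1 / l / (l ^ m) ^ 4 * |t| ^ (-(3 / 4) : ℝ) ≤
      |t| ^ (-(1 / 2 + min (ϖ * γ) (1 / 8))) := by
    have e1 : 1 / l / (l ^ m) ^ 4 = |t| ^ (1 / 8 : ℝ) := by
      have : 1 / l / (l ^ m) ^ 4 = (l ^ (4 * m + 1))⁻¹ := by
        rw [pow_succ l, mul_comm 4 m, pow_mul]; field_simp
      rw [this, hl, ← Real.rpow_natCast, ← Real.rpow_mul ht0.le, ← Real.rpow_neg ht0.le, hϖ]
      congr 1; push_cast; field_simp
    rw [e1, ← Real.rpow_add ht0]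
    refine Real.rpow_le_rpow_of_exponent_le ht ?_
    have := min_le_right (ϖ * γ) (1 / 8)
    linarith
  set T := |t| ^ (-(1 / 2 + min (ϖ * γ) (1 / 8)))
  calc _ = C₁ * M * (l ^ γ * |t| ^ (-(1 / 2) : ℝ)) + C * (2 * (2 * (K + 1) * Kη)) / c' ^ 4 *
        (2 * M) * (1 / l / (l ^ m) ^ 4 * |t| ^ (-(3 / 4) : ℝ)) := by
        field_simp
    _ ≤ C₁ * M * T + C * (2 * (2 * (K + 1) * Kη)) / c' ^ 4 * (2 * M) * T := by gcongr
    _ = _ := by ring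

/-! ### Local estimates in homogeneous coordinates -/

/-- The bound of the integral over a rectangle by the iterated integral, the inner one being over
the second variable. -/
theorem norm_setIntegral_prod_le_snd {x₁ x₂ u₁ u₂ b : ℝ} (hx : x₁ ≤ x₂) (hu : u₁ ≤ u₂)
    {F : ℝ × ℝ → ℂ} (hF : IntegrableOn F (Set.Icc x₁ x₂ ×ˢ Set.Icc u₁ u₂))
    (hb : ∀ x ∈ Set.Icc x₁ x₂, ‖∫ u in u₁..u₂, F (x, u)‖ ≤ b) :
    ‖∫ z in Set.Icc x₁ x₂ ×ˢ Set.Icc u₁ u₂, F z‖ ≤ b * (x₂ - x₁) := by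
  rw [Measure.volume_eq_prod, setIntegral_prod _ hF]
  have := norm_setIntegral_le_of_norm_le_const (μ := volume) (s := Set.Icc x₁ x₂)
    (f := fun x => ∫ u in Set.Icc u₁ u₂, F (x, u)) (C := b) measure_Icc_lt_top fun x hx => by
      rw [integral_Icc_eq_integral_Ioc, ← intervalIntegral.integral_of_le hu]
      exact hb x hx
  simpa [hx] using this

/-- The bound of the integral over a rectangle by the iterated integral, the inner one being over
the first variable. -/
theorem norm_setIntegral_prod_le_fst {x₁ x₂ u₁ u₂ : ℝ} (hx : x₁ ≤ x₂)
    {F : ℝ × ℝ → ℂ} (hF : IntegrableOn F (Set.Icc x₁ x₂ ×ˢ Set.Icc u₁ u₂)) {b : ℝ → ℝ}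
    (hb0 : ∀ u, 0 ≤ b u) (hbi : Integrable b)
    (hb : ∀ u ∈ Set.Icc u₁ u₂, ‖∫ x in x₁..x₂, F (x, u)‖ ≤ b u) :
    ‖∫ z in Set.Icc x₁ x₂ ×ˢ Set.Icc u₁ u₂, F z‖ ≤ ∫ u, b u := by
  have hF' : IntegrableOn F (Set.Icc x₁ x₂ ×ˢ Set.Icc u₁ u₂) (volume.prod volume) := hF
  rw [Measure.volume_eq_prod, ← setIntegral_prod_swap, setIntegral_prod (fun z : ℝ × ℝ => F z.swap) hF'.swap]
  calc _ ≤ ∫ u in Set.Icc u₁ u₂, b u := by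
        refine norm_integral_le_of_norm_le hbi.integrableOn ?_
        refine (ae_restrict_iff' measurableSet_Icc).2 (Eventually.of_forall fun u hu => ?_)
        simp only [Prod.swap_prod_mk]
        rw [integral_Icc_eq_integral_Ioc, ← intervalIntegral.integral_of_le hx]
        exact hb u hu
    _ ≤ _ := setIntegral_le_integral hbi (Eventually.of_forall hb0)

/-- One half of the estimate near a zero of the gradient: the ray `u = u₀ + s v`, `v ≥ 0`, with
`s = ± 1`. -/
theorem norm_integral_half_le {g : ℝ → ℝ} (hg : ContDiff ℝ ∞ g) {u₀ s r d l : ℝ}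
    (hs : s = 1 ∨ s = -1) (hr : 0 < r) (hr1 : r ≤ 1) (hl : 0 < l)
    {n : ℕ} (hd : 0 < d) (hg2 : ∀ v ∈ Set.Ioc 0 r, d * v ^ n ≤ |deriv (deriv g) (u₀ + s * v)|)
    {η η' : ℝ → ℝ} {Kη : ℝ} (hη : ∀ s, HasDerivAt η (η' s) s) (hη' : Continuous η')
    (hη0 : ∀ s, 2 ≤ |s| → η s = 0) (hηb : ∀ s, |η s| ≤ 1)
    (hηb' : ∀ s, |η' s| ≤ Kη)
    {w w' : ℝ → ℝ} {K β : ℝ} (hw : ContinuousOn (fun v => w (u₀ + s * v)) (Set.Icc 0 r))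
    (hw' : ∀ v ∈ Set.Ioc 0 r, HasDerivAt w (w' (u₀ + s * v)) (u₀ + s * v))
    (hwc : ContinuousOn (fun v => w' (u₀ + s * v)) (Set.Ioc 0 r))
    (hwb : ∀ v ∈ Set.Ioc 0 r, |w (u₀ + s * v)| ≤ K * v ^ β)
    (hwb' : ∀ v ∈ Set.Ioc 0 r, |w' (u₀ + s * v)| ≤ K * v ^ (β - 1))
    (hβ : 0 < β - n / 2) {A A' : ℝ → ℂ} {M : ℝ}
    (hA : ∀ v ∈ Set.Icc 0 r, HasDerivAt A (A' (u₀ + s * v)) (u₀ + s * v))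
    (hAc : ContinuousOn (fun v => A' (u₀ + s * v)) (Set.Icc 0 r))
    (hM₀ : ∀ v ∈ Set.Icc 0 r, ‖A (u₀ + s * v)‖ ≤ M)
    (hM₁ : ∀ v ∈ Set.Icc 0 r, ‖A' (u₀ + s * v)‖ ≤ M) {X Y Z : ℝ} (hX : X ≠ 0) :
    ‖∫ v in (0 : ℝ)..r, A (u₀ + s * v) * ((w (u₀ + s * v) * η (s * v / l) : ℝ) : ℂ) *
      cis (X * g (u₀ + s * v) + Y + Z * (u₀ + s * v))‖ ≤
      9 * (M * K * (2 + 2 * Kη)) / √(|X| * d) * (1 + 1 / (β - n / 2)) * (2 * l) ^ (β - n / 2) := by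
  have hs2 : s * s = 1 := by rcases hs with rfl | rfl <;> norm_num
  have hsabs : |s| = 1 := by rcases hs with rfl | rfl <;> norm_num
  have hM : 0 ≤ M := (norm_nonneg _).trans (hM₀ 0 ⟨le_rfl, hr.le⟩)
  have hKη : 0 ≤ Kη := (abs_nonneg _).trans (hηb' 0)
  have hK : 0 ≤ K := by
    have := (abs_nonneg _).trans (hwb r ⟨hr, le_rfl⟩)
    exact nonneg_of_mul_nonneg_left this (Real.rpow_pos_of_pos hr _)
  -- The cutoff vanishes beyond `2 l`, so the interval may be shortened and its length enters the
  -- bound as a power of `l`. On it `v / l ≤ 2`, so the derivative of the cutoff costs no more than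
  -- the singularity `v ^ (β - 1)` of `w'`.
  set q := min r (2 * l) with hq
  have hq0 : 0 < q := lt_min hr (by linarith)
  have hqr : q ≤ r := min_le_left _ _
  have hql : q ≤ 2 * l := min_le_right _ _
  have hX0 : 0 < |X| := abs_pos.2 hX
  have hlin : ∀ v, HasDerivAt (fun v => u₀ + s * v) s v := fun v => by
    simpa using ((hasDerivAt_id v).const_mul s).const_add u₀
  have hlin' : ∀ v, HasDerivAt (fun v => s * v / l) (s / l) v := fun v => by
    simpa using ((hasDerivAt_id v).const_mul s).div_const l
  have habs : ∀ v, 0 ≤ v → |s * v / l| = v / l := fun v hv => by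
    rw [abs_div, abs_mul, hsabs, one_mul, abs_of_nonneg hv, abs_of_pos hl]
  -- the support of the cutoff
  have htrunc : ∫ v in (0 : ℝ)..r, A (u₀ + s * v) * ((w (u₀ + s * v) * η (s * v / l) : ℝ) : ℂ) *
      cis (X * g (u₀ + s * v) + Y + Z * (u₀ + s * v)) =
      ∫ v in (0 : ℝ)..q, A (u₀ + s * v) * ((w (u₀ + s * v) * η (s * v / l) : ℝ) : ℂ) *
      cis (X * g (u₀ + s * v) + Y + Z * (u₀ + s * v)) := by
    rcases le_total r (2 * l) with h | h
    · rw [hq, min_eq_left h]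
    · have hq' : q = 2 * l := min_eq_right h
      rw [intervalIntegral.integral_of_le hr.le, intervalIntegral.integral_of_le hq0.le]
      refine (setIntegral_eq_of_subset_of_forall_sdiff_eq_zero measurableSet_Ioc
        (Set.Ioc_subset_Ioc_right hqr) fun v hv => ?_)
      have h1 : 2 * l < v := by
        by_contra hcon
        exact hv.2 ⟨hv.1.1, by rw [hq']; exact not_lt.1 hcon⟩
      rw [hη0 _ (by rw [habs v hv.1.1.le, le_div_iff₀ hl]; exact h1.le)]
      simp
  rw [htrunc]
  have g1 := fun u => hasDerivAt_of_infty hg u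
  have g2 := fun u => hasDerivAt_of_infty (contDiff_deriv_infty hg) u
  have cg := hg.continuous
  have cg2 := (contDiff_deriv_infty (contDiff_deriv_infty hg)).continuous
  have hη_cont : Continuous η := continuous_iff_continuousAt.2 fun s => (hη s).continuousAt
  have cA : ContinuousOn (fun v => A (u₀ + s * v)) (Set.Icc 0 r) := fun v hv =>
    ((hA v hv).continuousAt.comp (f := fun v => u₀ + s * v)
      (hlin v).continuousAt).continuousWithinAt
  have hsub : Set.Ioc 0 q ⊆ Set.Ioc 0 r := Set.Ioc_subset_Ioc_right hqr
  have hsub' : Set.Icc 0 q ⊆ Set.Icc 0 r := Set.Icc_subset_Icc_right hqr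
  have main := norm_integral_weight_cis_le hq0
    (ψ := fun v => X * g (u₀ + s * v) + Y + Z * (u₀ + s * v))
    (ψ' := fun v => X * (deriv g (u₀ + s * v) * s) + Z * s)
    (ψ'' := fun v => X * deriv (deriv g) (u₀ + s * v))
    (A := fun v => A (u₀ + s * v) * ((w (u₀ + s * v) * η (s * v / l) : ℝ) : ℂ))
    (A' := fun v => s * A' (u₀ + s * v) * ((w (u₀ + s * v) * η (s * v / l) : ℝ) : ℂ) +
      A (u₀ + s * v) * ((w' (u₀ + s * v) * s * η (s * v / l) +
        w (u₀ + s * v) * (η' (s * v / l) * (s / l)) : ℝ) : ℂ))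
    (Λ := |X| * d) (β := β) (m := n) (M := M * K * (2 + 2 * Kη)) (by fun_prop)
    (fun v _ => ?_) (fun v _ => ?_) (by fun_prop) (by positivity) (fun v hv => ?_) (fun v hv => ?_)
    ?_ ?_ (fun v hv => ?_) (fun v hv => ?_) hβ
  · refine main.trans ?_
    gcongr
  · exact ((((g1 _).comp v (hlin v)).const_mul X).add_const Y).add ((hlin v).const_mul Z)
  · refine (((((g2 _).comp v (hlin v)).mul_const s).const_mul X).add_const (Z * s)).congr_deriv ?_
    linear_combination X * deriv (deriv g) (u₀ + s * v) * hs2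
  · rw [abs_mul, mul_assoc]
    exact mul_le_mul_of_nonneg_left (hg2 v (hsub hv)) (abs_nonneg _)
  · have hv' := hsub hv
    have d1 := (hA v ⟨hv'.1.le, hv'.2⟩).scomp v (hlin v)
    have d2 := (hw' v hv').comp v (hlin v)
    have d3 := (hη (s * v / l)).comp v (hlin' v)
    refine (d1.mul (d2.mul d3).ofReal_comp).congr_deriv ?_
    simp
  · have hh : ContinuousOn (fun v => ((w (u₀ + s * v) * η (s * v / l) : ℝ) : ℂ)) (Set.Ioc 0 q) :=
      Complex.continuous_ofReal.comp_continuousOn ((hw.mono (Set.Ioc_subset_Icc_self.trans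
        hsub')).mul (by fun_prop : Continuous fun v => η (s * v / l)).continuousOn)
    refine ((continuousOn_const.mul (hAc.mono (Set.Ioc_subset_Icc_self.trans hsub'))).mul hh).add
      ((cA.mono (Set.Ioc_subset_Icc_self.trans hsub')).mul ?_)
    refine Complex.continuous_ofReal.comp_continuousOn (ContinuousOn.add ?_ ?_)
    · exact ((hwc.mono hsub).mul continuousOn_const).mul
        (by fun_prop : Continuous fun v => η (s * v / l)).continuousOn
    · exact (hw.mono (Set.Ioc_subset_Icc_self.trans hsub')).mul
        (by fun_prop : Continuous fun v => η' (s * v / l) * (s / l)).continuousOn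
  · exact (cA.mono hsub').mul (Complex.continuous_ofReal.comp_continuousOn ((hw.mono hsub').mul
      (by fun_prop : Continuous fun v => η (s * v / l)).continuousOn))
  · have hv' := hsub hv
    have hv0 : 0 ≤ v ^ β := Real.rpow_nonneg hv.1.le _
    rw [norm_mul, Complex.norm_real, Real.norm_eq_abs, abs_mul]
    calc _ ≤ M * ((K * v ^ β) * 1) := by
          gcongr
          · exact hM₀ v ⟨hv'.1.le, hv'.2⟩
          · exact hwb v hv'
          · exact hηb _
      _ = M * K * 1 * v ^ β := by ring
      _ ≤ _ := by gcongr; linarith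
  · have hv' := hsub hv
    have hv0 : 0 ≤ v ^ (β - 1) := Real.rpow_nonneg hv.1.le _
    have hvβ : v ^ β = v * v ^ (β - 1) := by
      have := Real.rpow_add hv.1 1 (β - 1)
      rw [Real.rpow_one] at this
      rw [← this]; congr 1; ring
    have hvβ0 : 0 ≤ v ^ β := Real.rpow_nonneg hv.1.le _
    have hv1 : v ≤ 1 := hv'.2.trans hr1
    have hvl : v ≤ 2 * l := hv.2.trans hql
    refine (norm_add_le _ _).trans ?_
    have e1 : ‖(s : ℂ) * A' (u₀ + s * v) * ((w (u₀ + s * v) * η (s * v / l) : ℝ) : ℂ)‖ ≤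
        M * K * v ^ (β - 1) := by
      rw [norm_mul, norm_mul, Complex.norm_real, Real.norm_eq_abs, hsabs, one_mul,
        Complex.norm_real, Real.norm_eq_abs, abs_mul]
      calc _ ≤ M * ((K * v ^ β) * 1) := by
            gcongr
            · exact hM₁ v ⟨hv'.1.le, hv'.2⟩
            · exact hwb v hv'
            · exact hηb _
        _ = M * K * (v * v ^ (β - 1)) := by rw [hvβ]; ring
        _ ≤ M * K * (1 * v ^ (β - 1)) := by gcongr
        _ = _ := by ring
    have e2 : |w' (u₀ + s * v) * s * η (s * v / l)| ≤ K * v ^ (β - 1) := by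
      rw [abs_mul, abs_mul, hsabs, mul_one]
      calc _ ≤ (K * v ^ (β - 1)) * 1 := by
            gcongr
            · exact hwb' v hv'
            · exact hηb _
        _ = _ := mul_one _
    have e3 : |w (u₀ + s * v) * (η' (s * v / l) * (s / l))| ≤ 2 * Kη * (K * v ^ (β - 1)) := by
      rw [abs_mul, abs_mul, abs_div, hsabs, abs_of_pos hl]
      calc _ ≤ (K * v ^ β) * (Kη * (1 / l)) := by
            gcongr
            · exact hwb v hv'
            · exact hηb' _
        _ = K * v ^ (β - 1) * Kη * (v / l) := by rw [hvβ]; ring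
        _ ≤ K * v ^ (β - 1) * Kη * 2 := by
            gcongr
            rwa [div_le_iff₀ hl]
        _ = _ := by ring
    calc _ ≤ M * K * v ^ (β - 1) + M * (K * v ^ (β - 1) + 2 * Kη * (K * v ^ (β - 1))) := by
          refine add_le_add e1 ?_
          rw [norm_mul, Complex.norm_real, Real.norm_eq_abs]
          exact mul_le_mul (hM₀ v ⟨hv'.1.le, hv'.2⟩)
            ((abs_add_le _ _).trans (add_le_add e2 e3)) (abs_nonneg _) hM
      _ = _ := by ring

/-- The local estimate at a zero of the gradient. -/
theorem exists_bound_critical {g : ℝ → ℝ} (hg : ContDiff ℝ ∞ g) {p : ℝ} (hp : 0 < p) (θ : ℝ)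
    {x₁ x₂ u₀ r : ℝ} (hx₁ : 0 < x₁) (hx : x₁ ≤ x₂) (hr : 0 < r) (hr1 : r ≤ 1)
    {c d : ℝ} {m n : ℕ} (hc : 0 < c) (hd : 0 < d)
    (hH : ∀ u, |u - u₀| ≤ r → c * |u - u₀| ^ m ≤ |hessFactor p θ g u|)
    (hg2 : ∀ u, |u - u₀| ≤ r → d * |u - u₀| ^ n ≤ |deriv (deriv g) u|)
    {w w' : ℝ → ℝ} {K β : ℝ} (hw : ContinuousOn w (Set.Icc (u₀ - r) (u₀ + r)))
    (hw' : ∀ u, |u - u₀| ≤ r → u ≠ u₀ → HasDerivAt w (w' u) u)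
    (hwc : ContinuousOn w' (Set.Icc (u₀ - r) (u₀ + r) \ {u₀}))
    (hwb : ∀ u, |u - u₀| ≤ r → |w u| ≤ K * |u - u₀| ^ β)
    (hwb' : ∀ u, |u - u₀| ≤ r → u ≠ u₀ → |w' u| ≤ K * |u - u₀| ^ (β - 1))
    (hβ : 0 < β - n / 2) :
    ∃ C : ℝ, 0 < C ∧ ∃ ε : ℝ, 0 < ε ∧ ∀ (M : ℝ) (A Ax Au : ℝ × ℝ → ℂ),
      AmplitudeOn x₁ x₂ (u₀ - r) (u₀ + r) M A Ax Au → ∀ t : ℝ, 1 ≤ |t| → ∀ σ,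
      ‖∫ z in Set.Icc x₁ x₂ ×ˢ Set.Icc (u₀ - r) (u₀ + r), A z * (w z.2 : ℂ) *
        cis (t * homPhase p θ g σ z)‖ ≤ C * M * |t| ^ (-(1 / 2 + ε)) := by
  obtain ⟨η, η', Kη, hη, hη', hη1, hη0, hηb, hKη, hηb', hη'0, -⟩ := exists_cutoff
  obtain ⟨L, hL, hph⟩ := exists_phaseOn (x₂ := x₂) (u₁ := u₀ - r) (u₂ := u₀ + r) hg p θ hx₁
  have hIcc : ∀ u, u ∈ Set.Icc (u₀ - r) (u₀ + r) ↔ |u - u₀| ≤ r := fun u => by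
    rw [abs_le, Set.mem_Icc]; constructor <;> rintro ⟨h1, h2⟩ <;> constructor <;> linarith
  have hβ0 : 0 < β := by
    have : (0 : ℝ) ≤ n / 2 := by positivity
    linarith
  have hK : 0 ≤ K := by
    have := (abs_nonneg _).trans (hwb (u₀ + r) (by simp [abs_of_pos hr]))
    refine nonneg_of_mul_nonneg_left this (Real.rpow_pos_of_pos ?_ _)
    simpa using hr.ne'
  set γ := β - n / 2 with hγ
  set C₁ := 2 * (9 * (K * (2 + 2 * Kη)) / √(x₁ ^ p * d) * (1 + 1 / γ) * 2 ^ γ) * (x₂ - x₁) + 1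
    with hC₁
  have hx21 : 0 ≤ x₂ - x₁ := sub_nonneg.2 hx
  have hKη0 : 0 ≤ Kη := by linarith
  have hη_cont : Continuous η := continuous_iff_continuousAt.2 fun s => (hη s).continuousAt
  have H := exists_bound_of_near hg p θ hx₁ hx (by linarith : u₀ - r ≤ u₀ + r)
    (u₀ := u₀) hc
    (fun u hu => hH u ((hIcc u).1 hu)) hη hη' hη1 hηb hKη hηb' hη'0 hw
    (fun u hu hne => hw' u ((hIcc u).1 hu) hne) hwc (K := K)
    (fun u hu => (hwb u ((hIcc u).1 hu)).trans (mul_le_of_le_one_right hK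
      (Real.rpow_le_one (abs_nonneg _) (((hIcc u).1 hu).trans hr1) hβ0.le)))
    (fun u hu hne => (hwb' u ((hIcc u).1 hu) hne).trans (by
      have h0 : 0 < |u - u₀| := abs_pos.2 (sub_ne_zero.2 hne)
      rw [Real.rpow_sub_one h0.ne', ← mul_div_assoc]
      gcongr
      exact mul_le_of_le_one_right hK
        (Real.rpow_le_one (abs_nonneg _) (((hIcc u).1 hu).trans hr1) hβ0.le)))
    (P := fun _ => True) (C₁ := C₁) (γ := γ) (by positivity) hβ ?_
  · obtain ⟨C, hC, ε, hε, h⟩ := H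
    exact ⟨C, hC, ε, hε, fun M A Ax Au hA t ht σ => h M A Ax Au hA t ht σ trivial⟩
  intro l hl hl1 M A Ax Au hA t ht σ _
  have ht0 : 0 < |t| := by linarith
  have hM : 0 ≤ M := (norm_nonneg _).trans (hA.b (x₁, u₀) ⟨⟨le_rfl, hx⟩, by simp [hr.le]⟩)
  have cη : ContinuousOn (fun u => η ((u - u₀) / l)) (Set.Icc (u₀ - r) (u₀ + r)) :=
    (by fun_prop : Continuous fun u => η ((u - u₀) / l)).continuousOn
  have h_int := hA.integrableOn (w := fun u => w u * η ((u - u₀) / l)) (hw.mul cη)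
    (φ := fun z => t * homPhase p θ g σ z) (continuousOn_const.mul (hph σ).c)
  set b := 9 * (M * K * (2 + 2 * Kη)) / √(|t| * x₁ ^ p * d) * (1 + 1 / γ) * (2 * l) ^ γ with hb
  have hb0 : 0 ≤ b := by positivity
  -- For fixed `x` the phase is `t x ^ p g(u)` plus a function affine in `u` that contains all of
  -- `σ`. Its second derivative in `u` therefore does not depend on `σ`.
  have key : ∀ x ∈ Set.Icc x₁ x₂, ∀ s : ℝ, s = 1 ∨ s = -1 →
      ‖∫ v in (0 : ℝ)..r, A (x, u₀ + s * v) * ((w (u₀ + s * v) * η (s * v / l) : ℝ) : ℂ) *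
        cis (t * x ^ p * g (u₀ + s * v) + t * σ.1 * x + t * σ.2 * x ^ θ * (u₀ + s * v))‖ ≤ b := by
    intro x hxm s hs
    have hx0 : 0 < x := hx₁.trans_le hxm.1
    have habs : ∀ v, 0 ≤ v → |u₀ + s * v - u₀| = v := fun v hv => by
      have hsabs : |s| = 1 := by rcases hs with rfl | rfl <;> norm_num
      rw [add_sub_cancel_left, abs_mul, hsabs, one_mul, abs_of_nonneg hv]
    have hmem : ∀ v ∈ Set.Icc 0 r, u₀ + s * v ∈ Set.Icc (u₀ - r) (u₀ + r) := fun v hv => by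
      rw [hIcc, habs v hv.1]; exact hv.2
    have hne : ∀ v ∈ Set.Ioc 0 r, u₀ + s * v ≠ u₀ := fun v hv h => by
      have := habs v hv.1.le
      rw [h, sub_self, abs_zero] at this
      exact hv.1.ne this
    have hcl : Continuous fun v => u₀ + s * v := by fun_prop
    have := norm_integral_half_le hg (u₀ := u₀) (s := s) hs hr hr1 hl hd
      (fun v hv => by
        have := hg2 (u₀ + s * v) (by rw [habs v hv.1.le]; exact hv.2)
        rwa [habs v hv.1.le] at this) hη hη' hη0 hηb hηb'
      (w := w) (w' := w') (K := K) (β := β) (hw.comp hcl.continuousOn hmem)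
      (fun v hv => hw' _ (by rw [habs v hv.1.le]; exact hv.2) (hne v hv))
      (hwc.comp hcl.continuousOn fun v hv => ⟨hmem v ⟨hv.1.le, hv.2⟩, hne v hv⟩)
      (fun v hv => by
        have := hwb (u₀ + s * v) (by rw [habs v hv.1.le]; exact hv.2)
        rwa [habs v hv.1.le] at this)
      (fun v hv => by
        have := hwb' (u₀ + s * v) (by rw [habs v hv.1.le]; exact hv.2) (hne v hv)
        rwa [habs v hv.1.le] at this) hβ
      (A := fun u => A (x, u)) (A' := fun u => Au (x, u)) (M := M)
      (fun v hv => hA.du x hxm _ (hmem v hv))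
      (hA.cu.comp (by fun_prop) fun v hv => ⟨hxm, hmem v hv⟩)
      (fun v hv => hA.b _ ⟨hxm, hmem v hv⟩) (fun v hv => hA.bu _ ⟨hxm, hmem v hv⟩)
      (X := t * x ^ p) (Y := t * σ.1 * x) (Z := t * σ.2 * x ^ θ)
      (mul_ne_zero (abs_pos.1 ht0) (Real.rpow_pos_of_pos hx0 p).ne')
    refine this.trans ?_
    rw [hb, abs_mul, abs_of_pos (Real.rpow_pos_of_pos hx0 p)]
    gcongr
    exact hxm.1
  have := norm_setIntegral_prod_le_snd (b := 2 * b) hx (by linarith : u₀ - r ≤ u₀ + r) h_int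
    fun x hxm => ?_
  · refine this.trans ?_
    have e1 : √(|t| * x₁ ^ p * d) = √(x₁ ^ p * d) * |t| ^ (1 / 2 : ℝ) := by
      rw [mul_assoc, mul_comm, Real.sqrt_mul (by positivity), Real.sqrt_eq_rpow |t|]
    have e2 : |t| ^ (-(1 / 2) : ℝ) = (|t| ^ (1 / 2 : ℝ))⁻¹ := Real.rpow_neg ht0.le _
    have e3 : (2 * l) ^ γ = 2 ^ γ * l ^ γ := Real.mul_rpow (by norm_num) hl.le
    calc 2 * b * (x₂ - x₁) = (C₁ - 1) * M * l ^ γ * |t| ^ (-(1 / 2) : ℝ) := by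
          rw [hb, e1, e2, e3, hC₁]; field_simp; ring
      _ ≤ _ := by gcongr; linarith
  · have hF : ContinuousOn (fun u => A (x, u) * ((w u * η ((u - u₀) / l) : ℝ) : ℂ) *
        cis (t * homPhase p θ g σ (x, u))) (Set.Icc (u₀ - r) (u₀ + r)) := by
      refine ContinuousOn.mul (ContinuousOn.mul ?_ ?_) ?_
      · exact hA.c.comp (by fun_prop) fun u hu => ⟨hxm, hu⟩
      · exact Complex.continuous_ofReal.comp_continuousOn (hw.mul cη)
      · refine continuous_cis.comp_continuousOn (continuousOn_const.mul ?_)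
        exact (hph σ).c.comp (by fun_prop) fun u hu => ⟨hxm, hu⟩
    set F := fun u => A (x, u) * ((w u * η ((u - u₀) / l) : ℝ) : ℂ) *
        cis (t * homPhase p θ g σ (x, u)) with hFdef
    have i1 : IntervalIntegrable F volume (u₀ - r) u₀ := by
      refine ContinuousOn.intervalIntegrable (hF.mono ?_)
      rw [Set.uIcc_of_le (by linarith)]
      exact Set.Icc_subset_Icc_right (by linarith)
    have i2 : IntervalIntegrable F volume u₀ (u₀ + r) := by
      refine ContinuousOn.intervalIntegrable (hF.mono ?_)
      rw [Set.uIcc_of_le (by linarith)]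
      exact Set.Icc_subset_Icc_left (by linarith)
    change ‖∫ u in (u₀ - r)..(u₀ + r), F u‖ ≤ 2 * b
    rw [← intervalIntegral.integral_add_adjacent_intervals i1 i2]
    have h1 : ∫ u in u₀..(u₀ + r), F u = ∫ v in (0 : ℝ)..r, F (u₀ + 1 * v) := by
      simp
    have h2 : ∫ u in (u₀ - r)..u₀, F u = ∫ v in (0 : ℝ)..r, F (u₀ + -1 * v) := by
      simp [← sub_eq_add_neg]
    have hFe : ∀ s v : ℝ, F (u₀ + s * v) =
        A (x, u₀ + s * v) * ((w (u₀ + s * v) * η (s * v / l) : ℝ) : ℂ) *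
        cis (t * x ^ p * g (u₀ + s * v) + t * σ.1 * x + t * σ.2 * x ^ θ * (u₀ + s * v)) := by
      intro s v
      simp only [hFdef, homPhase, add_sub_cancel_left]
      congr 2; ring
    simp only [h1, h2, hFe]
    refine (norm_add_le _ _).trans ?_
    linarith [key x hxm 1 (Or.inl rfl), key x hxm (-1) (Or.inr rfl)]

/-! ### The strip at a point that is not degenerate. -/

/-- The coefficient of `g''` in `hessFactor`. -/
def hessCoeff (p θ : ℝ) (g : ℝ → ℝ) (u : ℝ) : ℝ :=
  p * (p - 1) * g u + θ * (1 - θ) * u * deriv g u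

theorem abs_sub_le_iff_mem_Icc {u u₀ r : ℝ} : u ∈ Set.Icc (u₀ - r) (u₀ + r) ↔ |u - u₀| ≤ r := by
  rw [abs_le, Set.mem_Icc]; constructor <;> rintro ⟨h1, h2⟩ <;> constructor <;> linarith

/-- The local estimate where the coefficient `Ψ_u` is bounded away from zero. -/
theorem exists_bound_large {g : ℝ → ℝ} (hg : ContDiff ℝ ∞ g) (p θ : ℝ)
    {x₁ x₂ u₁ u₂ k : ℝ} (hx₁ : 0 < x₁) (hx : x₁ ≤ x₂) (hu : u₁ ≤ u₂) (hk : 0 < k) :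
    ∃ C : ℝ, 0 < C ∧ ∀ (M : ℝ) (A Ax Au : ℝ × ℝ → ℂ),
      AmplitudeOn x₁ x₂ u₁ u₂ M A Ax Au → ∀ t : ℝ, 1 ≤ |t| → ∀ σ : ℝ × ℝ,
      (∀ x ∈ Set.Icc x₁ x₂, ∀ u ∈ Set.Icc u₁ u₂, k ≤ |σ.2 + x ^ (p - θ) * deriv g u|) →
      ‖∫ z in Set.Icc x₁ x₂ ×ˢ Set.Icc u₁ u₂, A z * cis (t * homPhase p θ g σ z)‖ ≤
        C * M * |t|⁻¹ := by
  obtain ⟨L, hL, hph⟩ := exists_phaseOn (x₂ := x₂) (u₁ := u₁) (u₂ := u₂) hg p θ hx₁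
  have hQ : IsCompact (Set.Icc x₁ x₂ ×ˢ Set.Icc u₁ u₂) := isCompact_Icc.prod isCompact_Icc
  obtain ⟨m, hm, hmb⟩ : ∃ m : ℝ, 0 < m ∧ ∀ x ∈ Set.Icc x₁ x₂, m ≤ x ^ θ := by
    obtain ⟨y, hy, hymin⟩ := (isCompact_Icc (a := x₁) (b := x₂)).exists_isMinOn
      ⟨x₁, le_rfl, hx⟩ (f := fun x => x ^ θ) (fun x hx =>
        (Real.continuousAt_rpow_const x θ (Or.inl (hx₁.trans_le hx.1).ne')).continuousWithinAt)
    exact ⟨y ^ θ, Real.rpow_pos_of_pos (hx₁.trans_le hy.1) _, fun x hx => hymin hx⟩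
  -- The second derivative in `u` is `x ^ p g''(u)`, free of `σ`, so the bound for `σ = 0` serves
  -- for all `σ`.
  obtain ⟨B, hB⟩ := hQ.exists_bound_of_continuousOn (hph 0).cuu
  have hB0 : 0 ≤ B := (norm_nonneg _).trans (hB (x₁, u₁) ⟨⟨le_rfl, hx⟩, ⟨le_rfl, hu⟩⟩)
  have h0 : 0 ≤ (1 + B / (m * k)) * (u₂ - u₁) / (m * k) * (x₂ - x₁) := by
    have := sub_nonneg.2 hx
    have := sub_nonneg.2 hu
    positivity
  refine ⟨(1 + B / (m * k)) * (u₂ - u₁) / (m * k) * (x₂ - x₁) + 1, by linarith, ?_⟩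
  intro M A Ax Au hA t ht σ hσ
  have ht0 : 0 < |t| := by linarith
  have hM : 0 ≤ M := (norm_nonneg _).trans (hA.b (x₁, u₁) ⟨⟨le_rfl, hx⟩, ⟨le_rfl, hu⟩⟩)
  have h_int : IntegrableOn (fun z => A z * cis (t * homPhase p θ g σ z))
      (Set.Icc x₁ x₂ ×ˢ Set.Icc u₁ u₂) := by
    have := hA.integrableOn (w := fun _ => 1) continuousOn_const
      (φ := fun z => t * homPhase p θ g σ z) (continuousOn_const.mul (hph σ).c)
    simpa using this
  refine (norm_setIntegral_prod_le_snd (b := M * (1 + B / (m * k)) * (u₂ - u₁) / (|t| * (m * k)))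
    hx hu h_int fun x hxm => ?_).trans ?_
  · refine norm_integral_cis_le_of_deriv1 hu (ψ := fun u => t * homPhase p θ g σ (x, u))
      (fun u hum => ((hph σ).du x hxm u hum).const_mul t)
      (fun u hum => ((hph σ).duu x hxm u hum).const_mul t)
      (continuousOn_const.mul ((hph σ).cuu.comp (by fun_prop) fun u hum => ⟨hxm, hum⟩))
      (by positivity) (fun u hum => ?_) (fun u hum => ?_) (A := fun u => A (x, u))
      (A' := fun u => Au (x, u)) (hA.du x hxm)
      (hA.cu.comp (by fun_prop) fun u hum => ⟨hxm, hum⟩) (hA.zu₁ x hxm) (hA.zu₂ x hxm)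
      (fun u hum => hA.b _ ⟨hxm, hum⟩) (fun u hum => hA.bu _ ⟨hxm, hum⟩)
    · have hx0 : 0 < x := hx₁.trans_le hxm.1
      have e : x ^ p * deriv g u + σ.2 * x ^ θ = x ^ θ * (σ.2 + x ^ (p - θ) * deriv g u) := by
        have : x ^ p = x ^ θ * x ^ (p - θ) := by rw [← Real.rpow_add hx0]; congr 1; ring
        rw [this]; ring
      simp only
      rw [e, abs_mul, abs_mul, abs_of_pos (Real.rpow_pos_of_pos hx0 _)]
      gcongr
      · exact hmb x hxm
      · exact hσ x hxm u hum
    · have := hB (x, u) ⟨hxm, hum⟩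
      rw [Real.norm_eq_abs] at this
      simp only at this ⊢
      rw [abs_mul]
      calc _ ≤ |t| * B := by gcongr
        _ = _ := by field_simp
  · calc _ = (1 + B / (m * k)) * (u₂ - u₁) / (m * k) * (x₂ - x₁) * M * |t|⁻¹ := by
          field_simp
      _ ≤ _ := by gcongr; linarith

/-- The local estimate at a point that is not degenerate. -/
theorem exists_bound_nondegenerate {g : ℝ → ℝ} (hg : ContDiff ℝ ∞ g) (p θ : ℝ)
    {x₀ u₀ r : ℝ} (hx₀ : 0 < x₀) (hr : 0 < r) {c : ℝ} {m : ℕ} (hc : 0 < c)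
    (hH : ∀ u, |u - u₀| ≤ r → c * |u - u₀| ^ m ≤ |hessFactor p θ g u|)
    (hN : hessFactor p θ g u₀ ≠ 0 ∨ hessCoeff p θ g u₀ ≠ 0) :
    ∃ δ₀ : ℝ, 0 < δ₀ ∧ ∀ δ, 0 < δ → δ ≤ δ₀ →
    ∃ C : ℝ, 0 < C ∧ ∃ ε : ℝ, 0 < ε ∧ ∀ (M : ℝ) (A Ax Au : ℝ × ℝ → ℂ),
      AmplitudeOn (x₀ - δ) (x₀ + δ) (u₀ - δ) (u₀ + δ) M A Ax Au → ∀ t : ℝ, 1 ≤ |t| → ∀ σ,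
      ‖∫ z in Set.Icc (x₀ - δ) (x₀ + δ) ×ˢ Set.Icc (u₀ - δ) (u₀ + δ), A z *
        cis (t * homPhase p θ g σ z)‖ ≤ C * M * |t| ^ (-(1 / 2 + ε)) := by
  by_cases hH0 : hessFactor p θ g u₀ ≠ 0
  -- Where the Hessian does not vanish, the bound away from its zeros applies to the whole rectangle
  -- with a fixed `μ`, and no strip has to be removed.
  · set μ := min 1 (|hessFactor p θ g u₀| / 2) with hμ
    have hpos : 0 < |hessFactor p θ g u₀| := abs_pos.2 hH0
    have hμ0 : 0 < μ := by positivity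
    have hev : ∀ᶠ u in 𝓝 u₀, μ ≤ |hessFactor p θ g u| :=
      ((continuous_hessFactor hg p θ).abs.continuousAt.eventually_const_le
        ((min_le_right _ _).trans_lt (by linarith)))
    obtain ⟨δ₁, hδ₁, hδ₁'⟩ := Metric.nhds_basis_closedBall.mem_iff.1 hev
    refine ⟨min δ₁ (x₀ / 2), by positivity, fun δ hδ hδ₀ => ?_⟩
    have hδ₂ : δ ≤ x₀ / 2 := hδ₀.trans (min_le_right _ _)
    obtain ⟨C, hC, h⟩ := exists_far_bound hg p θ (by linarith : 0 < x₀ - δ)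
      (by linarith : x₀ - δ ≤ x₀ + δ) (by linarith : u₀ - δ ≤ u₀ + δ)
    refine ⟨C / μ ^ 4, by positivity, 1 / 4, by norm_num, fun M A Ax Au hA t ht σ => ?_⟩
    refine (h μ hμ0 (min_le_left _ _) Set.univ MeasurableSet.univ (fun u _ hu => hδ₁' ?_) M A Ax Au
      hA (fun z _ hz => absurd (Set.mem_univ _) hz) t ht σ).trans (le_of_eq ?_)
    · rw [Metric.mem_closedBall, Real.dist_eq]
      exact (abs_sub_le_iff_mem_Icc.1 hu).trans (hδ₀.trans (min_le_left _ _))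
    · norm_num
      exact Or.inl (by ring)
  have hN := hN.resolve_left hH0
  -- The dichotomy rests on `Ψ_xx = q + e (σ₂ + a)` and `Ψ_u = x ^ θ (σ₂ + a)`. If `σ₂` is close to
  -- `-a(x₀, u₀)`, then `Ψ_xx` is close to `q ≠ 0`. Otherwise `Ψ_u` has no zero on a small
  -- rectangle.
  set q : ℝ × ℝ → ℝ := fun z => z.1 ^ (p - 2) * hessCoeff p θ g z.2 with hq
  set e : ℝ × ℝ → ℝ := fun z => θ * (θ - 1) * z.1 ^ (θ - 2) * z.2 with he
  set a : ℝ × ℝ → ℝ := fun z => z.1 ^ (p - θ) * deriv g z.2 with ha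
  have crp : ∀ s : ℝ, ContinuousAt (fun z : ℝ × ℝ => z.1 ^ s) (x₀, u₀) := fun s =>
    (Real.continuousAt_rpow_const x₀ s (Or.inl hx₀.ne')).comp (f := Prod.fst)
      (x := (x₀, u₀)) continuousAt_fst
  have cg := hg.continuous
  have cg1 := (contDiff_deriv_infty hg).continuous
  have cN : Continuous fun z : ℝ × ℝ => hessCoeff p θ g z.2 := by unfold hessCoeff; fun_prop
  have cq : ContinuousAt q (x₀, u₀) := (crp _).mul cN.continuousAt
  have ce : ContinuousAt e (x₀, u₀) := (continuousAt_const.mul (crp _)).mul continuousAt_snd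
  have ca : ContinuousAt a (x₀, u₀) := (crp _).mul (by fun_prop)
  set c₀ := |q (x₀, u₀)| / 4 with hc₀
  have hq0 : q (x₀, u₀) ≠ 0 := mul_ne_zero (Real.rpow_pos_of_pos hx₀ _).ne' hN
  have hc₀0 : 0 < c₀ := by have := abs_pos.2 hq0; positivity
  -- In the first case `|σ₂ + a| ≤ 3 k`: `2 k` from the condition on `σ` and `k` from the
  -- oscillation of `a`. The error is then at most `c₀` while `|q| ≥ 2 c₀`, so `|Ψ_xx| ≥ c₀`.
  set k := c₀ / (3 * (|e (x₀, u₀)| + 1)) with hk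
  have hk0 : 0 < k := by positivity
  have hev : ∀ᶠ z in 𝓝 (x₀, u₀), 2 * c₀ ≤ |q z| ∧ |e z| ≤ |e (x₀, u₀)| + 1 ∧
      |a z - a (x₀, u₀)| ≤ k := by
    refine (cq.abs.eventually_const_le (by linarith)).and
      ((ce.abs.eventually_le_const (by linarith)).and ?_)
    have : ContinuousAt (fun z => |a z - a (x₀, u₀)|) (x₀, u₀) := (ca.sub continuousAt_const).abs
    exact this.eventually_le_const (by simpa using hk0)
  obtain ⟨δ₁, hδ₁, hδ₁'⟩ := Metric.nhds_basis_closedBall.mem_iff.1 hev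
  refine ⟨min (min δ₁ r) (x₀ / 2), by positivity, fun δ hδ hδ₀ => ?_⟩
  have hδ₂ : δ ≤ x₀ / 2 := hδ₀.trans (min_le_right _ _)
  have hδ₃ : δ ≤ δ₁ := hδ₀.trans ((min_le_left _ _).trans (min_le_left _ _))
  have hδ₄ : δ ≤ r := hδ₀.trans ((min_le_left _ _).trans (min_le_right _ _))
  have hx₁ : 0 < x₀ - δ := by linarith
  have hx : x₀ - δ ≤ x₀ + δ := by linarith
  have hu : u₀ - δ ≤ u₀ + δ := by linarith
  have hloc : ∀ x ∈ Set.Icc (x₀ - δ) (x₀ + δ), ∀ u ∈ Set.Icc (u₀ - δ) (u₀ + δ),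
      2 * c₀ ≤ |q (x, u)| ∧ |e (x, u)| ≤ |e (x₀, u₀)| + 1 ∧ |a (x, u) - a (x₀, u₀)| ≤ k := by
    intro x hx u hu
    refine hδ₁' ?_
    rw [Metric.mem_closedBall, Prod.dist_eq, Real.dist_eq, Real.dist_eq]
    exact max_le ((abs_sub_le_iff_mem_Icc.1 hx).trans hδ₃) ((abs_sub_le_iff_mem_Icc.1 hu).trans hδ₃)
  obtain ⟨η, η', Kη, hη, hη', hη1, hη0, hηb, hKη, hηb', hη'0, -⟩ := exists_cutoff
  have hη_cont : Continuous η := continuous_iff_continuousAt.2 fun s => (hη s).continuousAt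
  obtain ⟨L, hL, hph⟩ := exists_phaseOn (x₂ := x₀ + δ) (u₁ := u₀ - δ) (u₂ := u₀ + δ) hg p θ hx₁
  obtain ⟨C₂, hC₂, large⟩ := exists_bound_large hg p θ hx₁ hx hu hk0
  have H := exists_bound_of_near hg p θ hx₁ hx hu (u₀ := u₀) hc
    (fun u hu => hH u ((abs_sub_le_iff_mem_Icc.1 hu).trans hδ₄)) hη hη' hη1 hηb hKη hηb' hη'0
    (w := fun _ => 1) (w' := fun _ => 0) (K := 1) continuousOn_const
    (fun u _ _ => hasDerivAt_const u 1) continuousOn_const (fun u _ => by simp)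
    (fun u _ _ => by rw [abs_zero]; positivity)
    (P := fun σ => |σ.2 + a (x₀, u₀)| ≤ 2 * k) (C₁ := 4 * (9 * (1 + 2 * δ)) / √c₀) (γ := 1)
    (by positivity) one_pos ?_
  · obtain ⟨C₁, hC₁, ε, hε, small⟩ := H
    refine ⟨C₁ + C₂, by positivity, min ε (1 / 2), by positivity, fun M A Ax Au hA t ht σ => ?_⟩
    have hM : 0 ≤ M := (norm_nonneg _).trans (hA.b (x₀, u₀) ⟨by simp [hδ.le], by simp [hδ.le]⟩)
    by_cases hσ : |σ.2 + a (x₀, u₀)| ≤ 2 * k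
    · have := small M A Ax Au hA t ht σ hσ
      simp only [Complex.ofReal_one, mul_one] at this
      refine this.trans ?_
      gcongr
      · linarith
      · exact min_le_left _ _
    · push Not at hσ
      refine (large M A Ax Au hA t ht σ fun x hxm u hum => ?_).trans ?_
      · have h3 := (hloc x hxm u hum).2.2
        have h4 : σ.2 + a (x₀, u₀) = (σ.2 + a (x, u)) - (a (x, u) - a (x₀, u₀)) := by ring
        have h5 := abs_sub (σ.2 + a (x, u)) (a (x, u) - a (x₀, u₀))
        rw [← h4] at h5
        change k ≤ |σ.2 + a (x, u)|
        linarith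
      · rw [← Real.rpow_neg_one]
        gcongr
        · linarith
        · have := min_le_right ε (1 / 2); linarith
  intro l hl hl1 M A Ax Au hA t ht σ hσ
  have ht0 : 0 < |t| := by linarith
  have hM : 0 ≤ M := (norm_nonneg _).trans (hA.b (x₀, u₀) ⟨by simp [hδ.le], by simp [hδ.le]⟩)
  have cη : ContinuousOn (fun u => (1 : ℝ) * η ((u - u₀) / l)) (Set.Icc (u₀ - δ) (u₀ + δ)) :=
    (by fun_prop : Continuous fun u => (1 : ℝ) * η ((u - u₀) / l)).continuousOn
  have h_int := hA.integrableOn (w := fun u => 1 * η ((u - u₀) / l)) cη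
    (φ := fun z => t * homPhase p θ g σ z) (continuousOn_const.mul (hph σ).c)
  set b := 9 * (M + M * (2 * δ)) / √(|t| * c₀) with hb
  have hb0 : 0 ≤ b := by positivity
  -- Van der Corput in `x` bounds the inner integral by `b` for every `u`. Only `|u - u₀| ≤ 2 l`
  -- contributes, and the width of this strip supplies the gain with `γ = 1`.
  have := norm_setIntegral_prod_le_fst hx h_int
    (b := Set.indicator (Set.Icc (u₀ - 2 * l) (u₀ + 2 * l)) fun _ => b)
    (fun u => Set.indicator_nonneg (fun _ _ => hb0) u)
    ((integrable_indicator_iff measurableSet_Icc).2 (by simp)) fun u hum => ?_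
  · refine this.trans (le_of_eq ?_)
    rw [integral_indicator measurableSet_Icc, setIntegral_const, Measure.real, Real.volume_Icc,
      ENNReal.toReal_ofReal (by linarith), hb, Real.sqrt_mul ht0.le, Real.sqrt_eq_rpow |t|,
      Real.rpow_neg ht0.le, Real.rpow_one, smul_eq_mul]
    field_simp
    ring
  · by_cases hul : u ∈ Set.Icc (u₀ - 2 * l) (u₀ + 2 * l)
    · rw [Set.indicator_of_mem hul]
      have e1 : (x₀ + δ) - (x₀ - δ) = 2 * δ := by ring
      rw [hb, ← e1]
      have hη1' : ‖((1 * η ((u - u₀) / l) : ℝ) : ℂ)‖ ≤ 1 := by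
        rw [Complex.norm_real, Real.norm_eq_abs, one_mul]; exact hηb _
      refine norm_integral_cis_le_of_deriv2 hx (ψ := fun x => t * homPhase p θ g σ (x, u))
        (fun x hxm => ((hph σ).dx x hxm u hum).const_mul t)
        (fun x hxm => ((hph σ).dxx x hxm u hum).const_mul t)
        (continuousOn_const.mul ((hph σ).cxx.comp (by fun_prop) fun x hxm => ⟨hxm, hum⟩))
        (by positivity) (fun x hxm => ?_)
        (A := fun x => A (x, u) * ((1 * η ((u - u₀) / l) : ℝ) : ℂ))
        (A' := fun x => Ax (x, u) * ((1 * η ((u - u₀) / l) : ℝ) : ℂ))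
        (fun x hxm => (hA.dx x hxm u hum).mul_const _)
        ((hA.cx.comp (by fun_prop) fun x hxm => ⟨hxm, hum⟩).mul continuousOn_const)
        (fun x hxm => ?_) (fun x hxm => ?_)
      · obtain ⟨h1, h2, h3⟩ := hloc x hxm u hum
        have hx0 : 0 < x := hx₁.trans_le hxm.1
        have e2 : p * (p - 1) * x ^ (p - 2) * g u + θ * (θ - 1) * σ.2 * x ^ (θ - 2) * u =
            q (x, u) + e (x, u) * (σ.2 + a (x, u)) := by
          have : x ^ (p - 2) = x ^ (θ - 2) * x ^ (p - θ) := by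
            rw [← Real.rpow_add hx0]; congr 1; ring
          simp only [hq, he, ha, hessCoeff]
          rw [this]; ring
        have h6 : |σ.2 + a (x, u)| ≤ 3 * k := by
          have : σ.2 + a (x, u) = (σ.2 + a (x₀, u₀)) + (a (x, u) - a (x₀, u₀)) := by ring
          rw [this]
          exact (abs_add_le _ _).trans (by linarith)
        have h7 : |e (x, u) * (σ.2 + a (x, u))| ≤ c₀ := by
          rw [abs_mul]
          calc _ ≤ (|e (x₀, u₀)| + 1) * (3 * k) := by gcongr
            _ = c₀ := by rw [hk]; field_simp
        simp only
        rw [e2, abs_mul]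
        gcongr
        have h8 := abs_sub (q (x, u) + e (x, u) * (σ.2 + a (x, u))) (e (x, u) * (σ.2 + a (x, u)))
        rw [add_sub_cancel_right] at h8
        linarith
      · rw [norm_mul]
        exact (mul_le_mul (hA.b _ ⟨hxm, hum⟩) hη1' (norm_nonneg _) hM).trans (mul_one M).le
      · rw [norm_mul]
        exact (mul_le_mul (hA.bx _ ⟨hxm, hum⟩) hη1' (norm_nonneg _) hM).trans (mul_one M).le
    · rw [Set.indicator_of_notMem hul]
      rw [abs_sub_le_iff_mem_Icc] at hul
      push Not at hul
      simp only
      rw [hη0 ((u - u₀) / l) (by rw [abs_div, abs_of_pos hl, le_div_iff₀ hl]; exact hul.le)]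
      simp

/-! ### Orders of vanishing -/

/-- The remainder in Taylor's formula at a zero of order at least `m`. -/
theorem isLittleO_of_iteratedDeriv_eq_zero {φ : ℝ → ℝ} (hφ : ContDiff ℝ ∞ φ) {u₀ : ℝ} {m : ℕ}
    (h : ∀ k < m, iteratedDeriv k φ u₀ = 0) :
    (fun u => φ u - ((m.factorial : ℝ)⁻¹ * (u - u₀) ^ m) * iteratedDeriv m φ u₀) =o[𝓝 u₀]
      fun u => (u - u₀) ^ m := by
  have := taylor_isLittleO_univ (x₀ := u₀) (n := m) (hφ.of_le (by exact_mod_cast le_top))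
  refine this.congr_left fun u => ?_
  rw [taylor_within_apply, Finset.sum_range_succ, Finset.sum_eq_zero, zero_add,
    iteratedDerivWithin_univ, smul_eq_mul]
  intro k hk
  rw [iteratedDerivWithin_univ, h k (Finset.mem_range.1 hk), smul_zero]

theorem exists_abs_le_pow {φ : ℝ → ℝ} (hφ : ContDiff ℝ ∞ φ) {u₀ : ℝ} {m : ℕ}
    (h : ∀ k < m, iteratedDeriv k φ u₀ = 0) :
    ∃ C : ℝ, 0 < C ∧ ∀ᶠ u in 𝓝 u₀, |φ u| ≤ C * |u - u₀| ^ m := by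
  have h1 := (isLittleO_of_iteratedDeriv_eq_zero hφ h).def one_pos
  refine ⟨1 + (m.factorial : ℝ)⁻¹ * |iteratedDeriv m φ u₀|, by positivity, ?_⟩
  filter_upwards [h1] with u hu
  rw [Real.norm_eq_abs, Real.norm_eq_abs, abs_pow, one_mul] at hu
  have h2 := abs_add_le (φ u - ((m.factorial : ℝ)⁻¹ * (u - u₀) ^ m) * iteratedDeriv m φ u₀)
    (((m.factorial : ℝ)⁻¹ * (u - u₀) ^ m) * iteratedDeriv m φ u₀)
  rw [sub_add_cancel, abs_mul _ (iteratedDeriv m φ u₀), abs_mul, abs_pow,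
    abs_of_pos (by positivity : (0 : ℝ) < (m.factorial : ℝ)⁻¹)] at h2
  nlinarith

/-- Half of the leading Taylor coefficient is kept, and the other half absorbs the remainder. -/
theorem exists_pow_le_abs {φ : ℝ → ℝ} (hφ : ContDiff ℝ ∞ φ) {u₀ : ℝ} {m : ℕ}
    (h : ∀ k < m, iteratedDeriv k φ u₀ = 0) (hm : iteratedDeriv m φ u₀ ≠ 0) :
    ∃ c : ℝ, 0 < c ∧ ∀ᶠ u in 𝓝 u₀, c * |u - u₀| ^ m ≤ |φ u| := by
  set c := (m.factorial : ℝ)⁻¹ * |iteratedDeriv m φ u₀| / 2 with hc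
  have hpos := abs_pos.2 hm
  have hc0 : 0 < c := by positivity
  refine ⟨c, hc0, ?_⟩
  filter_upwards [(isLittleO_of_iteratedDeriv_eq_zero hφ h).def hc0] with u hu
  rw [Real.norm_eq_abs, Real.norm_eq_abs, abs_pow] at hu
  have h2 := abs_sub (φ u)
    (φ u - ((m.factorial : ℝ)⁻¹ * (u - u₀) ^ m) * iteratedDeriv m φ u₀)
  rw [sub_sub_cancel, abs_mul _ (iteratedDeriv m φ u₀), abs_mul, abs_pow,
    abs_of_pos (by positivity : (0 : ℝ) < (m.factorial : ℝ)⁻¹)] at h2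
  have : (m.factorial : ℝ)⁻¹ * |u - u₀| ^ m * |iteratedDeriv m φ u₀| = 2 * c * |u - u₀| ^ m := by
    rw [hc]; ring
  linarith

/-- A smooth function that is not flat at a point has a well-defined order there. -/
theorem exists_order {φ : ℝ → ℝ} {u₀ : ℝ} (h : ∃ k, iteratedDeriv k φ u₀ ≠ 0) :
    ∃ m, (∀ k < m, iteratedDeriv k φ u₀ = 0) ∧ iteratedDeriv m φ u₀ ≠ 0 := by
  classical
  exact ⟨Nat.find h, fun k hk => not_not.1 (Nat.find_min h hk), Nat.find_spec h⟩

/-- The second derivative factor is flat where `g` is. -/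
theorem exists_iteratedDeriv_ne_zero_of_hessFactor {g : ℝ → ℝ} (hg : ContDiff ℝ ∞ g) {p θ u₀ : ℝ}
    (h : ∃ k, iteratedDeriv k (hessFactor p θ g) u₀ ≠ 0)
    (hH : ContDiff ℝ ∞ (hessFactor p θ g)) : ∃ k, iteratedDeriv k g u₀ ≠ 0 := by
  by_contra hcon
  push Not at hcon
  -- If all derivatives of `g` vanish at `u₀`, then `g'` and `g''` are `O(|u - u₀| ^ (m + 1))`,
  -- hence so is `hessFactor`. This contradicts its lower bound `c |u - u₀| ^ m`.
  obtain ⟨m, hm, hm'⟩ := exists_order h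
  obtain ⟨c, hc, hlow⟩ := exists_pow_le_abs hH hm hm'
  have hg1 := contDiff_deriv_infty hg
  have hg2 := contDiff_deriv_infty hg1
  obtain ⟨C₁, hC₁, h1⟩ := exists_abs_le_pow (m := m + 1) hg1
    (fun k _ => by rw [← iteratedDeriv_succ']; exact hcon _)
  obtain ⟨C₂, hC₂, h2⟩ := exists_abs_le_pow (m := m + 1) hg2
    (fun k _ => by rw [← iteratedDeriv_succ', ← iteratedDeriv_succ']; exact hcon _)
  set B := |hessCoeff p θ g u₀| + 1 with hB
  have cN : Continuous fun u => |hessCoeff p θ g u| := by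
    have := hg.continuous
    have := hg1.continuous
    unfold hessCoeff; fun_prop
  have h3 : ∀ᶠ u in 𝓝 u₀, |hessCoeff p θ g u| ≤ B := cN.continuousAt.eventually_le_const (by simp [hB])
  have h4 : ∀ᶠ u in 𝓝 u₀, |u - u₀| < 1 :=
    (by fun_prop : Continuous fun u => |u - u₀|).continuousAt.eventually_lt_const (by simp)
  have h5 : ∀ᶠ u in 𝓝 u₀, |u - u₀| < c / (C₂ * B + (p - θ) ^ 2 * C₁ ^ 2) / 2 ∨
      C₂ * B + (p - θ) ^ 2 * C₁ ^ 2 = 0 := by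
    rcases eq_or_ne (C₂ * B + (p - θ) ^ 2 * C₁ ^ 2) 0 with h0 | h0
    · exact Eventually.of_forall fun _ => Or.inr h0
    · have : 0 < C₂ * B + (p - θ) ^ 2 * C₁ ^ 2 := by positivity
      filter_upwards [(by fun_prop : Continuous fun u => |u - u₀|).continuousAt.eventually_lt_const
        (u := c / (C₂ * B + (p - θ) ^ 2 * C₁ ^ 2) / 2)
        (show |u₀ - u₀| < _ by rw [sub_self, abs_zero]; positivity)] with u hu using Or.inl hu
  have hall := (hlow.and (h1.and (h2.and (h3.and (h4.and h5)))))
  obtain ⟨u, ⟨a0, a1, a2, a3, a4, a5⟩, hne⟩ :=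
    ((hall.filter_mono nhdsWithin_le_nhds).and (self_mem_nhdsWithin (a := u₀) (s := {u₀}ᶜ))).exists
  have hv : 0 < |u - u₀| := abs_pos.2 (sub_ne_zero.2 hne)
  set v := |u - u₀| with hvdef
  have hD : 0 < C₂ * B + (p - θ) ^ 2 * C₁ ^ 2 := by positivity
  have b1 : |hessFactor p θ g u| ≤ (C₂ * B + (p - θ) ^ 2 * C₁ ^ 2) * v ^ (m + 1) := by
    have hv1 : v ^ (m + 1) ≤ 1 := pow_le_one₀ hv.le a4.le
    have hv0 : 0 ≤ v ^ (m + 1) := by positivity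
    calc |hessFactor p θ g u| = |deriv (deriv g) u * hessCoeff p θ g u -
          (p - θ) ^ 2 * deriv g u ^ 2| := rfl
      _ ≤ |deriv (deriv g) u * hessCoeff p θ g u| + |(p - θ) ^ 2 * deriv g u ^ 2| := abs_sub _ _
      _ = |deriv (deriv g) u| * |hessCoeff p θ g u| + (p - θ) ^ 2 * |deriv g u| ^ 2 := by
          rw [abs_mul, abs_mul, abs_pow, abs_pow, sq_abs (p - θ)]
      _ ≤ (C₂ * v ^ (m + 1)) * B + (p - θ) ^ 2 * (C₁ * v ^ (m + 1)) ^ 2 := by gcongr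
      _ = C₂ * B * v ^ (m + 1) + (p - θ) ^ 2 * C₁ ^ 2 * v ^ (m + 1) * v ^ (m + 1) := by ring
      _ ≤ C₂ * B * v ^ (m + 1) + (p - θ) ^ 2 * C₁ ^ 2 * v ^ (m + 1) * 1 := by gcongr
      _ = _ := by ring
  rcases a5 with a5 | a5
  · rw [lt_div_iff₀ two_pos, lt_div_iff₀ hD] at a5
    have : 0 < v ^ m := by positivity
    rw [pow_succ] at b1
    have b2 : c * v ^ m ≤ (v * (C₂ * B + (p - θ) ^ 2 * C₁ ^ 2)) * v ^ m :=
      a0.trans (b1.trans (by apply le_of_eq; ring))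
    have b3 := le_of_mul_le_mul_right b2 this
    nlinarith [mul_pos hv hD]
  · exact hD.ne' a5

/-- Products with compositions inherit vanishing derivatives. -/
theorem iteratedFDeriv_mul_comp_eq_zero {E : Type*} [NormedAddCommGroup E] [NormedSpace ℝ E]
    {Φ ρ υ : E → ℝ} {φ : ℝ → ℝ} (hφ : ContDiff ℝ ∞ φ) {O : Set E} (hO : IsOpen O)
    (hρ : ContDiffOn ℝ ∞ ρ O) (hυ : ContDiffOn ℝ ∞ υ O) {y : E} (hy : y ∈ O)
    (hΦ : ∀ z ∈ O, Φ z = ρ z * φ (υ z)) {n : ℕ}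
    (h : ∀ k ≤ n, iteratedDeriv k φ (υ y) = 0) : iteratedFDeriv ℝ n Φ y = 0 := by
  have hcomp : ∀ k ≤ n, iteratedFDerivWithin ℝ k (φ ∘ υ) O y = 0 := by
    intro k hk
    -- The quantitative chain rule is applied with the bound `C = 0` for the outer derivatives. Any
    -- finite `D ≥ 1` dominating the inner ones will do, since `D ≤ D ^ i` for `i ≥ 1`.
    set D := 1 + ∑ i ∈ Finset.range (k + 1), ‖iteratedFDerivWithin ℝ i υ O y‖ with hD
    have hD1 : 1 ≤ D := by
      have : 0 ≤ ∑ i ∈ Finset.range (k + 1), ‖iteratedFDerivWithin ℝ i υ O y‖ :=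
        Finset.sum_nonneg fun _ _ => norm_nonneg _
      linarith
    have := norm_iteratedFDerivWithin_comp_le (n := k) (C := 0) (D := D) hφ.contDiffOn hυ
      (by exact_mod_cast le_top) uniqueDiffOn_univ hO.uniqueDiffOn (Set.mapsTo_univ _ _) hy
      (fun i hi => by
        rw [iteratedFDerivWithin_univ, norm_iteratedFDeriv_eq_norm_iteratedDeriv,
          h i (hi.trans hk), norm_zero])
      (fun i hi1 hi => by
        calc ‖iteratedFDerivWithin ℝ i υ O y‖ ≤
              ∑ i ∈ Finset.range (k + 1), ‖iteratedFDerivWithin ℝ i υ O y‖ :=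
              Finset.single_le_sum (f := fun i => ‖iteratedFDerivWithin ℝ i υ O y‖)
                (fun _ _ => norm_nonneg _) (Finset.mem_range.2 (by omega))
          _ ≤ D := by rw [hD]; linarith
          _ = D ^ 1 := (pow_one D).symm
          _ ≤ D ^ i := pow_le_pow_right₀ hD1 hi1)
    simpa using this
  have hev : Φ =ᶠ[𝓝 y] fun z => ρ z * (φ ∘ υ) z := by
    filter_upwards [hO.mem_nhds hy] with z hz using hΦ z hz
  rw [(EventuallyEq.iteratedFDeriv ℝ hev n).self_of_nhds, ← iteratedFDerivWithin_of_isOpen n hO hy]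
  have := norm_iteratedFDerivWithin_mul_le hρ (hφ.comp_contDiffOn hυ) hO.uniqueDiffOn hy (n := n)
    (by exact_mod_cast le_top)
  rw [Finset.sum_eq_zero] at this
  · simpa using this
  · intro i hi
    rw [hcomp (n - i) (Nat.sub_le _ _), norm_zero, mul_zero]

theorem ordAt_le_of_ne_zero {g : Plane → ℝ} {x : Plane} {j : ℕ} (h : iteratedFDeriv ℝ j g x ≠ 0) :
    ordAt g x ≤ j := iInf₂_le (f := fun (j : ℕ) (_ : iteratedFDeriv ℝ j g x ≠ 0) => (j : ℕ∞)) j h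

theorem le_ordAt {g : Plane → ℝ} {x : Plane} {n : ℕ} (h : ∀ k < n, iteratedFDeriv ℝ k g x = 0) :
    (n : ℕ∞) ≤ ordAt g x := by
  refine le_iInf₂ fun j hj => ?_
  by_contra hlt
  exact hj (h j (by exact_mod_cast not_le.1 hlt))

theorem exists_ne_zero_of_ordAt {g : Plane → ℝ} {x : Plane} (h : ordAt g x ≠ ⊤) :
    ∃ j, iteratedFDeriv ℝ j g x ≠ 0 := by
  by_contra hcon
  push Not at hcon
  exact h (by simp [ordAt, hcon])

theorem ordAt_le_ord (g : Plane → ℝ) {x : Plane} (hx : x ≠ 0) : ordAt g x ≤ ord g :=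
  le_iSup₂ (f := fun (x : Plane) (_ : x ≠ 0) => ordAt g x) x hx

/-! ### Charts adapted to the dilations -/

/-- The linear chart `(x, y) ↦ τ x e_j + y e_{1-j}`. -/
def chart (j : Fin 2) (τ : ℝ) : ℝ × ℝ →L[ℝ] Plane :=
  (ContinuousLinearMap.fst ℝ ℝ ℝ).smulRight (τ • EuclideanSpace.single j (1 : ℝ)) +
    (ContinuousLinearMap.snd ℝ ℝ ℝ).smulRight (EuclideanSpace.single (1 - j) (1 : ℝ))

section Chart

variable {κ : Fin 2 → ℝ} {j : Fin 2} {τ : ℝ}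

theorem chart_apply (z : ℝ × ℝ) : chart j τ z = z.1 • (τ • EuclideanSpace.single j (1 : ℝ)) +
    z.2 • EuclideanSpace.single (1 - j) (1 : ℝ) := rfl

theorem chart_apply_self (z : ℝ × ℝ) : chart j τ z j = τ * z.1 := by
  rw [chart_apply]; fin_cases j <;> simp [mul_comm]

theorem chart_apply_other (z : ℝ × ℝ) : chart j τ z (1 - j) = z.2 := by
  rw [chart_apply]; fin_cases j <;> simp

theorem plane_ext {x y : Plane} (j : Fin 2) (h1 : x j = y j) (h2 : x (1 - j) = y (1 - j)) :
    x = y := by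
  ext i
  fin_cases j <;> fin_cases i <;> first | exact h1 | exact h2

theorem dil_apply (r : ℝ) (x : Plane) (i : Fin 2) : dil κ r x i = r ^ κ i * x i := rfl

theorem dil_chart (r : ℝ) (z : ℝ × ℝ) :
    dil κ r (chart j τ z) = chart j τ (r ^ κ j * z.1, r ^ κ (1 - j) * z.2) := by
  refine plane_ext j ?_ ?_
  · rw [dil_apply, chart_apply_self, chart_apply_self]; ring
  · rw [dil_apply, chart_apply_other, chart_apply_other]

/-- The quantity `y x ^ (-κ (1 - j) / κ j)` is constant on orbits and marks where the orbit meets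
the line `x = 1`. A homogeneous function is thus a power of `x` times a function of this single
variable. -/
theorem chart_eq_dil (hκ : ∀ j, 0 < κ j) {x y : ℝ} (hx : 0 < x) : chart j τ (x, y) =
    dil κ (x ^ (1 / κ j)) (chart j τ (1, y * x ^ (-(κ (1 - j) / κ j)))) := by
  have h1 : 1 / κ j * κ j = 1 := by have := (hκ j).ne'; field_simp
  have h2 : 1 / κ j * κ (1 - j) = κ (1 - j) / κ j := by ring
  rw [dil_chart, ← Real.rpow_mul hx.le, ← Real.rpow_mul hx.le, h1, h2]
  congr 2
  · simp
  · rw [mul_left_comm, ← Real.rpow_add hx]; simp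

theorem chart_ne_zero (hτ : τ ≠ 0) {z : ℝ × ℝ} (hz : z.1 ≠ 0) : chart j τ z ≠ 0 := fun h => by
  have := chart_apply_self (j := j) (τ := τ) z
  rw [h] at this
  exact mul_ne_zero hτ hz this.symm

theorem IsHomog.chart (hκ : ∀ j, 0 < κ j) (hτ : τ ≠ 0) {d : ℝ} {h : Plane → ℝ}
    (hh : IsHomog κ d h) {x y : ℝ} (hx : 0 < x) : h (chart j τ (x, y)) =
    x ^ (1 / κ j * d) * h (DampedOsc.chart j τ (1, y * x ^ (-(κ (1 - j) / κ j)))) := by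
  rw [chart_eq_dil hκ hx, hh _ (chart_ne_zero hτ one_ne_zero) _ (Real.rpow_pos_of_pos hx _),
    Real.rpow_mul hx.le]

theorem norm_sq_eq (x : Plane) (j : Fin 2) : ‖x‖ ^ 2 = x j ^ 2 + x (1 - j) ^ 2 := by
  rw [EuclideanSpace.norm_sq_eq, Fin.sum_univ_two]
  fin_cases j <;> simp [add_comm]

theorem inner_chart (z : ℝ × ℝ) (s : Plane) :
    inner ℝ (chart j τ z) s = (τ * s j) * z.1 + s (1 - j) * z.2 := by
  rw [chart_apply, inner_add_left, inner_smul_left, inner_smul_left, inner_smul_left,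
    EuclideanSpace.inner_single_left, EuclideanSpace.inner_single_left]
  simp only [conj_trivial, one_mul]
  ring

/-- Four open half-planes cover the punctured plane. The second coordinate is written as `x₀ ^ θ u₀`
so that the point is given directly in homogeneous coordinates. -/
theorem exists_chart {y : Plane} (hy : y ≠ 0) (θ : Fin 2 → ℝ) :
    ∃ (j : Fin 2) (τ : ℝ), (τ = 1 ∨ τ = -1) ∧ ∃ x₀ u₀ : ℝ, 0 < x₀ ∧
      y = chart j τ (x₀, x₀ ^ θ j * u₀) := by
  obtain ⟨j, hj⟩ : ∃ j, y j ≠ 0 := by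
    by_contra hcon
    push Not at hcon
    exact hy (by ext i; simpa using hcon i)
  have key : ∀ τ : ℝ, τ * τ = 1 → 0 < τ * y j → ∃ x₀ u₀ : ℝ, 0 < x₀ ∧
      y = chart j τ (x₀, x₀ ^ θ j * u₀) := by
    intro τ hτ hpos
    refine ⟨τ * y j, ((τ * y j) ^ θ j)⁻¹ * y (1 - j), hpos, plane_ext j ?_ ?_⟩
    · rw [chart_apply_self, ← mul_assoc, hτ, one_mul]
    · rw [chart_apply_other, mul_inv_cancel_left₀ (Real.rpow_pos_of_pos hpos _).ne']
  rcases hj.lt_or_gt with h | h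
  · exact ⟨j, -1, Or.inr rfl, key _ (by norm_num) (by linarith)⟩
  · exact ⟨j, 1, Or.inl rfl, key _ (by norm_num) (by linarith)⟩

theorem measurePreserving_chart (hτ : τ = 1 ∨ τ = -1) :
    MeasurePreserving (chart j τ) volume volume := by
  have h0 : MeasurePreserving (fun z : ℝ × ℝ => (WithLp.toLp 2 ![z.1, z.2] : Plane)) :=
    (PiLp.volume_preserving_toLp (Fin 2)).comp
      (volume_preserving_finTwoArrow ℝ).symm
  have h1 : MeasurePreserving (fun z : ℝ × ℝ => (τ * z.1, z.2)) := by
    have : MeasurePreserving (fun x : ℝ => τ * x) := by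
      rcases hτ with rfl | rfl
      · simp only [one_mul]; exact MeasurePreserving.id volume
      · simpa using Measure.measurePreserving_neg (volume : Measure ℝ)
    exact this.prod (MeasurePreserving.id volume)
  have h2 : MeasurePreserving (Prod.swap : ℝ × ℝ → ℝ × ℝ) := Measure.measurePreserving_swap
  fin_cases j
  · refine (h0.comp h1).congr (chart _ τ).continuous.measurable (Eventually.of_forall fun z => ?_)
    ext i
    rw [chart_apply]; fin_cases i <;> simp [mul_comm]
  · refine (h0.comp (h2.comp h1)).congr (chart _ τ).continuous.measurable (Eventually.of_forall fun z => ?_)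
    ext i
    rw [chart_apply]; fin_cases i <;> simp [mul_comm]

theorem chart_injective (hτ : τ ≠ 0) : Function.Injective (chart j τ) := by
  intro z w h
  have h1 := congrArg (fun v : Plane => v j) h
  have h2 := congrArg (fun v : Plane => v (1 - j)) h
  simp only [chart_apply_self, chart_apply_other] at h1 h2
  exact Prod.ext (mul_left_cancel₀ hτ h1) h2

theorem measurableEmbedding_chart (hτ : τ ≠ 0) : MeasurableEmbedding (chart j τ) :=
  (chart j τ).continuous.measurableEmbedding (chart_injective hτ)

end Chart

/-! ### Derivatives of homogeneous functions in a chart -/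

section Deriv

variable {j : Fin 2} {τ : ℝ}

theorem hasDerivAt_chart_fst {h : Plane → ℝ} {x y : ℝ} (hd : DifferentiableAt ℝ h (chart j τ (x, y))) :
    HasDerivAt (fun x => h (chart j τ (x, y))) (fderiv ℝ h (chart j τ (x, y)) (chart j τ (1, 0))) x := by
  have h1 : HasDerivAt (fun x => chart j τ (x, y)) (chart j τ (1, 0)) x :=
    ((chart j τ).hasFDerivAt (x := (x, y))).comp_hasDerivAt x
      ((hasDerivAt_id x).prodMk (hasDerivAt_const x y))
  exact hd.hasFDerivAt.comp_hasDerivAt x h1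

theorem hasDerivAt_chart_snd {h : Plane → ℝ} {x y : ℝ} (hd : DifferentiableAt ℝ h (chart j τ (x, y))) :
    HasDerivAt (fun y => h (chart j τ (x, y))) (fderiv ℝ h (chart j τ (x, y)) (chart j τ (0, 1))) y := by
  have h1 : HasDerivAt (fun y => chart j τ (x, y)) (chart j τ (0, 1)) y :=
    ((chart j τ).hasFDerivAt (x := (x, y))).comp_hasDerivAt y
      ((hasDerivAt_const y x).prodMk (hasDerivAt_id y))
  exact hd.hasFDerivAt.comp_hasDerivAt y h1

/-- The derivatives of a function of the form `x ^ e * φ (y * x ^ (-θ))`. -/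
theorem fderiv_of_chart {h : Plane → ℝ} {φ : ℝ → ℝ} (hφ : ContDiff ℝ ∞ φ) {e θ : ℝ}
    (hh : ∀ x y : ℝ, 0 < x → h (chart j τ (x, y)) = x ^ e * φ (y * x ^ (-θ))) {x y : ℝ} (hx : 0 < x)
    (hd : DifferentiableAt ℝ h (chart j τ (x, y))) :
    fderiv ℝ h (chart j τ (x, y)) (chart j τ (0, 1)) = x ^ (e - θ) * deriv φ (y * x ^ (-θ)) ∧
    fderiv ℝ h (chart j τ (x, y)) (chart j τ (1, 0)) = x ^ (e - 1) *
      (e * φ (y * x ^ (-θ)) - θ * (y * x ^ (-θ)) * deriv φ (y * x ^ (-θ))) := by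
  constructor
  · refine (hasDerivAt_chart_snd hd).unique ?_
    have h1 : HasDerivAt (fun y => x ^ e * φ (y * x ^ (-θ)))
        (x ^ e * (deriv φ (y * x ^ (-θ)) * (1 * x ^ (-θ)))) y :=
      ((hasDerivAt_of_infty hφ _).comp y ((hasDerivAt_id y).mul_const _)).const_mul _
    simp only [hh x _ hx]
    refine h1.congr_deriv ?_
    rw [Real.rpow_sub hx, Real.rpow_neg hx.le]; ring
  · refine (hasDerivAt_chart_fst hd).unique ?_
    have h0 : HasDerivAt (fun x : ℝ => y * x ^ (-θ)) (y * (-θ * x ^ (-θ - 1))) x :=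
      (Real.hasDerivAt_rpow_const (Or.inl hx.ne')).const_mul y
    have h1 : HasDerivAt (fun x => x ^ e * φ (y * x ^ (-θ)))
        (e * x ^ (e - 1) * φ (y * x ^ (-θ)) +
          x ^ e * (deriv φ (y * x ^ (-θ)) * (y * (-θ * x ^ (-θ - 1))))) x :=
      (Real.hasDerivAt_rpow_const (Or.inl hx.ne')).mul
        ((hasDerivAt_of_infty hφ _).comp x h0)
    have h2 : (fun x => h (chart j τ (x, y))) =ᶠ[𝓝 x] fun x => x ^ e * φ (y * x ^ (-θ)) := by
      filter_upwards [lt_mem_nhds hx] with x' hx' using hh x' y hx'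
    refine (h1.congr_of_eventuallyEq h2).congr_deriv ?_
    rw [Real.rpow_sub hx, Real.rpow_sub hx, Real.rpow_one]; ring

theorem gradient_apply (f : Plane → ℝ) (x : Plane) (i : Fin 2) :
    gradient f x i = fderiv ℝ f x (EuclideanSpace.single i 1) := by
  have : inner ℝ (gradient f x) (EuclideanSpace.single i 1) =
      fderiv ℝ f x (EuclideanSpace.single i 1) := by
    rw [gradient, InnerProductSpace.toDual_symm_apply]
  rw [← this, EuclideanSpace.inner_single_right]
  simp

theorem chart_snd : chart j τ (0, 1) = EuclideanSpace.single (1 - j) (1 : ℝ) := by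
  rw [chart_apply]; simp

theorem chart_fst : chart j τ (1, 0) = τ • EuclideanSpace.single j (1 : ℝ) := by
  rw [chart_apply]; simp

theorem gradient_apply_other (f : Plane → ℝ) (x : Plane) :
    gradient f x (1 - j) = fderiv ℝ f x (chart j τ (0, 1)) := by
  rw [gradient_apply, chart_snd]

theorem gradient_apply_self (hτ : τ * τ = 1) (f : Plane → ℝ) (x : Plane) :
    gradient f x j = τ * fderiv ℝ f x (chart j τ (1, 0)) := by
  rw [gradient_apply, chart_fst, map_smul, smul_eq_mul, ← mul_assoc, hτ, one_mul]

/-- The chart is a reflection, possibly composed with an exchange of coordinates, so the determinant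
changes by `τ² = 1`. -/
theorem hess_eq_chart (hτ : τ * τ = 1) (f : Plane → ℝ) (x : Plane) : hess f x =
    fderiv ℝ (fderiv ℝ f) x (chart j τ (1, 0)) (chart j τ (1, 0)) *
      fderiv ℝ (fderiv ℝ f) x (chart j τ (0, 1)) (chart j τ (0, 1)) -
    fderiv ℝ (fderiv ℝ f) x (chart j τ (1, 0)) (chart j τ (0, 1)) *
      fderiv ℝ (fderiv ℝ f) x (chart j τ (0, 1)) (chart j τ (1, 0)) := by
  rw [hess, Matrix.det_fin_two]
  simp only [Matrix.of_apply, iteratedFDeriv_two_apply, chart_fst, chart_snd, map_smul,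
    FunLike.coe_smul, Pi.smul_apply, smul_eq_mul, Matrix.cons_val_zero, Matrix.cons_val_one]
  fin_cases j
  · simp only [Fin.zero_eta, sub_zero]
    linear_combination (-(fderiv ℝ (fderiv ℝ f) x (EuclideanSpace.single 0 1) (EuclideanSpace.single 0 1) *
      fderiv ℝ (fderiv ℝ f) x (EuclideanSpace.single 1 1) (EuclideanSpace.single 1 1) -
      fderiv ℝ (fderiv ℝ f) x (EuclideanSpace.single 0 1) (EuclideanSpace.single 1 1) *
      fderiv ℝ (fderiv ℝ f) x (EuclideanSpace.single 1 1) (EuclideanSpace.single 0 1))) * hτ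
  · simp only [Fin.mk_one, sub_self]
    linear_combination (-(fderiv ℝ (fderiv ℝ f) x (EuclideanSpace.single 0 1) (EuclideanSpace.single 0 1) *
      fderiv ℝ (fderiv ℝ f) x (EuclideanSpace.single 1 1) (EuclideanSpace.single 1 1) -
      fderiv ℝ (fderiv ℝ f) x (EuclideanSpace.single 0 1) (EuclideanSpace.single 1 1) *
      fderiv ℝ (fderiv ℝ f) x (EuclideanSpace.single 1 1) (EuclideanSpace.single 0 1))) * hτ

end Deriv

/-! ### Profiles, and the Hessian expressed through them. -/

section Profile

variable {κ : Fin 2 → ℝ} {j : Fin 2} {τ : ℝ} {f : Plane → ℝ}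

/-- The restriction of a function to the line `x = 1` of a chart. -/
def profile (f : Plane → ℝ) (j : Fin 2) (τ : ℝ) (u : ℝ) : ℝ := f (chart j τ (1, u))

theorem contDiff_profile (hτ : τ ≠ 0) (hf : ContDiffOn ℝ ∞ f {0}ᶜ) :
    ContDiff ℝ ∞ (profile f j τ) := by
  have h1 : ContDiff ℝ ∞ fun u : ℝ => chart j τ (1, u) :=
    (chart j τ).contDiff.comp (contDiff_const.prodMk contDiff_id)
  exact contDiffOn_univ.1 (hf.comp h1.contDiffOn fun u _ => chart_ne_zero hτ one_ne_zero)

theorem fderiv_profile (hκ : ∀ j, 0 < κ j) (hτ : τ ≠ 0) (hf : ContDiffOn ℝ ∞ f {0}ᶜ)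
    (hfκ : IsHomog κ 1 f) {x : ℝ} (hx : 0 < x) (y : ℝ) :
    fderiv ℝ f (chart j τ (x, y)) (chart j τ (0, 1)) =
      x ^ (1 / κ j - κ (1 - j) / κ j) * deriv (profile f j τ) (y * x ^ (-(κ (1 - j) / κ j))) ∧
    fderiv ℝ f (chart j τ (x, y)) (chart j τ (1, 0)) = x ^ (1 / κ j - 1) *
      (1 / κ j * profile f j τ (y * x ^ (-(κ (1 - j) / κ j))) -
        κ (1 - j) / κ j * (y * x ^ (-(κ (1 - j) / κ j))) *
          deriv (profile f j τ) (y * x ^ (-(κ (1 - j) / κ j)))) := by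
  refine fderiv_of_chart (contDiff_profile hτ hf) (fun x y hx => ?_) hx ?_
  · have := hfκ.chart (j := j) hκ hτ hx (y := y)
    rw [mul_one] at this
    exact this
  · exact (hf.contDiffAt (isOpen_compl_singleton.mem_nhds (chart_ne_zero hτ hx.ne'))).differentiableAt
      (by simp)

/-- Each first derivative of `f` in the chart is again a power of `x` times a function of `u`,
namely `g'` or `p g - θ u g'`. Applying the same differentiation rule to these two functions gives
all second derivatives, and the terms with `(θ u g'')²` cancel in the determinant. -/
theorem hess_profile (hκ : ∀ j, 0 < κ j) (hτ : τ * τ = 1) (hf : ContDiffOn ℝ ∞ f {0}ᶜ)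
    (hfκ : IsHomog κ 1 f) {x : ℝ} (hx : 0 < x) (y : ℝ) :
    hess f (chart j τ (x, y)) = x ^ (2 * (1 / κ j) - 2 * (κ (1 - j) / κ j) - 2) *
      hessFactor (1 / κ j) (κ (1 - j) / κ j) (profile f j τ) (y * x ^ (-(κ (1 - j) / κ j))) := by
  have hτ0 : τ ≠ 0 := fun h => by simp [h] at hτ
  have hg := contDiff_profile (j := j) hτ0 hf
  have hg1 := contDiff_deriv_infty hg
  have hfd := fun (x y : ℝ) (hx : 0 < x) => fderiv_profile (j := j) hκ hτ0 hf hfκ hx y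
  set p := 1 / κ j
  set θ := κ (1 - j) / κ j
  set g := profile f j τ
  have hK : ContDiff ℝ ∞ fun u => p * g u - θ * u * deriv g u := by fun_prop
  have hne : chart j τ (x, y) ≠ 0 := chart_ne_zero hτ0 hx.ne'
  have hat : ContDiffAt ℝ ∞ f (chart j τ (x, y)) := hf.contDiffAt (isOpen_compl_singleton.mem_nhds hne)
  have hD : DifferentiableAt ℝ (fderiv ℝ f) (chart j τ (x, y)) :=
    (hat.fderiv_right (m := ∞) (by simp)).differentiableAt (by simp)
  have hDv : ∀ v, DifferentiableAt ℝ (fun z => fderiv ℝ f z v) (chart j τ (x, y)) := fun v =>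
    hD.clm_apply (differentiableAt_const v)
  have hsec : ∀ v w, fderiv ℝ (fderiv ℝ f) (chart j τ (x, y)) w v =
      fderiv ℝ (fun z => fderiv ℝ f z v) (chart j τ (x, y)) w := fun v w => by
    rw [fderiv_clm_apply hD (differentiableAt_const v)]
    simp
  have hy := fderiv_of_chart hg1 (fun x y hx => (hfd x y hx).1) hx (hDv _)
  have hx' := fderiv_of_chart hK (fun x y hx => (hfd x y hx).2) hx (hDv _)
  have hK' : ∀ u, deriv (fun u => p * g u - θ * u * deriv g u) u =
      (p - θ) * deriv g u - θ * u * deriv (deriv g) u := fun u => by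
    have := ((hasDerivAt_of_infty hg u).const_mul p).sub
      (((hasDerivAt_id u).const_mul θ).mul (hasDerivAt_of_infty hg1 u))
    refine HasDerivAt.deriv (this.congr_deriv ?_)
    simp only [id]; ring
  rw [hess_eq_chart hτ, hsec, hsec, hsec, hsec, hx'.1, hx'.2, hy.1, hy.2]
  simp only [hK', hessFactor]
  have e1 : x ^ (p - 1 - 1) * x ^ (p - θ - θ) = x ^ (2 * p - 2 * θ - 2) := by
    rw [← Real.rpow_add hx]; congr 1; ring
  have e2 : x ^ (p - θ - 1) * x ^ (p - 1 - θ) = x ^ (2 * p - 2 * θ - 2) := by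
    rw [← Real.rpow_add hx]; congr 1; ring
  set u := y * x ^ (-θ)
  calc _ = (x ^ (p - 1 - 1) * x ^ (p - θ - θ)) * ((p - 1) * (p * g u - θ * u * deriv g u) -
        θ * u * ((p - θ) * deriv g u - θ * u * deriv (deriv g) u)) * deriv (deriv g) u -
      (x ^ (p - θ - 1) * x ^ (p - 1 - θ)) * ((p - θ) * deriv g u - θ * u * deriv (deriv g) u) ^ 2 := by
        ring
    _ = _ := by rw [e1, e2]; ring

end Profile

/-! ### Transfer of the local estimates to the plane -/

/-- The local estimate on some rectangle about `(x₀, u₀)` in homogeneous coordinates. -/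
def RectBound (p θ : ℝ) (g w : ℝ → ℝ) (x₀ u₀ : ℝ) : Prop :=
  ∃ δ : ℝ, 0 < δ ∧ δ < x₀ ∧ ContinuousOn w (Set.Icc (u₀ - δ) (u₀ + δ)) ∧
    ∃ C : ℝ, 0 < C ∧ ∃ ε : ℝ, 0 < ε ∧ ∀ (M : ℝ) (A Ax Au : ℝ × ℝ → ℂ),
      AmplitudeOn (x₀ - δ) (x₀ + δ) (u₀ - δ) (u₀ + δ) M A Ax Au → ∀ t : ℝ, 1 ≤ |t| → ∀ σ,
      ‖∫ z in Set.Icc (x₀ - δ) (x₀ + δ) ×ˢ Set.Icc (u₀ - δ) (u₀ + δ), A z * (w z.2 : ℂ) *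
        cis (t * homPhase p θ g σ z)‖ ≤ C * M * |t| ^ (-(1 / 2 + ε))

/-- The local estimate for amplitudes supported near a point of the plane. -/
def LocalBound (f W : Plane → ℝ) (y : Plane) : Prop :=
  ∃ U ∈ 𝓝 y, ∃ C : ℝ, 0 < C ∧ ∃ ε : ℝ, 0 < ε ∧ ∀ b : Plane → ℂ, ContDiff ℝ 1 b →
    tsupport b ⊆ U → ∀ M : ℝ, (∀ x, ‖b x‖ ≤ M) → (∀ x, ‖fderiv ℝ b x‖ ≤ M) →
    ∀ (t : ℝ) (s : Plane), ‖∫ x, b x * (W x : ℂ) * cis (t * (f x + inner ℝ x s))‖ ≤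
      C * M * (1 + |t|) ^ (-(1 / 2 + ε))

/-- For `|t| ≤ 1` the trivial bound suffices. For `|t| ≥ 1` one has `1 + |t| ≤ 2 |t|`, which
explains the factor `2 ^ (1/2 + ε)`. -/
theorem le_one_add_rpow {I C C' M ε t : ℝ} (hM : 0 ≤ M) (hC : 0 ≤ C) (hC' : 0 ≤ C') (hε : 0 < ε)
    (h1 : 1 ≤ |t| → I ≤ C * M * |t| ^ (-(1 / 2 + ε))) (h2 : I ≤ C' * M) :
    I ≤ 2 ^ (1 / 2 + ε) * (C + C') * M * (1 + |t|) ^ (-(1 / 2 + ε)) := by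
  have hp : (0 : ℝ) < 1 + |t| := by positivity
  rcases le_total 1 |t| with ht | ht
  · have e : |t| ^ (-(1 / 2 + ε)) ≤ 2 ^ (1 / 2 + ε) * (1 + |t|) ^ (-(1 / 2 + ε)) := by
      have ht0 : 0 < |t| := by linarith
      rw [Real.rpow_neg ht0.le, Real.rpow_neg hp.le, ← div_eq_mul_inv, ← Real.div_rpow (by norm_num) hp.le,
        ← Real.inv_rpow ht0.le]
      refine Real.rpow_le_rpow (by positivity) ?_ (by positivity)
      rw [inv_le_comm₀ ht0 (by positivity), inv_div]
      linarith
    calc I ≤ C * M * |t| ^ (-(1 / 2 + ε)) := h1 ht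
      _ ≤ C * M * (2 ^ (1 / 2 + ε) * (1 + |t|) ^ (-(1 / 2 + ε))) := by gcongr
      _ = 2 ^ (1 / 2 + ε) * C * M * (1 + |t|) ^ (-(1 / 2 + ε)) := by ring
      _ ≤ _ := by gcongr; linarith
  · have e : 1 ≤ 2 ^ (1 / 2 + ε) * (1 + |t|) ^ (-(1 / 2 + ε)) := by
      rw [Real.rpow_neg hp.le, ← div_eq_mul_inv, ← Real.div_rpow (by norm_num) hp.le]
      refine Real.one_le_rpow ?_ (by positivity)
      rw [one_le_div hp]; linarith
    calc I ≤ C' * M * 1 := by linarith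
      _ ≤ C' * M * (2 ^ (1 / 2 + ε) * (1 + |t|) ^ (-(1 / 2 + ε))) := by gcongr
      _ = 2 ^ (1 / 2 + ε) * C' * M * (1 + |t|) ^ (-(1 / 2 + ε)) := by ring
      _ ≤ _ := by gcongr; linarith

/-- The change of variables `(x, u) ↦ (x, x ^ θ u)`. -/
theorem integral_homogeneous_coordinates {θ x₁ x₂ u₁ u₂ : ℝ} (hx₁ : 0 < x₁) {F : ℝ × ℝ → ℂ}
    (hF : ∀ z : ℝ × ℝ, F z ≠ 0 → z.1 ∈ Set.Icc x₁ x₂ ∧ z.2 * z.1 ^ (-θ) ∈ Set.Icc u₁ u₂) :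
    ∫ z, F z = ∫ z in Set.Icc x₁ x₂ ×ˢ Set.Icc u₁ u₂,
      ((z.1 ^ θ : ℝ) : ℂ) * F (z.1, z.1 ^ θ * z.2) := by
  set Q := Set.Icc x₁ x₂ ×ˢ Set.Icc u₁ u₂ with hQ
  set S : ℝ × ℝ → ℝ × ℝ := fun z => (z.1, z.1 ^ θ * z.2) with hS
  set S' : ℝ × ℝ → (ℝ × ℝ →L[ℝ] ℝ × ℝ) := fun z => LinearMap.toContinuousLinearMap
    (Matrix.toLin (Module.Basis.finTwoProd ℝ) (Module.Basis.finTwoProd ℝ)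
      !![1, 0; θ * z.1 ^ (θ - 1) * z.2, z.1 ^ θ]) with hS'
  have hQ0 : ∀ z ∈ Q, 0 < z.1 := fun z hz => hx₁.trans_le hz.1.1
  have hder : ∀ z ∈ Q, HasFDerivWithinAt S (S' z) Q z := by
    intro z hz
    refine HasFDerivAt.hasFDerivWithinAt ?_
    simp only [hS']
    rw [Matrix.toLin_finTwoProd_toContinuousLinearMap]
    have h1 : HasFDerivAt (fun z : ℝ × ℝ => z.1 ^ θ)
        ((θ * z.1 ^ (θ - 1)) • ContinuousLinearMap.fst ℝ ℝ ℝ) z :=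
      (Real.hasDerivAt_rpow_const (Or.inl (hQ0 z hz).ne')).comp_hasFDerivAt z hasFDerivAt_fst
    have h2 := HasFDerivAt.prodMk (hasFDerivAt_fst (𝕜 := ℝ) (p := z))
      (h1.mul (hasFDerivAt_snd (𝕜 := ℝ) (p := z)))
    refine h2.congr_fderiv ?_
    ext <;> simp
    ring
  have hdet : ∀ z ∈ Q, |(S' z).det| = z.1 ^ θ := by
    intro z hz
    simp only [hS']
    rw [LinearMap.det_toContinuousLinearMap, LinearMap.det_toLin, Matrix.det_fin_two_of]
    simp [abs_of_pos (Real.rpow_pos_of_pos (hQ0 z hz) θ)]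
  have hinj : Set.InjOn S Q := by
    intro z hz w hw h
    simp only [hS, Prod.mk.injEq] at h
    have hpos := (Real.rpow_pos_of_pos (hQ0 z hz) θ).ne'
    obtain ⟨h1, h2⟩ := h
    rw [← h1] at h2
    exact Prod.ext h1 (mul_left_cancel₀ hpos h2)
  have key := integral_image_eq_integral_abs_det_fderiv_smul volume
    (measurableSet_Icc.prod measurableSet_Icc) hder hinj F
  rw [setIntegral_eq_integral_of_forall_compl_eq_zero] at key
  · rw [key]
    refine setIntegral_congr_fun (measurableSet_Icc.prod measurableSet_Icc) fun z hz => ?_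
    simp only [hdet z hz, hS, Complex.real_smul]
  · intro z hz
    by_contra hne
    obtain ⟨h1, h2⟩ := hF z hne
    have h0 : 0 < z.1 := hx₁.trans_le h1.1
    refine hz ⟨(z.1, z.2 * z.1 ^ (-θ)), ⟨h1, h2⟩, Prod.ext rfl ?_⟩
    simp only [hS]
    rw [mul_left_comm, ← Real.rpow_add h0]; simp

/-- The amplitude in homogeneous coordinates. -/
theorem exists_amplitudeOn (j : Fin 2) (τ θ e : ℝ) {x₁ x₂ : ℝ} (u₁ u₂ : ℝ) (hx₁ : 0 < x₁)
    (hx : x₁ ≤ x₂) (hu : u₁ ≤ u₂) : ∃ K : ℝ, 0 < K ∧ ∀ b : Plane → ℂ, ContDiff ℝ 1 b →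
      (∀ x u, 0 < x → b (chart j τ (x, x ^ θ * u)) ≠ 0 → x ∈ Set.Ioo x₁ x₂ ∧ u ∈ Set.Ioo u₁ u₂) →
      ∀ M : ℝ, (∀ x, ‖b x‖ ≤ M) → (∀ x, ‖fderiv ℝ b x‖ ≤ M) → ∃ Ax Au : ℝ × ℝ → ℂ,
      AmplitudeOn x₁ x₂ u₁ u₂ (K * M)
        (fun z => ((z.1 ^ e : ℝ) : ℂ) * b (chart j τ (z.1, z.1 ^ θ * z.2))) Ax Au := by
  set Q := Set.Icc x₁ x₂ ×ˢ Set.Icc u₁ u₂ with hQ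
  have hQc : IsCompact Q := isCompact_Icc.prod isCompact_Icc
  have hQ0 : ∀ z ∈ Q, 0 < z.1 := fun z hz => hx₁.trans_le hz.1.1
  have crp : ∀ s : ℝ, ContinuousOn (fun z : ℝ × ℝ => z.1 ^ s) Q := fun s =>
    continuousOn_rpow_fst hQ0 s
  have c1 : ContinuousOn (fun z : ℝ × ℝ => |z.1 ^ e| + |e * z.1 ^ (e - 1)|) Q :=
    (crp e).abs.add (continuousOn_const.mul (crp (e - 1))).abs
  have cv : ContinuousOn (fun z : ℝ × ℝ => chart j τ (1, θ * z.1 ^ (θ - 1) * z.2)) Q :=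
    (chart j τ).continuous.comp_continuousOn (continuousOn_const.prodMk
      ((continuousOn_const.mul (crp _)).mul continuousOn_snd))
  have cw : ContinuousOn (fun z : ℝ × ℝ => chart j τ (0, z.1 ^ θ)) Q :=
    (chart j τ).continuous.comp_continuousOn (continuousOn_const.prodMk (crp _))
  have cS : ContinuousOn (fun z : ℝ × ℝ => chart j τ (z.1, z.1 ^ θ * z.2)) Q :=
    (chart j τ).continuous.comp_continuousOn (continuousOn_fst.prodMk ((crp _).mul continuousOn_snd))
  obtain ⟨K₁, hK₁⟩ := hQc.exists_bound_of_continuousOn c1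
  obtain ⟨K₂, hK₂⟩ := hQc.exists_bound_of_continuousOn (cv.norm.add cw.norm)
  have hmem : (x₁, u₁) ∈ Q := ⟨⟨le_rfl, hx⟩, ⟨le_rfl, hu⟩⟩
  have hK₁0 : 0 ≤ K₁ := (norm_nonneg _).trans (hK₁ _ hmem)
  have hK₂0 : 0 ≤ K₂ := (norm_nonneg _).trans (hK₂ _ hmem)
  refine ⟨K₁ * (1 + K₂) + 1, by positivity, fun b hb hsupp M hM₀ hM₁ => ?_⟩
  have hM : 0 ≤ M := (norm_nonneg _).trans (hM₀ 0)
  have b1 : ∀ z ∈ Q, |z.1 ^ e| ≤ K₁ ∧ |e * z.1 ^ (e - 1)| ≤ K₁ := fun z hz => by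
    have := hK₁ z hz
    rw [Real.norm_eq_abs, abs_of_nonneg (by positivity)] at this
    exact ⟨by linarith [abs_nonneg (e * z.1 ^ (e - 1))], by linarith [abs_nonneg (z.1 ^ e)]⟩
  have b2 : ∀ z ∈ Q, ‖chart j τ (1, θ * z.1 ^ (θ - 1) * z.2)‖ ≤ K₂ ∧ ‖chart j τ (0, z.1 ^ θ)‖ ≤ K₂ :=
    fun z hz => by
      have : ‖chart j τ (1, θ * z.1 ^ (θ - 1) * z.2)‖ + ‖chart j τ (0, z.1 ^ θ)‖ ≤ K₂ :=
        (le_abs_self _).trans (hK₂ z hz)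
      exact ⟨by linarith [norm_nonneg (chart j τ (0, z.1 ^ θ))],
        by linarith [norm_nonneg (chart j τ (1, θ * z.1 ^ (θ - 1) * z.2))]⟩
  have hbd : ∀ v, HasFDerivAt b (fderiv ℝ b v) v := fun v =>
    (hb.differentiable one_ne_zero v).hasFDerivAt
  have cDb : Continuous (fderiv ℝ b) := hb.continuous_fderiv one_ne_zero
  have cDbS : ContinuousOn (fun z : ℝ × ℝ => fderiv ℝ b (chart j τ (z.1, z.1 ^ θ * z.2))) Q :=
    cDb.comp_continuousOn cS
  have cbS : ContinuousOn (fun z : ℝ × ℝ => b (chart j τ (z.1, z.1 ^ θ * z.2))) Q :=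
    hb.continuous.comp_continuousOn cS
  have cof : ∀ {h : ℝ × ℝ → ℝ}, ContinuousOn h Q → ContinuousOn (fun z => ((h z : ℝ) : ℂ)) Q :=
    fun h => Complex.continuous_ofReal.comp_continuousOn h
  have hzero : ∀ z ∈ Q, ¬ (z.1 ∈ Set.Ioo x₁ x₂ ∧ z.2 ∈ Set.Ioo u₁ u₂) →
      ((z.1 ^ e : ℝ) : ℂ) * b (chart j τ (z.1, z.1 ^ θ * z.2)) = 0 := fun z hz hcon => by
    by_contra hne
    exact hcon (hsupp z.1 z.2 (hQ0 z hz) (right_ne_zero_of_mul hne))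
  refine ⟨fun z => ((e * z.1 ^ (e - 1) : ℝ) : ℂ) * b (chart j τ (z.1, z.1 ^ θ * z.2)) +
      ((z.1 ^ e : ℝ) : ℂ) * fderiv ℝ b (chart j τ (z.1, z.1 ^ θ * z.2))
        (chart j τ (1, θ * z.1 ^ (θ - 1) * z.2)),
    fun z => ((z.1 ^ e : ℝ) : ℂ) * fderiv ℝ b (chart j τ (z.1, z.1 ^ θ * z.2))
        (chart j τ (0, z.1 ^ θ)), ?_⟩
  refine ⟨?_, ?_, ?_, ?_, ?_, ?_, ?_, ?_, ?_, ?_, ?_, ?_⟩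
  · intro x hxm u hum
    have hx0 : 0 < x := hx₁.trans_le hxm.1
    have d1 : HasDerivAt (fun x : ℝ => ((x ^ e : ℝ) : ℂ)) ((e * x ^ (e - 1) : ℝ) : ℂ) x :=
      (Real.hasDerivAt_rpow_const (Or.inl hx0.ne')).ofReal_comp
    have d2 : HasDerivAt (fun x => chart j τ (x, x ^ θ * u)) (chart j τ (1, θ * x ^ (θ - 1) * u)) x :=
      ((chart j τ).hasFDerivAt (x := (x, x ^ θ * u))).comp_hasDerivAt x
        ((hasDerivAt_id x).prodMk ((Real.hasDerivAt_rpow_const (Or.inl hx0.ne')).mul_const u))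
    exact d1.mul ((hbd _).comp_hasDerivAt x d2)
  · intro x hxm u hum
    have d2 : HasDerivAt (fun u => chart j τ (x, x ^ θ * u)) (chart j τ (0, x ^ θ)) u :=
      ((chart j τ).hasFDerivAt (x := (x, x ^ θ * u))).comp_hasDerivAt u
        ((hasDerivAt_const u x).prodMk (by simpa using (hasDerivAt_id u).const_mul (x ^ θ)))
    exact ((hbd _).comp_hasDerivAt u d2).const_mul ((x ^ e : ℝ) : ℂ)
  · exact (cof (crp e)).mul cbS
  · exact ((cof (continuousOn_const.mul (crp _))).mul cbS).add ((cof (crp e)).mul (cDbS.clm_apply cv))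
  · exact (cof (crp e)).mul (cDbS.clm_apply cw)
  · intro z hz
    rw [norm_mul, Complex.norm_real, Real.norm_eq_abs]
    calc _ ≤ K₁ * M := mul_le_mul (b1 z hz).1 (hM₀ _) (norm_nonneg _) hK₁0
      _ ≤ _ := by nlinarith [mul_nonneg (mul_nonneg hK₁0 hK₂0) hM]
  · intro z hz
    refine (norm_add_le _ _).trans ?_
    rw [norm_mul, norm_mul, Complex.norm_real, Complex.norm_real, Real.norm_eq_abs, Real.norm_eq_abs]
    calc _ ≤ K₁ * M + K₁ * (M * K₂) := add_le_add
          (mul_le_mul (b1 z hz).2 (hM₀ _) (norm_nonneg _) hK₁0)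
          (mul_le_mul (b1 z hz).1 (((fderiv ℝ b _).le_opNorm _).trans
            (mul_le_mul (hM₁ _) (b2 z hz).1 (norm_nonneg _) hM)) (norm_nonneg _) hK₁0)
      _ ≤ _ := by nlinarith
  · intro z hz
    rw [norm_mul, Complex.norm_real, Real.norm_eq_abs]
    calc _ ≤ K₁ * (M * K₂) :=
          (mul_le_mul (b1 z hz).1 (((fderiv ℝ b _).le_opNorm _).trans
            (mul_le_mul (hM₁ _) (b2 z hz).2 (norm_nonneg _) hM)) (norm_nonneg _) hK₁0)
      _ ≤ _ := by nlinarith [mul_nonneg hK₁0 hM]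
  · exact fun u hum => hzero (x₁, u) ⟨⟨le_rfl, hx⟩, hum⟩ fun h => lt_irrefl _ h.1.1
  · exact fun u hum => hzero (x₂, u) ⟨⟨hx, le_rfl⟩, hum⟩ fun h => lt_irrefl _ h.1.2
  · exact fun x hxm => hzero (x, u₁) ⟨hxm, ⟨le_rfl, hu⟩⟩ fun h => lt_irrefl _ h.2.1
  · exact fun x hxm => hzero (x, u₂) ⟨hxm, ⟨hu, le_rfl⟩⟩ fun h => lt_irrefl _ h.2.2

/-- The estimate in homogeneous coordinates implies the one in the plane. -/
theorem localBound_of_rectBound {κ : Fin 2 → ℝ} (hκ : ∀ j, 0 < κ j) {j : Fin 2} {τ : ℝ}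
    (hτ : τ = 1 ∨ τ = -1) {f W : Plane → ℝ} (hf : IsHomog κ 1 f) {d : ℝ} (hW : IsHomog κ d W)
    {x₀ u₀ : ℝ} (hx₀ : 0 < x₀)
    (h : RectBound (1 / κ j) (κ (1 - j) / κ j) (profile f j τ) (profile W j τ) x₀ u₀) :
    LocalBound f W (chart j τ (x₀, x₀ ^ (κ (1 - j) / κ j) * u₀)) := by
  obtain ⟨δ, hδ, hδx, hw, C, hC, ε, hε, hbd⟩ := h
  have hτ1 : τ * τ = 1 := by rcases hτ with rfl | rfl <;> norm_num
  have hτ0 : τ ≠ 0 := fun h => by simp [h] at hτ1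
  set θ := κ (1 - j) / κ j with hθ
  set p := 1 / κ j with hp
  have hx₁ : 0 < x₀ - δ := by linarith
  have hx : x₀ - δ ≤ x₀ + δ := by linarith
  have hu : u₀ - δ ≤ u₀ + δ := by linarith
  -- The exponent `θ + p d` combines the Jacobian `x ^ θ` with the power `x ^ (p d)` split off from
  -- the weight. What remains of the weight depends on `u` alone.
  obtain ⟨K, hK, hamp⟩ := exists_amplitudeOn j τ θ (θ + p * d) (u₀ - δ) (u₀ + δ) hx₁ hx hu
  set Q := Set.Icc (x₀ - δ) (x₀ + δ) ×ˢ Set.Icc (u₀ - δ) (u₀ + δ) with hQ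
  obtain ⟨Bw, hBw⟩ := isCompact_Icc.exists_bound_of_continuousOn hw
  have hBw0 : 0 ≤ Bw := (norm_nonneg _).trans (hBw u₀ (by simp [hδ.le]))
  have hQv : volume Q < ⊤ := (isCompact_Icc.prod isCompact_Icc).measure_lt_top
  refine ⟨{v | τ * v j ∈ Set.Ioo (x₀ - δ) (x₀ + δ) ∧
    v (1 - j) * (τ * v j) ^ (-θ) ∈ Set.Ioo (u₀ - δ) (u₀ + δ)}, ?_,
    2 ^ (1 / 2 + ε) * (C * K + K * Bw * volume.real Q) , by positivity, ε, hε, ?_⟩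
  · have e1 : τ * (chart j τ (x₀, x₀ ^ θ * u₀)) j = x₀ := by
      rw [chart_apply_self, ← mul_assoc, hτ1, one_mul]
    have c1 : Continuous fun v : Plane => τ * v j := by fun_prop
    have c2 : ContinuousAt (fun v : Plane => v (1 - j) * (τ * v j) ^ (-θ))
        (chart j τ (x₀, x₀ ^ θ * u₀)) := by
      refine ContinuousAt.mul (by fun_prop) ?_
      exact c1.continuousAt.rpow_const (Or.inl (by rw [e1]; exact hx₀.ne'))
    refine Filter.inter_mem (c1.continuousAt.preimage_mem_nhds (Ioo_mem_nhds ?_ ?_))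
      (c2.preimage_mem_nhds (Ioo_mem_nhds ?_ ?_))
    · rw [e1]; linarith
    · rw [e1]; linarith
    all_goals
      rw [e1, chart_apply_other, Real.rpow_neg hx₀.le, mul_comm, ← mul_assoc,
        inv_mul_cancel₀ (Real.rpow_pos_of_pos hx₀ _).ne']
      linarith
  · intro b hb hbU M hM₀ hM₁ t s
    have hM : 0 ≤ M := (norm_nonneg _).trans (hM₀ 0)
    have hsupp : ∀ z : ℝ × ℝ, b (chart j τ z) ≠ 0 → z.1 ∈ Set.Ioo (x₀ - δ) (x₀ + δ) ∧
        z.2 * z.1 ^ (-θ) ∈ Set.Ioo (u₀ - δ) (u₀ + δ) := fun z hz => by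
      have := hbU (subset_tsupport _ hz)
      simp only [Set.mem_ofPred_eq, chart_apply_self, chart_apply_other] at this
      rwa [← mul_assoc, hτ1, one_mul] at this
    have hcancel : ∀ x u : ℝ, 0 < x → x ^ θ * u * x ^ (-θ) = u := fun x u hx => by
      rw [mul_right_comm, ← Real.rpow_add hx]; simp
    obtain ⟨Ax, Au, hA⟩ := hamp b hb (fun x u hx hne => by
      have := hsupp _ hne
      rwa [hcancel x u hx] at this) M hM₀ hM₁
    have h_int : ∫ x, b x * (W x : ℂ) * cis (t * (f x + inner ℝ x s)) =
        ∫ z in Q, ((z.1 ^ (θ + p * d) : ℝ) : ℂ) * b (chart j τ (z.1, z.1 ^ θ * z.2)) *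
          (profile W j τ z.2 : ℂ) * cis (t * homPhase p θ (profile f j τ) (τ * s j, s (1 - j)) z) := by
      rw [← (measurePreserving_chart (j := j) hτ).integral_comp (measurableEmbedding_chart hτ0)]
      rw [integral_homogeneous_coordinates (θ := θ) (x₂ := x₀ + δ) (u₁ := u₀ - δ) (u₂ := u₀ + δ) hx₁]
      · refine setIntegral_congr_fun (measurableSet_Icc.prod measurableSet_Icc) fun z hz => ?_
        have hz0 : 0 < z.1 := hx₁.trans_le hz.1.1
        simp only
        rw [hW.chart hκ hτ0 hz0, hf.chart hκ hτ0 hz0, ← hθ, ← hp, hcancel _ _ hz0, inner_chart,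
          Real.rpow_add hz0, mul_one]
        simp only [homPhase, profile]
        push_cast
        have : τ * s j * z.1 + s (1 - j) * (z.1 ^ θ * z.2) = τ * s j * z.1 + s (1 - j) * z.1 ^ θ * z.2 := by
          ring
        rw [this, add_assoc]
        ring
      · intro z hz
        obtain ⟨h1, h2⟩ := hsupp z (left_ne_zero_of_mul (left_ne_zero_of_mul hz))
        exact ⟨Set.Ioo_subset_Icc_self h1, Set.Ioo_subset_Icc_self h2⟩
    rw [h_int]
    refine le_one_add_rpow hM (by positivity) (by positivity) hε (fun ht => ?_) ?_
    · exact (hbd (K * M) _ Ax Au hA t ht (τ * s j, s (1 - j))).trans (le_of_eq (by ring))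
    · refine (norm_setIntegral_le_of_norm_le_const (C := K * M * Bw) hQv fun z hz => ?_).trans
        (le_of_eq (by ring))
      rw [norm_mul, norm_cis, mul_one, norm_mul, Complex.norm_real]
      exact mul_le_mul (hA.b z hz) (hBw z.2 hz.2) (norm_nonneg _) (by positivity)

/-! ### The estimate in homogeneous coordinates -/

theorem eventually_abs_sub_le {u₀ : ℝ} {P : ℝ → Prop} (h : ∀ᶠ u in 𝓝 u₀, P u) :
    ∃ r : ℝ, 0 < r ∧ ∀ u, |u - u₀| ≤ r → P u := by
  obtain ⟨r, hr, hr'⟩ := Metric.nhds_basis_closedBall.mem_iff.1 h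
  exact ⟨r, hr, fun u hu => hr' (by rwa [Metric.mem_closedBall, Real.dist_eq])⟩

/-- A weight that is smooth near `u₀` is absorbed into the amplitude. -/
theorem rectBound_of_nondegenerate {g w : ℝ → ℝ} (hg : ContDiff ℝ ∞ g) (p θ : ℝ)
    {x₀ u₀ : ℝ} (hx₀ : 0 < x₀) {c : ℝ} {m : ℕ} (hc : 0 < c)
    (hH : ∀ᶠ u in 𝓝 u₀, c * |u - u₀| ^ m ≤ |hessFactor p θ g u|)
    (hN : hessFactor p θ g u₀ ≠ 0 ∨ hessCoeff p θ g u₀ ≠ 0) (hw : ContDiffAt ℝ ∞ w u₀) :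
    RectBound p θ g w x₀ u₀ := by
  obtain ⟨r, hr, hH'⟩ := eventually_abs_sub_le hH
  obtain ⟨δ₀, hδ₀, hbd⟩ := exists_bound_nondegenerate hg p θ hx₀ hr hc hH' hN
  obtain ⟨r₁, hr₁, hw'⟩ := eventually_abs_sub_le
    ((hw.of_le (by exact_mod_cast le_top) : ContDiffAt ℝ 1 w u₀).eventually (by simp))
  set δ := min (min δ₀ r₁) (x₀ / 2) with hδdef
  have hδ : 0 < δ := by positivity
  have hδ1 : δ ≤ δ₀ := (min_le_left _ _).trans (min_le_left _ _)
  have hδ2 : δ ≤ r₁ := (min_le_left _ _).trans (min_le_right _ _)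
  have hδ3 : δ ≤ x₀ / 2 := min_le_right _ _
  obtain ⟨C, hC, ε, hε, h⟩ := hbd δ hδ hδ1
  have hwd : ∀ u ∈ Set.Icc (u₀ - δ) (u₀ + δ), ContDiffAt ℝ 1 w u := fun u hu =>
    hw' u ((abs_sub_le_iff_mem_Icc.1 hu).trans hδ2)
  have hder : ∀ u ∈ Set.Icc (u₀ - δ) (u₀ + δ), HasDerivAt w (deriv w u) u := fun u hu =>
    ((hwd u hu).differentiableAt one_ne_zero).hasDerivAt
  have hderc : ContinuousOn (deriv w) (Set.Icc (u₀ - δ) (u₀ + δ)) := fun u hu => by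
    have : ContinuousAt (fun u => fderiv ℝ w u 1) u :=
      (((hwd u hu).fderiv_right (m := 0) (by simp)).continuousAt).clm_apply continuousAt_const
    exact this.continuousWithinAt
  have hwc : ContinuousOn w (Set.Icc (u₀ - δ) (u₀ + δ)) := fun u hu =>
    (hder u hu).continuousAt.continuousWithinAt
  obtain ⟨K₁, hK₁⟩ := isCompact_Icc.exists_bound_of_continuousOn hwc
  obtain ⟨K₂, hK₂⟩ := isCompact_Icc.exists_bound_of_continuousOn hderc
  have h0 : u₀ ∈ Set.Icc (u₀ - δ) (u₀ + δ) := by simp [hδ.le]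
  have hK₁0 : 0 ≤ K₁ := (norm_nonneg _).trans (hK₁ u₀ h0)
  have hK₂0 : 0 ≤ K₂ := (norm_nonneg _).trans (hK₂ u₀ h0)
  refine ⟨δ, hδ, by linarith, hwc, C * (2 * (K₁ + K₂ + 1)), by positivity, ε, hε,
    fun M A Ax Au hA t ht σ => ?_⟩
  have hA' := hA.mul_snd (K := K₁ + K₂ + 1) hder hderc
    (fun u hu => (hK₁ u hu).trans (by linarith)) (fun u hu => (hK₂ u hu).trans (by linarith))
  exact (h _ _ _ _ hA' t ht σ).trans (le_of_eq (by ring))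

/-- The weight is kept apart from the amplitude: its derivative may be singular at `u₀`, and its
vanishing there is what compensates the degeneracy of `g''`. -/
theorem rectBound_of_critical {g w w' : ℝ → ℝ} (hg : ContDiff ℝ ∞ g) {p : ℝ} (hp : 0 < p) (θ : ℝ)
    {x₀ u₀ : ℝ} (hx₀ : 0 < x₀) {c d : ℝ} {m n : ℕ} (hc : 0 < c) (hd : 0 < d)
    (hH : ∀ᶠ u in 𝓝 u₀, c * |u - u₀| ^ m ≤ |hessFactor p θ g u|)
    (hg2 : ∀ᶠ u in 𝓝 u₀, d * |u - u₀| ^ n ≤ |deriv (deriv g) u|)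
    {K β : ℝ} (hw : Continuous w)
    (hw' : ∀ᶠ u in 𝓝 u₀, u ≠ u₀ → HasDerivAt w (w' u) u ∧ ContinuousAt w' u ∧
      |w' u| ≤ K * |u - u₀| ^ (β - 1))
    (hwb : ∀ᶠ u in 𝓝 u₀, |w u| ≤ K * |u - u₀| ^ β) (hβ : 0 < β - n / 2) :
    RectBound p θ g w x₀ u₀ := by
  obtain ⟨r, hr, hall⟩ := eventually_abs_sub_le (hH.and (hg2.and (hw'.and hwb)))
  set δ := min (min r 1) (x₀ / 2) with hδdef
  have hδ : 0 < δ := by positivity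
  have hδ1 : δ ≤ r := (min_le_left _ _).trans (min_le_left _ _)
  have hδ2 : δ ≤ 1 := (min_le_left _ _).trans (min_le_right _ _)
  have hδ3 : δ ≤ x₀ / 2 := min_le_right _ _
  refine ⟨δ, hδ, by linarith, hw.continuousOn, ?_⟩
  refine exists_bound_critical hg hp θ (by linarith) (by linarith) hδ hδ2 hc hd
    (fun u hu => (hall u (hu.trans hδ1)).1) (fun u hu => (hall u (hu.trans hδ1)).2.1)
    hw.continuousOn (fun u hu hne => ((hall u (hu.trans hδ1)).2.2.1 hne).1) (fun u hu => ?_)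
    (fun u hu => (hall u (hu.trans hδ1)).2.2.2)
    (fun u hu hne => ((hall u (hu.trans hδ1)).2.2.1 hne).2.2) hβ
  exact ((hall u ((abs_sub_le_iff_mem_Icc.1 hu.1).trans hδ1)).2.2.1 hu.2).2.1.continuousWithinAt

/-- A smooth function that is `O(|u - u₀| ^ m)` has vanishing derivatives of order less than `m`. -/
theorem iteratedDeriv_eq_zero_of_le {φ : ℝ → ℝ} (hφ : ContDiff ℝ ∞ φ) {u₀ C : ℝ} {m : ℕ}
    (h : ∀ᶠ u in 𝓝 u₀, |φ u| ≤ C * |u - u₀| ^ m) : ∀ k < m, iteratedDeriv k φ u₀ = 0 := by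
  by_contra hcon
  push Not at hcon
  obtain ⟨k, hkm, hk⟩ := hcon
  obtain ⟨l, hl, hl'⟩ := exists_order ⟨k, hk⟩
  have hlm : l < m := lt_of_le_of_lt (not_lt.1 fun hlt => hk (hl k hlt)) hkm
  obtain ⟨c, hc, hlow⟩ := exists_pow_le_abs hφ hl hl'
  have h1 : ∀ᶠ u in 𝓝 u₀, |C| * |u - u₀| < c :=
    (by fun_prop : Continuous fun u => |C| * |u - u₀|).continuousAt.eventually_lt_const
      (by simpa using hc)
  have h2 : ∀ᶠ u in 𝓝 u₀, |u - u₀| < 1 :=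
    (by fun_prop : Continuous fun u => |u - u₀|).continuousAt.eventually_lt_const (by simp)
  obtain ⟨u, ⟨a0, a1, a2, a3⟩, hne⟩ := (((h.and (hlow.and (h1.and h2))).filter_mono
    nhdsWithin_le_nhds).and (self_mem_nhdsWithin (a := u₀) (s := {u₀}ᶜ))).exists
  have hv : 0 < |u - u₀| := abs_pos.2 (sub_ne_zero.2 hne)
  have h3 : |u - u₀| ^ m ≤ |u - u₀| ^ (l + 1) := pow_le_pow_of_le_one hv.le a3.le hlm
  have h4 : c * |u - u₀| ^ l ≤ (|C| * |u - u₀|) * |u - u₀| ^ l :=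
    calc _ ≤ C * |u - u₀| ^ m := a1.trans a0
      _ ≤ |C| * |u - u₀| ^ (l + 1) := mul_le_mul (le_abs_self C) h3 (by positivity) (abs_nonneg C)
      _ = _ := by ring
  exact absurd (le_of_mul_le_mul_right h4 (by positivity)) (not_le.2 a2)

/-- Bounds cannot be differentiated in general. For a smooth function this one forces the
derivatives of order at most `m` to vanish at `u₀`, and Taylor's formula then applies to the
derivative. -/
theorem exists_abs_deriv_le_pow {φ : ℝ → ℝ} (hφ : ContDiff ℝ ∞ φ) {u₀ C : ℝ} {m : ℕ}
    (h : ∀ᶠ u in 𝓝 u₀, |φ u| ≤ C * |u - u₀| ^ (m + 1)) :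
    ∃ C' : ℝ, 0 < C' ∧ ∀ᶠ u in 𝓝 u₀, |deriv φ u| ≤ C' * |u - u₀| ^ m :=
  exists_abs_le_pow (contDiff_deriv_infty hφ) fun k hk => by
    rw [← iteratedDeriv_succ']
    exact iteratedDeriv_eq_zero_of_le hφ h (k + 1) (by omega)

/-- The bounds for a power of a function of finite order. -/
theorem exists_weight_bound {R q : ℝ → ℝ} (hR : ContDiff ℝ ∞ R) (hq : ContDiff ℝ ∞ q)
    {u₀ c C s : ℝ} {m : ℕ} (hc : 0 < c) (hs : 0 < s)
    (hlow : ∀ᶠ u in 𝓝 u₀, c * |u - u₀| ^ (m + 1) ≤ q u)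
    (hup : ∀ᶠ u in 𝓝 u₀, q u ≤ C * |u - u₀| ^ (m + 1)) :
    ∃ (K : ℝ) (w' : ℝ → ℝ), (∀ᶠ u in 𝓝 u₀, u ≠ u₀ → HasDerivAt (fun u => R u * q u ^ s) (w' u) u ∧
      ContinuousAt w' u ∧ |w' u| ≤ K * |u - u₀| ^ (((m + 1 : ℕ) : ℝ) * s - 1)) ∧
      ∀ᶠ u in 𝓝 u₀, |R u * q u ^ s| ≤ K * |u - u₀| ^ (((m + 1 : ℕ) : ℝ) * s) := by
  have hR' := contDiff_deriv_infty hR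
  have hq' := contDiff_deriv_infty hq
  have hC : 0 < C := by
    obtain ⟨u, ⟨a0, a1⟩, hne⟩ := (((hlow.and hup).filter_mono
      nhdsWithin_le_nhds).and (self_mem_nhdsWithin (a := u₀) (s := {u₀}ᶜ))).exists
    have hv : 0 < |u - u₀| := abs_pos.2 (sub_ne_zero.2 hne)
    have h5 := a0.trans a1
    exact hc.trans_le (le_of_mul_le_mul_right h5 (by positivity))
  have hqabs : ∀ᶠ u in 𝓝 u₀, |q u| ≤ C * |u - u₀| ^ (m + 1) := by
    filter_upwards [hlow, hup] with u h1 h2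
    rwa [abs_of_nonneg ((by positivity : 0 ≤ c * |u - u₀| ^ (m + 1)).trans h1)]
  obtain ⟨C', hC', hqd⟩ := exists_abs_deriv_le_pow hq hqabs
  set B := |R u₀| + 1 with hB
  set B' := |deriv R u₀| + 1 with hB'
  have h1 : ∀ᶠ u in 𝓝 u₀, |R u| ≤ B := hR.continuous.abs.continuousAt.eventually_le_const (by simp [hB])
  have h2 : ∀ᶠ u in 𝓝 u₀, |deriv R u| ≤ B' :=
    hR'.continuous.abs.continuousAt.eventually_le_const (by simp [hB'])
  have h3 : ∀ᶠ u in 𝓝 u₀, |u - u₀| < 1 :=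
    (by fun_prop : Continuous fun u => |u - u₀|).continuousAt.eventually_lt_const (by simp)
  have hpow : ∀ u, |u - u₀| ^ (((m + 1 : ℕ) : ℝ) * s) = (|u - u₀| ^ (m + 1)) ^ s := fun u => by
    rw [Real.rpow_mul (abs_nonneg _), Real.rpow_natCast]
  have hqs : ∀ᶠ u in 𝓝 u₀, q u ^ s ≤ C ^ s * |u - u₀| ^ (((m + 1 : ℕ) : ℝ) * s) := by
    filter_upwards [hlow, hup] with u a1 a2
    have hq0 : 0 ≤ q u := (by positivity : 0 ≤ c * |u - u₀| ^ (m + 1)).trans a1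
    rw [hpow, ← Real.mul_rpow hC.le (by positivity)]
    exact Real.rpow_le_rpow hq0 a2 hs.le
  -- The exponent `s - 1` may have either sign. The upper bound of `q` is used if it is nonnegative
  -- and the lower bound if it is nonpositive; the sum covers both cases.
  set D := c ^ (s - 1) + C ^ (s - 1) with hD
  have hqs' : ∀ᶠ u in 𝓝 u₀, u ≠ u₀ → q u ^ (s - 1) ≤ D * (|u - u₀| ^ (m + 1)) ^ (s - 1) := by
    filter_upwards [hlow, hup] with u a1 a2 hne
    have hv : 0 < |u - u₀| := abs_pos.2 (sub_ne_zero.2 hne)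
    have hv' : 0 < |u - u₀| ^ (m + 1) := by positivity
    have hcv : 0 < c * |u - u₀| ^ (m + 1) := by positivity
    rw [hD, add_mul, ← Real.mul_rpow hc.le hv'.le, ← Real.mul_rpow hC.le hv'.le]
    rcases le_total 0 (s - 1) with hs1 | hs1
    · have := Real.rpow_le_rpow (hcv.le.trans a1) a2 hs1
      have := Real.rpow_nonneg hcv.le (s - 1)
      linarith
    · have := Real.rpow_le_rpow_of_nonpos hcv a1 hs1
      have := Real.rpow_nonneg ((hcv.le.trans a1).trans a2) (s - 1)
      linarith
  have hD0 : 0 < D := by positivity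
  refine ⟨B * C ^ s + (B' * C ^ s + B * s * D * C'),
    fun u => deriv R u * q u ^ s + R u * (deriv q u * s * q u ^ (s - 1)), ?_, ?_⟩
  · filter_upwards [hlow, h1, h2, h3, hqs, hqs', hqd] with u a0 a1 a2 a3 a4 a5 a6 hne
    have hv : 0 < |u - u₀| := abs_pos.2 (sub_ne_zero.2 hne)
    have hcv : 0 < c * |u - u₀| ^ (m + 1) := by positivity
    have hq0 : 0 < q u := hcv.trans_le a0
    refine ⟨?_, ?_, ?_⟩
    · exact (hasDerivAt_of_infty hR u).mul
        ((hasDerivAt_of_infty hq u).rpow_const (Or.inl hq0.ne'))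
    · have e1 := hR'.continuous.continuousAt (x := u)
      have e2 := hR.continuous.continuousAt (x := u)
      have e3 := hq'.continuous.continuousAt (x := u)
      have e4 := hq.continuous.continuousAt (x := u)
      exact (e1.mul (e4.rpow_const (Or.inl hq0.ne'))).add
        (e2.mul ((e3.mul continuousAt_const).mul (e4.rpow_const (Or.inl hq0.ne'))))
    · set v := |u - u₀| with hvdef
      have e1 : v ^ (((m + 1 : ℕ) : ℝ) * s) = v * v ^ (((m + 1 : ℕ) : ℝ) * s - 1) := by
        conv_rhs => rw [← Real.rpow_one v, Real.rpow_one (v), ← Real.rpow_one_add' hv.le (by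
          have : (0 : ℝ) < ((m + 1 : ℕ) : ℝ) * s := by positivity
          linarith)]
        congr 1; ring
      have e2 : v ^ m * (v ^ (m + 1)) ^ (s - 1) = v ^ (((m + 1 : ℕ) : ℝ) * s - 1) := by
        rw [← Real.rpow_natCast v (m + 1), ← Real.rpow_mul hv.le, ← Real.rpow_natCast v m,
          ← Real.rpow_add hv]
        congr 1; push_cast; ring
      have hvp : 0 < v ^ (((m + 1 : ℕ) : ℝ) * s - 1) := Real.rpow_pos_of_pos hv _
      have f1 : |deriv R u * q u ^ s| ≤ B' * C ^ s * v ^ (((m + 1 : ℕ) : ℝ) * s - 1) := by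
        rw [abs_mul, abs_of_pos (Real.rpow_pos_of_pos hq0 s)]
        calc _ ≤ B' * (C ^ s * v ^ (((m + 1 : ℕ) : ℝ) * s)) := by gcongr
          _ = B' * C ^ s * (v * v ^ (((m + 1 : ℕ) : ℝ) * s - 1)) := by rw [e1]; ring
          _ ≤ B' * C ^ s * (1 * v ^ (((m + 1 : ℕ) : ℝ) * s - 1)) := by gcongr
          _ = _ := by ring
      have f2 : |R u * (deriv q u * s * q u ^ (s - 1))| ≤
          B * s * D * C' * v ^ (((m + 1 : ℕ) : ℝ) * s - 1) := by
        rw [abs_mul, abs_mul, abs_mul, abs_of_pos hs, abs_of_pos (Real.rpow_pos_of_pos hq0 _)]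
        calc _ ≤ B * (C' * v ^ m * s * (D * (v ^ (m + 1)) ^ (s - 1))) := by
              gcongr
              exact a5 hne
          _ = B * s * D * C' * (v ^ m * (v ^ (m + 1)) ^ (s - 1)) := by ring
          _ = _ := by rw [e2]
      calc _ ≤ _ := abs_add_le _ _
        _ ≤ 0 + (B' * C ^ s * v ^ (((m + 1 : ℕ) : ℝ) * s - 1) +
            B * s * D * C' * v ^ (((m + 1 : ℕ) : ℝ) * s - 1)) := by linarith
        _ ≤ B * C ^ s * v ^ (((m + 1 : ℕ) : ℝ) * s - 1) + (B' * C ^ s * v ^ (((m + 1 : ℕ) : ℝ) * s - 1) +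
            B * s * D * C' * v ^ (((m + 1 : ℕ) : ℝ) * s - 1)) := by
            gcongr
            positivity
        _ = _ := by ring
  · filter_upwards [hlow, h1, hqs] with u a0 a1 a4
    have hq0 : 0 ≤ q u := (by positivity : 0 ≤ c * |u - u₀| ^ (m + 1)).trans a0
    have hvp : 0 ≤ |u - u₀| ^ (((m + 1 : ℕ) : ℝ) * s) := by positivity
    rw [abs_mul, abs_of_nonneg (Real.rpow_nonneg hq0 s)]
    calc _ ≤ B * (C ^ s * |u - u₀| ^ (((m + 1 : ℕ) : ℝ) * s)) := by gcongr
      _ = B * C ^ s * |u - u₀| ^ (((m + 1 : ℕ) : ℝ) * s) := by ring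
      _ ≤ _ := by
        gcongr
        have : 0 ≤ B' * C ^ s + B * s * D * C' := by positivity
        linarith

/-! ### The homogeneous radius in a chart -/

theorem homRadius_eq {κ : Fin 2 → ℝ} (hκ : ∀ j, 0 < κ j) {x : Plane} {r : ℝ} (hr : 0 < r)
    (h : ‖dil κ r⁻¹ x‖ = 1) : homRadius κ x = r := by
  have e : x = dil κ r (dil κ r⁻¹ x) := by
    rw [dil_dil κ hr.le (inv_nonneg.2 hr.le), mul_inv_cancel₀ hr.ne']
    ext i
    simp [dil]
  rw [e, homRadius_dil κ hr, homRadius_of_norm_eq_one κ hκ _ h, mul_one]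

section Radius

variable {κ : Fin 2 → ℝ} {j : Fin 2} {τ : ℝ}

theorem norm_sq_dil_inv_chart (hτ : τ * τ = 1) {r : ℝ} (hr : 0 < r) (u : ℝ) :
    ‖dil κ r⁻¹ (chart j τ (1, u))‖ ^ 2 = r ^ (-(2 * κ j)) + r ^ (-(2 * κ (1 - j))) * u ^ 2 := by
  have e : ∀ k : ℝ, (r⁻¹ ^ k) ^ 2 = r ^ (-(2 * k)) := fun k => by
    rw [Real.inv_rpow hr.le, ← Real.rpow_neg hr.le, ← Real.rpow_natCast, ← Real.rpow_mul hr.le]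
    congr 1; push_cast; ring
  rw [norm_sq_eq _ j, dil_chart, chart_apply_self, chart_apply_other, mul_pow, mul_pow, mul_pow,
    e, e, pow_two τ, hτ]
  ring

theorem norm_dil_inv_chart_eq_one (hτ : τ * τ = 1) {r : ℝ} (hr : 0 < r) {u : ℝ}
    (h : r ^ (2 * κ (1 - j)) - r ^ (2 * κ (1 - j) - 2 * κ j) = u ^ 2) :
    ‖dil κ r⁻¹ (chart j τ (1, u))‖ = 1 := by
  have h1 : ‖dil κ r⁻¹ (chart j τ (1, u))‖ ^ 2 = 1 := by
    rw [norm_sq_dil_inv_chart hτ hr, ← h, mul_sub, ← Real.rpow_add hr, ← Real.rpow_add hr]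
    have e1 : -(2 * κ (1 - j)) + 2 * κ (1 - j) = 0 := by ring
    have e2 : -(2 * κ (1 - j)) + (2 * κ (1 - j) - 2 * κ j) = -(2 * κ j) := by ring
    rw [e1, e2, Real.rpow_zero]; ring
  nlinarith [norm_nonneg (dil κ r⁻¹ (chart j τ (1, u)))]

/-- The squared norm of the rescaled point equals `1 + u²` at `r = 1` and tends to zero as `r → ∞`,
so it takes the value one. The equation is solved for `u²` to prepare for the inverse function
theorem. -/
theorem exists_radius (hκ : ∀ j, 0 < κ j) (j : Fin 2) (u : ℝ) :
    ∃ r : ℝ, 1 ≤ r ∧ r ^ (2 * κ (1 - j)) - r ^ (2 * κ (1 - j) - 2 * κ j) = u ^ 2 := by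
  have hlim : Tendsto (fun r : ℝ => r ^ (-(2 * κ j)) + r ^ (-(2 * κ (1 - j))) * u ^ 2) atTop (𝓝 0) := by
    have := (tendsto_rpow_neg_atTop (by linarith [hκ j] : 0 < 2 * κ j)).add
      ((tendsto_rpow_neg_atTop (by linarith [hκ (1 - j)] : 0 < 2 * κ (1 - j))).mul_const (u ^ 2))
    simpa using this
  obtain ⟨b, hb, hb1⟩ := ((hlim.eventually_lt_const one_pos).and (eventually_ge_atTop 1)).exists
  have hcont : ContinuousOn (fun r : ℝ => r ^ (-(2 * κ j)) + r ^ (-(2 * κ (1 - j))) * u ^ 2)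
      (Set.Icc 1 b) := by
    have hc : ∀ s : ℝ, ContinuousOn (fun r : ℝ => r ^ s) (Set.Icc 1 b) := fun s r hr =>
      (Real.continuousAt_rpow_const r s (Or.inl (by linarith [hr.1]))).continuousWithinAt
    exact (hc _).add ((hc _).mul continuousOn_const)
  obtain ⟨r, hr, hr1⟩ := intermediate_value_Icc' hb1 hcont
    (show (1 : ℝ) ∈ _ from ⟨hb.le, by simp [sq_nonneg]⟩)
  have hr0 : 0 < r := by linarith [hr.1]
  refine ⟨r, hr.1, ?_⟩
  have h1 := congrArg (fun v => r ^ (2 * κ (1 - j)) * v) hr1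
  simp only [mul_add, mul_one, ← mul_assoc, ← Real.rpow_add hr0] at h1
  have e1 : 2 * κ (1 - j) + -(2 * κ (1 - j)) = 0 := by ring
  rw [e1, Real.rpow_zero, one_mul, ← sub_eq_add_neg] at h1
  linarith

/-- The radius inverts `ρ(r) = r ^ a - r ^ b` at `u²`. For `r ≥ 1` the derivative of `ρ` is a
positive multiple of `a r ^ (2 κ j) - b ≥ a - b = 2 κ j > 0`, so the local inverse is smooth, and
composing it with `u²` causes no trouble at `u = 0`. -/
theorem contDiff_radius (hκ : ∀ j, 0 < κ j) (hτ : τ * τ = 1) :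
    ContDiff ℝ ∞ (fun u => homRadius κ (chart j τ (1, u))) := by
  rw [contDiff_iff_contDiffAt]
  intro u₀
  obtain ⟨r₀, hr₀, hr₀u⟩ := exists_radius hκ j u₀
  have h0 : 0 < r₀ := by linarith
  set a := 2 * κ (1 - j) with ha
  set b := 2 * κ (1 - j) - 2 * κ j with hb
  set ρ : ℝ → ℝ := fun r => r ^ a - r ^ b with hρ
  have hρd : HasDerivAt ρ (a * r₀ ^ (a - 1) - b * r₀ ^ (b - 1)) r₀ :=
    (Real.hasDerivAt_rpow_const (Or.inl h0.ne')).sub (Real.hasDerivAt_rpow_const (Or.inl h0.ne'))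
  have hρ' : a * r₀ ^ (a - 1) - b * r₀ ^ (b - 1) ≠ 0 := by
    have e : r₀ ^ (a - 1) = r₀ ^ (b - 1) * r₀ ^ (2 * κ j) := by
      rw [← Real.rpow_add h0]; congr 1; rw [ha, hb]; ring
    have h1 : 1 ≤ r₀ ^ (2 * κ j) := Real.one_le_rpow hr₀ (by linarith [hκ j])
    have h2 : 0 < r₀ ^ (b - 1) := Real.rpow_pos_of_pos h0 _
    have h3 : 0 < a * r₀ ^ (2 * κ j) - b := by
      have := hκ j
      have := hκ (1 - j)
      nlinarith
    rw [e]
    have : 0 < r₀ ^ (b - 1) * (a * r₀ ^ (2 * κ j) - b) := mul_pos h2 h3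
    intro hcon
    linarith
  have hρc : ContDiffAt ℝ ∞ ρ r₀ :=
    (Real.contDiffAt_rpow_const_of_ne h0.ne').sub (Real.contDiffAt_rpow_const_of_ne h0.ne')
  have hF := hρd.hasFDerivAt_equiv hρ'
  have hinv := hρc.to_localInverse hF (by simp)
  have himg := hρc.localInverse_apply_image hF (by simp)
  set S := hρc.localInverse hF (by simp) with hS
  have hright : ∀ᶠ v in 𝓝 (ρ r₀), ρ (S v) = v :=
    (hρc.hasStrictFDerivAt' hF (by simp)).eventually_right_inverse
  have hSpos : ∀ᶠ v in 𝓝 (ρ r₀), 0 < S v :=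
    hinv.continuousAt.eventually_const_lt (by rw [himg]; exact h0)
  have hval : ρ r₀ = u₀ ^ 2 := hr₀u
  have hsq : Tendsto (fun u : ℝ => u ^ 2) (𝓝 u₀) (𝓝 (ρ r₀)) := by
    rw [hval]; exact (by fun_prop : Continuous fun u : ℝ => u ^ 2).continuousAt
  have hev : (fun u => homRadius κ (chart j τ (1, u))) =ᶠ[𝓝 u₀] fun u => S (u ^ 2) := by
    filter_upwards [hsq.eventually hright, hsq.eventually hSpos] with u h1 h2
    exact homRadius_eq hκ h2 (norm_dil_inv_chart_eq_one hτ h2 h1)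
  refine ContDiffAt.congr_of_eventuallyEq ?_ hev
  rw [hval] at hinv
  exact ContDiffAt.comp u₀ hinv (by fun_prop)

theorem radius_pos (hκ : ∀ j, 0 < κ j) (hτ : τ * τ = 1) (u : ℝ) :
    0 < homRadius κ (chart j τ (1, u)) := by
  obtain ⟨r, hr, hru⟩ := exists_radius hκ j u
  have h0 : 0 < r := by linarith
  rw [homRadius_eq hκ h0 (norm_dil_inv_chart_eq_one hτ h0 hru)]
  exact h0

end Radius

/-! ### Homogeneous weights -/

theorem homExtend_nonneg {κ : Fin 2 → ℝ} {g : Plane → ℝ} (hg : ∀ x, 0 ≤ g x) (x : Plane) :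
    0 ≤ homExtend κ g x := mul_nonneg (homRadius_nonneg κ x) (hg _)

theorem IsHomog.rpow {κ : Fin 2 → ℝ} {G : Plane → ℝ} (hG : IsHomog κ 1 G) (h0 : ∀ x, 0 ≤ G x)
    (α : ℝ) : IsHomog κ α fun x => G x ^ α := by
  intro x hx r hr
  simp only
  rw [hG x hx r hr, Real.rpow_one, Real.mul_rpow hr.le (h0 x)]

theorem IsHomog.continuousOn {κ : Fin 2 → ℝ} (hκ : ∀ j, 0 < κ j) {W : Plane → ℝ} {d : ℝ}
    (hW : IsHomog κ d W) (hc : ∀ (j : Fin 2) (τ : ℝ), τ = 1 ∨ τ = -1 → Continuous (profile W j τ)) :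
    ContinuousOn W {0}ᶜ := by
  intro y hy
  refine ContinuousAt.continuousWithinAt ?_
  obtain ⟨j, τ, hτ, x₀, u₀, hx₀, rfl⟩ := exists_chart hy (fun j => κ (1 - j) / κ j)
  have hτ1 : τ * τ = 1 := by rcases hτ with rfl | rfl <;> norm_num
  have hτ0 : τ ≠ 0 := fun h => by simp [h] at hτ1
  set y := DampedOsc.chart j τ (x₀, x₀ ^ (κ (1 - j) / κ j) * u₀)
  have e1 : τ * y j = x₀ := by rw [chart_apply_self, ← mul_assoc, hτ1, one_mul]
  have c1 : Continuous fun v : Plane => τ * v j := by fun_prop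
  have hpos : ∀ᶠ v in 𝓝 y, 0 < τ * v j :=
    c1.continuousAt.eventually_const_lt (show 0 < τ * y j by rw [e1]; exact hx₀)
  have hev : W =ᶠ[𝓝 y] fun v => (τ * v j) ^ (1 / κ j * d) *
      profile W j τ (v (1 - j) * (τ * v j) ^ (-(κ (1 - j) / κ j))) := by
    filter_upwards [hpos] with v hv
    have : v = DampedOsc.chart j τ (τ * v j, v (1 - j)) := by
      refine plane_ext j ?_ ?_
      · rw [chart_apply_self, ← mul_assoc, hτ1, one_mul]
      · rw [chart_apply_other]
    conv_lhs => rw [this, hW.chart hκ hτ0 hv]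
    rfl
  refine ContinuousAt.congr ?_ hev.symm
  have crp : ∀ s : ℝ, ContinuousAt (fun v : Plane => (τ * v j) ^ s) y := fun s =>
    c1.continuousAt.rpow_const (Or.inl (by rw [e1]; exact hx₀.ne'))
  exact (crp _).mul ((hc j τ hτ).continuousAt.comp
    (f := fun v : Plane => v (1 - j) * (τ * v j) ^ (-(κ (1 - j) / κ j)))
    (ContinuousAt.mul (by fun_prop) (crp _)))

/-- The profile of the function that equals one on the unit circle. -/
theorem profile_homExtend_one {κ : Fin 2 → ℝ} {j : Fin 2} {τ α : ℝ} : profile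
    (fun x => homExtend κ (fun _ => 1) x ^ α) j τ = fun u => homRadius κ (chart j τ (1, u)) ^ α := by
  funext u
  simp [profile, homExtend]

theorem contDiff_radius_rpow {κ : Fin 2 → ℝ} (hκ : ∀ j, 0 < κ j) {j : Fin 2} {τ : ℝ}
    (hτ : τ * τ = 1) (s : ℝ) : ContDiff ℝ ∞ fun u => homRadius κ (chart j τ (1, u)) ^ s :=
  (contDiff_radius hκ hτ).rpow_const_of_ne fun u => (radius_pos hκ hτ u).ne'

/-- The square of the gradient at the point of the unit circle on the orbit of `chart j τ (1, u)`. -/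
def gradSq (κ : Fin 2 → ℝ) (f : Plane → ℝ) (j : Fin 2) (τ : ℝ) (u : ℝ) : ℝ :=
  (homRadius κ (chart j τ (1, u)) ^ (-κ j * (1 / κ j - κ (1 - j) / κ j)) *
    deriv (profile f j τ) u) ^ 2 +
  (homRadius κ (chart j τ (1, u)) ^ (-κ j * (1 / κ j - 1)) *
    (1 / κ j * profile f j τ u - κ (1 - j) / κ j * u * deriv (profile f j τ) u)) ^ 2

theorem contDiff_gradSq {κ : Fin 2 → ℝ} (hκ : ∀ j, 0 < κ j) {j : Fin 2} {τ : ℝ} (hτ : τ * τ = 1)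
    {f : Plane → ℝ} (hf : ContDiffOn ℝ ∞ f {0}ᶜ) : ContDiff ℝ ∞ (gradSq κ f j τ) := by
  have hτ0 : τ ≠ 0 := fun h => by simp [h] at hτ
  have h1 := contDiff_profile (j := j) hτ0 hf
  have h2 := contDiff_deriv_infty h1
  have h3 := fun s => contDiff_radius_rpow (j := j) hκ hτ s
  exact (((h3 _).mul h2).pow 2).add (((h3 _).mul
    ((contDiff_const.mul h1).sub ((contDiff_const.mul contDiff_id).mul h2))).pow 2)

/-- The representative on the circle has first chart coordinate `r ^ (-κ j)` and the same orbit
parameter `u`. Inserting this in `fderiv_profile` gives the exponents in `gradSq`. -/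
theorem norm_gradient_sq {κ : Fin 2 → ℝ} (hκ : ∀ j, 0 < κ j) {j : Fin 2} {τ : ℝ} (hτ : τ * τ = 1)
    {f : Plane → ℝ} (hf : ContDiffOn ℝ ∞ f {0}ᶜ) (hfκ : IsHomog κ 1 f) (u : ℝ) :
    ‖gradient f (dil κ (homRadius κ (chart j τ (1, u)))⁻¹ (chart j τ (1, u)))‖ ^ 2 =
      gradSq κ f j τ u := by
  have hτ0 : τ ≠ 0 := fun h => by simp [h] at hτ
  have hr := radius_pos (j := j) hκ hτ u
  unfold gradSq
  set r := homRadius κ (chart j τ (1, u))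
  have hx : 0 < r⁻¹ ^ κ j * 1 := by positivity
  obtain ⟨h1, h2⟩ := fderiv_profile (j := j) hκ hτ0 hf hfκ hx (r⁻¹ ^ κ (1 - j) * u)
  have e : r⁻¹ ^ κ j * 1 = r ^ (-κ j) := by
    rw [mul_one, Real.inv_rpow hr.le, Real.rpow_neg hr.le]
  have e2 : r⁻¹ ^ κ (1 - j) * u * (r⁻¹ ^ κ j * 1) ^ (-(κ (1 - j) / κ j)) = u := by
    rw [e, ← Real.rpow_mul hr.le, Real.inv_rpow hr.le, ← Real.rpow_neg hr.le, mul_right_comm,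
      ← Real.rpow_add hr]
    have : -κ (1 - j) + -κ j * -(κ (1 - j) / κ j) = 0 := by
      have := (hκ j).ne'
      field_simp; ring
    rw [this, Real.rpow_zero, one_mul]
  rw [dil_chart, norm_sq_eq _ j, gradient_apply_self hτ, gradient_apply_other (τ := τ), h1, h2, e2, e,
    ← Real.rpow_mul hr.le, ← Real.rpow_mul hr.le, mul_pow τ, pow_two τ, hτ]
  ring

/-- The square of the gradient is smooth while its norm is not, so the exponent is halved and the
base squared. -/
theorem profile_gradDamping {κ : Fin 2 → ℝ} (hκ : ∀ j, 0 < κ j) {j : Fin 2} {τ : ℝ}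
    (hτ : τ * τ = 1) {f : Plane → ℝ} (hf : ContDiffOn ℝ ∞ f {0}ᶜ) (hfκ : IsHomog κ 1 f) (x0 : Plane)
    (α : ℝ) : profile (fun x => gradDamping κ f x0 x ^ α) j τ = fun u =>
      homRadius κ (chart j τ (1, u)) ^ α * gradSq κ f j τ u ^
        (((ordAt f x0).toNat : ℝ) / (((ordAt f x0).toNat : ℝ) - 1) * α / 2) := by
  funext u
  have hr := radius_pos (j := j) hκ hτ u
  rw [← norm_gradient_sq hκ hτ hf hfκ]
  simp only [profile, gradDamping, homExtend]
  rw [Real.mul_rpow hr.le (by positivity), ← Real.rpow_mul (norm_nonneg _), ← Real.rpow_natCast,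
    ← Real.rpow_mul (norm_nonneg _)]
  congr 2
  push_cast; ring

/-! ### The local estimate at points of the plane -/

section Points

variable {κ : Fin 2 → ℝ} {f : Plane → ℝ} {j : Fin 2} {τ : ℝ}

theorem contDiff_hessFactor {g : ℝ → ℝ} (hg : ContDiff ℝ ∞ g) (p θ : ℝ) :
    ContDiff ℝ ∞ (hessFactor p θ g) := by
  have h1 := contDiff_deriv_infty hg
  have h2 := contDiff_deriv_infty h1
  unfold hessFactor
  fun_prop

/-- A homogeneous function is flat at a point where its profile is. -/
theorem iteratedFDeriv_eq_zero_of_profile (hτ : τ * τ = 1) {h : Plane → ℝ} {φ : ℝ → ℝ}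
    (hφ : ContDiff ℝ ∞ φ) {e θ : ℝ}
    (hh : ∀ x y : ℝ, 0 < x → h (chart j τ (x, y)) = x ^ e * φ (y * x ^ (-θ))) {u₀ : ℝ} {n : ℕ}
    (hn : ∀ k ≤ n, iteratedDeriv k φ u₀ = 0) : iteratedFDeriv ℝ n h (chart j τ (1, u₀)) = 0 := by
  have c1 : ContDiff ℝ ∞ fun v : Plane => τ * v j := by fun_prop
  have hO : IsOpen {v : Plane | 0 < τ * v j} := isOpen_lt continuous_const c1.continuous
  have hpow : ∀ s : ℝ, ContDiffOn ℝ ∞ (fun v : Plane => (τ * v j) ^ s) {v : Plane | 0 < τ * v j} :=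
    fun s => c1.contDiffOn.rpow_const_of_ne fun v hv => ne_of_gt hv
  have e1 : τ * chart j τ (1, u₀) j = 1 := by rw [chart_apply_self, ← mul_assoc, hτ, one_mul]
  refine iteratedFDeriv_mul_comp_eq_zero (ρ := fun v : Plane => (τ * v j) ^ e)
    (υ := fun v : Plane => v (1 - j) * (τ * v j) ^ (-θ)) hφ hO (hpow e)
    (ContDiffOn.mul (by fun_prop) (hpow _)) (show 0 < τ * chart j τ (1, u₀) j by rw [e1]; exact one_pos)
    (fun v hv => ?_) ?_
  · rw [← hh _ _ hv]
    congr 1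
    refine plane_ext j ?_ ?_
    · rw [chart_apply_self, ← mul_assoc, hτ, one_mul]
    · rw [chart_apply_other]
  · simpa only [e1, Real.one_rpow, chart_apply_other, mul_one] using hn

/-- If `hessFactor` were flat at `u₀`, so would be the Hessian determinant, a power of `x` times it,
at a point of the punctured plane. -/
theorem hessFactor_order (hκ : ∀ j, 0 < κ j) (hτ : τ * τ = 1) (hf : ContDiffOn ℝ ∞ f {0}ᶜ)
    (hfκ : IsHomog κ 1 f) (hord : ord (hess f) < ⊤) (u₀ : ℝ) :
    ∃ k, iteratedDeriv k (hessFactor (1 / κ j) (κ (1 - j) / κ j) (profile f j τ)) u₀ ≠ 0 := by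
  have hτ0 : τ ≠ 0 := fun h => by simp [h] at hτ
  by_contra hcon
  push Not at hcon
  have hne : chart j τ (1, u₀) ≠ 0 := chart_ne_zero hτ0 one_ne_zero
  obtain ⟨n, hn⟩ := exists_ne_zero_of_ordAt (((ordAt_le_ord (hess f) hne).trans_lt hord).ne)
  exact hn (iteratedFDeriv_eq_zero_of_profile hτ
    (contDiff_hessFactor (contDiff_profile hτ0 hf) _ _)
    (fun x y hx => hess_profile hκ hτ hf hfκ hx y) fun k _ => hcon k)

theorem hessFactor_finite_type (hκ : ∀ j, 0 < κ j) (hτ : τ * τ = 1) (hf : ContDiffOn ℝ ∞ f {0}ᶜ)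
    (hfκ : IsHomog κ 1 f) (hord : ord (hess f) < ⊤) (u₀ : ℝ) :
    ∃ (m : ℕ) (c : ℝ), 0 < c ∧ ∀ᶠ u in 𝓝 u₀, c * |u - u₀| ^ m ≤
      |hessFactor (1 / κ j) (κ (1 - j) / κ j) (profile f j τ) u| := by
  have hτ0 : τ ≠ 0 := fun h => by simp [h] at hτ
  obtain ⟨m, hm, hm'⟩ := exists_order (hessFactor_order (j := j) hκ hτ hf hfκ hord u₀)
  obtain ⟨c, hc, h⟩ := exists_pow_le_abs (contDiff_hessFactor (contDiff_profile hτ0 hf) _ _) hm hm'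
  exact ⟨m, c, hc, h⟩

/-- The order of the profile at a point is finite and at most the order of the function. -/
theorem profile_order (hκ : ∀ j, 0 < κ j) (hτ : τ * τ = 1) (hf : ContDiffOn ℝ ∞ f {0}ᶜ)
    (hfκ : IsHomog κ 1 f) (hord : ord (hess f) < ⊤) (u₀ : ℝ) :
    ∃ n : ℕ, (∀ k < n, iteratedDeriv k (profile f j τ) u₀ = 0) ∧
      iteratedDeriv n (profile f j τ) u₀ ≠ 0 ∧ (n : ℕ∞) ≤ ord f := by
  have hτ0 : τ ≠ 0 := fun h => by simp [h] at hτ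
  have hg := contDiff_profile (j := j) hτ0 hf
  obtain ⟨n, hn, hn'⟩ := exists_order (exists_iteratedDeriv_ne_zero_of_hessFactor hg
    (hessFactor_order (j := j) hκ hτ hf hfκ hord u₀) (contDiff_hessFactor hg _ _))
  refine ⟨n, hn, hn', (le_ordAt fun k hk => ?_).trans
    (ordAt_le_ord f (chart_ne_zero (j := j) hτ0 (z := (1, u₀)) one_ne_zero))⟩
  refine iteratedFDeriv_eq_zero_of_profile hτ hg (e := 1 / κ j) (θ := κ (1 - j) / κ j)
    (fun x y hx => ?_) fun i hi => hn i (by omega)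
  have := hfκ.chart (j := j) hκ hτ0 hx (y := y)
  rwa [mul_one] at this

theorem gradient_chart_eq_zero_iff (hκ : ∀ j, 0 < κ j) (hτ : τ * τ = 1) (hf : ContDiffOn ℝ ∞ f {0}ᶜ)
    (hfκ : IsHomog κ 1 f) {x₀ : ℝ} (hx₀ : 0 < x₀) (u₀ : ℝ) :
    (gradient f (chart j τ (x₀, x₀ ^ (κ (1 - j) / κ j) * u₀)) (1 - j) = 0 ↔
      deriv (profile f j τ) u₀ = 0) ∧
    (gradient f (chart j τ (x₀, x₀ ^ (κ (1 - j) / κ j) * u₀)) j = 0 ↔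
      1 / κ j * profile f j τ u₀ - κ (1 - j) / κ j * u₀ * deriv (profile f j τ) u₀ = 0) := by
  have hτ0 : τ ≠ 0 := fun h => by simp [h] at hτ
  obtain ⟨h1, h2⟩ := fderiv_profile (j := j) hκ hτ0 hf hfκ hx₀ (x₀ ^ (κ (1 - j) / κ j) * u₀)
  have e : x₀ ^ (κ (1 - j) / κ j) * u₀ * x₀ ^ (-(κ (1 - j) / κ j)) = u₀ := by
    rw [mul_right_comm, ← Real.rpow_add hx₀]; simp
  rw [e] at h1 h2
  rw [gradient_apply_other (j := j) (τ := τ), gradient_apply_self (j := j) hτ, h1, h2]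
  simp [hτ0, (Real.rpow_pos_of_pos hx₀ _).ne']

/-- If `hessCoeff` and `hessFactor` both vanish, then `(p - θ) g' = 0`. For `p ≠ θ`, that is `κ (1 -
j) ≠ 1`, this gives `g' = 0`, and `hessCoeff` reduces to `p (p - 1) g`. For `p = θ` it reduces to `p
(p - 1) (g - u g')`, a multiple of the derivative in direction `j`. Since `p = 1` means `κ j = 1`,
the surviving conditions are those of degeneracy. -/
theorem hessFactor_or_hessCoeff_ne_zero (hκ : ∀ j, 0 < κ j) (hτ : τ * τ = 1)
    (hf : ContDiffOn ℝ ∞ f {0}ᶜ) (hfκ : IsHomog κ 1 f) {x₀ : ℝ} (hx₀ : 0 < x₀) {u₀ : ℝ}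
    (hdeg : ¬ IsDegenerate κ f (chart j τ (x₀, x₀ ^ (κ (1 - j) / κ j) * u₀))) :
    hessFactor (1 / κ j) (κ (1 - j) / κ j) (profile f j τ) u₀ ≠ 0 ∨
      hessCoeff (1 / κ j) (κ (1 - j) / κ j) (profile f j τ) u₀ ≠ 0 := by
  by_contra hcon
  push Not at hcon
  obtain ⟨hH, hN⟩ := hcon
  obtain ⟨i1, i2⟩ := gradient_chart_eq_zero_iff (j := j) hκ hτ hf hfκ hx₀ u₀
  have hk := (hκ j).ne'
  have hk' := (hκ (1 - j)).ne'
  have hp : 1 / κ j ≠ 0 := one_div_ne_zero hk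
  have hθ : κ (1 - j) / κ j ≠ 0 := div_ne_zero hk' hk
  have hpθ : 1 / κ j = κ (1 - j) / κ j → κ (1 - j) = 1 := fun h => by
    field_simp at h; exact h.symm
  have hp1 : 1 / κ j = 1 → κ j = 1 := fun h => by field_simp at h; exact h.symm
  set p := 1 / κ j
  set θ := κ (1 - j) / κ j
  set g := profile f j τ
  have hH' : (p - θ) * deriv g u₀ = 0 := by
    have : hessFactor p θ g u₀ = deriv (deriv g) u₀ * hessCoeff p θ g u₀ -
      ((p - θ) * deriv g u₀) ^ 2 := by simp only [hessFactor, hessCoeff]; ring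
    rw [this, hN] at hH
    simpa using hH
  refine hdeg fun i hi => ?_
  have hij : i = j ∨ i = 1 - j := by
    fin_cases j <;> fin_cases i <;> simp
  rcases hij with rfl | rfl
  · rw [i2]
    have hp1' : p - 1 ≠ 0 := fun h => hi (hp1 (by linarith))
    unfold hessCoeff at hN
    rcases mul_eq_zero.1 hH' with h | h
    · have hpe : θ = p := by linarith
      rw [hpe] at hN ⊢
      have : p * (p - 1) * (g u₀ - u₀ * deriv g u₀) = 0 := by linear_combination hN
      have := (mul_eq_zero.1 this).resolve_left (mul_ne_zero hp hp1')
      linear_combination p * this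
    · rw [h] at hN ⊢
      have : p * (p - 1) * g u₀ = 0 := by linear_combination hN
      have := (mul_eq_zero.1 this).resolve_left (mul_ne_zero hp hp1')
      rw [this]; ring
  · rw [i1]
    exact (mul_eq_zero.1 hH').resolve_left fun h => hi (hpθ (by linarith))

theorem localBound_of_not_degenerate (hκ : ∀ j, 0 < κ j) (hf : ContDiffOn ℝ ∞ f {0}ᶜ)
    (hfκ : IsHomog κ 1 f) (hord : ord (hess f) < ⊤) {W : Plane → ℝ} {d : ℝ} (hW : IsHomog κ d W)
    {y : Plane} (hy : y ≠ 0) (hdeg : ¬ IsDegenerate κ f y)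
    (hWc : ∀ (j : Fin 2) (τ : ℝ), τ = 1 ∨ τ = -1 → ContDiff ℝ ∞ (profile W j τ)) :
    LocalBound f W y := by
  obtain ⟨j, τ, hτ, x₀, u₀, hx₀, rfl⟩ := exists_chart hy (fun j => κ (1 - j) / κ j)
  have hτ1 : τ * τ = 1 := by rcases hτ with rfl | rfl <;> norm_num
  have hτ0 : τ ≠ 0 := fun h => by simp [h] at hτ1
  obtain ⟨m, c, hc, hH⟩ := hessFactor_finite_type (j := j) hκ hτ1 hf hfκ hord u₀
  exact localBound_of_rectBound hκ hτ hfκ hW hx₀ (rectBound_of_nondegenerate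
    (contDiff_profile hτ0 hf) _ _ hx₀ hc hH
    (hessFactor_or_hessCoeff_ne_zero hκ hτ1 hf hfκ hx₀ hdeg) (hWc j τ hτ).contDiffAt)

/-- The numerology of the critical points. -/
theorem exponent_pos {h : ℝ≥0∞} {α : ℝ} (hα : 1 / 2 - 1 / h.toReal < α) {n n₀ : ℕ}
    (hn₀ : 2 ≤ n₀) (hn : ((n + 2 : ℕ) : ℝ≥0∞) ≤ h) (hn₀h : (n₀ : ℝ≥0∞) ≤ h) :
    0 < ((2 * n + 1 + 1 : ℕ) : ℝ) * ((n₀ : ℝ) / ((n₀ : ℝ) - 1) * α / 2) - (n : ℝ) / 2 := by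
  have hn₀' : (2 : ℝ) ≤ n₀ := by exact_mod_cast hn₀
  have hn0 : (0 : ℝ) ≤ n := Nat.cast_nonneg n
  have h1 : (0 : ℝ) < n₀ - 1 := by linarith
  -- The orders `n + 2` and `n₀` need not agree, only both be at most `h`. As `x / (x - 1)`
  -- decreases and `(x - 2) / (2 (x - 1))` increases, the extreme case is `n + 2 = n₀ = h`, where
  -- the claim is `α > 1/2 - 1/h`.
  suffices hs : (n : ℝ) / (2 * (n + 1)) < (n₀ : ℝ) / ((n₀ : ℝ) - 1) * α by
    rw [div_lt_iff₀ (by positivity)] at hs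
    push_cast
    linarith
  rcases eq_or_ne h ⊤ with rfl | htop
  -- For infinite height `toReal` is zero and `1 / 0 = 0`, so the hypothesis reads `α > 1/2`, as it
  -- should.
  · simp only [ENNReal.toReal_top, div_zero, sub_zero] at hα
    have e1 : (1 : ℝ) ≤ (n₀ : ℝ) / ((n₀ : ℝ) - 1) := by rw [one_le_div h1]; linarith
    have e2 : (n : ℝ) / (2 * (n + 1)) ≤ 1 / 2 := by
      rw [div_le_div_iff₀ (by positivity) two_pos]; linarith
    nlinarith
  · have hH1 : (n : ℝ) + 2 ≤ h.toReal := by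
      have := ENNReal.toReal_mono htop hn
      rw [ENNReal.toReal_natCast] at this
      push_cast at this; exact this
    have hH2 : (n₀ : ℝ) ≤ h.toReal := by
      have := ENNReal.toReal_mono htop hn₀h
      rwa [ENNReal.toReal_natCast] at this
    set H := h.toReal
    have hH1' : 0 < H - 1 := by linarith
    have hH0 : 0 < H := by linarith
    have e1 : H / (H - 1) ≤ (n₀ : ℝ) / ((n₀ : ℝ) - 1) := by
      rw [div_le_div_iff₀ hH1' h1]; nlinarith
    have e2 : (H - 2) / (2 * H) < α := by
      have : (H - 2) / (2 * H) = 1 / 2 - 1 / H := by field_simp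
      rwa [this]
    have hα0 : 0 < α := lt_of_le_of_lt (div_nonneg (by linarith) (by linarith)) e2
    calc (n : ℝ) / (2 * (n + 1)) ≤ (H - 2) / (2 * (H - 1)) := by
          rw [div_le_div_iff₀ (by positivity) (by positivity)]; nlinarith
      _ = H / (H - 1) * ((H - 2) / (2 * H)) := by field_simp
      _ < H / (H - 1) * α := by gcongr
      _ ≤ _ := by gcongr

/-- At a zero of the gradient with profile of order `n + 2`, the squared gradient is comparable with
`|u - u₀| ^ (2 n + 2)`: from below by the term with `g'`, from above because `g` and `g'` are both
`O(|u - u₀| ^ (n + 1))`. Its power is then the weight that balances `g''`, of order `n`. Where the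
gradient is nonzero the weight is smooth and the point is not degenerate. -/
theorem localBound_gradDamping (hκ : ∀ j, 0 < κ j) (hf : ContDiffOn ℝ ∞ f {0}ᶜ)
    (hfκ : IsHomog κ 1 f) (hord : ord (hess f) < ⊤) {α : ℝ} (hα0 : 0 < α)
    (hα : 1 / 2 - 1 / (height κ f).toReal < α) {x0 : Plane} (hn₀ : 2 ≤ (ordAt f x0).toNat)
    (hn₀h : ((ordAt f x0).toNat : ℝ≥0∞) ≤ height κ f) {y : Plane} (hy : y ≠ 0)
    (hdeg : IsDegenerate κ f y → gradient f y = 0) :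
    LocalBound f (fun x => gradDamping κ f x0 x ^ α) y := by
  have hW : IsHomog κ α fun x => gradDamping κ f x0 x ^ α :=
    (homExtend_isHomog κ _).rpow (homExtend_nonneg fun x => by positivity) α
  obtain ⟨j, τ, hτ, x₀, u₀, hx₀, rfl⟩ := exists_chart hy (fun j => κ (1 - j) / κ j)
  have hτ1 : τ * τ = 1 := by rcases hτ with rfl | rfl <;> norm_num
  have hτ0 : τ ≠ 0 := fun h => by simp [h] at hτ1
  refine localBound_of_rectBound hκ hτ hfκ hW hx₀ ?_
  rw [profile_gradDamping hκ hτ1 hf hfκ]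
  set s := ((ordAt f x0).toNat : ℝ) / (((ordAt f x0).toNat : ℝ) - 1) * α / 2 with hs
  have hs0 : 0 < s := by
    have : (2 : ℝ) ≤ (ordAt f x0).toNat := by exact_mod_cast hn₀
    have : (0 : ℝ) < (ordAt f x0).toNat - 1 := by linarith
    positivity
  have hg := contDiff_profile (j := j) hτ0 hf
  have hq := contDiff_gradSq (j := j) hκ hτ1 hf
  have hR := contDiff_radius_rpow (j := j) hκ hτ1 α
  obtain ⟨m, c, hc, hH⟩ := hessFactor_finite_type (j := j) hκ hτ1 hf hfκ hord u₀
  obtain ⟨i1, i2⟩ := gradient_chart_eq_zero_iff (j := j) hκ hτ1 hf hfκ hx₀ u₀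
  by_cases hgrad : gradient f (chart j τ (x₀, x₀ ^ (κ (1 - j) / κ j) * u₀)) = 0
  · obtain ⟨n, hn, hn', hnord⟩ := profile_order (j := j) hκ hτ1 hf hfκ hord u₀
    have hg1 : deriv (profile f j τ) u₀ = 0 := i1.1 (by rw [hgrad]; rfl)
    have hg0 : profile f j τ u₀ = 0 := by
      have := i2.1 (by rw [hgrad]; rfl)
      rw [hg1, mul_zero, sub_zero] at this
      exact (mul_eq_zero.1 this).resolve_left (one_div_ne_zero (hκ j).ne')
    have hn2 : 2 ≤ n := by
      by_contra hlt
      interval_cases n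
      · exact hn' (by simpa using hg0)
      · exact hn' (by simpa using hg1)
    obtain ⟨n, rfl⟩ := Nat.exists_eq_add_of_le' hn2
    have hd1 := contDiff_deriv_infty hg
    have hd2 := contDiff_deriv_infty hd1
    obtain ⟨d, hd, hg2⟩ := exists_pow_le_abs (m := n) hd2
      (fun k hk => by rw [← iteratedDeriv_succ', ← iteratedDeriv_succ']; exact hn _ (by omega))
      (by rw [← iteratedDeriv_succ', ← iteratedDeriv_succ']; exact hn')
    obtain ⟨c₁, hc₁, hlow₁⟩ := exists_pow_le_abs (m := n + 1) hd1
      (fun k hk => by rw [← iteratedDeriv_succ']; exact hn _ (by omega))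
      (by rw [← iteratedDeriv_succ']; exact hn')
    have hr := radius_pos (j := j) (κ := κ) hκ hτ1
    -- the lower and upper bounds of the squared gradient
    have hcr := fun s => (contDiff_radius_rpow (j := j) hκ hτ1 s).continuous
    obtain ⟨c₂, hc₂, hlow⟩ : ∃ c₂ : ℝ, 0 < c₂ ∧
        ∀ᶠ u in 𝓝 u₀, c₂ * |u - u₀| ^ (2 * n + 1 + 1) ≤ gradSq κ f j τ u := by
      set ρ := fun u => homRadius κ (chart j τ (1, u)) ^ (-κ j * (1 / κ j - κ (1 - j) / κ j)) with hρ
      have hρ0 : ∀ u, 0 < ρ u := fun u => Real.rpow_pos_of_pos (hr u) _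
      have h1 : ∀ᶠ u in 𝓝 u₀, ρ u₀ / 2 ≤ ρ u :=
        (hcr _).continuousAt.eventually_const_le (show ρ u₀ / 2 < ρ u₀ by linarith [hρ0 u₀])
      have := hρ0 u₀
      refine ⟨(ρ u₀ / 2 * c₁) ^ 2, by positivity, ?_⟩
      filter_upwards [h1, hlow₁] with u a1 a2
      calc (ρ u₀ / 2 * c₁) ^ 2 * |u - u₀| ^ (2 * n + 1 + 1) =
            (ρ u₀ / 2 * (c₁ * |u - u₀| ^ (n + 1))) ^ 2 := by ring
        _ ≤ (ρ u * |deriv (profile f j τ) u|) ^ 2 := by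
            gcongr
            exact (hρ0 u).le
        _ = (ρ u * deriv (profile f j τ) u) ^ 2 := by rw [mul_pow, mul_pow, sq_abs]
        _ ≤ _ := le_add_of_nonneg_right (sq_nonneg _)
    obtain ⟨C, hC⟩ : ∃ C : ℝ, ∀ᶠ u in 𝓝 u₀, gradSq κ f j τ u ≤ C * |u - u₀| ^ (2 * n + 1 + 1) := by
      have hr1 := contDiff_radius_rpow (j := j) hκ hτ1 (-κ j * (1 / κ j - κ (1 - j) / κ j))
      have hr2 := contDiff_radius_rpow (j := j) hκ hτ1 (-κ j * (1 / κ j - 1))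
      obtain ⟨C₁, hC₁, hup₁⟩ := exists_abs_le_pow (m := n + 1) hd1
        (fun k hk => by rw [← iteratedDeriv_succ']; exact hn _ (by omega))
      obtain ⟨C₀, hC₀, hup₀⟩ := exists_abs_le_pow (m := n + 1) hg (fun k hk => hn _ (by omega))
      set ρ := fun u => homRadius κ (chart j τ (1, u)) ^ (-κ j * (1 / κ j - κ (1 - j) / κ j)) with hρ
      set ρ' := fun u => homRadius κ (chart j τ (1, u)) ^ (-κ j * (1 / κ j - 1)) with hρ'
      set B := |ρ u₀| + |ρ' u₀| + |u₀| + 1 with hB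
      have cB : Continuous fun u => |ρ u| + |ρ' u| + |u| :=
        ((hcr _).abs.add (hcr _).abs).add continuous_abs
      have h1 : ∀ᶠ u in 𝓝 u₀, |ρ u| + |ρ' u| + |u| ≤ B :=
        cB.continuousAt.eventually_le_const (show |ρ u₀| + |ρ' u₀| + |u₀| < B by linarith)
      refine ⟨(B * C₁) ^ 2 + (B * (|1 / κ j| * C₀ + |κ (1 - j) / κ j| * B * C₁)) ^ 2, ?_⟩
      filter_upwards [h1, hup₁, hup₀] with u a0 a1 a2
      have b1 : |ρ u| ≤ B := by linarith [abs_nonneg (ρ' u), abs_nonneg u]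
      have b2 : |ρ' u| ≤ B := by linarith [abs_nonneg (ρ u), abs_nonneg u]
      have b3 : |u| ≤ B := by linarith [abs_nonneg (ρ u), abs_nonneg (ρ' u)]
      have hB0 : 0 ≤ B := (abs_nonneg _).trans b1
      have f1 : |ρ u * deriv (profile f j τ) u| ≤ B * (C₁ * |u - u₀| ^ (n + 1)) := by
        rw [abs_mul]; gcongr
      have f2 : |ρ' u * (1 / κ j * profile f j τ u -
          κ (1 - j) / κ j * u * deriv (profile f j τ) u)| ≤
          B * (|1 / κ j| * (C₀ * |u - u₀| ^ (n + 1)) +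
            |κ (1 - j) / κ j| * B * (C₁ * |u - u₀| ^ (n + 1))) := by
        rw [abs_mul]
        refine mul_le_mul b2 ((abs_sub _ _).trans ?_) (abs_nonneg _) hB0
        rw [abs_mul, abs_mul, abs_mul]
        gcongr
      calc gradSq κ f j τ u = |ρ u * deriv (profile f j τ) u| ^ 2 +
            |ρ' u * (1 / κ j * profile f j τ u -
              κ (1 - j) / κ j * u * deriv (profile f j τ) u)| ^ 2 := by
            rw [sq_abs, sq_abs]; rfl
        _ ≤ (B * (C₁ * |u - u₀| ^ (n + 1))) ^ 2 + (B * (|1 / κ j| * (C₀ * |u - u₀| ^ (n + 1)) +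
            |κ (1 - j) / κ j| * B * (C₁ * |u - u₀| ^ (n + 1)))) ^ 2 := by gcongr
        _ = _ := by ring
    obtain ⟨K, w', hw', hwb⟩ := exists_weight_bound hR hq hc₂ hs0 hlow hC
    refine rectBound_of_critical hg (one_div_pos.2 (hκ j)) _ hx₀ hc hd hH hg2
      (hR.continuous.mul (hq.continuous.rpow_const fun u => Or.inr hs0.le)) hw' hwb ?_
    have hnh : ((n + 2 : ℕ) : ℝ≥0∞) ≤ height κ f := by
      refine le_trans ?_ (le_max_right _ _)
      exact_mod_cast ENat.toENNReal_mono hnord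
    exact exponent_pos hα hn₀ hnh hn₀h
  · refine rectBound_of_nondegenerate hg _ _ hx₀ hc hH
      (hessFactor_or_hessCoeff_ne_zero hκ hτ1 hf hfκ hx₀ fun h => hgrad (hdeg h)) ?_
    refine hR.contDiffAt.mul (hq.contDiffAt.rpow_const_of_ne fun h0 => hgrad ?_)
    have hr1 := (Real.rpow_pos_of_pos (radius_pos (j := j) (κ := κ) hκ hτ1 u₀)
      (-κ j * (1 / κ j - κ (1 - j) / κ j))).ne'
    have hr2 := (Real.rpow_pos_of_pos (radius_pos (j := j) (κ := κ) hκ hτ1 u₀)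
      (-κ j * (1 / κ j - 1))).ne'
    obtain ⟨z1, z2⟩ := (add_eq_zero_iff_of_nonneg (sq_nonneg _) (sq_nonneg _)).1 h0
    rw [sq_eq_zero_iff] at z1 z2
    refine plane_ext j ?_ ?_
    · exact i2.2 ((mul_eq_zero.1 z2).resolve_left hr2)
    · exact i1.2 ((mul_eq_zero.1 z1).resolve_left hr1)

/-- The order of `f` at a zero of its gradient. -/
theorem ordAt_critical (hκ : ∀ j, 0 < κ j) (hf : ContDiffOn ℝ ∞ f {0}ᶜ) (hfκ : IsHomog κ 1 f)
    (hord : ord (hess f) < ⊤) {x0 : Plane} (hx0 : x0 ≠ 0) (hgrad : gradient f x0 = 0) :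
    2 ≤ (ordAt f x0).toNat ∧ ((ordAt f x0).toNat : ℝ≥0∞) ≤ height κ f := by
  obtain ⟨j, τ, hτ, x₀, u₀, hx₀, hx0e⟩ := exists_chart hx0 (fun j => κ (1 - j) / κ j)
  have hτ1 : τ * τ = 1 := by rcases hτ with rfl | rfl <;> norm_num
  have hτ0 : τ ≠ 0 := fun h => by simp [h] at hτ1
  have hg := contDiff_profile (j := j) hτ0 hf
  -- Finiteness matters because `toNat` sends `⊤` to zero. If `f` were flat at `x0`, so would be its
  -- profile, a multiple of `f` along the line `S`, contradicting the finite order of `hessFactor`.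
  have hfin : ordAt f x0 ≠ ⊤ := by
    intro htop
    have hflat : ∀ k, iteratedFDeriv ℝ k f x0 = 0 := fun k => by
      by_contra hne
      have := ordAt_le_of_ne_zero hne
      rw [htop] at this
      exact absurd this (by simp)
    obtain ⟨n, hn⟩ := exists_iteratedDeriv_ne_zero_of_hessFactor hg
      (hessFactor_order (j := j) hκ hτ1 hf hfκ hord u₀) (contDiff_hessFactor hg _ _)
    refine hn ?_
    set S : ℝ → Plane := fun u => chart j τ (x₀, x₀ ^ (κ (1 - j) / κ j) * u) with hS
    have hSc : ContDiff ℝ ∞ S := (chart j τ).contDiff.comp (by fun_prop)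
    have hSne : ∀ u, S u ∈ ({0}ᶜ : Set Plane) := fun u => chart_ne_zero hτ0 hx₀.ne'
    have hprof : profile f j τ = fun u => (x₀ ^ (1 / κ j))⁻¹ • (f ∘ S) u := by
      funext u
      have := hfκ.chart (j := j) hκ hτ0 hx₀ (y := x₀ ^ (κ (1 - j) / κ j) * u)
      simp only [Function.comp, hS, smul_eq_mul]
      rw [this, mul_one, mul_right_comm, ← Real.rpow_add hx₀, add_neg_cancel, Real.rpow_zero, one_mul,
        inv_mul_cancel_left₀ (Real.rpow_pos_of_pos hx₀ _).ne']
      rfl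
    have hcomp : iteratedFDerivWithin ℝ n (f ∘ S) Set.univ u₀ = 0 := by
      set D := 1 + ∑ i ∈ Finset.range (n + 1), ‖iteratedFDerivWithin ℝ i S Set.univ u₀‖ with hD
      have hD1 : 1 ≤ D := by
        have : 0 ≤ ∑ i ∈ Finset.range (n + 1), ‖iteratedFDerivWithin ℝ i S Set.univ u₀‖ :=
          Finset.sum_nonneg fun _ _ => norm_nonneg _
        linarith
      have := norm_iteratedFDerivWithin_comp_le (n := n) (C := 0) (D := D) hf hSc.contDiffOn
        (by exact_mod_cast le_top) isOpen_compl_singleton.uniqueDiffOn uniqueDiffOn_univ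
        (fun u _ => hSne u) (Set.mem_univ u₀)
        (fun i _ => by
          rw [iteratedFDerivWithin_of_isOpen i isOpen_compl_singleton (hSne u₀)]
          simp only [hS, ← hx0e, hflat, norm_zero, le_refl])
        (fun i hi1 hi => by
          calc ‖iteratedFDerivWithin ℝ i S Set.univ u₀‖ ≤
                ∑ i ∈ Finset.range (n + 1), ‖iteratedFDerivWithin ℝ i S Set.univ u₀‖ :=
                Finset.single_le_sum (f := fun i => ‖iteratedFDerivWithin ℝ i S Set.univ u₀‖)
                  (fun _ _ => norm_nonneg _) (Finset.mem_range.2 (by omega))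
            _ ≤ D := by rw [hD]; linarith
            _ = D ^ 1 := (pow_one D).symm
            _ ≤ D ^ i := pow_le_pow_right₀ hD1 hi1)
      simpa using this
    have hfS : ContDiff ℝ ∞ (f ∘ S) := contDiffOn_univ.1 (hf.comp hSc.contDiffOn fun u _ => hSne u)
    rw [hprof, ← norm_eq_zero, ← norm_iteratedFDeriv_eq_norm_iteratedDeriv,
      iteratedFDeriv_const_smul_apply' ((hfS.of_le (by exact_mod_cast le_top)).contDiffAt),
      ← iteratedFDerivWithin_univ, hcomp, smul_zero, norm_zero]
  have hcast : (((ordAt f x0).toNat : ℕ) : ℕ∞) = ordAt f x0 := ENat.natCast_toNat hfin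
  constructor
  · have h2 : ((2 : ℕ) : ℕ∞) ≤ ordAt f x0 := by
      refine le_ordAt fun k hk => ?_
      obtain ⟨i1, i2⟩ := gradient_chart_eq_zero_iff (j := j) hκ hτ1 hf hfκ hx₀ u₀
      rw [← hx0e] at i1 i2
      have hg1 : deriv (profile f j τ) u₀ = 0 := i1.1 (by rw [hgrad]; rfl)
      have hg0 : profile f j τ u₀ = 0 := by
        have := i2.1 (by rw [hgrad]; rfl)
        rw [hg1, mul_zero, sub_zero] at this
        exact (mul_eq_zero.1 this).resolve_left (one_div_ne_zero (hκ j).ne')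
      interval_cases k
      · rw [← norm_eq_zero, norm_iteratedFDeriv_zero, hx0e, hfκ.chart (j := j) hκ hτ0 hx₀,
          mul_right_comm (x₀ ^ _) u₀, ← Real.rpow_add hx₀, add_neg_cancel, Real.rpow_zero, one_mul]
        change ‖_ * profile f j τ u₀‖ = 0
        rw [hg0, mul_zero, norm_zero]
      · rw [← norm_eq_zero, norm_iteratedFDeriv_one]
        have : fderiv ℝ f x0 = InnerProductSpace.toDual ℝ Plane (gradient f x0) := by
          rw [gradient, LinearIsometryEquiv.apply_symm_apply]
        rw [this, hgrad, map_zero, norm_zero]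
    rw [← hcast] at h2
    exact_mod_cast h2
  · refine le_trans ?_ (le_max_right _ _)
    have := ENat.toENNReal_mono (hcast.le.trans (ordAt_le_ord f hx0))
    exact_mod_cast this

end Points

/-! ### Sobolev embedding in the plane -/

theorem norm_chart_sq {j : Fin 2} {τ : ℝ} (hτ : τ * τ = 1) (z : ℝ × ℝ) :
    ‖chart j τ z‖ ^ 2 = z.1 ^ 2 + z.2 ^ 2 := by
  rw [norm_sq_eq _ j, chart_apply_self, chart_apply_other, mul_pow, pow_two τ, hτ, one_mul]

section Sobolev

theorem exists_norm_le_of_hasCompactSupport {E : Type*} [NormedAddCommGroup E] {F : Plane → E} (hc : HasCompactSupport F) :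
    ∃ R : ℝ, ∀ x, F x ≠ 0 → ‖x‖ ≤ R := by
  obtain ⟨R, hR⟩ := hc.isCompact.isBounded.exists_norm_le
  exact ⟨R, fun x hx => hR x (subset_tsupport F hx)⟩

variable {E : Type*} [NormedAddCommGroup E] [NormedSpace ℝ E]

/-- A function with compact support is bounded by the integral of its derivative over a line. -/
theorem enorm_le_lintegral_line {F : Plane → E} (hF : ContDiff ℝ 1 F) (hc : HasCompactSupport F)
    {v q : Plane} (hq : ∀ s : ℝ, |s| ≤ ‖q + s • v‖) (s₀ : ℝ) :
    ‖F (q + s₀ • v)‖ₑ ≤ ∫⁻ s : ℝ, ‖fderiv ℝ F (q + s • v) v‖ₑ := by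
  obtain ⟨R, hR⟩ := exists_norm_le_of_hasCompactSupport hc
  have hline : ContDiff ℝ 1 fun s : ℝ => F (q + s • v) := by fun_prop
  -- The hypothesis `hq` makes the line leave every ball, so the restriction of `F` to it has
  -- compact support.
  have hsupp : HasCompactSupport fun s : ℝ => F (q + s • v) := by
    refine HasCompactSupport.intro (isCompact_Icc (a := -R) (b := R)) fun s hs => ?_
    by_contra hne
    exact hs (abs_le.1 ((hq s).trans (hR _ hne)))
  refine (hsupp.enorm_le_lintegral_Ici_deriv hline s₀).trans ?_
  refine (setLIntegral_le_lintegral _ _).trans (lintegral_mono fun s => le_of_eq ?_)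
  have h1 : HasDerivAt (fun s : ℝ => q + s • v) v s := by
    simpa using ((hasDerivAt_id s).smul_const v).const_add q
  have h2 : HasDerivAt (fun s : ℝ => F (q + s • v)) (fderiv ℝ F (q + s • v) v) s :=
    (hF.differentiable one_ne_zero _).hasFDerivAt.comp_hasDerivAt s h1
  rw [h2.deriv]

/-- The fundamental theorem of calculus along one axis and then along the other bounds `F` by the
integral of a mixed second derivative. Two derivatives in `L¹` control the supremum, so three
control the `C¹` norm required of the amplitude. -/
theorem enorm_le_lintegral_fderiv_fderiv {F : Plane → E} (hF : ContDiff ℝ ∞ F)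
    (hc : HasCompactSupport F) (x : Plane) :
    ‖F x‖ₑ ≤ ∫⁻ y, ‖fderiv ℝ (fderiv ℝ F) y‖ₑ := by
  set L := chart (0 : Fin 2) 1 with hL
  have hLn : ∀ z, ‖L z‖ ^ 2 = z.1 ^ 2 + z.2 ^ 2 := norm_chart_sq (by norm_num)
  have hLz : ∀ z : ℝ × ℝ, L z = L (0, z.2) + z.1 • L (1, 0) := fun z => by
    rw [← map_smul, ← map_add]; simp
  have hLz' : ∀ z : ℝ × ℝ, L z = L (z.1, 0) + z.2 • L (0, 1) := fun z => by
    rw [← map_smul, ← map_add]; simp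
  have n1 : ‖L (1, 0)‖ = 1 := by
    have := hLn (1, 0)
    norm_num at this
    rcases this with h | h
    · exact h
    · linarith [norm_nonneg (L (1, 0))]
  have n2 : ‖L (0, 1)‖ = 1 := by
    have := hLn (0, 1)
    norm_num at this
    rcases this with h | h
    · exact h
    · linarith [norm_nonneg (L (0, 1))]
  have a1 : ∀ z : ℝ × ℝ, |z.1| ≤ ‖L z‖ := fun z =>
    abs_le_of_sq_le_sq (by rw [hLn]; nlinarith [sq_nonneg z.2]) (norm_nonneg _)
  have a2 : ∀ z : ℝ × ℝ, |z.2| ≤ ‖L z‖ := fun z =>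
    abs_le_of_sq_le_sq (by rw [hLn]; nlinarith [sq_nonneg z.1]) (norm_nonneg _)
  have hF1 : ContDiff ℝ 1 F := hF.of_le (by exact_mod_cast le_top)
  have hDF : ContDiff ℝ ∞ (fderiv ℝ F) := hF.fderiv_right (by simp)
  have hDD : Continuous (fderiv ℝ (fderiv ℝ F)) := hDF.continuous_fderiv (by simp)
  set G : Plane → E := fun y => fderiv ℝ F y (L (1, 0)) with hG
  have hG1 : ContDiff ℝ 1 G := (hDF.of_le (by exact_mod_cast le_top)).clm_apply contDiff_const
  have hGc : HasCompactSupport G := (hc.fderiv ℝ).mono fun y hy h0 => hy (by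
    simp only [hG]; rw [h0]; rfl)
  obtain ⟨z, rfl⟩ : ∃ z, x = L z := ⟨(x 0, x 1), plane_ext 0
    (by rw [hL, chart_apply_self]; simp) (by rw [hL, chart_apply_other]; simp)⟩
  calc ‖F (L z)‖ₑ ≤ ∫⁻ s : ℝ, ‖G (L (s, z.2))‖ₑ := by
        have := enorm_le_lintegral_line hF1 hc (v := L (1, 0)) (q := L (0, z.2))
          (fun s => by rw [← hLz (s, z.2)]; exact a1 (s, z.2)) z.1
        rw [← hLz z] at this
        refine this.trans (lintegral_mono fun s => ?_)
        rw [← hLz (s, z.2)]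
    _ ≤ ∫⁻ s : ℝ, ∫⁻ t : ℝ, ‖fderiv ℝ (fderiv ℝ F) (L (s, t))‖ₑ := by
        refine lintegral_mono fun s => ?_
        have := enorm_le_lintegral_line hG1 hGc (v := L (0, 1)) (q := L (s, 0))
          (fun t => by rw [← hLz' (s, t)]; exact a2 (s, t)) z.2
        rw [← hLz' (s, z.2)] at this
        refine this.trans (lintegral_mono fun t => ?_)
        rw [← hLz' (s, t)]
        refine enorm_le_iff_norm_le.2 ?_
        have e : fderiv ℝ G (L (s, t)) (L (0, 1)) =
            fderiv ℝ (fderiv ℝ F) (L (s, t)) (L (0, 1)) (L (1, 0)) := by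
          rw [hG, fderiv_clm_apply (hDF.differentiable (by simp) _) (differentiableAt_const _)]
          simp
        rw [e]
        refine ((fderiv ℝ (fderiv ℝ F) (L (s, t)) (L (0, 1))).le_opNorm _).trans ?_
        rw [n1, mul_one]
        refine ((fderiv ℝ (fderiv ℝ F) (L (s, t))).le_opNorm _).trans ?_
        rw [n2, mul_one]
    _ = ∫⁻ w : ℝ × ℝ, ‖fderiv ℝ (fderiv ℝ F) (L w)‖ₑ := by
        rw [Measure.volume_eq_prod, lintegral_prod]
        have hm : Measurable fun w => ‖fderiv ℝ (fderiv ℝ F) (L w)‖₊ :=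
          (hDD.comp L.continuous).nnnorm.measurable
        exact hm.coe_nnreal_ennreal.aemeasurable
    _ = _ := (measurePreserving_chart (j := 0) (Or.inl rfl)).lintegral_comp_emb
        (measurableEmbedding_chart one_ne_zero) (fun y => ‖fderiv ℝ (fderiv ℝ F) y‖ₑ)

end Sobolev

section SobolevNorm

variable {a : Plane → ℂ}

theorem sobolevNorm_nonneg (a : Plane → ℂ) : 0 ≤ sobolevNorm a :=
  Finset.sum_nonneg fun _ _ => integral_nonneg fun _ => norm_nonneg _

theorem integral_iteratedFDeriv_le (a : Plane → ℂ) {n : ℕ} (hn : n < 4) :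
    ∫ x, ‖iteratedFDeriv ℝ n a x‖ ≤ sobolevNorm a :=
  Finset.single_le_sum (f := fun n => ∫ x, ‖iteratedFDeriv ℝ n a x‖)
    (fun _ _ => integral_nonneg fun _ => norm_nonneg _) (Finset.mem_range.2 hn)

theorem le_sobolevNorm (ha : ContDiff ℝ ∞ a) (hc : HasCompactSupport a) {n : ℕ} (hn : n < 4)
    {I : ℝ} (h : ENNReal.ofReal I ≤ ∫⁻ x, ‖iteratedFDeriv ℝ n a x‖ₑ) : I ≤ sobolevNorm a := by
  have h_int : Integrable (iteratedFDeriv ℝ n a) :=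
    (ha.continuous_iteratedFDeriv (by exact_mod_cast le_top)).integrable_of_hasCompactSupport
      (hc.iteratedFDeriv n)
  rw [← ofReal_integral_norm_eq_lintegral_enorm h_int,
    ENNReal.ofReal_le_ofReal_iff (integral_nonneg fun _ => norm_nonneg _)] at h
  exact h.trans (integral_iteratedFDeriv_le a hn)

theorem norm_le_sobolevNorm (ha : ContDiff ℝ ∞ a) (hc : HasCompactSupport a) (x : Plane) :
    ‖a x‖ ≤ sobolevNorm a := by
  refine le_sobolevNorm ha hc (n := 2) (by norm_num) ?_
  rw [ofReal_norm]
  refine (enorm_le_lintegral_fderiv_fderiv ha hc x).trans (lintegral_mono fun y => ?_)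
  refine enorm_le_iff_norm_le.2 (le_of_eq ?_)
  rw [← norm_iteratedFDeriv_one, norm_iteratedFDeriv_fderiv]

theorem norm_fderiv_le_sobolevNorm (ha : ContDiff ℝ ∞ a) (hc : HasCompactSupport a) (x : Plane) :
    ‖fderiv ℝ a x‖ ≤ sobolevNorm a := by
  refine le_sobolevNorm ha hc (n := 3) (by norm_num) ?_
  rw [ofReal_norm]
  refine (enorm_le_lintegral_fderiv_fderiv (ha.fderiv_right (m := ∞) (by simp)) (hc.fderiv ℝ)
    x).trans (lintegral_mono fun y => ?_)
  refine enorm_le_iff_norm_le.2 (le_of_eq ?_)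
  rw [← norm_iteratedFDeriv_one, norm_iteratedFDeriv_fderiv, norm_iteratedFDeriv_fderiv]

end SobolevNorm

/-! ### Dilations -/

section Dil

variable {κ : Fin 2 → ℝ}

theorem integral_comp_dil {E : Type*} [NormedAddCommGroup E] [NormedSpace ℝ E] {r : ℝ} (hr : 0 < r)
    (F : Plane → E) :
    ∫ x, F (dil κ r x) = ((r ^ (κ 0 + κ 1))⁻¹ : ℝ) • ∫ x, F x := by
  set D : Fin 2 → ℝ := fun i => r ^ κ i with hD
  have hdet : (Matrix.diagonal D).det = r ^ (κ 0 + κ 1) := by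
    rw [Matrix.det_diagonal, Fin.prod_univ_two, Real.rpow_add hr]
  have hpos : 0 < r ^ (κ 0 + κ 1) := Real.rpow_pos_of_pos hr _
  have hmp := PiLp.volume_preserving_toLp (Fin 2)
  have hme : MeasurableEmbedding (WithLp.toLp 2 : (Fin 2 → ℝ) → Plane) :=
    (MeasurableEquiv.toLp 2 (Fin 2 → ℝ)).measurableEmbedding
  set T := Matrix.toLin' (Matrix.diagonal D) with hT
  have hTapp : ∀ v, WithLp.toLp 2 (T v) = dil κ r (WithLp.toLp 2 v) := fun v => by
    ext i
    simp [hT, Matrix.mulVec_diagonal, dil, hD]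
  have hTinj : Function.Injective T := by
    intro v w h
    funext i
    have := congrFun h i
    simp only [hT, Matrix.toLin'_apply, Matrix.mulVec_diagonal] at this
    exact mul_left_cancel₀ (Real.rpow_pos_of_pos hr _).ne' this
  have hTc : Continuous T := T.continuous_of_finiteDimensional
  have hTme : MeasurableEmbedding T := hTc.measurableEmbedding hTinj
  have hmap := Real.smul_map_diagonal_volume_pi (D := D) (by rw [hdet]; exact hpos.ne')
  rw [← hmp.integral_comp hme, ← hmp.integral_comp hme]
  simp only [← hTapp]
  rw [← hTme.integral_map (fun v => F (WithLp.toLp 2 v))]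
  conv_rhs => rw [← hmap]
  rw [integral_smul_measure, hdet, abs_of_pos hpos, ENNReal.toReal_ofReal hpos.le, smul_smul,
    inv_mul_cancel₀ hpos.ne', one_smul]

theorem inner_dil (r : ℝ) (x s : Plane) : inner ℝ (dil κ r x) s = inner ℝ x (dil κ r s) := by
  simp only [PiLp.inner_apply, dil_apply, RCLike.inner_apply, conj_trivial]
  exact Finset.sum_congr rfl fun i _ => by ring

/-- The dilation as a continuous linear map. -/
def dilCLM (κ : Fin 2 → ℝ) (r : ℝ) : Plane →L[ℝ] Plane :=
  LinearMap.toContinuousLinearMap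
    { toFun := dil κ r
      map_add' := fun x y => by ext i; simp [dil, mul_add]
      map_smul' := fun c x => by ext i; simp [dil, mul_left_comm] }

theorem dilCLM_apply (r : ℝ) (x : Plane) : dilCLM κ r x = dil κ r x := rfl

theorem continuous_dil (r : ℝ) : Continuous (dil κ r) := (dilCLM κ r).continuous

theorem norm_dilCLM_le (hκ : ∀ j, 0 < κ j) {r : ℝ} (hr : 0 < r) (hr1 : r ≤ 1) :
    ‖dilCLM κ r‖ ≤ 1 := by
  refine ContinuousLinearMap.opNorm_le_bound _ zero_le_one fun x => ?_
  rw [one_mul, dilCLM_apply]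
  refine (sq_le_sq₀ (norm_nonneg _) (norm_nonneg _)).1 ?_
  rw [norm_sq_eq _ 0, norm_sq_eq x 0, dil_apply, dil_apply, mul_pow, mul_pow]
  have h : ∀ i, (r ^ κ i) ^ 2 ≤ 1 := fun i =>
    pow_le_one₀ (by positivity) (Real.rpow_le_one hr.le hr1 (hκ i).le)
  exact add_le_add (mul_le_of_le_one_left (sq_nonneg _) (h _))
    (mul_le_of_le_one_left (sq_nonneg _) (h _))

theorem dil_one (x : Plane) : dil κ 1 x = x := by ext i; simp [dil]

theorem dil_inv_dil {r : ℝ} (hr : 0 < r) (x : Plane) : dil κ r⁻¹ (dil κ r x) = x := by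
  rw [dil_dil κ (inv_nonneg.2 hr.le) hr.le, inv_mul_cancel₀ hr.ne', dil_one]

theorem dil_dil_inv {r : ℝ} (hr : 0 < r) (x : Plane) : dil κ r (dil κ r⁻¹ x) = x := by
  rw [dil_dil κ hr.le (inv_nonneg.2 hr.le), mul_inv_cancel₀ hr.ne', dil_one]

theorem dil_zero (r : ℝ) : dil κ r 0 = 0 := by ext i; simp [dil]

theorem dil_ne_zero {r : ℝ} (hr : 0 < r) {x : Plane} (hx : x ≠ 0) : dil κ r x ≠ 0 := fun h =>
  hx (by rw [← dil_inv_dil (κ := κ) hr x, h, dil_zero])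

/-- Generalized polar coordinates. -/
theorem exists_polar (hκ : ∀ j, 0 < κ j) {x : Plane} (hx : x ≠ 0) :
    ∃ (r : ℝ) (z : Plane), 0 < r ∧ ‖z‖ = 1 ∧ x = dil κ r z := by
  obtain ⟨j, τ, hτ, x₀, u₀, hx₀, rfl⟩ := exists_chart hx (fun j => κ (1 - j) / κ j)
  have hτ1 : τ * τ = 1 := by rcases hτ with rfl | rfl <;> norm_num
  rw [chart_eq_dil hκ hx₀]
  obtain ⟨r, hr, hru⟩ := exists_radius hκ j (x₀ ^ (κ (1 - j) / κ j) * u₀ * x₀ ^ (-(κ (1 - j) / κ j)))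
  have h0 : 0 < r := by linarith
  refine ⟨x₀ ^ (1 / κ j) * r, _, by positivity, norm_dil_inv_chart_eq_one hτ1 h0 hru, ?_⟩
  rw [← dil_dil κ (by positivity) h0.le, dil_dil_inv h0]

/-- A continuous homogeneous function of nonnegative degree is bounded on bounded sets. -/
theorem IsHomog.exists_bound (hκ : ∀ j, 0 < κ j) {W : Plane → ℝ} {d : ℝ} (hd : 0 ≤ d)
    (hW : IsHomog κ d W) (hc : ContinuousOn W {0}ᶜ) (R : ℝ) :
    ∃ B : ℝ, 0 < B ∧ ∀ x : Plane, x ≠ 0 → ‖x‖ ≤ R → |W x| ≤ B := by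
  have hS : IsCompact (Metric.sphere (0 : Plane) 1) := isCompact_sphere 0 1
  obtain ⟨B, hB⟩ := hS.exists_bound_of_continuousOn (hc.mono fun x hx h0 => by
    rw [Set.mem_singleton_iff] at h0
    rw [h0] at hx
    simp at hx)
  set R' := max R 1 with hR'
  have hR'0 : 0 < R' := lt_of_lt_of_le one_pos (le_max_right _ _)
  obtain ⟨r₁, hr₁, hr₁'⟩ : ∃ r₁ : ℝ, 0 < r₁ ∧ ∀ i, r₁ ^ (-κ i) ≤ 1 / R' := by
    have h : ∀ i, ∀ᶠ r : ℝ in atTop, r ^ (-κ i) ≤ 1 / R' := fun i =>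
      (tendsto_rpow_neg_atTop (hκ i)).eventually_le_const (by positivity)
    obtain ⟨r, h1, h2⟩ := ((eventually_all.2 h).and (eventually_gt_atTop 0)).exists
    exact ⟨r, h2, h1⟩
  refine ⟨r₁ ^ d * |B| + 1, by positivity, fun x hx hxR => ?_⟩
  obtain ⟨r, z, hr, hz, rfl⟩ := exists_polar hκ hx
  have hrad : homRadius κ (dil κ r z) = r := by
    rw [homRadius_dil κ hr, homRadius_of_norm_eq_one κ hκ z hz, mul_one]
  have hle : r ≤ r₁ := by
    rw [← hrad]
    refine csInf_le ⟨0, fun s hs => hs.1.le⟩ ⟨hr₁, ?_⟩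
    set x := dil κ r z
    refine (sq_le_sq₀ (norm_nonneg _) zero_le_one).1 ?_
    have hsq : ‖x‖ ^ 2 ≤ R' ^ 2 :=
      pow_le_pow_left₀ (norm_nonneg _) (hxR.trans (le_max_left _ _)) 2
    rw [norm_sq_eq _ 0] at hsq
    have e : ∀ i, dil κ r₁⁻¹ x i = r₁ ^ (-κ i) * x i := fun i => by
      rw [dil_apply _ x, Real.inv_rpow hr₁.le, ← Real.rpow_neg hr₁.le]
    rw [norm_sq_eq _ 0, e, e, mul_pow, mul_pow]
    calc _ ≤ (1 / R') ^ 2 * x 0 ^ 2 + (1 / R') ^ 2 * x (1 - 0) ^ 2 := by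
          gcongr
          · exact hr₁' 0
          · exact hr₁' (1 - 0)
      _ = (1 / R') ^ 2 * (x 0 ^ 2 + x (1 - 0) ^ 2) := by ring
      _ ≤ (1 / R') ^ 2 * R' ^ 2 := by gcongr
      _ = 1 ^ 2 := by field_simp
  have hz0 : z ≠ 0 := fun h => by simp [h] at hz
  rw [hW z hz0 r hr, abs_mul, abs_of_pos (Real.rpow_pos_of_pos hr d)]
  have h1 : |W z| ≤ |B| := (hB z (by simpa using hz)).trans (le_abs_self B)
  calc r ^ d * |W z| ≤ r₁ ^ d * |B| :=
        mul_le_mul (Real.rpow_le_rpow hr.le hle hd) h1 (abs_nonneg _) (by positivity)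
    _ ≤ _ := by linarith

end Dil

/-! ### From local to global estimates -/

/-- The estimate for amplitudes supported in `K`. -/
def BoundOn (f W : Plane → ℝ) (K : Set Plane) (C ε : ℝ) : Prop :=
  ∀ b : Plane → ℂ, ContDiff ℝ 1 b → tsupport b ⊆ K → ∀ M : ℝ, (∀ x, ‖b x‖ ≤ M) →
    (∀ x, ‖fderiv ℝ b x‖ ≤ M) → ∀ (t : ℝ) (s : Plane),
    ‖∫ x, b x * (W x : ℂ) * cis (t * (f x + inner ℝ x s))‖ ≤ C * M * (1 + |t|) ^ (-(1 / 2 + ε))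

theorem BoundOn.mono_exponent {f W : Plane → ℝ} {K : Set Plane} {C ε ε' : ℝ} (hC : 0 ≤ C)
    (h : BoundOn f W K C ε) (hε : ε' ≤ ε) : BoundOn f W K C ε' := by
  intro b hb hbK M h0 h1 t s
  refine (h b hb hbK M h0 h1 t s).trans ?_
  have hM : 0 ≤ M := (norm_nonneg _).trans (h0 0)
  have : (1 : ℝ) ≤ 1 + |t| := by linarith [abs_nonneg t]
  gcongr

theorem integrable_mul_cis {f W : Plane → ℝ} {K : Set Plane} (hK : IsCompact K)
    (hf : ContinuousOn f K) (hW : ContinuousOn W K) {b : Plane → ℂ} (hb : Continuous b)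
    (hbK : tsupport b ⊆ K) (t : ℝ) (s : Plane) :
    Integrable fun x => b x * (W x : ℂ) * cis (t * (f x + inner ℝ x s)) := by
  have hc : ContinuousOn (fun x => b x * (W x : ℂ) * cis (t * (f x + inner ℝ x s))) K := by
    refine (hb.continuousOn.mul (Complex.continuous_ofReal.comp_continuousOn hW)).mul
      (continuous_cis.comp_continuousOn (continuousOn_const.mul (hf.add ?_)))
    fun_prop
  refine (integrableOn_iff_integrable_of_support_subset fun x hx => hbK ?_).1
    (hc.integrableOn_compact hK)
  exact subset_tsupport b (left_ne_zero_of_mul (left_ne_zero_of_mul hx))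

theorem norm_fderiv_smul_le {χ : Plane → ℝ} {b : Plane → ℂ} {x : Plane}
    (hχ : DifferentiableAt ℝ χ x) (hb : DifferentiableAt ℝ b x) :
    ‖fderiv ℝ (fun x => (χ x : ℂ) * b x) x‖ ≤ |χ x| * ‖fderiv ℝ b x‖ + ‖fderiv ℝ χ x‖ * ‖b x‖ := by
  have e : (fun x => (χ x : ℂ) * b x) = fun x => χ x • b x := by
    funext x; rw [Complex.real_smul]
  rw [e, fderiv_fun_smul hχ hb]
  refine (norm_add_le _ _).trans (add_le_add ?_ ?_)
  · rw [norm_smul, Real.norm_eq_abs]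
  · rw [ContinuousLinearMap.norm_smulRight_apply]

/-- A smooth partition of unity on finitely many neighbourhoods reduces to the local bounds.
Multiplying by a cutoff enlarges the `C¹` bound by `1 + D i`, and the smallest of the finitely many
exponents is kept. -/
theorem exists_boundOn_of_isCompact {f W : Plane → ℝ} {K : Set Plane} (hK : IsCompact K)
    (hf : ContinuousOn f K) (hW : ContinuousOn W K) (h : ∀ y ∈ K, LocalBound f W y) :
    ∃ C : ℝ, 0 < C ∧ ∃ ε : ℝ, 0 < ε ∧ BoundOn f W K C ε := by
  classical
  choose! U hU C hC ε hε hbd using h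
  obtain ⟨T, hT⟩ := hK.elim_nhds_subcover' (fun y _ => interior (U y))
    (fun y hy => interior_mem_nhds.2 (hU y hy))
  have hcov : K ⊆ ⋃ i : T, interior (U (i : K)) := fun x hx => by
    obtain ⟨i, hi, hxi⟩ := Set.mem_iUnion₂.1 (hT hx)
    exact Set.mem_iUnion.2 ⟨⟨i, hi⟩, hxi⟩
  obtain ⟨χ, hχ⟩ := SmoothPartitionOfUnity.exists_isSubordinate (modelWithCornersSelf ℝ Plane)
    hK.isClosed (fun i : T => interior (U (i : K))) (fun i => isOpen_interior) hcov
  have hχs : ∀ i : T, ContDiff ℝ ∞ (χ i) := fun i => (χ i).contMDiff.contDiff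
  have hχ1 : ∀ i x, |χ i x| ≤ 1 := fun i x => by
    rw [abs_of_nonneg (χ.nonneg i x)]; exact χ.le_one i x
  have hD : ∀ i : T, ∃ D : ℝ, 0 ≤ D ∧ ∀ x ∈ K, ‖fderiv ℝ (χ i) x‖ ≤ D := fun i => by
    obtain ⟨D, hD⟩ := hK.exists_bound_of_continuousOn
      ((hχs i).continuous_fderiv (by simp)).continuousOn
    exact ⟨|D|, abs_nonneg D, fun x hx => (hD x hx).trans (le_abs_self D)⟩
  choose D hD0 hDb using hD
  obtain ⟨ε₀, hε₀, hε₀'⟩ : ∃ ε₀ : ℝ, 0 < ε₀ ∧ ∀ i : T, ε₀ ≤ ε (i : K) := by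
    have : ∀ i : T, ∀ᶠ e in 𝓝[>] (0 : ℝ), e ≤ ε (i : K) := fun i =>
      (eventually_le_nhds (hε (i : K) (i : K).2)).filter_mono nhdsWithin_le_nhds
    obtain ⟨e, he, he0⟩ := ((eventually_all.2 this).and self_mem_nhdsWithin).exists
    exact ⟨e, he0, he⟩
  have hCi : ∀ i : T, 0 < C (i : K) := fun i => hC _ (i : K).2
  refine ⟨∑ i : T, C (i : K) * (1 + D i) + 1, ?_, ε₀, hε₀, ?_⟩
  · have : 0 ≤ ∑ i : T, C (i : K) * (1 + D i) := Finset.sum_nonneg fun i _ =>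
      mul_nonneg (hCi i).le (by linarith [hD0 i])
    linarith
  intro b hb hbK M hM₀ hM₁ t s
  have hM : 0 ≤ M := (norm_nonneg _).trans (hM₀ 0)
  have hsum : ∀ x, b x * (W x : ℂ) * cis (t * (f x + inner ℝ x s)) =
      ∑ i : T, (χ i x : ℂ) * b x * (W x : ℂ) * cis (t * (f x + inner ℝ x s)) := fun x => by
    rw [← Finset.sum_mul, ← Finset.sum_mul, ← Finset.sum_mul]
    by_cases hx : x ∈ K
    · have h1 := χ.sum_eq_one hx
      rw [finsum_eq_sum_of_fintype] at h1
      have h2 : ∑ i : T, (χ i x : ℂ) = 1 := by exact_mod_cast congrArg (fun r : ℝ => (r : ℂ)) h1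
      rw [h2, one_mul]
    · have : b x = 0 := image_eq_zero_of_notMem_tsupport fun hx' => hx (hbK hx')
      rw [this]; simp
  have hsub : ∀ i : T, tsupport (fun x => (χ i x : ℂ) * b x) ⊆ tsupport b := fun i =>
    tsupport_mul_subset_right
  have hsub' : ∀ i : T, tsupport (fun x => (χ i x : ℂ) * b x) ⊆ U (i : K) := fun i => by
    refine (tsupport_mul_subset_left (f := fun x => (χ i x : ℂ))).trans
      (Set.Subset.trans (closure_mono fun x hx => ?_) ((hχ i).trans interior_subset))
    exact fun h0 => hx (by simp only; rw [h0]; rfl)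
  have hbd1 : ∀ i : T, ContDiff ℝ 1 fun x => (χ i x : ℂ) * b x := fun i =>
    (Complex.ofRealCLM.contDiff.comp ((hχs i).of_le (by exact_mod_cast le_top))).mul hb
  have hpt : ∀ i : T, ‖∫ x, (χ i x : ℂ) * b x * (W x : ℂ) * cis (t * (f x + inner ℝ x s))‖ ≤
      C (i : K) * ((1 + D i) * M) * (1 + |t|) ^ (-(1 / 2 + ε₀)) := by
    intro i
    have hDi := hD0 i
    refine (hbd (i : K) (i : K).2 _ (hbd1 i) (hsub' i) ((1 + D i) * M) (fun x => ?_) (fun x => ?_)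
      t s).trans ?_
    · rw [norm_mul, Complex.norm_real]
      calc _ ≤ 1 * M := mul_le_mul (hχ1 i x) (hM₀ x) (norm_nonneg _) zero_le_one
        _ ≤ _ := by nlinarith
    · by_cases hx : x ∈ K
      · refine (norm_fderiv_smul_le ((hχs i).differentiable (by simp) x)
          (hb.differentiable one_ne_zero x)).trans ?_
        calc _ ≤ 1 * M + D i * M := add_le_add
              (mul_le_mul (hχ1 i x) (hM₁ x) (norm_nonneg _) zero_le_one)
              (mul_le_mul (hDb i x hx) (hM₀ x) (norm_nonneg _) hDi)
          _ = _ := by ring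
      · have : fderiv ℝ (fun x => (χ i x : ℂ) * b x) x = 0 :=
          image_eq_zero_of_notMem_tsupport fun hx' =>
            hx (hbK (hsub i (tsupport_fderiv_subset ℝ hx')))
        rw [this, norm_zero]; positivity
    · have : (1 : ℝ) ≤ 1 + |t| := by linarith [abs_nonneg t]
      have h3 := (hCi i).le
      gcongr
      exact hε₀' i
  simp only [hsum]
  rw [integral_finsetSum _ fun i _ => integrable_mul_cis hK hf hW (hbd1 i).continuous
    ((hsub i).trans hbK) t s]
  refine (norm_sum_le _ _).trans ((Finset.sum_le_sum fun i _ => hpt i).trans ?_)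
  have e : ∑ i : T, C (i : K) * ((1 + D i) * M) * (1 + |t|) ^ (-(1 / 2 + ε₀)) =
      (∑ i : T, C (i : K) * (1 + D i)) * M * (1 + |t|) ^ (-(1 / 2 + ε₀)) := by
    rw [Finset.sum_mul, Finset.sum_mul]
    exact Finset.sum_congr rfl fun i _ => by ring
  rw [e]
  gcongr
  linarith

/-- A dyadic partition of unity adapted to the dilations. -/
theorem exists_dyadic {κ : Fin 2 → ℝ} (hκ : ∀ j, 0 < κ j) (R : ℝ) :
    ∃ η ζ : Plane → ℝ, ContDiff ℝ ∞ η ∧ HasCompactSupport η ∧ ContDiff ℝ ∞ ζ ∧ HasCompactSupport ζ ∧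
      0 ∉ tsupport ζ ∧ (∀ x, ‖x‖ ≤ R → η x = 1) ∧ (∀ x, |η x| ≤ 1) ∧
      ∀ (N : ℕ) (x : Plane), ∑ k ∈ Finset.range N, ζ (dil κ (2 ^ k) x) = η x - η (dil κ (2 ^ N) x) := by
  set R' := max R 1 with hR'
  have hR'0 : 0 < R' := lt_of_lt_of_le one_pos (le_max_right _ _)
  let η : ContDiffBump (0 : Plane) := ⟨R', 2 * R', hR'0, by linarith⟩
  have hηs : ContDiff ℝ ∞ η := η.contDiff
  have hη1 : ∀ x : Plane, ‖x‖ ≤ R' → η x = 1 := fun x hx =>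
    η.one_of_mem_closedBall (by simpa using hx)
  have hdil : ContDiff ℝ ∞ (dil κ 2) := (dilCLM κ 2).contDiff
  have hηd : HasCompactSupport fun x => η (dil κ 2 x) := by
    obtain ⟨S, hS⟩ := exists_norm_le_of_hasCompactSupport η.hasCompactSupport
    refine HasCompactSupport.intro (isCompact_closedBall (0 : Plane) S) fun x hx => ?_
    by_contra hne
    refine hx ?_
    rw [mem_closedBall_zero_iff]
    refine le_trans ?_ (hS _ hne)
    conv_lhs => rw [← dil_inv_dil (κ := κ) two_pos x, ← dilCLM_apply]
    refine ((dilCLM κ (2 : ℝ)⁻¹).le_opNorm _).trans ?_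
    exact mul_le_of_le_one_left (norm_nonneg _)
      (norm_dilCLM_le hκ (by norm_num) (by norm_num))
  -- The difference telescopes along powers of two and vanishes near the origin, where both terms
  -- are one.
  refine ⟨η, fun x => η x - η (dil κ 2 x), hηs, η.hasCompactSupport,
    hηs.sub (hηs.comp hdil), η.hasCompactSupport.sub hηd, ?_, fun x hx => hη1 x (hx.trans (le_max_left _ _)),
    fun x => by rw [abs_of_nonneg η.nonneg]; exact η.le_one, fun N x => ?_⟩
  · rw [notMem_tsupport_iff_eventuallyEq]
    have h1 : ∀ᶠ x : Plane in 𝓝 0, ‖x‖ ≤ R' :=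
      continuous_norm.continuousAt.eventually_le_const (by simpa using hR'0)
    have h2 : ∀ᶠ x : Plane in 𝓝 0, ‖dil κ 2 x‖ ≤ R' :=
      (continuous_dil 2).norm.continuousAt.eventually_le_const (by simpa [dil_zero] using hR'0)
    filter_upwards [h1, h2] with x a1 a2
    simp only [Pi.zero_apply]
    rw [hη1 x a1, hη1 _ a2, sub_self]
  · induction N with
    | zero => simp [dil_one]
    | succ N ih =>
      rw [Finset.sum_range_succ, ih]
      simp only
      rw [dil_dil κ (by norm_num) (by positivity), ← pow_succ']
      ring

theorem aestronglyMeasurable_mul_cis {f W : Plane → ℝ} (hf : ContinuousOn f {0}ᶜ)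
    (hW : ContinuousOn W {0}ᶜ) {b : Plane → ℂ} (hb : Continuous b) (t : ℝ) (s : Plane) :
    AEStronglyMeasurable (fun x => b x * (W x : ℂ) * cis (t * (f x + inner ℝ x s))) volume := by
  rw [← restrict_compl_singleton (μ := (volume : Measure Plane)) 0]
  refine ContinuousOn.aestronglyMeasurable ?_ (measurableSet_singleton 0).compl
  refine (hb.continuousOn.mul (Complex.continuous_ofReal.comp_continuousOn hW)).mul
    (continuous_cis.comp_continuousOn (continuousOn_const.mul (hf.add ?_)))
  fun_prop

/-- Amplitudes with compact support are integrable against homogeneous weights. -/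
theorem integrable_mul_homog {κ : Fin 2 → ℝ} (hκ : ∀ j, 0 < κ j) {f W : Plane → ℝ} {d : ℝ}
    (hd : 0 ≤ d) (hf : ContinuousOn f {0}ᶜ) (hW : IsHomog κ d W) (hWc : ContinuousOn W {0}ᶜ)
    {b : Plane → ℂ} (hb : Continuous b) (hbc : HasCompactSupport b) (t : ℝ) (s : Plane) :
    Integrable fun x => b x * (W x : ℂ) * cis (t * (f x + inner ℝ x s)) := by
  obtain ⟨R, hR⟩ := exists_norm_le_of_hasCompactSupport hbc
  obtain ⟨B, hB, hWB⟩ := hW.exists_bound hκ hd hWc R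
  refine Integrable.mono' ((hb.integrable_of_hasCompactSupport hbc).norm.mul_const B)
    (aestronglyMeasurable_mul_cis hf hWc hb t s) ?_
  have hne : ∀ᵐ x : Plane, x ≠ 0 := by
    rw [ae_iff]; simp
  filter_upwards [hne] with x hx
  rw [norm_mul, norm_cis, mul_one, norm_mul, Complex.norm_real, Real.norm_eq_abs]
  by_cases hbx : b x = 0
  · simp [hbx]
  · gcongr
    exact hWB x hx (hR x hbx)

/-- The contribution of a dyadic shell. -/
theorem norm_integral_shell_le {κ : Fin 2 → ℝ} (hκ : ∀ j, 0 < κ j) {f W : Plane → ℝ} {d : ℝ}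
    (hfκ : IsHomog κ 1 f) (hW : IsHomog κ d W) {Γ : Set Plane} (hΓ : IsClosedCone κ Γ)
    {ζ : Plane → ℝ} (hζ : ContDiff ℝ ∞ ζ) (hζ0 : 0 ∉ tsupport ζ) {Z : ℝ} (hZ : ∀ x, |ζ x| ≤ Z)
    (hZ' : ∀ x, ‖fderiv ℝ ζ x‖ ≤ Z) {C ε : ℝ} (hC : 0 ≤ C) (hε : 0 < ε)
    (hbd : BoundOn f W (tsupport ζ ∩ Γ) C ε) {a : Plane → ℂ} (ha : ContDiff ℝ ∞ a)
    (hac : HasCompactSupport a) (haΓ : tsupport a ⊆ Γ) {r : ℝ} (hr : 0 < r) (hr1 : r ≤ 1) (t : ℝ)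
    (s : Plane) :
    ‖∫ x, (ζ (dil κ r⁻¹ x) : ℂ) * a x * (W x : ℂ) * cis (t * (f x + inner ℝ x s))‖ ≤
      r ^ (κ 0 + κ 1 + d - (1 / 2 + ε)) * (C * (2 * Z) * sobolevNorm a *
        (1 + |t|) ^ (-(1 / 2 + ε))) := by
  set S := sobolevNorm a with hS
  have hS0 : 0 ≤ S := sobolevNorm_nonneg a
  have hZ0 : 0 ≤ Z := (abs_nonneg _).trans (hZ 0)
  have hz0 : ζ 0 = 0 := image_eq_zero_of_notMem_tsupport hζ0
  set b : Plane → ℂ := fun y => (ζ y : ℂ) * a (dil κ r y) with hb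
  -- With `x = dil κ r y` the phase `t (f x + x · s)` becomes `t r (f y + y · s')`. The vector `s'`
  -- may be arbitrarily large, which is harmless because the local bounds are uniform in `s`.
  set s' : Plane := r⁻¹ • dil κ r s with hs'
  have hchange : ∫ x, (ζ (dil κ r⁻¹ x) : ℂ) * a x * (W x : ℂ) * cis (t * (f x + inner ℝ x s)) =
      (r ^ (κ 0 + κ 1) * r ^ d : ℝ) • ∫ y, b y * (W y : ℂ) * cis (t * r * (f y + inner ℝ y s')) := by
    have h1 : ∀ x, (ζ (dil κ r⁻¹ x) : ℂ) * a x * (W x : ℂ) * cis (t * (f x + inner ℝ x s)) =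
        (fun y => (r ^ d : ℝ) • (b y * (W y : ℂ) * cis (t * r * (f y + inner ℝ y s'))))
          (dil κ r⁻¹ x) := by
      intro x
      simp only [hb, dil_dil_inv hr]
      by_cases hx : x = 0
      · rw [hx, dil_zero, hz0]; simp
      · have hy : dil κ r⁻¹ x ≠ 0 := dil_ne_zero (inv_pos.2 hr) hx
        have e1 : W x = r ^ d * W (dil κ r⁻¹ x) := by
          rw [← hW _ hy r hr, dil_dil_inv hr]
        have e2 : f x = r * f (dil κ r⁻¹ x) := by
          have := hfκ _ hy r hr
          rwa [dil_dil_inv hr, Real.rpow_one] at this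
        have e3 : inner ℝ (dil κ r⁻¹ x) s' = r⁻¹ * inner ℝ x s := by
          rw [hs', inner_smul_right, ← inner_dil, dil_dil_inv hr]
        have e4 : t * r * (f (dil κ r⁻¹ x) + inner ℝ (dil κ r⁻¹ x) s') =
            t * (f x + inner ℝ x s) := by
          rw [e3, e2]; field_simp
        rw [e4, e1, Complex.real_smul]
        push_cast; ring
    have h2 := integral_comp_dil (κ := κ) (inv_pos.2 hr)
      (fun y => (r ^ d : ℝ) • (b y * (W y : ℂ) * cis (t * r * (f y + inner ℝ y s'))))
    rw [integral_congr_ae (Eventually.of_forall h1), h2, integral_smul, smul_smul, Real.inv_rpow hr.le, inv_inv]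
  have hDa : ∀ y, fderiv ℝ (fun y => a (dil κ r y)) y = (fderiv ℝ a (dil κ r y)).comp (dilCLM κ r) :=
    fun y => ((ha.differentiable (by simp) (dil κ r y)).hasFDerivAt.comp y
      (dilCLM κ r).hasFDerivAt).fderiv
  have hadil : ContDiff ℝ ∞ fun y => a (dil κ r y) := ha.comp (dilCLM κ r).contDiff
  have hbs : ContDiff ℝ 1 b :=
    ((Complex.ofRealCLM.contDiff.comp hζ).mul hadil).of_le (by exact_mod_cast le_top)
  have hbsupp : tsupport b ⊆ tsupport ζ ∩ Γ := by
    intro y hy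
    refine ⟨?_, ?_⟩
    · refine closure_mono (fun x hx => ?_) (tsupport_mul_subset_left (f := fun y => (ζ y : ℂ)) hy)
      exact fun h0 => hx (by simp only; rw [h0]; rfl)
    · have h1 : y ∈ dil κ r ⁻¹' tsupport a := tsupport_comp_subset_preimage a (continuous_dil r)
        (tsupport_mul_subset_right (g := fun y => a (dil κ r y)) hy)
      have := hΓ.2 _ (haΓ h1) r⁻¹ (inv_pos.2 hr)
      rwa [dil_inv_dil hr] at this
  have hmain := hbd b hbs hbsupp (2 * Z * S) (fun y => ?_) (fun y => ?_) (t * r) s'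
  · rw [hchange, norm_smul, Real.norm_eq_abs, abs_of_pos (by positivity)]
    -- This is `r (1 + |t|) ≤ 1 + |t r|` for `r ≤ 1`. Passing from `t r` back to `t` costs `r ^
    -- (-(1/2 + ε))`.
    have hrt : r ^ (1 / 2 + ε) * (1 + |t * r|) ^ (-(1 / 2 + ε)) ≤ (1 + |t|) ^ (-(1 / 2 + ε)) := by
      have hp1 : 0 < 1 + |t| := by positivity
      have hp2 : 0 < 1 + |t * r| := by positivity
      rw [Real.rpow_neg hp1.le, Real.rpow_neg hp2.le, ← div_eq_mul_inv, ← Real.div_rpow hr.le hp2.le,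
        ← Real.inv_rpow hp1.le]
      refine Real.rpow_le_rpow (by positivity) ?_ (by positivity)
      rw [div_le_iff₀ hp2, inv_mul_eq_div, le_div_iff₀ hp1, abs_mul, abs_of_pos hr]
      nlinarith [abs_nonneg t]
    have hsplit : r ^ (κ 0 + κ 1) * r ^ d =
        r ^ (κ 0 + κ 1 + d - (1 / 2 + ε)) * r ^ (1 / 2 + ε) := by
      rw [← Real.rpow_add hr, ← Real.rpow_add hr]; congr 1; ring
    calc _ ≤ (r ^ (κ 0 + κ 1) * r ^ d) * (C * (2 * Z * S) * (1 + |t * r|) ^ (-(1 / 2 + ε))) := by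
          gcongr
      _ = r ^ (κ 0 + κ 1 + d - (1 / 2 + ε)) * (C * (2 * Z) * S *
            (r ^ (1 / 2 + ε) * (1 + |t * r|) ^ (-(1 / 2 + ε)))) := by rw [hsplit]; ring
      _ ≤ _ := by gcongr
  · rw [hb, norm_mul, Complex.norm_real]
    calc _ ≤ Z * S := mul_le_mul (hZ y) (norm_le_sobolevNorm ha hac _) (norm_nonneg _) hZ0
      _ ≤ _ := by nlinarith [mul_nonneg hZ0 hS0]
  · refine (norm_fderiv_smul_le (hζ.differentiable (by simp) y)
      (hadil.differentiable (by simp) y)).trans ?_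
    rw [hDa]
    have h1 : ‖(fderiv ℝ a (dil κ r y)).comp (dilCLM κ r)‖ ≤ S :=
      (ContinuousLinearMap.opNorm_comp_le _ _).trans ((mul_le_mul
        (norm_fderiv_le_sobolevNorm ha hac _) (norm_dilCLM_le hκ hr hr1) (norm_nonneg _) hS0).trans
        (mul_one S).le)
    calc _ ≤ Z * S + Z * S := add_le_add (mul_le_mul (hZ y) h1 (norm_nonneg _) hZ0)
          (mul_le_mul (hZ' y) (norm_le_sobolevNorm ha hac _) (norm_nonneg _) hZ0)
      _ = _ := by ring

/-- The global estimate. -/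
theorem exists_global_bound {κ : Fin 2 → ℝ} (hκ : ∀ j, 0 < κ j) {f W : Plane → ℝ} {d : ℝ}
    (hd : 0 ≤ d) (hκd : 1 / 2 < κ 0 + κ 1 + d) (hf : ContinuousOn f {0}ᶜ) (hfκ : IsHomog κ 1 f)
    (hW : IsHomog κ d W) (hWc : ContinuousOn W {0}ᶜ) {V Γ : Set Plane} (hV : Bornology.IsBounded V)
    (hΓ : IsClosedCone κ Γ) (hloc : ∀ y ∈ Γ, y ≠ 0 → LocalBound f W y) :
    ∃ C : ℝ, 0 < C ∧ ∃ ε : ℝ, 0 < ε ∧ ∀ a : Plane → ℂ, IsTest (V ∩ Γ) a → ∀ (t : ℝ) (s : Plane),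
      ‖∫ x, a x * (W x : ℂ) * cis (t * (f x + inner ℝ x s))‖ ≤
        C * sobolevNorm a * (1 + |t|) ^ (-(1 / 2 + ε)) := by
  obtain ⟨R, hR⟩ := hV.exists_norm_le
  obtain ⟨η, ζ, hη, hηc, hζ, hζc, hζ0, hη1, hηb, hsum⟩ := exists_dyadic hκ R
  have hK : IsCompact (tsupport ζ ∩ Γ) := hζc.isCompact.inter_right hΓ.1
  have hK0 : tsupport ζ ∩ Γ ⊆ {0}ᶜ := fun x hx h0 => hζ0 (by
    rw [Set.mem_singleton_iff] at h0; rw [← h0]; exact hx.1)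
  obtain ⟨C₀, hC₀, ε₀, hε₀, hbd₀⟩ := exists_boundOn_of_isCompact hK (hf.mono hK0) (hWc.mono hK0)
    fun y hy => hloc y hy.2 (hK0 hy)
  -- Using at most half of the margin keeps the exponent `e` of the shells positive, so their
  -- contributions form a geometric series with ratio `2 ^ (-e) < 1`.
  set ε := min ε₀ ((κ 0 + κ 1 + d - 1 / 2) / 2) with hε
  have hε0 : 0 < ε := lt_min hε₀ (by linarith)
  have hbd := hbd₀.mono_exponent hC₀.le (min_le_left _ _ : ε ≤ ε₀)
  obtain ⟨Z₁, hZ₁⟩ := hζc.exists_bound_of_continuous hζ.continuous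
  obtain ⟨Z₂, hZ₂⟩ := (hζc.fderiv ℝ).exists_bound_of_continuous (hζ.continuous_fderiv (by simp))
  set Z := max Z₁ Z₂ with hZ
  have hZ0 : 0 ≤ Z := (norm_nonneg _).trans ((hZ₁ 0).trans (le_max_left _ _))
  obtain ⟨B, hB, hWB⟩ := hW.exists_bound hκ hd hWc R
  set e := κ 0 + κ 1 + d - (1 / 2 + ε) with he
  have he0 : 0 < e := by
    have := min_le_right ε₀ ((κ 0 + κ 1 + d - 1 / 2) / 2)
    rw [← hε] at this
    linarith
  set ρ := (2⁻¹ : ℝ) ^ e with hρ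
  have hρ0 : 0 < ρ := by positivity
  have hρ1 : ρ < 1 := Real.rpow_lt_one (by norm_num) (by norm_num) he0
  have h1ρ : 0 < 1 - ρ := by linarith
  refine ⟨(1 - ρ)⁻¹ * (C₀ * (2 * Z)) + 1, by positivity, ε, hε0, ?_⟩
  rintro a ⟨ha, hac, haV⟩ t s
  set S := sobolevNorm a with hS
  have hS0 : 0 ≤ S := sobolevNorm_nonneg a
  set Q := (1 + |t|) ^ (-(1 / 2 + ε)) with hQ
  have hQ0 : 0 ≤ Q := by positivity
  have hηd : ∀ N : ℕ, Continuous fun x => η (dil κ (2 ^ N) x) := fun N =>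
    hη.continuous.comp (continuous_dil _)
  have hζd : ∀ N : ℕ, Continuous fun x => ζ (dil κ (2 ^ N) x) := fun N =>
    hζ.continuous.comp (continuous_dil _)
  set q := (2 : ℝ) ^ (κ 0 + κ 1) with hq
  have hq1 : 1 < q := Real.one_lt_rpow one_lt_two (by linarith [hκ 0, hκ 1])
  -- Since `η = 1` on the support of `a`, telescoping leaves after `N` shells a remainder cut off by
  -- `η` at scale `2 ^ (-N)`. Its integral is `O(q ^ (-N))` because the weight is bounded, and it
  -- disappears in the limit.
  have key : ∀ N : ℕ, ‖∫ x, a x * (W x : ℂ) * cis (t * (f x + inner ℝ x s))‖ ≤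
      (1 - ρ)⁻¹ * (C₀ * (2 * Z)) * S * Q + (q⁻¹) ^ N * (S * B * ∫ x, |η x|) := by
    intro N
    have hdec : ∀ x, a x * (W x : ℂ) * cis (t * (f x + inner ℝ x s)) =
        (∑ k ∈ Finset.range N, (ζ (dil κ (2 ^ k) x) : ℂ) * a x * (W x : ℂ) *
          cis (t * (f x + inner ℝ x s))) +
        (η (dil κ (2 ^ N) x) : ℂ) * a x * (W x : ℂ) * cis (t * (f x + inner ℝ x s)) := by
      intro x
      rw [← Finset.sum_mul, ← Finset.sum_mul, ← Finset.sum_mul, ← Complex.ofReal_sum, hsum,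
        ← add_mul, ← add_mul, ← add_mul, ← Complex.ofReal_add, sub_add_cancel]
      by_cases hax : a x = 0
      · simp [hax]
      · rw [hη1 x (hR x (haV (subset_tsupport a hax)).1)]; simp
    have hi1 : ∀ k ∈ Finset.range N, Integrable fun x => (ζ (dil κ (2 ^ k) x) : ℂ) * a x *
        (W x : ℂ) * cis (t * (f x + inner ℝ x s)) := fun k _ =>
      integrable_mul_homog hκ hd hf hW hWc
        ((Complex.continuous_ofReal.comp (hζd k)).mul ha.continuous) hac.mul_left t s
    have hi2 : Integrable fun x => (η (dil κ (2 ^ N) x) : ℂ) * a x *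
        (W x : ℂ) * cis (t * (f x + inner ℝ x s)) :=
      integrable_mul_homog hκ hd hf hW hWc
        ((Complex.continuous_ofReal.comp (hηd N)).mul ha.continuous) hac.mul_left t s
    simp only [hdec]
    rw [integral_add (integrable_finsetSum _ hi1) hi2, integral_finsetSum _ hi1]
    refine (norm_add_le _ _).trans (add_le_add ?_ ?_)
    · have hk : ∀ k ∈ Finset.range N, ‖∫ x, (ζ (dil κ (2 ^ k) x) : ℂ) * a x *
          (W x : ℂ) * cis (t * (f x + inner ℝ x s))‖ ≤ ρ ^ k * (C₀ * (2 * Z) * S * Q) := by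
        intro k _
        have := norm_integral_shell_le hκ hfκ hW hΓ hζ hζ0 (Z := Z)
          (fun x => (hZ₁ x).trans (le_max_left _ _)) (fun x => (hZ₂ x).trans (le_max_right _ _))
          hC₀.le hε0 hbd ha hac (haV.trans Set.inter_subset_right)
          (r := (2 ^ k)⁻¹) (by positivity) (inv_le_one_of_one_le₀ (one_le_pow₀ one_le_two)) t s
        rw [inv_inv] at this
        refine this.trans (le_of_eq ?_)
        congr 1
        rw [hρ, ← he, ← inv_pow, ← Real.rpow_natCast, ← Real.rpow_mul (by norm_num), mul_comm,
          Real.rpow_mul (by norm_num), Real.rpow_natCast]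
      refine (norm_sum_le _ _).trans ((Finset.sum_le_sum hk).trans ?_)
      have hassoc : (1 - ρ)⁻¹ * (C₀ * (2 * Z)) * S * Q = (1 - ρ)⁻¹ * (C₀ * (2 * Z) * S * Q) := by ring
      rw [← Finset.sum_mul, hassoc]
      refine mul_le_mul_of_nonneg_right ?_ (by positivity)
      rw [← tsum_geometric_of_lt_one hρ0.le hρ1]
      exact (summable_geometric_of_lt_one hρ0.le hρ1).sum_le_tsum _ fun k _ => by positivity
    · have hηi : Integrable fun x => |η (dil κ (2 ^ N) x)| := by
        refine Integrable.abs ?_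
        refine (hηd N).integrable_of_hasCompactSupport ?_
        obtain ⟨T, hT⟩ := exists_norm_le_of_hasCompactSupport hηc
        refine HasCompactSupport.intro (isCompact_closedBall (0 : Plane) T) fun x hx => ?_
        by_contra hne
        refine hx ?_
        rw [mem_closedBall_zero_iff]
        refine le_trans ?_ (hT _ hne)
        have h2N : (0 : ℝ) < 2 ^ N := by positivity
        conv_lhs => rw [← dil_inv_dil (κ := κ) h2N x, ← dilCLM_apply]
        refine ((dilCLM κ ((2 : ℝ) ^ N)⁻¹).le_opNorm _).trans ?_
        exact mul_le_of_le_one_left (norm_nonneg _) (norm_dilCLM_le hκ (by positivity)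
          (inv_le_one_of_one_le₀ (one_le_pow₀ one_le_two)))
      have hne : ∀ᵐ x : Plane, x ≠ 0 := by
        rw [ae_iff]; simp
      refine (norm_integral_le_of_norm_le (hηi.mul_const (S * B)) ?_).trans (le_of_eq ?_)
      · filter_upwards [hne] with x hx
        rw [norm_mul, norm_cis, mul_one, norm_mul, norm_mul, Complex.norm_real, Complex.norm_real,
          Real.norm_eq_abs, Real.norm_eq_abs, mul_assoc]
        by_cases hax : a x = 0
        · rw [hax, norm_zero, zero_mul, mul_zero]; positivity
        · gcongr
          · exact norm_le_sobolevNorm ha hac x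
          · exact hWB x hx (hR x (haV (subset_tsupport a hax)).1)
      · rw [integral_mul_const, integral_comp_dil (by positivity) (fun x => |η x|), smul_eq_mul]
        have : ((2 : ℝ) ^ N) ^ (κ 0 + κ 1) = q ^ N := by
          rw [hq, ← Real.rpow_natCast, ← Real.rpow_mul (by norm_num), mul_comm,
            Real.rpow_mul (by norm_num), Real.rpow_natCast]
        rw [this, inv_pow]; ring
  have hlim : Tendsto (fun N : ℕ => (1 - ρ)⁻¹ * (C₀ * (2 * Z)) * S * Q +
      (q⁻¹) ^ N * (S * B * ∫ x, |η x|)) atTop (𝓝 ((1 - ρ)⁻¹ * (C₀ * (2 * Z)) * S * Q)) := by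
    have h1 := (tendsto_pow_atTop_nhds_zero_of_lt_one (inv_nonneg.2 (by linarith : (0 : ℝ) ≤ q))
      (inv_lt_one_of_one_lt₀ hq1)).mul_const (S * B * ∫ x, |η x|)
    rw [zero_mul] at h1
    simpa using h1.const_add ((1 - ρ)⁻¹ * (C₀ * (2 * Z)) * S * Q)
  refine (ge_of_tendsto' hlim key).trans ?_
  gcongr
  linarith

/-- The global estimate away from the origin. -/
theorem exists_global_bound_off_origin {κ : Fin 2 → ℝ} {f W : Plane → ℝ}
    (hf : ContinuousOn f {0}ᶜ) (hWc : ContinuousOn W {0}ᶜ) {V Γ : Set Plane}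
    (hV : Bornology.IsBounded V) (hΓ : IsClosedCone κ Γ)
    (hloc : ∀ y ∈ Γ, y ≠ 0 → LocalBound f W y) {ρ : ℝ} (hρ : 0 < ρ) :
    ∃ C : ℝ, 0 < C ∧ ∃ ε : ℝ, 0 < ε ∧ ∀ a : Plane → ℂ, IsTest (V ∩ Γ ∩ {x | ρ ≤ ‖x‖}) a →
      ∀ (t : ℝ) (s : Plane), ‖∫ x, a x * (W x : ℂ) * cis (t * (f x + inner ℝ x s))‖ ≤
        C * sobolevNorm a * (1 + |t|) ^ (-(1 / 2 + ε)) := by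
  have hK : IsCompact (closure V ∩ Γ ∩ {x : Plane | ρ ≤ ‖x‖}) :=
    (hV.isCompact_closure.inter_right hΓ.1).inter_right (isClosed_le continuous_const continuous_norm)
  have hK0 : closure V ∩ Γ ∩ {x : Plane | ρ ≤ ‖x‖} ⊆ {0}ᶜ := fun x hx h0 => by
    rw [Set.mem_singleton_iff] at h0
    have h1 : ρ ≤ ‖x‖ := hx.2
    rw [h0, norm_zero] at h1
    linarith
  obtain ⟨C, hC, ε, hε, hbd⟩ := exists_boundOn_of_isCompact hK (hf.mono hK0) (hWc.mono hK0)
    fun y hy => hloc y hy.1.2 (hK0 hy)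
  refine ⟨C, hC, ε, hε, fun a ⟨ha, hac, haV⟩ t s => ?_⟩
  exact hbd a (ha.of_le (by exact_mod_cast le_top))
    (haV.trans (Set.inter_subset_inter_left _ (Set.inter_subset_inter_left _ subset_closure)))
    (sobolevNorm a) (norm_le_sobolevNorm ha hac) (norm_fderiv_le_sobolevNorm ha hac) t s

/-- The numerology of the exponents. -/
theorem exponent_bounds {κ : Fin 2 → ℝ} (hκ : ∀ j, 0 < κ j) {f : Plane → ℝ} (hh : 2 ≤ height κ f)
    {α : ℝ} (hα : 1 / 2 - 1 / (height κ f).toReal < α) : 0 < α ∧ 1 / 2 < κ 0 + κ 1 + α := by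
  have hk : 0 < κ 0 + κ 1 := add_pos (hκ 0) (hκ 1)
  have h1 : ENNReal.ofReal (1 / (κ 0 + κ 1)) ≤ height κ f := le_max_left _ _
  rcases eq_or_ne (height κ f) ⊤ with htop | htop
  · rw [htop, ENNReal.toReal_top, div_zero, sub_zero] at hα
    exact ⟨by linarith, by linarith⟩
  · have h2 : (2 : ℝ) ≤ (height κ f).toReal := by
      have := ENNReal.toReal_mono htop hh
      simpa using this
    have h3 : 1 / (κ 0 + κ 1) ≤ (height κ f).toReal := by
      have := ENNReal.toReal_mono htop h1
      rwa [ENNReal.toReal_ofReal (by positivity)] at this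
    -- The bound `h ≥ 2` yields `α > 0`; the bound `h ≥ 1 / (κ 0 + κ 1)` yields summability over the
    -- shells.
    have h4 : 1 / (height κ f).toReal ≤ 1 / 2 := one_div_le_one_div_of_le two_pos h2
    have h5 : 1 / (height κ f).toReal ≤ κ 0 + κ 1 := by
      rw [one_div_le (by linarith) hk]; exact h3
    exact ⟨by linarith, by linarith⟩

end DampedOsc
end

/-! ### The three estimates of the theorem. -/

open DampedOsc

theorem theorem4p1 (κ : Fin 2 → ℝ) (hκ : ∀ j, 0 < κ j) (hκ1 : κ ≠ fun _ => 1)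
    (f : DampedOsc.Plane → ℝ) (hf : ContDiffOn ℝ ∞ f {0}ᶜ) (hfκ : DampedOsc.IsHomog κ 1 f)
    (hh : 2 ≤ DampedOsc.height κ f) (hord : DampedOsc.ord (DampedOsc.hess f) < ⊤)
    (α : ℝ) (hα : 1 / 2 - 1 / (DampedOsc.height κ f).toReal < α)
    (V : Set DampedOsc.Plane) (hV0 : V ∈ 𝓝 0) (hV : Bornology.IsBounded V)
    (Γ : Set DampedOsc.Plane) (hΓ : DampedOsc.IsClosedCone κ Γ) :
    -- damping by the homogenized gradient attached to a zero `x0` of the gradient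
    (∀ x0 : DampedOsc.Plane, ‖x0‖ = 1 → gradient f x0 = 0 →
      (∀ x ∈ Γ, x ≠ 0 → DampedOsc.IsDegenerate κ f x → gradient f x = 0) →
      ∃ C : ℝ, 0 < C ∧ ∃ ε : ℝ, 0 < ε ∧ ∀ a : DampedOsc.Plane → ℂ, DampedOsc.IsTest (V ∩ Γ) a →
        (∀ x ∈ tsupport a, x ≠ 0 → gradient f x = 0 → ∃ r : ℝ, 0 < r ∧ x = DampedOsc.dil κ r x0) →
        ∀ (t : ℝ) (s : DampedOsc.Plane),
          ‖DampedOsc.oscInt f (DampedOsc.gradDamping κ f x0) α a t s‖ ≤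
            C * DampedOsc.sobolevNorm a * (1 + |t|) ^ (-(1 / 2 + ε))) ∧
    -- no zeros of the gradient: the damping function is identically one on the unit circle
    ((∀ x ∈ Γ, x ≠ 0 → ¬ DampedOsc.IsDegenerate κ f x) →
      ∃ C : ℝ, 0 < C ∧ ∃ ε : ℝ, 0 < ε ∧ ∀ a : DampedOsc.Plane → ℂ, DampedOsc.IsTest (V ∩ Γ) a →
        ∀ (t : ℝ) (s : DampedOsc.Plane),
          ‖DampedOsc.oscInt f (DampedOsc.homExtend κ fun _ => 1) α a t s‖ ≤
            C * DampedOsc.sobolevNorm a * (1 + |t|) ^ (-(1 / 2 + ε))) ∧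
    -- no zeros of the gradient: the damping function is identically one on the plane
    ((∀ x ∈ Γ, x ≠ 0 → ¬ DampedOsc.IsDegenerate κ f x) →
      ∀ ρ : ℝ, (0 < ρ ∨ 1 / 2 < κ 0 + κ 1) →
      ∃ C : ℝ, 0 < C ∧ ∃ ε : ℝ, 0 < ε ∧ ∀ a : DampedOsc.Plane → ℂ,
        DampedOsc.IsTest (V ∩ Γ ∩ {x | ρ ≤ ‖x‖}) a →
        ∀ (t : ℝ) (s : DampedOsc.Plane),
          ‖DampedOsc.oscInt f (fun _ => 1) α a t s‖ ≤
            C * DampedOsc.sobolevNorm a * (1 + |t|) ^ (-(1 / 2 + ε))) := by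
  obtain ⟨hα0, hκα⟩ := exponent_bounds hκ hh hα
  have hfc := hf.continuousOn
  have hsign : ∀ τ : ℝ, τ = 1 ∨ τ = -1 → τ * τ = 1 := by rintro τ (rfl | rfl) <;> norm_num
  refine ⟨fun x0 hx0 hgrad hdeg => ?_, fun hdeg => ?_, fun hdeg ρ hρ => ?_⟩
  · have hx0' : x0 ≠ 0 := fun h => by simp [h] at hx0
    obtain ⟨hn₀, hn₀h⟩ := ordAt_critical hκ hf hfκ hord hx0' hgrad
    have hW : IsHomog κ α fun x => gradDamping κ f x0 x ^ α :=
      (homExtend_isHomog κ _).rpow (homExtend_nonneg fun x => by positivity) α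
    have hWc : ContinuousOn (fun x => gradDamping κ f x0 x ^ α) {0}ᶜ := by
      refine hW.continuousOn hκ fun j τ hτ => ?_
      -- The weight is continuous across the zeros of the gradient because the exponent of `gradSq`
      -- is nonnegative.
      rw [profile_gradDamping hκ (hsign τ hτ) hf hfκ]
      refine (contDiff_radius_rpow hκ (hsign τ hτ) α).continuous.mul
        ((contDiff_gradSq hκ (hsign τ hτ) hf).continuous.rpow_const fun u => Or.inr ?_)
      have h2 : (2 : ℝ) ≤ (ordAt f x0).toNat := by exact_mod_cast hn₀
      have h3 : (0 : ℝ) < (ordAt f x0).toNat - 1 := by linarith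
      positivity
    obtain ⟨C, hC, ε, hε, h⟩ := exists_global_bound hκ hα0.le hκα hfc hfκ hW hWc hV hΓ
      fun y hy hy0 => localBound_gradDamping hκ hf hfκ hord hα0 hα hn₀ hn₀h hy0 (hdeg y hy hy0)
    exact ⟨C, hC, ε, hε, fun a ha _ t s => h a ha t s⟩
  · have hW : IsHomog κ α fun x => homExtend κ (fun _ => 1) x ^ α :=
      (homExtend_isHomog κ _).rpow (homExtend_nonneg fun x => zero_le_one) α
    have hprof : ∀ (j : Fin 2) (τ : ℝ), τ = 1 ∨ τ = -1 →
        ContDiff ℝ ∞ (profile (fun x => homExtend κ (fun _ => 1) x ^ α) j τ) := fun j τ hτ => by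
      rw [profile_homExtend_one]
      exact contDiff_radius_rpow hκ (hsign τ hτ) α
    exact exists_global_bound hκ hα0.le hκα hfc hfκ hW
      (hW.continuousOn hκ fun j τ hτ => (hprof j τ hτ).continuous) hV hΓ
      fun y hy hy0 => localBound_of_not_degenerate hκ hf hfκ hord hW hy0 (hdeg y hy hy0) hprof
  -- Without damping the weight has degree zero. The shells are then summable only under `κ 0 + κ 1
  -- > 1/2`; otherwise the support must stay away from the origin, and compactness alone suffices.
  · have hW : IsHomog κ 0 fun _ => (1 : ℝ) ^ α := fun x _ r _ => by simp
    have hloc : ∀ y ∈ Γ, y ≠ 0 → LocalBound f (fun _ => (1 : ℝ) ^ α) y := fun y hy hy0 =>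
      localBound_of_not_degenerate hκ hf hfκ hord hW hy0 (hdeg y hy hy0) fun j τ _ => contDiff_const
    rcases hρ with hρ | hρ
    · exact exists_global_bound_off_origin hfc continuousOn_const hV hΓ hloc hρ
    · obtain ⟨C, hC, ε, hε, h⟩ := exists_global_bound hκ le_rfl (by linarith) hfc hfκ hW
        continuousOn_const hV hΓ hloc
      exact ⟨C, hC, ε, hε, fun a ha t s =>
        h a ⟨ha.1, ha.2.1, ha.2.2.trans Set.inter_subset_left⟩ t s⟩
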